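/- Let $K$ be an algebraically closed field of characteristic zero (for example $K=\mathbb C$), let $n\ge 0$, and let $A_n$ be the $n$-th Weyl algebra over $K$, generated by $p_1,\dots,p_n,q_1,\dots,q_n$ subject to $[p_i,p_j]=[q_i,q_j]=0$ and $[q_i,p_j]=\delta_{ij}$ for all $i,j$. Let $V\subset A_n$ be the subspace spanned by these generators. The symplectic group $\mathrm{Sp}_{2n}(K)$ acts on $A_n$ by algebra automorphisms extending its linear substitutions of the generators. Let $G\subset \mathrm{Sp}_{2n}(K)$ be a finite subgroup, and let $A_n^G$ be the algebra of invariants. Then $V$ is $G$-invariant. For $g\in G$ put $d(g)=2n-\dim_K V^g$, and for $p\ge 0$ let $F_pKG$ be the subspace of the group algebra $KG$ spanned by the elements $g\in G$ with $d(g)\le p$. Then $F_\bullet KG$ is an exhaustive increasing algebra filtration on $KG$ (that is, $1\in F_0KG$ and $F_pKG\cdot F_qKG\subset F_{p+q}KG$), so it restricts to an exhaustive increasing algebra filtration $F_p\mathcal ZG=F_pKG\cap \mathcal ZG$ on the center $\mathcal ZG$ of $KG$. Let $\operatorname{gr}\mathcal ZG=\bigoplus_{p\ge0}F_p\mathcal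 ZG/F_{p-1}\mathcal ZG$ (with $F_{-1}\mathcal ZG=0$) be the associated graded algebra. Let $HH^\bullet(A_n^G)=\bigoplus_{p\ge 0}\operatorname{Ext}^p_{(A_n^G)^e}(A_n^G,A_n^G)$, with $(A_n^G)^e=A_n^G\otimes_K (A_n^G)^{\mathrm{op}}$, be the Hochschild cohomology algebra of $A_n^G$, whose product is the cup product, that is, the composition (Yoneda) product of self-extensions of the bimodule $A_n^G$. Then there is an isomorphism of graded $K$-algebras $$HH^\bullet(A_n^G)\;\cong\;\operatorname{gr}\mathcal ZG .$$ -/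

import Mathlib

open CategoryTheory
open scoped TensorProduct DirectSum

universe u

/-! ### The Weyl algebra and the symplectic action -/

section Weyl

variable (K : Type u) [Field K] (n : ℕ)

/-- The Heisenberg relations. The letters `Sum.inl i` and `Sum.inr i` stand for the generators
`p i` and `q i`. -/
inductive WeylRel : FreeAlgebra K (Fin n ⊕ Fin n) → FreeAlgebra K (Fin n ⊕ Fin n) → Prop
  | pp (i j : Fin n) : WeylRel
      (FreeAlgebra.ι K (Sum.inl i) * FreeAlgebra.ι K (Sum.inl j))
      (FreeAlgebra.ι K (Sum.inl j) * FreeAlgebra.ι K (Sum.inl i))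
  | qq (i j : Fin n) : WeylRel
      (FreeAlgebra.ι K (Sum.inr i) * FreeAlgebra.ι K (Sum.inr j))
      (FreeAlgebra.ι K (Sum.inr j) * FreeAlgebra.ι K (Sum.inr i))
  | qp (i j : Fin n) : WeylRel
      (FreeAlgebra.ι K (Sum.inr i) * FreeAlgebra.ι K (Sum.inl j))
      (FreeAlgebra.ι K (Sum.inl j) * FreeAlgebra.ι K (Sum.inr i) + if i = j then 1 else 0)

/-- The `n`-th Weyl algebra over `K`. -/
def WeylAlgebra : Type u := RingQuot (WeylRel K n)

namespace WeylAlgebra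

noncomputable instance : Ring (WeylAlgebra K n) := inferInstanceAs (Ring (RingQuot (WeylRel K n)))

noncomputable instance : Algebra K (WeylAlgebra K n) :=
  inferInstanceAs (Algebra K (RingQuot (WeylRel K n)))

/-- The quotient map from the free algebra onto the Weyl algebra. -/
noncomputable def ofFree : FreeAlgebra K (Fin n ⊕ Fin n) →ₐ[K] WeylAlgebra K n :=
  RingQuot.mkAlgHom K (WeylRel K n)

variable {K n} in
theorem ofFree_rel {x y : FreeAlgebra K (Fin n ⊕ Fin n)} (h : WeylRel K n x y) :
    ofFree K n x = ofFree K n y :=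
  RingQuot.mkAlgHom_rel K h

/-- The standard generators of the Weyl algebra: `gen (inl i)` is `p i`, `gen (inr i)` is `q i`. -/
noncomputable def gen (a : Fin n ⊕ Fin n) : WeylAlgebra K n :=
  ofFree K n (FreeAlgebra.ι K a)

/-- The subspace `V` of the Weyl algebra spanned by the standard generators. -/
noncomputable def generatorSpace : Submodule K (WeylAlgebra K n) :=
  Submodule.span K (Set.range (gen K n))

variable {K n}

theorem gen_pp (i j : Fin n) :
    gen K n (.inl i) * gen K n (.inl j) = gen K n (.inl j) * gen K n (.inl i) := by
  simpa [gen] using ofFree_rel (WeylRel.pp (K := K) i j)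

theorem gen_qq (i j : Fin n) :
    gen K n (.inr i) * gen K n (.inr j) = gen K n (.inr j) * gen K n (.inr i) := by
  simpa [gen] using ofFree_rel (WeylRel.qq (K := K) i j)

theorem gen_qp (i j : Fin n) :
    gen K n (.inr i) * gen K n (.inl j) =
      gen K n (.inl j) * gen K n (.inr i) + if i = j then 1 else 0 := by
  have h := ofFree_rel (WeylRel.qp (K := K) i j)
  by_cases hij : i = j <;> simpa [gen, hij] using h

/-- The commutators of the generators are the entries of the standard symplectic matrix. -/
theorem gen_comm (a b : Fin n ⊕ Fin n) :
    gen K n a * gen K n b - gen K n b * gen K n a =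
      algebraMap K (WeylAlgebra K n) (Matrix.J (Fin n) K a b) := by
  rcases a with i | i <;> rcases b with j | j
  · simp [gen_pp i j, Matrix.J]
  · rw [gen_qp j i]
    by_cases hij : i = j
    · simp [hij, Matrix.J]
    · simp [hij, Ne.symm hij, Matrix.J]
  · rw [gen_qp i j]
    by_cases hij : i = j <;> simp [hij, Matrix.J]
  · simp [gen_qq i j, Matrix.J]

/-- The image of the generator indexed by `b` under the matrix `g`, that is
`∑ a, g a b • gen a`. -/
noncomputable def actGen (g : Matrix (Fin n ⊕ Fin n) (Fin n ⊕ Fin n) K)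
    (b : Fin n ⊕ Fin n) : WeylAlgebra K n :=
  ∑ a, g a b • gen K n a

theorem actGen_comm {g : Matrix (Fin n ⊕ Fin n) (Fin n ⊕ Fin n) K}
    (hg : g ∈ Matrix.symplecticGroup (Fin n) K) (b c : Fin n ⊕ Fin n) :
    actGen g b * actGen g c - actGen g c * actGen g b =
      algebraMap K (WeylAlgebra K n) (Matrix.J (Fin n) K b c) := by
  have h : (g.transpose * Matrix.J (Fin n) K * g) b c = Matrix.J (Fin n) K b c := by
    rw [SymplecticGroup.mem_iff'.1 hg]
  have h1 (x y : Fin n ⊕ Fin n) : actGen g x * actGen g y =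
      ∑ i, ∑ j, (g i x * g j y) • (gen K n i * gen K n j) := by
    unfold actGen
    rw [Finset.sum_mul_sum]
    simp only [smul_mul_smul_comm]
  rw [← h, h1 b c, h1 c b, Finset.sum_comm, ← Finset.sum_sub_distrib]
  simp only [Matrix.mul_apply, Matrix.transpose_apply, Finset.sum_mul, map_sum,
    ← Finset.sum_sub_distrib]
  refine Finset.sum_congr rfl fun j _ => Finset.sum_congr rfl fun i _ => ?_
  rw [mul_comm (g j c), ← smul_sub, gen_comm, mul_right_comm, map_mul,
    Algebra.smul_def]

/-- The algebra endomorphism of the Weyl algebra that extends the linear substitution of the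
generators given by a symplectic matrix. -/
noncomputable def actHom (g : Matrix.symplecticGroup (Fin n) K) :
    WeylAlgebra K n →ₐ[K] WeylAlgebra K n :=
  RingQuot.liftAlgHom K ⟨FreeAlgebra.lift K (actGen g.1), by
    have key := actGen_comm g.2
    intro x y h
    induction h with
    | pp i j => simpa [sub_eq_zero, Matrix.J] using key (.inl i) (.inl j)
    | qq i j => simpa [sub_eq_zero, Matrix.J] using key (.inr i) (.inr j)
    | qp i j =>
      have h := key (.inr i) (.inl j)
      rw [sub_eq_iff_eq_add'] at h
      by_cases hij : i = j
      · simpa [Matrix.J, Matrix.one_apply, hij] using h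
      · simpa [Matrix.J, Matrix.one_apply, hij] using h⟩

theorem actHom_gen (g : Matrix.symplecticGroup (Fin n) K) (b : Fin n ⊕ Fin n) :
    actHom g (gen K n b) = ∑ a, g.1 a b • gen K n a := by
  have h : actHom g (gen K n b) = FreeAlgebra.lift K (actGen g.1) (FreeAlgebra.ι K b) :=
    RingQuot.liftAlgHom_mkAlgHom_apply _ _ _ _
  rw [h, FreeAlgebra.lift_ι_apply, actGen]

theorem algHom_ext {f g : WeylAlgebra K n →ₐ[K] WeylAlgebra K n}
    (h : ∀ a, f (gen K n a) = g (gen K n a)) : f = g := by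
  apply RingQuot.ringQuot_ext'
  apply FreeAlgebra.hom_ext
  funext a
  exact h a

variable (K n) in
/-- The natural action of the symplectic group on the Weyl algebra by algebra endomorphisms
(automatically automorphisms, since the action is one of a group). -/
noncomputable def action :
    Matrix.symplecticGroup (Fin n) K →* (WeylAlgebra K n →ₐ[K] WeylAlgebra K n) where
  toFun := actHom
  map_one' := algHom_ext fun b => by
    simp [actHom_gen, Matrix.one_apply]
  map_mul' g h := algHom_ext fun b => by
    simp only [actHom_gen, AlgHom.mul_apply, map_sum, map_smul, Finset.smul_sum, smul_smul]
    rw [Finset.sum_comm]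
    refine Finset.sum_congr rfl fun a _ => ?_
    rw [← Finset.sum_smul]
    congr 1
    simp [Matrix.mul_apply, mul_comm]

/-- The algebra of invariants of a subgroup of the symplectic group. -/
noncomputable def invariants (G : Subgroup (Matrix.symplecticGroup (Fin n) K)) :
    Subalgebra K (WeylAlgebra K n) :=
  ⨅ g ∈ G, AlgHom.equalizer (action K n g) (AlgHom.id K (WeylAlgebra K n))

theorem mem_invariants (G : Subgroup (Matrix.symplecticGroup (Fin n) K)) (a : WeylAlgebra K n) :
    a ∈ invariants G ↔ ∀ g ∈ G, action K n g a = a := by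
  simp [invariants, Algebra.mem_iInf]

/-- The fixed subspace `V ^ g` of the space `V` spanned by the generators. -/
noncomputable def fixedSpace (g : Matrix.symplecticGroup (Fin n) K) :
    Submodule K (WeylAlgebra K n) :=
  generatorSpace K n ⊓
    LinearMap.eqLocus (action K n g).toLinearMap (LinearMap.id (R := K) (M := WeylAlgebra K n))

/-- The number `d g = 2 n - dim V ^ g`. -/
noncomputable def codimFixed (g : Matrix.symplecticGroup (Fin n) K) : ℕ :=
  2 * n - Module.finrank K (fixedSpace g)

/-- The subspace `F p` of the group algebra of `G` spanned by the `g` in `G` with `d g ≤ p`. -/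
noncomputable def groupFiltration (G : Subgroup (Matrix.symplecticGroup (Fin n) K)) (p : ℕ) :
    Submodule K (MonoidAlgebra K G) :=
  Submodule.span K {x | ∃ g : G, codimFixed (g : Matrix.symplecticGroup (Fin n) K) ≤ p ∧
    x = MonoidAlgebra.of K G g}

/-- The filtration that `groupFiltration` induces on the center of the group algebra. -/
noncomputable def centerFiltration (G : Subgroup (Matrix.symplecticGroup (Fin n) K)) (p : ℕ) :
    Submodule K (Subalgebra.center K (MonoidAlgebra K G)) :=
  (groupFiltration G p).comap (Subalgebra.center K (MonoidAlgebra K G)).val.toLinearMap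

end WeylAlgebra

end Weyl

/-! ### The associated graded algebra of an ascending filtration -/

section AssocGraded

variable {K : Type u} [Field K] {B : Type u} [Ring B] [Algebra K B]

/-- The part `∑ i < p, F i` of a family of subspaces strictly below `p`. -/
def lowerStep (F : ℕ → Submodule K B) (p : ℕ) : Submodule K B := ⨆ (i : ℕ) (_ : i < p), F i

/-- The component of degree `p` of the associated graded space, `F p` modulo the sum of the `F i`
with `i < p`; for an increasing `F` this is `F p / F (p - 1)`, and `F 0` for `p = 0`. -/
def AssocGraded (F : ℕ → Submodule K B) (p : ℕ) : Type u :=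
  F p ⧸ (lowerStep F p).submoduleOf (F p)

namespace AssocGraded

variable (F : ℕ → Submodule K B)

instance (p : ℕ) : AddCommGroup (AssocGraded F p) :=
  inferInstanceAs (AddCommGroup (F p ⧸ (lowerStep F p).submoduleOf (F p)))

instance (p : ℕ) : Module K (AssocGraded F p) :=
  inferInstanceAs (Module K (F p ⧸ (lowerStep F p).submoduleOf (F p)))

/-- The class in degree `p` of an element of `F p`. -/
def mk (p : ℕ) : F p →ₗ[K] AssocGraded F p := Submodule.mkQ _

theorem mk_surjective (p : ℕ) : Function.Surjective (mk F p) := Submodule.mkQ_surjective _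

variable {F} in
theorem gradedMk_eq {p q : ℕ} (h : p = q) (x : F p) (y : F q) (hxy : (x : B) = y) :
    GradedMonoid.mk (A := AssocGraded F) p (mk F p x) = GradedMonoid.mk q (mk F q y) := by
  subst h
  rw [Subtype.ext hxy]

variable [IsRingFiltration F (lowerStep F)]

theorem one_mem : (1 : B) ∈ F 0 := SetLike.GradedOne.one_mem

theorem smul_one_mem (r : K) : r • (1 : B) ∈ F 0 := Submodule.smul_mem _ r (one_mem F)

theorem mul_mem {i j : ℕ} {x y : B} (hx : x ∈ F i) (hy : y ∈ F j) : x * y ∈ F (i + j) :=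
  SetLike.mul_mem_graded hx hy

theorem lower_mul_mem {i j : ℕ} {x y : B} (hx : x ∈ lowerStep F i) (hy : y ∈ F j) :
    x * y ∈ lowerStep F (i + j) := by
  have h : lowerStep F i ≤ (lowerStep F (i + j)).comap (LinearMap.mulRight K y) :=
    IsFiltration.is_sup (F := F) _ _ fun k hk z hz =>
      IsFiltration.is_le (F := F) (show k + j < i + j by omega) (SetLike.mul_mem_graded hz hy)
  exact h hx

theorem mul_lower_mem {i j : ℕ} {x y : B} (hx : x ∈ F i) (hy : y ∈ lowerStep F j) :
    x * y ∈ lowerStep F (i + j) := by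
  have h : lowerStep F j ≤ (lowerStep F (i + j)).comap (LinearMap.mulLeft K x) :=
    IsFiltration.is_sup (F := F) _ _ fun k hk z hz =>
      IsFiltration.is_le (F := F) (show i + k < i + j by omega) (SetLike.mul_mem_graded hx hz)
  exact h hy

/-- The product `F i × F j → F (i + j)`. -/
def stepMul (i j : ℕ) : F i →ₗ[K] F j →ₗ[K] F (i + j) :=
  LinearMap.mk₂ K (fun x y => ⟨(x : B) * y, mul_mem F x.2 y.2⟩)
    (fun _ _ _ => Subtype.ext (add_mul _ _ _))
    (fun _ _ _ => Subtype.ext (smul_mul_assoc _ _ _))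
    (fun _ _ _ => Subtype.ext (mul_add _ _ _))
    (fun _ _ _ => Subtype.ext (mul_smul_comm _ _ _))

/-- The product of the associated graded algebra: the class of `x` times the class of `y` is the
class of `x * y`. -/
def gmul (i j : ℕ) : AssocGraded F i →ₗ[K] AssocGraded F j →ₗ[K] AssocGraded F (i + j) :=
  Submodule.liftQ ((lowerStep F i).submoduleOf (F i))
    (LinearMap.flip <| Submodule.liftQ ((lowerStep F j).submoduleOf (F j))
      ((stepMul F i j).compr₂ (mk F (i + j))).flip
      (fun y hy => LinearMap.ext fun x =>
        (Submodule.Quotient.mk_eq_zero _).2 (mul_lower_mem F x.2 hy)))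
    (fun x hx => LinearMap.ext fun y => by
      obtain ⟨y, rfl⟩ := mk_surjective F j y
      exact (Submodule.Quotient.mk_eq_zero _).2 (lower_mul_mem F hx y.2))

theorem gmul_mk (i j : ℕ) (x : F i) (y : F j) :
    gmul F i j (mk F i x) (mk F j y) =
      mk F (i + j) ⟨(x : B) * y, mul_mem F x.2 y.2⟩ := rfl

/-- The unit of the associated graded algebra: the class of `1`. -/
def gone : AssocGraded F 0 := mk F 0 ⟨1, one_mem F⟩

noncomputable instance : GradedMonoid.GMul (AssocGraded F) where
  mul {i j} x y := gmul F i j x y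

noncomputable instance : GradedMonoid.GOne (AssocGraded F) where
  one := gone F

noncomputable instance : DirectSum.GRing (AssocGraded F) where
  mul_zero {i j} x := map_zero (gmul F i j x)
  zero_mul {i j} y := LinearMap.map_zero₂ (gmul F i j) y
  mul_add {i j} x y z := map_add (gmul F i j x) y z
  add_mul {i j} x y z := LinearMap.map_add₂ (gmul F i j) x y z
  one_mul := by
    rintro ⟨i, x⟩
    obtain ⟨x, rfl⟩ := mk_surjective F _ x
    exact gradedMk_eq (zero_add i) _ _ (one_mul _)
  mul_one := by
    rintro ⟨i, x⟩
    obtain ⟨x, rfl⟩ := mk_surjective F _ x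
    exact gradedMk_eq (add_zero i) _ _ (mul_one _)
  mul_assoc := by
    rintro ⟨i, x⟩ ⟨j, y⟩ ⟨k, z⟩
    obtain ⟨x, rfl⟩ := mk_surjective F _ x
    obtain ⟨y, rfl⟩ := mk_surjective F _ y
    obtain ⟨z, rfl⟩ := mk_surjective F _ z
    exact gradedMk_eq (add_assoc i j k) _ _ (mul_assoc _ _ _)
  natCast m := m • gone F
  natCast_zero := zero_nsmul _
  natCast_succ m := succ_nsmul _ _
  intCast m := m • gone F
  intCast_ofNat m := natCast_zsmul _ _
  intCast_negSucc_ofNat m := negSucc_zsmul _ _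

noncomputable instance : DirectSum.GAlgebra K (AssocGraded F) where
  toFun := (LinearMap.toSpanSingleton K (AssocGraded F 0) (gone F)).toAddMonoidHom
  map_one := one_smul K (gone F)
  map_mul r s :=
    gradedMk_eq (zero_add 0).symm ((r * s) • ⟨1, one_mem F⟩)
      ⟨(r • (1 : B)) * (s • (1 : B)), mul_mem F (smul_one_mem F r) (smul_one_mem F s)⟩
      (by simp [smul_smul, mul_comm])
  commutes := by
    rintro r ⟨i, x⟩
    obtain ⟨x, rfl⟩ := mk_surjective F _ x
    exact gradedMk_eq ((zero_add i).trans (add_zero i).symm)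
      ⟨(r • (1 : B)) * x, mul_mem F (smul_one_mem F r) x.2⟩
      ⟨x * (r • (1 : B)), mul_mem F x.2 (smul_one_mem F r)⟩ (by simp)
  smul_def := by
    rintro r ⟨i, x⟩
    obtain ⟨x, rfl⟩ := mk_surjective F _ x
    exact gradedMk_eq (zero_add i).symm (r • x)
      ⟨(r • (1 : B)) * x, mul_mem F (smul_one_mem F r) x.2⟩ (by simp)

end AssocGraded

end AssocGraded

/-! ### Hochschild cohomology -/

section Hochschild

variable (K : Type u) [Field K] (B : Type u) [Ring B] [Algebra K B]

/-- The algebra `B` as a bimodule over itself, that is, as a left module over the enveloping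
algebra `B ⊗ Bᵐᵒᵖ`, with `(a ⊗ b) • x = a * x * b`. -/
noncomputable def selfBimodule : ModuleCat.{u} (B ⊗[K] Bᵐᵒᵖ) :=
  letI : Module (B ⊗[K] Bᵐᵒᵖ) B := TensorProduct.Algebra.module
  ModuleCat.of (B ⊗[K] Bᵐᵒᵖ) B

variable {K B} in
theorem selfBimodule_smul (a b x : B) :
    (a ⊗ₜ[K] MulOpposite.op b : B ⊗[K] Bᵐᵒᵖ) • (id x : selfBimodule K B) =
      (id (a * (x * b)) : selfBimodule K B) := rfl

/-- The Hochschild cohomology `HH ^ p` of `B` with coefficients in `B`, as the `Ext` of the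
bimodule `B` with itself. -/
def HochschildCohomology (p : ℕ) : Type u :=
  Abelian.Ext.{u} (selfBimodule K B) (selfBimodule K B) p

namespace HochschildCohomology

noncomputable instance (p : ℕ) : AddCommGroup (HochschildCohomology K B p) :=
  inferInstanceAs (AddCommGroup (Abelian.Ext.{u} (selfBimodule K B) (selfBimodule K B) p))

noncomputable instance (p : ℕ) : Module K (HochschildCohomology K B p) :=
  inferInstanceAs (Module K (Abelian.Ext.{u} (selfBimodule K B) (selfBimodule K B) p))

variable {K B}

variable (K B) in
/-- The unit of the Hochschild cohomology algebra: the class of the identity. -/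
noncomputable def gone : HochschildCohomology K B 0 := Abelian.Ext.mk₀ (𝟙 (selfBimodule K B))

/-- The product of the Hochschild cohomology algebra: the Yoneda product, that is, the composition
of iterated self-extensions of the bimodule `B`. Under the identification of `Ext` with the
cohomology of the Hochschild complex this is the cup product. -/
noncomputable def gmul {i j k : ℕ} (x : HochschildCohomology K B i)
    (y : HochschildCohomology K B j) (h : i + j = k) : HochschildCohomology K B k :=
  Abelian.Ext.comp x y h

theorem gradedMk_eq {i j p q : ℕ} (x : HochschildCohomology K B i)
    (y : HochschildCohomology K B j) (hp : i + j = p) (hq : i + j = q) :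
    GradedMonoid.mk (A := HochschildCohomology K B) p (gmul x y hp) =
      GradedMonoid.mk q (gmul x y hq) := by
  subst hp
  subst hq
  rfl

theorem gone_gmul {i : ℕ} (x : HochschildCohomology K B i) : gmul (gone K B) x (zero_add i) = x :=
  Abelian.Ext.mk₀_id_comp x

theorem gmul_gone {i : ℕ} (x : HochschildCohomology K B i) : gmul x (gone K B) (add_zero i) = x :=
  Abelian.Ext.comp_mk₀_id x

noncomputable instance : GradedMonoid.GMul (HochschildCohomology K B) where
  mul x y := gmul x y rfl

noncomputable instance : GradedMonoid.GOne (HochschildCohomology K B) where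
  one := gone K B

noncomputable instance : DirectSum.GRing (HochschildCohomology K B) where
  mul_zero {i j} x := Abelian.Ext.comp_zero x _ j _ rfl
  zero_mul {i j} y := Abelian.Ext.zero_comp _ i y _ rfl
  mul_add x y z := Abelian.Ext.comp_add x y z rfl
  add_mul x y z := Abelian.Ext.add_comp x y z rfl
  one_mul := by
    rintro ⟨i, x⟩
    exact (gradedMk_eq (gone K B) x rfl (zero_add i)).trans (by rw [gone_gmul]; rfl)
  mul_one := by
    rintro ⟨i, x⟩
    exact (gradedMk_eq x (gone K B) rfl (add_zero i)).trans (by rw [gmul_gone]; rfl)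
  mul_assoc := by
    rintro ⟨i, x⟩ ⟨j, y⟩ ⟨k, z⟩
    refine (gradedMk_eq (gmul x y rfl) z rfl (add_assoc i j k)).trans ?_
    exact congrArg (GradedMonoid.mk (A := HochschildCohomology K B) (i + (j + k)))
      (Abelian.Ext.comp_assoc x y z rfl rfl (add_assoc i j k))
  natCast m := m • gone K B
  natCast_zero := zero_nsmul _
  natCast_succ m := succ_nsmul _ _
  intCast m := m • gone K B
  intCast_ofNat m := natCast_zsmul _ _
  intCast_negSucc_ofNat m := negSucc_zsmul _ _

theorem smul_gmul {i j k : ℕ} (r : K) (x : HochschildCohomology K B i)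
    (y : HochschildCohomology K B j) (h : i + j = k) : gmul (r • x) y h = r • gmul x y h :=
  Abelian.Ext.smul_comp x y h r

theorem gmul_smul {i j k : ℕ} (r : K) (x : HochschildCohomology K B i)
    (y : HochschildCohomology K B j) (h : i + j = k) : gmul x (r • y) h = r • gmul x y h :=
  Abelian.Ext.comp_smul x y h r

noncomputable instance : DirectSum.GAlgebra K (HochschildCohomology K B) where
  toFun := (LinearMap.toSpanSingleton K (HochschildCohomology K B 0) (gone K B)).toAddMonoidHom
  map_one := one_smul K (gone K B)
  map_mul r s := by
    refine Eq.trans ?_ (gradedMk_eq (r • gone K B) (s • gone K B) (zero_add 0) rfl)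
    rw [smul_gmul, gone_gmul, smul_smul]
    rfl
  commutes := by
    rintro r ⟨i, x⟩
    refine (gradedMk_eq (r • gone K B) x rfl (zero_add i)).trans
      (Eq.trans ?_ (gradedMk_eq x (r • gone K B) (add_zero i) rfl))
    rw [smul_gmul, gone_gmul, gmul_smul, gmul_gone]
  smul_def := by
    rintro r ⟨i, x⟩
    refine Eq.trans ?_ (gradedMk_eq (r • gone K B) x (zero_add i) rfl)
    rw [smul_gmul, gone_gmul]
    rfl

end HochschildCohomology

end Hochschild

/-! Write `A` for the Weyl algebra, `B` for its invariants and `ω` for the symplectic form. The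
Koszul complex `A ⊗ A ⊗ Λ V` resolves `A` by bimodules. It has a homotopy whose Laplacian is, up to
terms of lower filtration, an Euler operator: multiplication by the degree in the generators plus
the exterior degree. In characteristic zero this suffices for exactness, by the descent in
`exists_add_of_homotopy` and `eq_zero_of_homotopy`. The same descent handles the twisted complexes
below, so the argument needs filtrations only and no PBW basis of `A`.

The extension `B ⊂ A` is Galois: there are `a i`, `b i` in `A` such that `∑ a i * h (b i)` is `1`
for `h = 1` and `0` for other `h` in `G` (`IsSymplecticAction.exists_isGaloisPair`). Hence the
Koszul terms are projective over the enveloping algebra of `B`, and averaging over `G` shows that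
their invariants form a projective resolution of `B` (`koszulResolution`). The Galois identity also
turns bimodule maps with values in `B` into families, indexed by `g ∈ G`, of linear maps `Λ V → A`,
and the differential into the Koszul differential twisted by `g`
(`IsGaloisPair.recoverCochain_koszulDiff`). In other words, the cohomology of `B` consists of the
`G`-invariants in the sum over `g` of the twisted Koszul cohomologies.

For one `g` the twisted cohomology is a line in degree `d g`, the rank of `1 - g`. It is spanned by
contraction with a top form `α g` on the image of `1 - g`, followed by the scalar part
(`IsTopForm.exists_eq_smul_add`, `IsTopForm.eq_zero_of_smul_eq`). So cohomology in degree `p`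
amounts to class functions supported on `{g | d g = p}`, and these are the elements of degree `p` in
the associated graded space of the center of the group algebra.

For products, let `g` act on the second factor of `A ⊗ A ⊗ Λ V` and contract `Λ V` with `α g`. This
commutes with the Koszul differential and lifts the cocycle of `g`, and such maps compose as the
forms multiply. So the theorem needs a conjugation-equivariant family with `α g * α h = α (g * h)`
when lengths add and `α g * α h = 0` otherwise (`IsTwistedVolume`, `classMap_mul`). The vanishing is
automatic: lengths add exactly when the images of `1 - g` and `1 - h` are disjoint. Otherwise the
Gram determinant of `ω ((1 - g) u) v` serves as a normalisation. It is multiplicative and fixes `α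
g` up to sign (`IsNormalVolume.mul`, `IsNormalVolume.eq_or_eq_neg`).

The signs come from an orientation. Over `ℂ` a finite group of symplectic maps commutes with an
antilinear `J` such that `J ^ 2 = -1` and `ω (J u) v` is positive Hermitian
(`IsSymplecticRep.exists_quaternionic`). Subspaces stable under `J` are oriented by products of
factors `u ∧ J u`, because operators that commute with `J` have positive determinant. Positive
multivectors are closed under products and under `G`, so the positive normalised forms are
compatible. For general `K`, the matrix entries of `G` lie in an algebraically closed subfield that
embeds into `ℂ`; the signs are chosen there and the family is extended to `K`
(`exists_isNormalSystem`). -/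

/-! ### Yoneda products through syzygies -/

section Syzygies

universe v w

/-- A projective resolution of `obj 0`, cut into short exact sequences
`0 ⟶ obj (n + 1) ⟶ proj n ⟶ obj n ⟶ 0`. -/
structure SyzygySequence (C : Type v) [Category.{w} C] [Abelian C] where
  obj : ℕ → C
  proj : ℕ → C
  incl (n : ℕ) : obj (n + 1) ⟶ proj n
  cover (n : ℕ) : proj n ⟶ obj n
  zero (n : ℕ) : incl n ≫ cover n = 0
  exact (n : ℕ) : (ShortComplex.mk (incl n) (cover n) (zero n)).ShortExact
  projective (n : ℕ) : Projective (proj n)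

namespace SyzygySequence

open Abelian

variable {C : Type v} [Category.{w} C] [Abelian C] [HasExt.{u} C] (S : SyzygySequence C)

/-- The iterated extension class of the resolution. -/
noncomputable def extClass : ∀ (k p m : ℕ), k + p = m → Ext.{u} (S.obj k) (S.obj m) p
  | k, 0, m, h => Ext.mk₀ (eqToHom (congrArg S.obj h))
  | k, p + 1, m, h => (S.exact k).extClass.comp
      (extClass (k + 1) p m (by omega)) (add_comm 1 p)

theorem extClass_zero (k : ℕ) : S.extClass k 0 k rfl = Ext.mk₀ (𝟙 _) := rfl

theorem extClass_succ (k p m : ℕ) (h : k + (p + 1) = m) :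
    S.extClass k (p + 1) m h = (S.exact k).extClass.comp
      (S.extClass (k + 1) p m (by omega)) (add_comm 1 p) := rfl

theorem extClass_comp (k p m q l r : ℕ) (h : k + p = m) (h' : m + q = l) (hr : p + q = r) :
    (S.extClass k p m h).comp (S.extClass m q l h') hr = S.extClass k r l (by omega) := by
  induction p generalizing k r with
  | zero =>
    obtain rfl : k = m := h
    obtain rfl : r = q := by omega
    rw [extClass_zero, Ext.mk₀_id_comp]
  | succ p ih =>
    obtain rfl : r = (p + q) + 1 := by omega
    rw [extClass_succ, extClass_succ, Ext.comp_assoc _ _ _ _ (rfl : p + q = p + q) (by omega),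
      ih (k + 1) (p + q) (by omega) rfl]

/-- Dimension shifting: a projective object has no `Ext` in positive degree, so a class of degree `p
+ 1` comes from a class of degree `p` on the next syzygy. Iteration ends with a morphism. -/
theorem exists_comp_mk₀ {Y : C} (k p m : ℕ) (h : k + p = m) (x : Ext.{u} (S.obj k) Y p) :
    ∃ f : S.obj m ⟶ Y, x = (S.extClass k p m h).comp (Ext.mk₀ f) (add_zero p) := by
  induction p generalizing k with
  | zero =>
    obtain rfl : k = m := h
    obtain ⟨f, rfl⟩ := (Ext.mk₀_bijective (S.obj k) Y).2 x
    exact ⟨f, by rw [extClass_zero, Ext.mk₀_id_comp]⟩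
  | succ p ih =>
    have := S.projective k
    obtain ⟨y, rfl⟩ := Ext.contravariant_sequence_exact₃ (S.exact k) Y x
      (Ext.eq_zero_of_projective _) (add_comm 1 p)
    obtain ⟨f, rfl⟩ := ih (k + 1) (by omega) y
    exact ⟨f, by rw [extClass_succ, Ext.comp_assoc _ _ _ _ (add_zero p) (by omega)]⟩

/-- Of the successive connecting maps only the last one has a kernel, namely the morphisms that
extend to the projective object. The earlier ones start in positive degree and are injective. -/
theorem extClass_comp_mk₀_eq_zero_iff {Y : C} (k p m : ℕ) (h : k + p = m)
    (f : S.obj (m + 1) ⟶ Y) :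
    (S.extClass k (p + 1) (m + 1) (by omega)).comp (Ext.mk₀ f) (add_zero (p + 1)) = 0 ↔
      ∃ g : S.proj m ⟶ Y, S.incl m ≫ g = f := by
  induction p generalizing k with
  | zero =>
    have := S.projective k
    obtain rfl : k = m := h
    have e : (S.extClass k 1 (k + 1) rfl).comp (Ext.mk₀ f) (add_zero 1) =
        (S.exact k).extClass.comp (Ext.mk₀ f) (add_zero 1) := by
      rw [extClass_succ, Ext.comp_assoc _ _ _ _ (add_zero 0) (by omega)]
      congr 1
      rw [extClass_zero, Ext.mk₀_id_comp]
    rw [e]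
    constructor
    · intro h0
      obtain ⟨x, hx⟩ := Ext.contravariant_sequence_exact₁ (S.exact k) Y (Ext.mk₀ f)
        (add_zero 1) h0
      obtain ⟨g, rfl⟩ := (Ext.mk₀_bijective _ Y).2 x
      refine ⟨g, (Ext.mk₀_bijective _ _).1 ?_⟩
      rw [← hx, Ext.mk₀_comp_mk₀]
    · rintro ⟨g, rfl⟩
      rw [← Ext.mk₀_comp_mk₀]
      exact (S.exact k).extClass_comp_assoc _
  | succ p ih =>
    have := S.projective k
    refine Iff.trans ?_ (ih (k + 1) (by omega))
    rw [extClass_succ, Ext.comp_assoc _ _ _ _ (add_zero (p + 1)) (by omega)]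
    constructor
    · intro h0
      obtain ⟨x, hx⟩ := Ext.contravariant_sequence_exact₁ (S.exact k) Y _
        (add_comm 1 (p + 1)) h0
      rw [← hx, Ext.eq_zero_of_projective x, Ext.comp_zero]
    · intro h0
      rw [h0, Ext.comp_zero]

/-- A morphism of degree `-p` from a resolution to itself. -/
structure ShiftHom (p : ℕ) where
  obj (n : ℕ) : S.obj (p + n) ⟶ S.obj n
  proj (n : ℕ) : S.proj (p + n) ⟶ S.proj n
  incl_comm (n : ℕ) : S.incl (p + n) ≫ proj n = obj (n + 1) ≫ S.incl n
  cover_comm (n : ℕ) : S.cover (p + n) ≫ obj n = proj n ≫ S.cover n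

variable {S}

/-- Naturality of the extension class of a short exact sequence, applied once for every step of the
splice. -/
theorem ShiftHom.extClass_comp {p : ℕ} (T : S.ShiftHom p) (k q m : ℕ) (h : k + q = m) :
    (S.extClass (p + k) q (p + m) (by omega)).comp (Ext.mk₀ (T.obj m)) (add_zero q) =
      (Ext.mk₀ (T.obj k)).comp (S.extClass k q m h) (zero_add q) := by
  induction q generalizing k with
  | zero =>
    obtain rfl : k = m := h
    rw [extClass_zero, extClass_zero, Ext.mk₀_id_comp, Ext.comp_mk₀_id]
  | succ q ih =>
    have e := ShortComplex.ShortExact.extClass_naturality (S.exact (p + k)) (S.exact k)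
      { τ₁ := T.obj (k + 1), τ₂ := T.proj k, τ₃ := T.obj k
        comm₁₂ := (T.incl_comm k).symm, comm₂₃ := (T.cover_comm k).symm }
    dsimp only at e
    rw [extClass_succ, extClass_succ, Ext.comp_assoc _ _ _ _ (add_zero q) (by omega)]
    refine (congrArg (fun t => (S.exact (p + k)).extClass.comp t (add_comm 1 q))
      (ih (k + 1) (by omega))).trans ?_
    rw [← Ext.comp_assoc _ _ _ (add_zero 1) (zero_add q) (by omega), e]
    exact Ext.comp_assoc _ _ _ (zero_add 1) (add_comm 1 q) (by omega)

/-- The morphism between the two splices is moved past the second one. The splices then merge, and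
only composition of morphisms remains. -/
theorem ShiftHom.comp_eq {p : ℕ} (T : S.ShiftHom p) {Y : C} (q : ℕ) (g : S.obj q ⟶ Y) :
    ((S.extClass 0 p p (zero_add p)).comp (Ext.mk₀ (T.obj 0)) (add_zero p)).comp
        ((S.extClass 0 q q (zero_add q)).comp (Ext.mk₀ g) (add_zero q)) rfl =
      (S.extClass 0 (p + q) (p + q) (zero_add _)).comp (Ext.mk₀ (T.obj q ≫ g))
        (add_zero (p + q)) := by
  rw [Ext.comp_assoc _ _ _ (add_zero p) (zero_add q) (by omega),
    ← Ext.comp_assoc _ _ _ (zero_add q) (add_zero q) (by omega),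
    ← T.extClass_comp 0 q q (zero_add q),
    Ext.comp_assoc _ _ _ (add_zero q) (add_zero 0) (by omega),
    ← Ext.comp_assoc _ _ _ rfl (by omega) (by omega), Ext.mk₀_comp_mk₀]
  congr 1
  exact S.extClass_comp 0 p p q (p + q) (p + q) _ _ rfl

end SyzygySequence

end Syzygies

/-! ### Contractions on the exterior algebra -/

section Exterior

open ExteriorAlgebra

/-- The joint eigenspace of a family of endomorphisms, with eigenvalue `1` on `S` and `0` off `S`. -/
def jointEigenspace {K M I : Type*} [Field K] [AddCommGroup M] [Module K M]
    (P : I → Module.End K M) (S : Finset I) : Submodule K M where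
  carrier := {x | (∀ i ∈ S, P i x = x) ∧ ∀ i ∉ S, P i x = 0}
  zero_mem' := by simp
  add_mem' := fun {a b} ha hb => ⟨fun i hi => by rw [map_add, ha.1 i hi, hb.1 i hi],
    fun i hi => by rw [map_add, ha.2 i hi, hb.2 i hi, add_zero]⟩
  smul_mem' := fun c a ha => ⟨fun i hi => by rw [map_smul, ha.1 i hi],
    fun i hi => by rw [map_smul, ha.2 i hi, smul_zero]⟩

/-- Commuting idempotents can be diagonalised one after the other through `y = P y + (y - P y)`.
Directness of the sum is not needed: the eigenspaces only serve to test linear maps. -/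
theorem iSup_jointEigenspace {K M I : Type*} [Field K] [AddCommGroup M] [Module K M]
    [Fintype I] [DecidableEq I]
    (P : I → Module.End K M) (hP : ∀ i x, P i (P i x) = P i x)
    (hc : ∀ i j, i ≠ j → ∀ x, P i (P j x) = P j (P i x)) :
    ⨆ S, jointEigenspace P S = ⊤ := by
  have key : ∀ T : Finset I, ∀ x : M, x ∈ Submodule.span K
      {y | ∃ S : Finset I, (∀ i ∈ T ∩ S, P i y = y) ∧ ∀ i ∈ T \ S, P i y = 0} := by
    intro T
    induction T using Finset.induction_on with
    | empty => exact fun x => Submodule.subset_span ⟨∅, by simp, by simp⟩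
    | insert a T ha ih =>
      intro x
      refine Submodule.span_induction ?_ (Submodule.zero_mem _)
        (fun _ _ _ _ => Submodule.add_mem _) (fun c _ _ => Submodule.smul_mem _ c) (ih x)
      rintro y ⟨S, h1, h2⟩
      have e : y = P a y + (y - P a y) := by abel
      rw [e]
      refine Submodule.add_mem _ (Submodule.subset_span ⟨insert a S, ?_, ?_⟩)
        (Submodule.subset_span ⟨S.erase a, ?_, ?_⟩)
      · intro i hi
        by_cases hia : i = a
        · subst hia; exact hP _ _
        · have hi' : i ∈ T ∩ S := by
            simpa [Finset.mem_inter, Finset.mem_insert, hia] using hi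
          rw [hc i a hia, h1 i hi']
      · intro i hi
        have hia : i ≠ a := by rintro rfl; simp at hi
        have hi' : i ∈ T \ S := by
          simpa [Finset.mem_sdiff, Finset.mem_insert, hia] using hi
        rw [hc i a hia, h2 i hi', map_zero]
      · intro i hi
        have hia : i ≠ a := by rintro rfl; simp at hi
        have hi' : i ∈ T ∩ S := by
          simpa [Finset.mem_inter, Finset.mem_insert, Finset.mem_erase, hia] using hi
        rw [map_sub, hc i a hia, h1 i hi']
      · intro i hi
        by_cases hia : i = a
        · subst hia; rw [map_sub, hP, sub_self]
        · have hi' : i ∈ T \ S := by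
            simpa [Finset.mem_sdiff, Finset.mem_insert, Finset.mem_erase, hia] using hi
          rw [map_sub, hc i a hia, h2 i hi', map_zero, sub_zero]
  rw [eq_top_iff]
  intro x _
  refine Submodule.span_le.2 ?_ (key Finset.univ x)
  intro y hy
  obtain ⟨S, h1, h2⟩ := hy
  exact Submodule.mem_iSup_of_mem S ⟨fun i hi => h1 i (by simpa using hi),
    fun i hi => h2 i (by simpa using hi)⟩

variable {K : Type*} [Field K] {V : Type*} [AddCommGroup V] [Module K V]

/-- Contraction of the exterior algebra with a covector. -/
noncomputable def contr : Module.Dual K V →ₗ[K] Module.End K (ExteriorAlgebra K V) :=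
  CliffordAlgebra.contractLeft

/-- Left multiplication of the exterior algebra by a vector. -/
noncomputable def wedge : V →ₗ[K] Module.End K (ExteriorAlgebra K V) :=
  (LinearMap.mul K (ExteriorAlgebra K V)).comp (ι K)

theorem wedge_apply (v : V) (x : ExteriorAlgebra K V) : wedge v x = ι K v * x := rfl

theorem contr_ι_mul (ξ : Module.Dual K V) (v : V) (x : ExteriorAlgebra K V) :
    contr ξ (ι K v * x) = ξ v • x - ι K v * contr ξ x :=
  CliffordAlgebra.contractLeft_ι_mul ξ v x

theorem contr_wedge (ξ : Module.Dual K V) (v : V) (x : ExteriorAlgebra K V) :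
    contr ξ (wedge v x) = ξ v • x - wedge v (contr ξ x) := contr_ι_mul ξ v x

theorem contr_algebraMap (ξ : Module.Dual K V) (r : K) :
    contr ξ (algebraMap K (ExteriorAlgebra K V) r) = 0 :=
  CliffordAlgebra.contractLeft_algebraMap _ ξ r

theorem contr_one (ξ : Module.Dual K V) : contr ξ (1 : ExteriorAlgebra K V) = 0 :=
  CliffordAlgebra.contractLeft_one _ ξ

theorem contr_contr (ξ : Module.Dual K V) (x : ExteriorAlgebra K V) : contr ξ (contr ξ x) = 0 :=
  CliffordAlgebra.contractLeft_contractLeft ξ x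

theorem contr_comm (ξ η : Module.Dual K V) (x : ExteriorAlgebra K V) :
    contr ξ (contr η x) = -contr η (contr ξ x) :=
  CliffordAlgebra.contractLeft_comm ξ η x

theorem wedge_wedge (v : V) (x : ExteriorAlgebra K V) : wedge v (wedge v x) = 0 := by
  rw [wedge_apply, wedge_apply, ← mul_assoc, ι_sq_zero, zero_mul]

theorem wedge_comm (v w : V) (x : ExteriorAlgebra K V) :
    wedge v (wedge w x) = -wedge w (wedge v x) := by
  rw [wedge_apply, wedge_apply, wedge_apply, wedge_apply, ← mul_assoc, ← mul_assoc,
    eq_neg_of_add_eq_zero_left (ι_add_mul_swap v w), neg_mul]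

theorem contr_mem (ξ : Module.Dual K V) (p : ℕ) {x : ExteriorAlgebra K V}
    (hx : x ∈ ⋀[K]^(p + 1) V) : contr ξ x ∈ ⋀[K]^p V := by
  induction p generalizing x with
  | zero =>
    rw [zero_add, exteriorPower, pow_one] at hx
    obtain ⟨v, rfl⟩ := hx
    rw [exteriorPower, pow_zero, Submodule.mem_one]
    exact ⟨ξ v, (CliffordAlgebra.contractLeft_ι _ ξ v).symm⟩
  | succ p ih =>
    rw [exteriorPower, pow_succ'] at hx
    refine Submodule.mul_induction_on hx ?_ fun a b ha hb => by
      rw [map_add]; exact Submodule.add_mem _ ha hb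
    rintro _ ⟨v, rfl⟩ y hy
    rw [contr_ι_mul]
    refine Submodule.sub_mem _ (Submodule.smul_mem _ _ hy) ?_
    rw [exteriorPower, pow_succ']
    exact Submodule.mul_mem_mul ⟨v, rfl⟩ (ih hy)

theorem wedge_mem (v : V) (p : ℕ) {x : ExteriorAlgebra K V}
    (hx : x ∈ ⋀[K]^p V) : wedge v x ∈ ⋀[K]^(p + 1) V := by
  rw [exteriorPower, pow_succ']
  exact Submodule.mul_mem_mul ⟨v, rfl⟩ hx

/-- The projection of the exterior algebra onto its component of degree `p`. -/
noncomputable def degProj (p : ℕ) : Module.End K (ExteriorAlgebra K V) :=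
  GradedAlgebra.proj (fun i : ℕ => ⋀[K]^i V) p

theorem degProj_mem (p : ℕ) (x : ExteriorAlgebra K V) : degProj p x ∈ ⋀[K]^p V :=
  SetLike.coe_mem _

theorem degProj_of_mem {p : ℕ} {x : ExteriorAlgebra K V} (hx : x ∈ ⋀[K]^p V) :
    degProj p x = x := DirectSum.decompose_of_mem_same (fun i : ℕ => ⋀[K]^i V) hx

theorem degProj_of_mem_ne {p q : ℕ} {x : ExteriorAlgebra K V} (hx : x ∈ ⋀[K]^p V)
    (h : p ≠ q) : degProj q x = 0 := DirectSum.decompose_of_mem_ne (fun i : ℕ => ⋀[K]^i V) hx h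

theorem homogeneous_induction {C : ExteriorAlgebra K V → Prop} (h0 : C 0)
    (hh : ∀ p x, x ∈ ⋀[K]^p V → C x)
    (ha : ∀ x y, C x → C y → C (x + y)) (x : ExteriorAlgebra K V) : C x :=
  DirectSum.Decomposition.inductionOn (fun i : ℕ => ⋀[K]^i V) h0 (fun {p} m => hh p m m.2) ha x

theorem degProj_contr (ξ : Module.Dual K V) (p : ℕ) (x : ExteriorAlgebra K V) :
    degProj p (contr ξ x) = contr ξ (degProj (p + 1) x) := by
  induction x using homogeneous_induction with
  | h0 => simp
  | ha x y hx hy => simp only [map_add, hx, hy]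
  | hh q x hx =>
    rcases q with _ | q
    · rw [degProj_of_mem_ne hx (by omega), map_zero]
      rw [exteriorPower, pow_zero, Submodule.mem_one] at hx
      obtain ⟨r, rfl⟩ := hx
      rw [contr_algebraMap, map_zero]
    · by_cases h : q = p
      · subst h
        rw [degProj_of_mem hx, degProj_of_mem (contr_mem ξ _ hx)]
      · rw [degProj_of_mem_ne hx (by omega), degProj_of_mem_ne (contr_mem ξ _ hx) h, map_zero]

theorem contr_degProj_zero (ξ : Module.Dual K V) (x : ExteriorAlgebra K V) :
    contr ξ (degProj 0 x) = 0 := by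
  have hx := degProj_mem 0 x
  rw [exteriorPower, pow_zero, Submodule.mem_one] at hx
  obtain ⟨r, hr⟩ := hx
  rw [← hr, contr_algebraMap]

theorem degProj_wedge (v : V) (p : ℕ) (x : ExteriorAlgebra K V) :
    degProj (p + 1) (wedge v x) = wedge v (degProj p x) := by
  induction x using homogeneous_induction with
  | h0 => simp
  | ha x y hx hy => simp only [map_add, hx, hy]
  | hh q x hx =>
    by_cases h : q = p
    · subst h
      rw [degProj_of_mem hx, degProj_of_mem (wedge_mem v _ hx)]
    · rw [degProj_of_mem_ne hx (by omega), degProj_of_mem_ne (wedge_mem v _ hx) (by omega),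
        map_zero]

theorem map_mem_exteriorPower (f : V →ₗ[K] V) {p : ℕ} {x : ExteriorAlgebra K V}
    (hx : x ∈ ⋀[K]^p V) : ExteriorAlgebra.map f x ∈ ⋀[K]^p V := by
  induction p generalizing x with
  | zero =>
    rw [exteriorPower, pow_zero, Submodule.mem_one] at hx ⊢
    obtain ⟨r, rfl⟩ := hx
    exact ⟨r, (AlgHom.commutes _ r).symm⟩
  | succ p ih =>
    rw [exteriorPower, pow_succ'] at hx
    refine Submodule.mul_induction_on hx ?_ fun a b ha hb => by
      rw [map_add]; exact Submodule.add_mem _ ha hb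
    rintro _ ⟨v, rfl⟩ y hy
    rw [map_mul, map_apply_ι]
    exact wedge_mem _ _ (ih hy)

theorem degProj_map (f : V →ₗ[K] V) (p : ℕ) (x : ExteriorAlgebra K V) :
    degProj p (ExteriorAlgebra.map f x) = ExteriorAlgebra.map f (degProj p x) := by
  induction x using homogeneous_induction with
  | h0 => simp
  | ha x y hx hy => simp only [map_add, hx, hy]
  | hh q x hx =>
    by_cases h : q = p
    · subst h
      rw [degProj_of_mem hx, degProj_of_mem (map_mem_exteriorPower f hx)]
    · rw [degProj_of_mem_ne hx h, degProj_of_mem_ne (map_mem_exteriorPower f hx) h, map_zero]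

theorem ext_degProj {x y : ExteriorAlgebra K V} (h : ∀ p, degProj p x = degProj p y) : x = y := by
  apply (DirectSum.decompose (fun i : ℕ => ⋀[K]^i V)).injective
  ext p
  exact h p

/-- Euler's identity on the exterior algebra. Moving a factor `ι v` out of the operator leaves one
extra copy of `wedge v`, so each factor counts once. -/
theorem sum_wedge_contr {I : Type*} [Fintype I] (b : Module.Basis I K V) (p : ℕ)
    {x : ExteriorAlgebra K V} (hx : x ∈ ⋀[K]^p V) :
    ∑ i, wedge (b i) (contr (b.coord i) x) = p • x := by
  induction p generalizing x with
  | zero =>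
    rw [exteriorPower, pow_zero, Submodule.mem_one] at hx
    obtain ⟨r, rfl⟩ := hx
    simp [contr_algebraMap]
  | succ p ih =>
    rw [exteriorPower, pow_succ'] at hx
    refine Submodule.mul_induction_on hx ?_ fun a b ha hb => by
      simp only [map_add, Finset.sum_add_distrib, ha, hb, smul_add]
    rintro _ ⟨v, rfl⟩ y hy
    have h1 : ∀ i, wedge (b i) (contr (b.coord i) (ι K v * y)) =
        b.coord i v • wedge (b i) y + wedge v (wedge (b i) (contr (b.coord i) y)) := by
      intro i
      rw [contr_ι_mul, map_sub, map_smul, ← wedge_apply, wedge_comm, sub_neg_eq_add]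
    simp only [h1, Finset.sum_add_distrib, ← map_sum, ih hy]
    rw [map_nsmul, ← wedge_apply]
    have h2 : ∑ i, b.coord i v • wedge (b i) y = wedge v y := by
      conv_rhs => rw [← b.sum_repr v, map_sum, LinearMap.sum_apply]
      simp only [map_smul, LinearMap.smul_apply, Module.Basis.coord_apply]
    rw [h2, add_comm, succ_nsmul]

/-- In degree `p + 1` Euler's identity gives `(p + 1) • x = 0`, and characteristic zero permits
division. -/
theorem eq_algebraMap_of_contr_eq_zero [CharZero K] {I : Type*} [Fintype I]
    (b : Module.Basis I K V) {x : ExteriorAlgebra K V} (hx : ∀ i, contr (b.coord i) x = 0) :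
    ∃ r : K, x = algebraMap K _ r := by
  have h0 : x = degProj 0 x := by
    refine ext_degProj fun p => ?_
    rcases p with _ | p
    · exact (degProj_of_mem (degProj_mem 0 x)).symm
    · rw [degProj_of_mem_ne (degProj_mem 0 x) (by omega)]
      have h := sum_wedge_contr b (p + 1) (degProj_mem (p + 1) x)
      simp only [← degProj_contr, hx, map_zero, Finset.sum_const_zero] at h
      have h2 : ((p + 1 : ℕ) : K) • degProj (p + 1) x = 0 := by
        rw [Nat.cast_smul_eq_nsmul]; exact h.symm
      exact (smul_eq_zero.1 h2).resolve_left (Nat.cast_ne_zero.2 (by omega))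
  have hm := degProj_mem 0 x
  rw [exteriorPower, pow_zero, Submodule.mem_one] at hm
  obtain ⟨r, hr⟩ := hm
  exact ⟨r, by rw [h0, ← hr]⟩

/-- If `b a ∧ x = 0`, then `x` is `b a` times its own contraction along `a`. Removing the factors in
this way leaves an element killed by all contractions, that is, a scalar. -/
theorem eq_smul_prod_of_wedge_eq_zero [CharZero K] {I : Type*} [Fintype I]
    (b : Module.Basis I K V) (l : List I) (hl : l.Nodup) {x : ExteriorAlgebra K V}
    (h1 : ∀ j ∈ l, wedge (b j) x = 0) (h2 : ∀ k ∉ l, contr (b.coord k) x = 0) :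
    ∃ r : K, x = r • (l.map fun j => ι K (b j)).prod := by
  classical
  induction l generalizing x with
  | nil =>
    obtain ⟨r, rfl⟩ := eq_algebraMap_of_contr_eq_zero b fun i => h2 i (by simp)
    exact ⟨r, by simp [Algebra.algebraMap_eq_smul_one]⟩
  | cons a l ih =>
    have ha : a ∉ l := (List.nodup_cons.1 hl).1
    have hx : x = wedge (b a) (contr (b.coord a) x) := by
      have h := contr_wedge (b.coord a) (b a) x
      rw [h1 a (by simp), map_zero] at h
      simpa [sub_eq_zero] using h.symm
    obtain ⟨r, hr⟩ := ih (List.nodup_cons.1 hl).2 (x := contr (b.coord a) x) (by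
        intro j hj
        have h := contr_wedge (b.coord a) (b j) x
        rw [h1 j (by simp [hj]), map_zero] at h
        have hja : a ≠ j := by rintro rfl; exact ha hj
        simpa [Finsupp.single_apply, hja.symm] using h) (by
        intro k hk
        by_cases hka : k = a
        · subst hka; exact contr_contr _ _
        · rw [contr_comm, h2 k (by simp [hka, hk]), map_zero, neg_zero])
    refine ⟨r, ?_⟩
    rw [hx, hr, map_smul, List.map_cons, List.prod_cons, wedge_apply]

/-- The action of the exterior algebra on itself by contraction, after an identification of
vectors with covectors. -/
noncomputable def ctr (β : V →ₗ[K] Module.Dual K V) :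
    ExteriorAlgebra K V →ₐ[K] Module.End K (ExteriorAlgebra K V) :=
  ExteriorAlgebra.lift K ⟨contr.comp β, fun v => LinearMap.ext fun x => contr_contr (β v) x⟩

theorem ctr_ι (β : V →ₗ[K] Module.Dual K V) (v : V) : ctr β (ι K v) = contr (β v) :=
  ExteriorAlgebra.lift_ι_apply _ _ _ _

theorem ctr_ι_mul (β : V →ₗ[K] Module.Dual K V) (v : V) (a x : ExteriorAlgebra K V) :
    ctr β (ι K v * a) x = contr (β v) (ctr β a x) := by
  rw [map_mul, ctr_ι]; rfl

theorem exteriorPower_induction {d : ℕ} {C : ℕ → ExteriorAlgebra K V → Prop}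
    (h0 : ∀ r : K, C 0 (algebraMap K _ r))
    (hm : ∀ d v a, a ∈ ⋀[K]^d V → C d a → C (d + 1) (ι K v * a))
    (ha : ∀ d a b, C d a → C d b → C d (a + b))
    {a : ExteriorAlgebra K V} (h : a ∈ ⋀[K]^d V) : C d a := by
  induction d generalizing a with
  | zero =>
    rw [exteriorPower, pow_zero, Submodule.mem_one] at h
    obtain ⟨r, rfl⟩ := h
    exact h0 r
  | succ d ih =>
    rw [exteriorPower, pow_succ'] at h
    refine Submodule.mul_induction_on h ?_ fun a b ha' hb' => ha _ _ _ ha' hb'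
    rintro _ ⟨v, rfl⟩ y hy
    exact hm _ _ _ hy (ih hy)

theorem contr_ctr (β : V →ₗ[K] Module.Dual K V) (ξ : Module.Dual K V) {d : ℕ}
    {a : ExteriorAlgebra K V} (ha : a ∈ ⋀[K]^d V) (x : ExteriorAlgebra K V) :
    contr ξ (ctr β a x) = (-1 : K) ^ d • ctr β a (contr ξ x) := by
  refine exteriorPower_induction (C := fun d a => contr ξ (ctr β a x) =
    (-1 : K) ^ d • ctr β a (contr ξ x)) ?_ ?_ ?_ ha
  · intro r; simp
  · intro d v a _ h
    rw [ctr_ι_mul, ctr_ι_mul, contr_comm, h, map_smul, pow_succ, mul_neg_one, neg_smul]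
  · intro d a b h h'
    simp only [map_add, LinearMap.add_apply, h, h', smul_add]

theorem degProj_ctr (β : V →ₗ[K] Module.Dual K V) {d : ℕ}
    {a : ExteriorAlgebra K V} (ha : a ∈ ⋀[K]^d V) (p : ℕ) (x : ExteriorAlgebra K V) :
    degProj p (ctr β a x) = ctr β a (degProj (p + d) x) := by
  refine exteriorPower_induction (C := fun d a => ∀ p, degProj p (ctr β a x) =
    ctr β a (degProj (p + d) x)) ?_ ?_ ?_ ha p
  · intro r p; simp
  · intro d v a _ h p
    rw [ctr_ι_mul, ctr_ι_mul, degProj_contr, h, Nat.add_right_comm, add_assoc]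
  · intro d a b h h' p
    simp only [map_add, LinearMap.add_apply, h, h']

theorem ctr_wedge (β : V →ₗ[K] Module.Dual K V) (l : List V) (v : V)
    (hv : ∀ w ∈ l, β w v = 0) (x : ExteriorAlgebra K V) :
    ctr β (l.map fun w => ι K w).prod (wedge v x) =
      (-1 : K) ^ l.length • wedge v (ctr β (l.map fun w => ι K w).prod x) := by
  induction l with
  | nil => simp
  | cons a l ih =>
    rw [List.map_cons, List.prod_cons, ctr_ι_mul, ih fun w hw => hv w (by simp [hw]),
      map_smul, contr_wedge, hv a (by simp), zero_smul, zero_sub, ctr_ι_mul, List.length_cons,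
      pow_succ, mul_neg_one, neg_smul, smul_neg]

theorem map_contr (f f' : V →ₗ[K] V) (hf : f' ∘ₗ f = LinearMap.id) (ξ : Module.Dual K V)
    (x : ExteriorAlgebra K V) :
    ExteriorAlgebra.map f (contr ξ x) = contr (ξ ∘ₗ f') (ExteriorAlgebra.map f x) := by
  induction x using CliffordAlgebra.left_induction with
  | algebraMap r =>
    have h1 : contr ξ (algebraMap K (ExteriorAlgebra K V) r) = 0 := contr_algebraMap ξ r
    have h2 : ExteriorAlgebra.map f (algebraMap K (ExteriorAlgebra K V) r) =
      algebraMap K (ExteriorAlgebra K V) r := AlgHom.commutes _ r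
    exact (congrArg _ h1).trans ((map_zero _).trans
      ((contr_algebraMap (ξ ∘ₗ f') r).symm.trans (congrArg _ h2.symm)))
  | add x y hx hy => simp only [map_add, hx, hy]
  | ι_mul x v hx =>
    have e := contr_ι_mul ξ v x
    have h1 : f' (f v) = v := LinearMap.congr_fun hf v
    refine (congrArg _ e).trans ?_
    refine Eq.trans ?_ (congrArg _ (map_mul (ExteriorAlgebra.map f) (ι K v) x)).symm
    rw [map_apply_ι, contr_ι_mul, map_sub, map_smul, map_mul, map_apply_ι, hx]
    simp [h1]

theorem map_ctr (β : V →ₗ[K] Module.Dual K V) (f f' : V →ₗ[K] V) (hf : f' ∘ₗ f = LinearMap.id)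
    (hβ : ∀ v, β v ∘ₗ f' = β (f v)) (a x : ExteriorAlgebra K V) :
    ExteriorAlgebra.map f (ctr β a x) =
      ctr β (ExteriorAlgebra.map f a) (ExteriorAlgebra.map f x) := by
  induction a using homogeneous_induction with
  | h0 => simp
  | ha a b h h' => simp only [map_add, LinearMap.add_apply, h, h']
  | hh d a ha =>
    refine exteriorPower_induction (C := fun d a => ExteriorAlgebra.map f (ctr β a x) =
      ctr β (ExteriorAlgebra.map f a) (ExteriorAlgebra.map f x)) ?_ ?_ ?_ ha
    · intro r; simp
    · intro d v a _ h
      rw [ctr_ι_mul, map_contr f f' hf, h, hβ, map_mul, map_apply_ι, ctr_ι_mul]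
    · intro d a b h h'
      simp only [map_add, LinearMap.add_apply, h, h']

end Exterior

/-! ### Koszul cohomology by an Euler homotopy -/

section Homotopy

variable {K L : Type*} [Field K] [CharZero K] [AddCommGroup L] [Module K L]

/-- The Laplacian acts as `m + 1` on `F (m + 1)` modulo `F m`. For a cocycle `z` it equals `d (h
z)`, so `z` is a coboundary up to a cocycle in `F m`, and the descent continues down to `F 0`. -/
theorem exists_add_of_homotopy (d h : Module.End K L) (F : ℕ → Submodule K L)
    (hd : ∀ x, d (d x) = 0)
    (hs : ∀ m, ∀ x ∈ F (m + 1), d (h x) + h (d x) - ((m + 1 : ℕ) : K) • x ∈ F m)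
    (m : ℕ) (z : L) (hz : z ∈ F m) (hdz : d z = 0) : ∃ z₀ ∈ F 0, ∃ y, z = z₀ + d y := by
  induction m generalizing z with
  | zero => exact ⟨z, hz, 0, by simp⟩
  | succ m ih =>
    have h1 := hs m z hz
    rw [hdz, map_zero, add_zero] at h1
    obtain ⟨z₀, h0, y, hy⟩ := ih _ h1 (by rw [map_sub, map_smul, hdz, hd]; simp)
    have hm : ((m + 1 : ℕ) : K) ≠ 0 := Nat.cast_ne_zero.2 (by omega)
    refine ⟨((m + 1 : ℕ) : K)⁻¹ • -z₀, Submodule.smul_mem _ _ (Submodule.neg_mem _ h0),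
      ((m + 1 : ℕ) : K)⁻¹ • (h z - y), ?_⟩
    rw [map_smul, ← smul_add, eq_inv_smul_iff₀ hm, map_sub]
    rw [sub_eq_iff_eq_add] at hy
    rw [hy]
    abel

/-- Replace `z` by the Laplacian of `z` minus `(m + 1) • z`. The result lies one step lower and
still in `U`, and its differential is `-(m + 1) • d z`, since the Laplacian vanishes on `d z ∈ F 0`.
The descent ends where `U` meets `F 0` trivially. -/
theorem eq_zero_of_homotopy (d h : Module.End K L) (F : ℕ → Submodule K L) (U : Submodule K L)
    (hd : ∀ x, d (d x) = 0)
    (h0 : ∀ x ∈ F 0, d (h x) + h (d x) = 0)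
    (hs : ∀ m, ∀ x ∈ F (m + 1), d (h x) + h (d x) - ((m + 1 : ℕ) : K) • x ∈ F m)
    (hU : ∀ x ∈ U, d (h x) + h (d x) ∈ U) (hUF : ∀ x ∈ U, x ∈ F 0 → x = 0)
    (m : ℕ) (z : L) (hz : z ∈ F m) (hzU : z ∈ U) (hdz : d z ∈ F 0) : d z = 0 := by
  induction m generalizing z with
  | zero => rw [hUF z hzU hz, map_zero]
  | succ m ih =>
    have e : d (d (h z) + h (d z) - ((m + 1 : ℕ) : K) • z) = -(((m + 1 : ℕ) : K) • d z) := by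
      have h2 := h0 _ hdz
      rw [hd, map_zero, add_zero] at h2
      rw [map_sub, map_add, map_smul, hd, h2]
      simp
    have h1 := ih _ (hs m z hz) (Submodule.sub_mem _ (hU z hzU) (Submodule.smul_mem _ _ hzU))
      (by rw [e]; exact Submodule.neg_mem _ (Submodule.smul_mem _ _ hdz))
    rw [e, neg_eq_zero] at h1
    exact (smul_eq_zero.1 h1).resolve_left (Nat.cast_ne_zero.2 (by omega))

end Homotopy

/-! ### Degree filtration and Euler operators of an algebra with Heisenberg generators. -/

section WeylFiltration

variable {K A V : Type*} [Field K] [Ring A] [Algebra K A] [AddCommGroup V] [Module K V]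

/-- A linear map into an algebra whose values satisfy the canonical commutation relations of a
bilinear form, and generate the algebra. -/
structure IsHeisenberg (ω : V →ₗ[K] V →ₗ[K] K) (f : V →ₗ[K] A) : Prop where
  comm (u v : V) : f u * f v - f v * f u = algebraMap K A (ω u v)
  gen : Algebra.adjoin K (Set.range f) = ⊤

/-- The commutator with a generator. -/
noncomputable def adGen (f : V →ₗ[K] A) : V →ₗ[K] Module.End K A :=
  (LinearMap.mul K A).comp f - (LinearMap.mul K A).flip.comp f

theorem adGen_apply (f : V →ₗ[K] A) (v : V) (a : A) : adGen f v a = f v * a - a * f v := rfl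

theorem adGen_mul (f : V →ₗ[K] A) (v : V) (a b : A) :
    adGen f v (a * b) = adGen f v a * b + a * adGen f v b := by
  simp only [adGen_apply]; noncomm_ring

/-- The filtration of the algebra by the degree in the generators, shifted by one. -/
def degFil (f : V →ₗ[K] A) : ℕ → Submodule K A
  | 0 => ⊥
  | m + 1 => (1 ⊔ LinearMap.range f) ^ m

theorem degFil_mono_succ (f : V →ₗ[K] A) (m : ℕ) : degFil f m ≤ degFil f (m + 1) := by
  rcases m with _ | m
  · exact bot_le
  · simp only [degFil]
    rw [pow_succ]
    exact le_mul_of_one_le_right' le_sup_left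

theorem degFil_mono (f : V →ₗ[K] A) : Monotone (degFil f) :=
  monotone_nat_of_le_succ (degFil_mono_succ f)

theorem gen_mul_mem (f : V →ₗ[K] A) (v : V) {m : ℕ} {a : A} (ha : a ∈ degFil f m) :
    f v * a ∈ degFil f (m + 1) := by
  rcases m with _ | m
  · rw [(Submodule.mem_bot K).1 ha, mul_zero]; exact Submodule.zero_mem _
  · simp only [degFil] at ha ⊢
    rw [pow_succ']
    exact Submodule.mul_mem_mul (Submodule.mem_sup_right ⟨v, rfl⟩) ha

theorem degFil_induction (f : V →ₗ[K] A) {C : ℕ → A → Prop}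
    (h1 : ∀ r : K, C 0 (algebraMap K A r))
    (hm : ∀ m v a, a ∈ degFil f (m + 1) → C m a → C (m + 1) (f v * a))
    (hs : ∀ m a, a ∈ degFil f (m + 1) → C m a → C (m + 1) a)
    (ha : ∀ m a b, C m a → C m b → C m (a + b)) (hr : ∀ m (r : K) a, C m a → C m (r • a))
    {m : ℕ} {a : A} (h : a ∈ degFil f (m + 1)) : C m a := by
  induction m generalizing a with
  | zero =>
    simp only [degFil, pow_zero, Submodule.mem_one] at h
    obtain ⟨r, rfl⟩ := h
    exact h1 r
  | succ m ih =>
    simp only [degFil] at h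
    rw [pow_succ'] at h
    refine Submodule.mul_induction_on h ?_ fun a b ha' hb' => ha _ _ _ ha' hb'
    intro x hx y hy
    obtain ⟨x₁, h1, x₂, ⟨v, rfl⟩, rfl⟩ := Submodule.mem_sup.1 hx
    obtain ⟨r, rfl⟩ := Submodule.mem_one.1 h1
    rw [add_mul, ← Algebra.smul_def]
    exact ha _ _ _ (hr _ _ _ (hs _ _ hy (ih hy))) (hm _ _ _ hy (ih hy))

variable {ω : V →ₗ[K] V →ₗ[K] K} {f : V →ₗ[K] A} (hf : IsHeisenberg ω f)
include hf

theorem IsHeisenberg.adGen_gen (u v : V) : adGen f u (f v) = algebraMap K A (ω u v) := hf.comm u v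

/-- Commutators of generators are scalars, so `adGen` is a derivation of degree `-1`. The index
shift in `degFil` makes this true for scalars too, because their commutators lie in `degFil f 0 =
⊥`. -/
theorem IsHeisenberg.adGen_mem (x : V) {m : ℕ} {a : A} (ha : a ∈ degFil f (m + 1)) :
    adGen f x a ∈ degFil f m := by
  refine degFil_induction f (C := fun m a => adGen f x a ∈ degFil f m) ?_ ?_ ?_ ?_ ?_ ha
  · intro r
    rw [adGen_apply, Algebra.commutes, sub_self]; exact Submodule.zero_mem _
  · intro m v a ha h
    rw [adGen_mul, hf.adGen_gen, ← Algebra.smul_def]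
    exact Submodule.add_mem _ (Submodule.smul_mem _ _ ha) (gen_mul_mem f v h)
  · intro m a _ h
    exact degFil_mono_succ f m h
  · intro m a b h h'
    rw [map_add]; exact Submodule.add_mem _ h h'
  · intro m r a h
    rw [map_smul]; exact Submodule.smul_mem _ _ h

/-- The sum of the `f (y l) * adGen f (x l)` fixes the generators by duality of the families, and it
is a derivation up to terms of lower degree. So it acts as `m` on degree `m` modulo lower degree. -/
theorem IsHeisenberg.euler {J : Type*} [Fintype J] (x y : J → V)
    (hxy : ∀ w, ∑ l, ω (x l) w • y l = w) {m : ℕ} {a : A} (ha : a ∈ degFil f (m + 1)) :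
    ∑ l, f (y l) * adGen f (x l) a - (m : K) • a ∈ degFil f m := by
  have hxy' : ∀ w, ∑ l, ω (x l) w • f (y l) = f w := fun w => by
    conv_rhs => rw [← hxy w]
    simp
  refine degFil_induction f (C := fun m a =>
    ∑ l, f (y l) * adGen f (x l) a - (m : K) • a ∈ degFil f m) ?_ ?_ ?_ ?_ ?_ ha
  · intro r
    have : ∀ l, adGen f (x l) (algebraMap K A r) = 0 := fun l => by
      rw [adGen_apply, Algebra.commutes, sub_self]
    simp [this]
  · intro m v a ha h
    have e : ∀ l, f (y l) * adGen f (x l) (f v * a) = (ω (x l) v • f (y l)) * a +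
        (f v * (f (y l) * adGen f (x l) a) + ω (y l) v • adGen f (x l) a) := fun l => by
      have h1 : f (y l) * f v = f v * f (y l) + algebraMap K A (ω (y l) v) := by
        rw [← hf.comm]; abel
      rw [adGen_mul, hf.adGen_gen, mul_add, ← mul_assoc, ← mul_assoc, h1, ← Algebra.commutes,
        ← Algebra.smul_def, add_mul, mul_assoc, ← Algebra.smul_def]
    simp only [e, Finset.sum_add_distrib, ← Finset.sum_mul, hxy', ← Finset.mul_sum]
    have e2 : f v * a + (f v * ∑ l, f (y l) * adGen f (x l) a + ∑ l, ω (y l) v • adGen f (x l) a)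
        - ((m + 1 : ℕ) : K) • (f v * a) =
        f v * (∑ l, f (y l) * adGen f (x l) a - (m : K) • a) +
          ∑ l, ω (y l) v • adGen f (x l) a := by
      rw [mul_sub, Nat.cast_succ, add_smul, one_smul, mul_smul_comm]; abel
    rw [e2]
    exact Submodule.add_mem _ (gen_mul_mem f v h) (Submodule.sum_mem _ fun l _ =>
      Submodule.smul_mem _ _ (degFil_mono_succ f m (hf.adGen_mem _ ha)))
  · intro m a ha h
    have e : ∑ l, f (y l) * adGen f (x l) a - ((m + 1 : ℕ) : K) • a =
      (∑ l, f (y l) * adGen f (x l) a - (m : K) • a) - a := by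
      rw [Nat.cast_succ, add_smul, one_smul]; abel
    rw [e]
    exact Submodule.sub_mem _ (degFil_mono_succ f m h) ha
  · intro m a b h h'
    have e : ∑ l, f (y l) * adGen f (x l) (a + b) - (m : K) • (a + b) =
      (∑ l, f (y l) * adGen f (x l) a - (m : K) • a) +
      (∑ l, f (y l) * adGen f (x l) b - (m : K) • b) := by
      simp only [map_add, mul_add, Finset.sum_add_distrib, smul_add]; abel
    rw [e]; exact Submodule.add_mem _ h h'
  · intro m r a h
    have e : ∑ l, f (y l) * adGen f (x l) (r • a) - (m : K) • (r • a) =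
      r • (∑ l, f (y l) * adGen f (x l) a - (m : K) • a) := by
      simp only [map_smul, mul_smul_comm, ← Finset.smul_sum, smul_sub, smul_comm r]
    rw [e]; exact Submodule.smul_mem _ _ h

/-- The generators generate. The induction over `Algebra.adjoin` is run on left multiplication
operators, so products of elements become compositions. -/
theorem IsHeisenberg.exists_mem (a : A) : ∃ m, a ∈ degFil f m := by
  have ha : a ∈ Algebra.adjoin K (Set.range f) := hf.gen ▸ trivial
  have key : ∀ m, ∀ b ∈ degFil f m, ∃ k, a * b ∈ degFil f k := by
    induction ha using Algebra.adjoin_induction with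
    | mem x hx =>
      obtain ⟨v, rfl⟩ := hx
      exact fun m b hb => ⟨_, gen_mul_mem f v hb⟩
    | algebraMap r =>
      exact fun m b hb => ⟨m, by rw [← Algebra.smul_def]; exact Submodule.smul_mem _ _ hb⟩
    | add x y _ _ hx hy =>
      intro m b hb
      obtain ⟨k, hk⟩ := hx m b hb
      obtain ⟨l, hl⟩ := hy m b hb
      refine ⟨max k l, ?_⟩
      rw [add_mul]
      exact Submodule.add_mem _ (degFil_mono f (le_max_left k l) hk)
        (degFil_mono f (le_max_right k l) hl)
    | mul x y _ _ hx hy =>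
      intro m b hb
      obtain ⟨k, hk⟩ := hy m b hb
      obtain ⟨l, hl⟩ := hx k _ hk
      exact ⟨l, by rwa [mul_assoc]⟩
  obtain ⟨k, hk⟩ := key 1 1 (by simp only [degFil, pow_zero]; exact Submodule.one_le.1 le_rfl)
  exact ⟨k, by rwa [mul_one] at hk⟩

end WeylFiltration

/-! ### Twisted Koszul cohomology of an algebra with Heisenberg relations -/

section TwistedKoszul

open ExteriorAlgebra

variable {K A V : Type*} [Field K] [Ring A] [Algebra K A] [AddCommGroup V] [Module K V]

/-- The commutator with a generator, twisted by a linear substitution. -/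
noncomputable def twistedComm (f : V →ₗ[K] A) (g : V →ₗ[K] V) : V →ₗ[K] Module.End K A :=
  (LinearMap.mul K A).comp f - (LinearMap.mul K A).flip.comp (f.comp g)

theorem twistedComm_apply (f : V →ₗ[K] A) (g : V →ₗ[K] V) (v : V) (a : A) :
    twistedComm f g v a = f v * a - a * f (g v) := rfl

/-- The endomorphism `φ ↦ D ∘ φ ∘ c` of a space of linear maps. -/
def sandwich {M N : Type*} [AddCommGroup M] [Module K M] [AddCommGroup N] [Module K N]
    (D : Module.End K N) (c : Module.End K M) : Module.End K (M →ₗ[K] N) where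
  toFun φ := D ∘ₗ φ ∘ₗ c
  map_add' _ _ := LinearMap.ext fun _ => by simp
  map_smul' _ _ := LinearMap.ext fun _ => by simp

/-- The differential of the twisted Koszul cochain complex. -/
noncomputable def twistedDiff {I : Type*} [Fintype I] (b : Module.Basis I K V) (f : V →ₗ[K] A)
    (g : V →ₗ[K] V) : Module.End K (ExteriorAlgebra K V →ₗ[K] A) :=
  ∑ i, sandwich (twistedComm f g (b i)) (contr (b.coord i))

theorem twistedDiff_apply {I : Type*} [Fintype I] (b : Module.Basis I K V) (f : V →ₗ[K] A)
    (g : V →ₗ[K] V) (φ : ExteriorAlgebra K V →ₗ[K] A) (x : ExteriorAlgebra K V) :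
    twistedDiff b f g φ x = ∑ i, twistedComm f g (b i) (φ (contr (b.coord i) x)) := by
  simp [twistedDiff, sandwich, LinearMap.sum_apply]

/-- The canonical element of `V ⊗ Dual V` does not depend on the basis. Koszul differentials may
therefore be computed in a basis adapted to `g`. -/
theorem sum_basis_coord {M I I' : Type*} [AddCommGroup M] [Module K M] [Fintype I] [Fintype I']
    (b : Module.Basis I K V) (b' : Module.Basis I' K V) (Φ : V →ₗ[K] Module.Dual K V →ₗ[K] M) :
    ∑ i, Φ (b i) (b.coord i) = ∑ j, Φ (b' j) (b'.coord j) := by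
  have h1 : ∀ i, Φ (b i) (b.coord i) = ∑ j, Φ (b' j) (b'.coord j (b i) • b.coord i) := fun i => by
    conv_lhs => rw [← b'.sum_repr (b i), map_sum, LinearMap.sum_apply]
    simp only [map_smul, LinearMap.smul_apply, Module.Basis.coord_apply]
  simp only [h1]
  rw [Finset.sum_comm]
  refine Finset.sum_congr rfl fun j _ => ?_
  rw [← map_sum]
  congr 1
  refine b.ext fun k => ?_
  classical
  simp [Finsupp.single_apply]

theorem twistedDiff_basis {I I' : Type*} [Fintype I] [Fintype I'] (b : Module.Basis I K V)
    (b' : Module.Basis I' K V) (f : V →ₗ[K] A) (g : V →ₗ[K] V) :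
    twistedDiff b f g = twistedDiff b' f g := by
  ext φ : 1
  refine LinearMap.ext fun x => ?_
  rw [twistedDiff_apply, twistedDiff_apply]
  let Φ : V →ₗ[K] Module.Dual K V →ₗ[K] A := LinearMap.mk₂ K
    (fun v ξ => twistedComm f g v (φ (contr ξ x))) (by simp) (by simp) (by simp) (by simp)
  exact sum_basis_coord b b' Φ

variable {ω : V →ₗ[K] V →ₗ[K] K} {f : V →ₗ[K] A} (hf : IsHeisenberg ω f)

/-- The commutator of the two operators is multiplication by `ω u v - ω (g u) (g v)`, which vanishes
for an isometry. -/
theorem IsHeisenberg.twistedComm_comm (hf : IsHeisenberg ω f) {g : V →ₗ[K] V}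
    (hg : ∀ u v, ω (g u) (g v) = ω u v) (u v : V) (a : A) :
    twistedComm f g u (twistedComm f g v a) = twistedComm f g v (twistedComm f g u a) := by
  have h1 : f u * f v = f v * f u + algebraMap K A (ω u v) := by rw [← hf.comm]; abel
  have h2 : f (g u) * f (g v) = f (g v) * f (g u) + algebraMap K A (ω u v) := by
    rw [← hg, ← hf.comm]; abel
  simp only [twistedComm_apply, mul_sub, sub_mul]
  rw [← mul_assoc, h1, mul_assoc a, mul_assoc a, h2, add_mul, mul_add, ← Algebra.commutes]
  noncomm_ring

/-- The twisted commutators commute and the contractions anticommute, so the double sum equals its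
own negative. -/
theorem IsHeisenberg.twistedDiff_twistedDiff [CharZero K] (hf : IsHeisenberg ω f)
    {I : Type*} [Fintype I]
    (b : Module.Basis I K V) {g : V →ₗ[K] V} (hg : ∀ u v, ω (g u) (g v) = ω u v)
    (φ : ExteriorAlgebra K V →ₗ[K] A) : twistedDiff b f g (twistedDiff b f g φ) = 0 := by
  refine LinearMap.ext fun x => ?_
  have e : twistedDiff b f g (twistedDiff b f g φ) x = -twistedDiff b f g (twistedDiff b f g φ) x := by
    simp only [twistedDiff_apply, map_sum]
    conv_rhs => rw [Finset.sum_comm]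
    rw [← Finset.sum_neg_distrib]
    refine Finset.sum_congr rfl fun i _ => ?_
    rw [← Finset.sum_neg_distrib]
    refine Finset.sum_congr rfl fun j _ => ?_
    rw [contr_comm, map_neg, map_neg, map_neg, hf.twistedComm_comm hg]
  have h2 : (2 : K) • twistedDiff b f g (twistedDiff b f g φ) x = 0 := by
    rw [two_smul]; nth_rewrite 1 [e]; exact neg_add_cancel _
  exact (smul_eq_zero.1 h2).resolve_left two_ne_zero

/-- A basis adapted to the decomposition of a symplectic space into the kernel and the image of
`1 - g`, with the elements that give a contracting homotopy for the Koszul complex. -/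
structure AdaptedBasis (ω : V →ₗ[K] V →ₗ[K] K) (g : V →ₗ[K] V) {I : Type*} [Fintype I]
    [DecidableEq I] (b : Module.Basis I K V) (J : Finset I) (s : I → V) : Prop where
  isometry : ∀ u v, ω (g u) (g v) = ω u v
  fixed : ∀ k ∉ J, g (b k) = b k
  dual_fixed : ∀ i, ∀ k ∉ J, ω (b i) (s k) = if i = k then 1 else 0
  dual_moved : ∀ i, ∀ j ∈ J, ω (s j) (b i - g (b i)) = if i = j then 1 else 0
  sum_eq : ∀ w, ∑ i, ω (if i ∈ J then s i else b i) w • (if i ∈ J then b i - g (b i) else s i) = w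

/-- The idempotents `e ι` for the fixed directions and `ι e` for the moved ones. -/
noncomputable def koszulIdem {I : Type*} [Fintype I] [DecidableEq I] (b : Module.Basis I K V)
    (J : Finset I) (i : I) : Module.End K (ExteriorAlgebra K V) :=
  if i ∈ J then contr (b.coord i) * wedge (b i) else wedge (b i) * contr (b.coord i)

section Idem

variable {I : Type*} (b : Module.Basis I K V)

theorem contr_wedge_self (i : I) (x : ExteriorAlgebra K V) :
    contr (b.coord i) (wedge (b i) x) = x - wedge (b i) (contr (b.coord i) x) := by
  rw [contr_wedge]; simp

theorem contr_wedge_ne {i j : I} (h : i ≠ j) (x : ExteriorAlgebra K V) :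
    contr (b.coord i) (wedge (b j) x) = -wedge (b j) (contr (b.coord i) x) := by
  rw [contr_wedge]; simp [h.symm]

variable [Fintype I] [DecidableEq I] (J : Finset I)

theorem koszulIdem_of_mem {i : I} (hi : i ∈ J) (x : ExteriorAlgebra K V) :
    koszulIdem b J i x = contr (b.coord i) (wedge (b i) x) := by
  rw [koszulIdem, if_pos hi]; rfl

theorem koszulIdem_of_notMem {i : I} (hi : i ∉ J) (x : ExteriorAlgebra K V) :
    koszulIdem b J i x = wedge (b i) (contr (b.coord i) x) := by
  rw [koszulIdem, if_neg hi]; rfl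

theorem koszulIdem_idem (i : I) (x : ExteriorAlgebra K V) :
    koszulIdem b J i (koszulIdem b J i x) = koszulIdem b J i x := by
  by_cases hi : i ∈ J
  · simp only [koszulIdem_of_mem b J hi]
    rw [contr_wedge_self b i x, map_sub, wedge_wedge, sub_zero, contr_wedge_self]
  · simp only [koszulIdem_of_notMem b J hi]
    rw [contr_wedge_self, contr_contr, map_zero, sub_zero]

theorem koszulIdem_comm (i j : I) (h : i ≠ j) (x : ExteriorAlgebra K V) :
    koszulIdem b J i (koszulIdem b J j x) = koszulIdem b J j (koszulIdem b J i x) := by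
  have key : ∀ y, wedge (b i) (contr (b.coord i) (wedge (b j) (contr (b.coord j) y))) =
      wedge (b j) (contr (b.coord j) (wedge (b i) (contr (b.coord i) y))) := fun y => by
    rw [contr_wedge_ne b h, contr_wedge_ne b h.symm, map_neg, map_neg, wedge_comm,
      contr_comm (b.coord j), map_neg, map_neg]
  by_cases hi : i ∈ J <;> by_cases hj : j ∈ J <;>
    simp only [koszulIdem_of_mem b J, koszulIdem_of_notMem b J, hi, hj, not_false_eq_true,
      contr_wedge_self, map_sub, key] <;> abel

theorem iSup_koszulIdem : ⨆ S, jointEigenspace (koszulIdem b J) S = ⊤ :=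
  iSup_jointEigenspace _ (koszulIdem_idem b J) (koszulIdem_comm b J)

theorem sum_koszulIdem {S : Finset I} {x : ExteriorAlgebra K V}
    (hx : x ∈ jointEigenspace (koszulIdem b J) S) :
    ∑ i, koszulIdem b J i x = (S.card : K) • x := by
  rw [← Finset.sum_subset (Finset.subset_univ S) fun i _ hi => hx.2 i hi,
    Finset.sum_congr rfl hx.1, Finset.sum_const, Nat.cast_smul_eq_nsmul]

theorem ext_koszulIdem {M : Type*} [AddCommGroup M] [Module K M]
    {φ ψ : ExteriorAlgebra K V →ₗ[K] M}
    (h : ∀ S, ∀ x ∈ jointEigenspace (koszulIdem b J) S, φ x = ψ x) : φ = ψ := by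
  have : ⊤ ≤ LinearMap.eqLocus φ ψ := by
    rw [← iSup_koszulIdem b J]
    exact iSup_le fun S x hx => h S x hx
  exact LinearMap.ext fun x => this trivial

end Idem

/-- The filtration of the twisted Koszul cochains. -/
noncomputable def cochainFil {I : Type*} [Fintype I] [DecidableEq I] (b : Module.Basis I K V)
    (J : Finset I) (f : V →ₗ[K] A) (m : ℕ) : Submodule K (ExteriorAlgebra K V →ₗ[K] A) where
  carrier := {φ | ∀ S, ∀ x ∈ jointEigenspace (koszulIdem b J) S,
    φ x ∈ degFil f (m + 1 - S.card)}
  zero_mem' := fun _ _ _ => Submodule.zero_mem _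
  add_mem' := fun h h' S x hx => Submodule.add_mem _ (h S x hx) (h' S x hx)
  smul_mem' := fun r _ h S x hx => Submodule.smul_mem _ r (h S x hx)

section Adapted

variable {I : Type*} [Fintype I] [DecidableEq I] {b : Module.Basis I K V} {J : Finset I}
  {s : I → V} {g : V →ₗ[K] V}

/-- The operators on the algebra that are dual to the twisted commutators. -/
noncomputable def dualOp (f : V →ₗ[K] A) (J : Finset I) (s : I → V) (i : I) : Module.End K A :=
  if i ∈ J then adGen f (s i) else LinearMap.mulLeft K (f (s i))

/-- The contracting homotopy of the twisted Koszul complex. -/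
noncomputable def koszulHomotopy (b : Module.Basis I K V) (f : V →ₗ[K] A) (J : Finset I)
    (s : I → V) : Module.End K (ExteriorAlgebra K V →ₗ[K] A) :=
  ∑ i, sandwich (dualOp f J s i) (wedge (b i))

theorem koszulHomotopy_apply (φ : ExteriorAlgebra K V →ₗ[K] A) (x : ExteriorAlgebra K V) :
    koszulHomotopy b f J s φ x = ∑ i, dualOp f J s i (φ (wedge (b i) x)) := by
  simp [koszulHomotopy, sandwich, LinearMap.sum_apply]

/-- Canonical commutation relations. In a moved direction `adGen f (s j)` differentiates the factors
`f (b i)` and `f (g (b i))`; in a fixed one the factor `f (s j)` is commuted with `f (b i)`. The two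
cases have opposite signs, which is why `koszulIdem` uses `contr` and `wedge` in opposite orders. -/
theorem dualOp_comm (hf : IsHeisenberg ω f) (h : AdaptedBasis ω g b J s) (i j : I) (a : A) :
    twistedComm f g (b i) (dualOp f J s j a) - dualOp f J s j (twistedComm f g (b i) a) =
      if i = j then (if j ∈ J then -a else a) else 0 := by
  by_cases hj : j ∈ J
  · have e : twistedComm f g (b i) (dualOp f J s j a) - dualOp f J s j (twistedComm f g (b i) a) =
        -(ω (s j) (b i - g (b i)) • a) := by
      simp only [dualOp, if_pos hj, twistedComm_apply, map_sub, adGen_mul, hf.adGen_gen]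
      rw [Algebra.algebraMap_eq_smul_one, Algebra.algebraMap_eq_smul_one, smul_mul_assoc, one_mul,
        mul_smul_comm, mul_one, sub_smul]
      abel
    rw [e, h.dual_moved i j hj]
    split_ifs <;> simp
  · have e : twistedComm f g (b i) (dualOp f J s j a) - dualOp f J s j (twistedComm f g (b i) a) =
        ω (b i) (s j) • a := by
      simp only [dualOp, if_neg hj, twistedComm_apply, LinearMap.mulLeft_apply, mul_sub]
      rw [Algebra.smul_def, ← hf.comm]
      noncomm_ring
    rw [e, h.dual_fixed i j hj]
    split_ifs <;> simp

/-- The algebra part of the Laplacian of the homotopy. -/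
noncomputable def algLaplacian (b : Module.Basis I K V) (f : V →ₗ[K] A) (J : Finset I)
    (s : I → V) (g : V →ₗ[K] V) : Module.End K A :=
  ∑ i, dualOp f J s i * twistedComm f g (b i) - (J.card : K) • 1

/-- The relations between `contr` and `wedge` and those of `dualOp_comm` cancel all off-diagonal
terms. The summand `J.card` in `algLaplacian` balances the difference between `contr ∘ wedge` and
`-(wedge ∘ contr)` in the moved directions. -/
theorem laplacian_apply (hf : IsHeisenberg ω f) (h : AdaptedBasis ω g b J s)
    (φ : ExteriorAlgebra K V →ₗ[K] A) (x : ExteriorAlgebra K V) :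
    (twistedDiff b f g (koszulHomotopy b f J s φ) +
      koszulHomotopy b f J s (twistedDiff b f g φ)) x =
      algLaplacian b f J s g (φ x) + φ (∑ i, koszulIdem b J i x) := by
  have h1 : ∀ i j, dualOp f J s j (twistedComm f g (b i) (φ (contr (b.coord i) (wedge (b j) x)))) =
      (if i = j then dualOp f J s j (twistedComm f g (b i) (φ x)) else 0) -
        dualOp f J s j (twistedComm f g (b i) (φ (wedge (b j) (contr (b.coord i) x)))) := by
    intro i j
    by_cases hij : i = j
    · subst hij
      rw [contr_wedge_self, map_sub, map_sub, map_sub, if_pos rfl]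
    · rw [contr_wedge_ne b hij, if_neg hij, map_neg, map_neg, map_neg, zero_sub]
  have h2 : ∀ i j, twistedComm f g (b i) (dualOp f J s j (φ (wedge (b j) (contr (b.coord i) x)))) =
      dualOp f J s j (twistedComm f g (b i) (φ (wedge (b j) (contr (b.coord i) x)))) +
      if i = j then (if j ∈ J then -φ (wedge (b j) (contr (b.coord i) x)) else
        φ (wedge (b j) (contr (b.coord i) x))) else 0 := by
    intro i j
    rw [← dualOp_comm hf h i j]; abel
  rw [LinearMap.add_apply, twistedDiff_apply, koszulHomotopy_apply]
  simp only [koszulHomotopy_apply, twistedDiff_apply, map_sum]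
  rw [Finset.sum_comm (γ := I) (s := Finset.univ) (t := Finset.univ)
    (f := fun j i => dualOp f J s j (twistedComm f g (b i) (φ (contr (b.coord i) (wedge (b j) x)))))]
  simp only [h1, h2, Finset.sum_add_distrib, Finset.sum_sub_distrib, Finset.sum_ite_eq,
    Finset.mem_univ, if_true]
  have h3 : ∀ i, φ (koszulIdem b J i x) = (if i ∈ J then φ x else 0) +
      (if i ∈ J then -φ (wedge (b i) (contr (b.coord i) x)) else
        φ (wedge (b i) (contr (b.coord i) x))) := by
    intro i
    by_cases hi : i ∈ J
    · rw [koszulIdem_of_mem b J hi, contr_wedge_self, if_pos hi, if_pos hi, map_sub]; abel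
    · rw [koszulIdem_of_notMem b J hi, if_neg hi, if_neg hi, zero_add]
  simp only [h3, Finset.sum_add_distrib, Finset.sum_ite_mem, Finset.univ_inter, Finset.sum_const]
  rw [algLaplacian, LinearMap.sub_apply, LinearMap.sum_apply, LinearMap.smul_apply,
    ← Nat.cast_smul_eq_nsmul K]
  simp only [Module.End.mul_apply, Module.End.one_apply]
  abel

/-- Each moved direction gives a term `f (b i - g (b i)) * adGen f (s i) a`, one copy of `a`, and a
double commutator of lower degree. The copies of `a` cancel `J.card`, and `AdaptedBasis.sum_eq` is
the duality that `IsHeisenberg.euler` requires. -/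
theorem algLaplacian_mem (hf : IsHeisenberg ω f) (h : AdaptedBasis ω g b J s) {m : ℕ} {a : A}
    (ha : a ∈ degFil f (m + 1)) : algLaplacian b f J s g a - (m : K) • a ∈ degFil f m := by
  have h1 : ∀ i, dualOp f J s i (twistedComm f g (b i) a) =
      f (if i ∈ J then b i - g (b i) else s i) * adGen f (if i ∈ J then s i else b i) a +
      ((if i ∈ J then adGen f (g (b i)) (adGen f (s i) a) else 0) + if i ∈ J then a else 0) := by
    intro i
    by_cases hi : i ∈ J
    · simp only [dualOp, if_pos hi, twistedComm_apply, map_sub, adGen_mul, hf.adGen_gen]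
      have e := h.dual_moved i i hi
      rw [if_pos rfl, map_sub, sub_eq_iff_eq_add] at e
      rw [e, map_add, map_one, add_mul, one_mul, ← Algebra.commutes (R := K) (A := A) _ a,
        adGen_apply f (g (b i)), sub_mul]
      abel
    · simp only [dualOp, if_neg hi, twistedComm_apply, LinearMap.mulLeft_apply, h.fixed i hi,
        adGen_apply, add_zero]
  have e : algLaplacian b f J s g a - (m : K) • a =
      (∑ i, f (if i ∈ J then b i - g (b i) else s i) * adGen f (if i ∈ J then s i else b i) a
        - (m : K) • a) + ∑ i ∈ J, adGen f (g (b i)) (adGen f (s i) a) := by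
    rw [algLaplacian, LinearMap.sub_apply, LinearMap.sum_apply, LinearMap.smul_apply]
    simp only [Module.End.mul_apply, Module.End.one_apply, h1, Finset.sum_add_distrib,
      Finset.sum_ite_mem, Finset.univ_inter, Finset.sum_const]
    rw [← Nat.cast_smul_eq_nsmul K]
    abel
  rw [e]
  refine Submodule.add_mem _ (hf.euler _ _ h.sum_eq ha) (Submodule.sum_mem _ fun i _ => ?_)
  exact hf.adGen_mem _ (degFil_mono_succ f m (hf.adGen_mem _ ha))

/-- The weight of a cochain is the degree of its values plus the number of idempotents with
eigenvalue `1`. The algebra part of the Laplacian measures the first summand up to lower order, and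
the sum of the idempotents measures the second exactly. -/
theorem laplacian_mem (hf : IsHeisenberg ω f) (h : AdaptedBasis ω g b J s) (m : ℕ)
    (φ : ExteriorAlgebra K V →ₗ[K] A) (hφ : φ ∈ cochainFil b J f (m + 1)) :
    twistedDiff b f g (koszulHomotopy b f J s φ) + koszulHomotopy b f J s (twistedDiff b f g φ) -
      ((m + 1 : ℕ) : K) • φ ∈ cochainFil b J f m := by
  intro S x hx
  have hx' := hφ S x hx
  rw [LinearMap.sub_apply, laplacian_apply hf h, sum_koszulIdem b J hx, LinearMap.smul_apply,
    map_smul]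
  rcases Nat.lt_or_ge (m + 1) S.card with hS | hS
  -- With too many eigenvalues `1` the truncated difference is `0`, and `degFil f 0 = ⊥` forces the
  -- value to vanish.
  · rw [show m + 1 + 1 - S.card = 0 by omega] at hx'
    rw [(Submodule.mem_bot K).1 hx']
    simp
  · obtain ⟨k, hk⟩ := Nat.exists_eq_add_of_le hS
    rw [show m + 1 + 1 - S.card = k + 1 by omega] at hx'
    have h2 := algLaplacian_mem hf h hx'
    rw [show m + 1 - S.card = k by omega]
    have e : algLaplacian b f J s g (φ x) + (S.card : K) • φ x - ((m + 1 : ℕ) : K) • φ x =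
      algLaplacian b f J s g (φ x) - (k : K) • φ x := by
      rw [hk, Nat.cast_add, add_smul]; abel
    rw [e]; exact h2

/-- In weight zero there is no lower term left, so the Laplacian vanishes exactly: values are
scalars on the eigenspace of `∅` and zero on the others. -/
theorem laplacian_eq_zero (hf : IsHeisenberg ω f) (h : AdaptedBasis ω g b J s)
    (φ : ExteriorAlgebra K V →ₗ[K] A) (hφ : φ ∈ cochainFil b J f 0) :
    twistedDiff b f g (koszulHomotopy b f J s φ) +
      koszulHomotopy b f J s (twistedDiff b f g φ) = 0 := by
  refine ext_koszulIdem b J fun S x hx => ?_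
  have hx' := hφ S x hx
  rw [laplacian_apply hf h, sum_koszulIdem b J hx, map_smul, LinearMap.zero_apply]
  rcases S.eq_empty_or_nonempty with rfl | hS
  · have h2 := algLaplacian_mem hf h hx'
    simpa using (Submodule.mem_bot K).1 h2
  · have := hS.card_pos
    rw [show 0 + 1 - S.card = 0 by omega] at hx'
    rw [(Submodule.mem_bot K).1 hx']
    simp

theorem exists_mem_cochainFil [Module.Finite K (ExteriorAlgebra K V)] (hf : IsHeisenberg ω f)
    (φ : ExteriorAlgebra K V →ₗ[K] A) :
    ∃ m, φ ∈ cochainFil b J f m := by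
  obtain ⟨T, hT⟩ := (Module.Finite.fg_top (R := K) (M := ExteriorAlgebra K V))
  choose k hk using fun x : ExteriorAlgebra K V => hf.exists_mem (φ x)
  have h1 : ∀ x, φ x ∈ degFil f (T.sup k) := by
    intro x
    have hx : x ∈ Submodule.span K (T : Set (ExteriorAlgebra K V)) := hT ▸ trivial
    induction hx using Submodule.span_induction with
    | mem y hy => exact degFil_mono f (Finset.le_sup hy) (hk y)
    | zero => rw [map_zero]; exact Submodule.zero_mem _
    | add y z _ _ h h' => rw [map_add]; exact Submodule.add_mem _ h h'
    | smul r y _ h => rw [map_smul]; exact Submodule.smul_mem _ _ h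
  refine ⟨T.sup k + Fintype.card I, fun S x _ => degFil_mono f ?_ (h1 x)⟩
  have := Finset.card_le_univ S
  omega

end Adapted

end TwistedKoszul

/-! ### The cohomology class of a top form -/

section TopForm

open ExteriorAlgebra

variable {K A V : Type*} [Field K] [Ring A] [Algebra K A] [AddCommGroup V] [Module K V]

theorem algebraMapInv_of_mem {p : ℕ} {x : ExteriorAlgebra K V} (hx : x ∈ ⋀[K]^(p + 1) V) :
    algebraMapInv x = 0 := by
  rw [exteriorPower, pow_succ'] at hx
  refine Submodule.mul_induction_on hx ?_ fun a b ha hb => by rw [map_add, ha, hb, add_zero]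
  rintro _ ⟨v, rfl⟩ y _
  rw [map_mul, algebraMapInv, lift_ι_apply, LinearMap.zero_apply, zero_mul]

theorem algebraMapInv_wedge (v : V) (x : ExteriorAlgebra K V) :
    algebraMapInv (wedge v x) = 0 := by
  rw [wedge_apply, map_mul, algebraMapInv, lift_ι_apply, LinearMap.zero_apply, zero_mul]

theorem algebraMapInv_degProj_zero (x : ExteriorAlgebra K V) :
    algebraMapInv (degProj 0 x) = algebraMapInv x := by
  induction x using homogeneous_induction with
  | h0 => simp
  | ha x y hx hy => simp only [map_add, hx, hy]
  | hh p x hx =>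
    rcases p with _ | p
    · rw [degProj_of_mem hx]
    · rw [degProj_of_mem_ne hx (by omega), algebraMapInv_of_mem hx, map_zero]

theorem degProj_zero_wedge (v : V) (x : ExteriorAlgebra K V) : degProj 0 (wedge v x) = 0 := by
  induction x using homogeneous_induction with
  | h0 => simp
  | ha x y hx hy => simp only [map_add, hx, hy, add_zero]
  | hh p x hx => rw [degProj_of_mem_ne (wedge_mem v p hx) (by omega)]

theorem ι_mul_prod_of_mem {I : Type*} (w : I → V) {l : List I} {i : I} (hi : i ∈ l) :
    ι K (w i) * (l.map fun j => ι K (w j)).prod = 0 := by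
  induction l with
  | nil => simp at hi
  | cons a l ih =>
    rw [List.map_cons, List.prod_cons]
    rcases List.mem_cons.1 hi with rfl | h
    · rw [← mul_assoc, ι_sq_zero, zero_mul]
    · rw [← mul_assoc, eq_neg_of_add_eq_zero_left (ι_add_mul_swap (w i) (w a)), neg_mul, mul_assoc,
        ih h, mul_zero, neg_zero]

theorem prod_ι_mem {I : Type*} (w : I → V) (l : List I) :
    (l.map fun j => ι K (w j)).prod ∈ ⋀[K]^l.length V := by
  induction l with
  | nil => simp [exteriorPower]
  | cons a l ih =>
    rw [List.map_cons, List.prod_cons, List.length_cons]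
    exact wedge_mem _ _ ih

theorem contr_prod_of_notMem {I : Type*} (b : Module.Basis I K V) {l : List I} {i : I}
    (hi : i ∉ l) : contr (b.coord i) (l.map fun j => ι K (b j)).prod = 0 := by
  induction l with
  | nil => exact contr_one _
  | cons a l ih =>
    rw [List.mem_cons, not_or] at hi
    rw [List.map_cons, List.prod_cons, ← wedge_apply, contr_wedge_ne b hi.1, ih hi.2, map_zero,
      neg_zero]

/-- Reversing the list lets each contraction meet its own vector at the front of the product, so no
sign occurs. -/
theorem ctr_prod_reverse {I : Type*} (b : Module.Basis I K V) (β : V →ₗ[K] Module.Dual K V)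
    (w : I → V) (l : List I) (hl : l.Nodup) (hw : ∀ j ∈ l, β (w j) = b.coord j) :
    ctr β (l.reverse.map fun j => ι K (w j)).prod (l.map fun j => ι K (b j)).prod = 1 := by
  induction l with
  | nil => simp
  | cons a l ih =>
    have ha := List.nodup_cons.1 hl
    rw [List.reverse_cons, List.map_append, List.prod_append, map_mul, Module.End.mul_apply,
      List.map_singleton, List.prod_singleton, ctr_ι, hw a (by simp), List.map_cons,
      List.prod_cons, ← wedge_apply, contr_wedge_self, contr_prod_of_notMem b ha.1, map_zero,
      sub_zero]
    exact ih ha.2 fun j hj => hw j (by simp [hj])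

/-- The cochain that contracts with an element of the exterior algebra and takes the scalar part. -/
noncomputable def scalarCochain (A : Type*) [Ring A] [Algebra K A]
    (β : V →ₗ[K] Module.Dual K V) (α : ExteriorAlgebra K V) : ExteriorAlgebra K V →ₗ[K] A :=
  Algebra.linearMap K A ∘ₗ algebraMapInv.toLinearMap ∘ₗ ctr β α

theorem scalarCochain_apply (β : V →ₗ[K] Module.Dual K V) (α x : ExteriorAlgebra K V) :
    scalarCochain A β α x = algebraMap K A (algebraMapInv (ctr β α x)) := rfl

/-- An element of the exterior algebra that spans the line of top forms along the moved
directions of an adapted basis. -/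
structure IsTopForm (β : V →ₗ[K] Module.Dual K V) {I : Type*}
    (b : Module.Basis I K V) (l : List I) (α : ExteriorAlgebra K V) : Prop where
  nodup : l.Nodup
  exists_eq : ∃ w : I → V, (∀ j ∈ l, β (w j) = b.coord j) ∧ ∃ c : K, c ≠ 0 ∧
    α = c • (l.reverse.map fun j => ι K (w j)).prod

variable {I : Type*} {b : Module.Basis I K V} {l : List I}
  {s : I → V} {g : V →ₗ[K] V} {β : V →ₗ[K] Module.Dual K V} {α : ExteriorAlgebra K V}
  {ω : V →ₗ[K] V →ₗ[K] K} {f : V →ₗ[K] A}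

theorem IsTopForm.mem (hα : IsTopForm β b l α) : α ∈ ⋀[K]^l.length V := by
  obtain ⟨w, -, c, -, rfl⟩ := hα.exists_eq
  rw [← List.length_reverse]
  exact Submodule.smul_mem _ _ (prod_ι_mem w _)

theorem IsTopForm.scalarCochain_ne [Nontrivial A] (hα : IsTopForm β b l α) :
    scalarCochain A β α (l.map fun j => ι K (b j)).prod ≠ 0 := by
  obtain ⟨w, hw, c, hc, rfl⟩ := hα.exists_eq
  rw [scalarCochain_apply, map_smul, LinearMap.smul_apply,
    ctr_prod_reverse b β w l hα.nodup hw, map_smul, map_one]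
  simpa using hc

theorem mem_degFil_one {a : A} : a ∈ degFil f 1 ↔ ∃ r, algebraMap K A r = a := by
  simp only [degFil, pow_zero]
  exact Submodule.mem_one

variable [Fintype I] [DecidableEq I]

theorem prod_mem_jointEigenspace :
    (l.map fun j => ι K (b j)).prod ∈ jointEigenspace (koszulIdem b l.toFinset) ∅ := by
  refine ⟨by simp, fun i _ => ?_⟩
  by_cases hi : i ∈ l
  · rw [koszulIdem_of_mem b _ (by simpa using hi), wedge_apply, ι_mul_prod_of_mem b hi, map_zero]
  · rw [koszulIdem_of_notMem b _ (by simpa using hi), contr_prod_of_notMem b hi, map_zero]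

theorem mem_jointEigenspace_empty [CharZero K] (hl : l.Nodup) {x : ExteriorAlgebra K V}
    (hx : x ∈ jointEigenspace (koszulIdem b l.toFinset) ∅) :
    ∃ r : K, x = r • (l.map fun j => ι K (b j)).prod := by
  refine eq_smul_prod_of_wedge_eq_zero b l hl (fun j hj => ?_) fun k hk => ?_
  · have h := hx.2 j (by simp)
    rw [koszulIdem_of_mem b _ (by simpa using hj)] at h
    have h2 := congrArg (wedge (b j)) h
    rwa [contr_wedge_self, map_sub, wedge_wedge, sub_zero, map_zero] at h2
  · have h := hx.2 k (by simp)
    rw [koszulIdem_of_notMem b _ (by simpa using hk)] at h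
    have h2 := congrArg (contr (b.coord k)) h
    rwa [contr_wedge_self, contr_contr, map_zero, sub_zero, map_zero] at h2

/-- If a moved direction `i` has eigenvalue `1`, then `x` is a contraction along `i`, and `α`
contracts along `i` once more. If a fixed direction does, then `x` is a multiple of `b i`, a factor
that survives the contraction with `α` and has no scalar part. -/
theorem IsTopForm.scalarCochain_eigen (hα : IsTopForm β b l α) {S : Finset I} (hS : S ≠ ∅)
    {x : ExteriorAlgebra K V} (hx : x ∈ jointEigenspace (koszulIdem b l.toFinset) S) :
    scalarCochain A β α x = 0 := by
  obtain ⟨w, hw, c, -, rfl⟩ := hα.exists_eq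
  obtain ⟨i, hi⟩ := Finset.nonempty_iff_ne_empty.2 hS
  have hxi := hx.1 i hi
  suffices h : algebraMapInv (ctr β (l.reverse.map fun j => ι K (w j)).prod x) = 0 by
    rw [scalarCochain_apply, map_smul, LinearMap.smul_apply, map_smul, h, smul_zero, map_zero]
  by_cases hil : i ∈ l
  · rw [koszulIdem_of_mem b _ (by simpa using hil)] at hxi
    have h1 := contr_ctr β (b.coord i) (prod_ι_mem w l.reverse) (wedge (b i) x)
    rw [hxi, ← hw i hil, ← ctr_ι_mul, ι_mul_prod_of_mem w (by simpa using hil), map_zero,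
      LinearMap.zero_apply] at h1
    rw [(smul_eq_zero.1 h1.symm).resolve_left (pow_ne_zero _ (by simp)), map_zero]
  · rw [koszulIdem_of_notMem b _ (by simpa using hil)] at hxi
    rw [← hxi]
    have h1 := ctr_wedge β (l.reverse.map w) (b i) (by
      intro v hv
      obtain ⟨j, hj, rfl⟩ := List.mem_map.1 hv
      rw [List.mem_reverse] at hj
      have hij : j ≠ i := by rintro rfl; exact hil hj
      rw [hw j hj]
      simp [hij.symm]) (contr (b.coord i) x)
    rw [List.map_map] at h1
    rw [show (fun j => ι K (w j)) = (fun v => ι K v) ∘ w from rfl, h1, map_smul,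
      algebraMapInv_wedge, smul_zero]

theorem IsTopForm.scalarCochain_mem (hα : IsTopForm β b l α) :
    scalarCochain A β α ∈ cochainFil b l.toFinset f 0 := by
  intro S x hx
  by_cases hS : S = ∅
  · subst hS
    exact mem_degFil_one.2 ⟨_, rfl⟩
  · rw [hα.scalarCochain_eigen hS hx]
    exact Submodule.zero_mem _

/-- Cochains of weight zero form a line: they have scalar values on the joint eigenspace of `∅`,
which is spanned by the product of the moved basis vectors, and vanish on the other eigenspaces. -/
theorem IsTopForm.eq_smul_of_mem [CharZero K] [Nontrivial A] (hα : IsTopForm β b l α)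
    {φ : ExteriorAlgebra K V →ₗ[K] A}
    (hφ : φ ∈ cochainFil b l.toFinset f 0) : ∃ r : K, φ = r • scalarCochain A β α := by
  have h1 := hφ ∅ _ prod_mem_jointEigenspace
  obtain ⟨r, hr⟩ := mem_degFil_one.1 h1
  have h2 := hα.scalarCochain_ne (A := A)
  rw [scalarCochain_apply] at h2
  have hne : algebraMapInv (ctr β α (l.map fun j => ι K (b j)).prod) ≠ 0 := by
    intro h; rw [h, map_zero] at h2; exact h2 rfl
  refine ⟨r * (algebraMapInv (ctr β α (l.map fun j => ι K (b j)).prod))⁻¹,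
    ext_koszulIdem b l.toFinset fun S x hx => ?_⟩
  by_cases hS : S = ∅
  · subst hS
    obtain ⟨t, rfl⟩ := mem_jointEigenspace_empty hα.nodup hx
    rw [map_smul, ← hr, LinearMap.smul_apply, map_smul, scalarCochain_apply, smul_comm]
    congr 1
    rw [Algebra.smul_def, ← map_mul, inv_mul_cancel_right₀ hne]
  · have h3 := hφ S x hx
    have := (Finset.nonempty_iff_ne_empty.2 hS).card_pos
    rw [show 0 + 1 - S.card = 0 by omega] at h3
    rw [(Submodule.mem_bot K).1 h3, LinearMap.smul_apply, hα.scalarCochain_eigen hS hx, smul_zero]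

theorem degProj_koszulIdem (J : Finset I) (i : I) (p : ℕ) (x : ExteriorAlgebra K V) :
    koszulIdem b J i (degProj p x) = degProj p (koszulIdem b J i x) := by
  by_cases hi : i ∈ J
  · rw [koszulIdem_of_mem b J hi, koszulIdem_of_mem b J hi, degProj_contr, degProj_wedge]
  · rw [koszulIdem_of_notMem b J hi, koszulIdem_of_notMem b J hi]
    rcases p with _ | p
    · rw [contr_degProj_zero, map_zero, degProj_zero_wedge]
    · rw [degProj_wedge, degProj_contr]

theorem scalarCochain_degProj {d : ℕ} (hα : α ∈ ⋀[K]^d V) (x : ExteriorAlgebra K V) :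
    scalarCochain A β α (degProj d x) = scalarCochain A β α x := by
  have h := degProj_ctr β hα 0 x
  rw [zero_add] at h
  rw [scalarCochain_apply, ← h, algebraMapInv_degProj_zero, scalarCochain_apply]

theorem scalarCochain_degProj_ne {d p : ℕ} (hα : α ∈ ⋀[K]^d V) (hp : p ≠ d)
    (x : ExteriorAlgebra K V) : scalarCochain A β α (degProj p x) = 0 := by
  rw [← scalarCochain_degProj hα, degProj_of_mem_ne (degProj_mem p x) hp, map_zero]

variable [Module.Finite K (ExteriorAlgebra K V)] [CharZero K] [Nontrivial A]

/-- Finite dimension of the exterior algebra bounds the weight of a cochain. The Euler descent then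
moves a cocycle, up to a coboundary, into the line of weight zero. -/
theorem IsTopForm.exists_eq_smul_add (hα : IsTopForm β b l α) (hf : IsHeisenberg ω f)
    (h : AdaptedBasis ω g b l.toFinset s) (φ : ExteriorAlgebra K V →ₗ[K] A)
    (hφ : twistedDiff b f g φ = 0) :
    ∃ r : K, ∃ ψ, φ = r • scalarCochain A β α + twistedDiff b f g ψ := by
  obtain ⟨m, hm⟩ := exists_mem_cochainFil (b := b) (J := l.toFinset) hf φ
  obtain ⟨φ₀, h0, ψ, e⟩ := exists_add_of_homotopy (twistedDiff b f g)
    (koszulHomotopy b f l.toFinset s) (cochainFil b l.toFinset f)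
    (hf.twistedDiff_twistedDiff b h.isometry) (laplacian_mem hf h) m φ hm hφ
  obtain ⟨r, hr⟩ := hα.eq_smul_of_mem h0
  exact ⟨r, ψ, by rw [e, hr]⟩

theorem IsTopForm.eq_zero_of_smul_eq (hα : IsTopForm β b l α) (hf : IsHeisenberg ω f)
    (h : AdaptedBasis ω g b l.toFinset s) (ψ : ExteriorAlgebra K V →ₗ[K] A) (r : K)
    (hψ : r • scalarCochain A β α = twistedDiff b f g ψ) : r = 0 := by
  let U : Submodule K (ExteriorAlgebra K V →ₗ[K] A) :=
    LinearMap.ker (LinearMap.lcomp K A (degProj (K := K) (V := V) l.length))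
  have hU : ∀ φ, φ ∈ U ↔ ∀ x, φ (degProj l.length x) = 0 := fun φ =>
    ⟨fun h x => LinearMap.congr_fun h x, fun h => LinearMap.ext h⟩
  -- The component of `ψ` in the degree of the top form can be dropped: its coboundary is the
  -- component of `twistedDiff b f g ψ` one degree higher, where the scalar cochain is zero. What
  -- remains lies in `U`, which meets the line of weight zero trivially.
  let ψ' := ψ - ψ ∘ₗ degProj l.length
  have hψ' : twistedDiff b f g ψ' = r • scalarCochain A β α := by
    rw [map_sub, ← hψ, sub_eq_self]
    refine LinearMap.ext fun x => ?_
    have e : twistedDiff b f g (ψ ∘ₗ degProj l.length) x =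
        twistedDiff b f g ψ (degProj (l.length + 1) x) := by
      simp only [twistedDiff_apply, LinearMap.comp_apply, degProj_contr]
    rw [e, ← hψ, LinearMap.smul_apply, scalarCochain_degProj_ne hα.mem (by omega), smul_zero]
    rfl
  obtain ⟨m, hm⟩ := exists_mem_cochainFil (b := b) (J := l.toFinset) hf ψ'
  have key := eq_zero_of_homotopy (twistedDiff b f g)
    (koszulHomotopy b f l.toFinset s) (cochainFil b l.toFinset f) U
    (hf.twistedDiff_twistedDiff b h.isometry) (laplacian_eq_zero hf h) (laplacian_mem hf h)
    (by
      intro φ hφ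
      rw [hU] at hφ ⊢
      intro x
      rw [laplacian_apply hf h, hφ, map_zero, zero_add]
      simp only [degProj_koszulIdem, ← map_sum, hφ])
    (by
      intro φ hφ h0
      obtain ⟨t, rfl⟩ := hα.eq_smul_of_mem h0
      rw [hU] at hφ
      refine LinearMap.ext fun x => ?_
      rw [LinearMap.smul_apply, ← scalarCochain_degProj hα.mem, ← LinearMap.smul_apply, hφ]
      rfl)
    m ψ' hm (by
      rw [hU]
      intro x
      simp only [ψ', LinearMap.sub_apply, LinearMap.comp_apply,
        degProj_of_mem (degProj_mem l.length x), sub_self])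
    (by rw [hψ']; exact Submodule.smul_mem _ _ hα.scalarCochain_mem)
  rw [hψ'] at key
  have h2 := LinearMap.congr_fun key (l.map fun j => ι K (b j)).prod
  rw [LinearMap.smul_apply, LinearMap.zero_apply] at h2
  exact (smul_eq_zero.1 h2).resolve_right hα.scalarCochain_ne

end TopForm

/-! ### The Koszul bimodule complex -/

section KoszulBimodule

open ExteriorAlgebra

/-- The space `A ⊗ A ⊗ Λ V` of the Koszul bimodule complex. -/
abbrev KoszulSpace (K A V : Type*) [Field K] [Ring A] [Algebra K A] [AddCommGroup V]
    [Module K V] := A ⊗[K] (A ⊗[K] ExteriorAlgebra K V)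

variable {K A V : Type*} [Field K] [Ring A] [Algebra K A] [AddCommGroup V] [Module K V]

theorem koszulSpace_induction {C : KoszulSpace K A V → Prop} (h0 : C 0)
    (ht : ∀ (a c : A) (x : ExteriorAlgebra K V), C (a ⊗ₜ (c ⊗ₜ x)))
    (ha : ∀ y z, C y → C z → C (y + z)) (z : KoszulSpace K A V) : C z := by
  induction z using TensorProduct.induction_on with
  | zero => exact h0
  | add y z hy hz => exact ha y z hy hz
  | tmul a t =>
    induction t using TensorProduct.induction_on with
    | zero => rw [TensorProduct.tmul_zero]; exact h0
    | add y z hy hz => rw [TensorProduct.tmul_add]; exact ha _ _ hy hz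
    | tmul c x => exact ht a c x

theorem koszulSpace_hom_ext {M : Type*} [AddCommGroup M] [Module K M]
    {φ ψ : KoszulSpace K A V →ₗ[K] M}
    (h : ∀ (a c : A) (x : ExteriorAlgebra K V), φ (a ⊗ₜ (c ⊗ₜ x)) = ψ (a ⊗ₜ (c ⊗ₜ x))) : φ = ψ :=
  LinearMap.ext fun z => koszulSpace_induction (C := fun z => φ z = ψ z) (by simp) h
    (fun y z hy hz => by rw [map_add, map_add, hy, hz]) z

/-- The differential of the Koszul bimodule complex. -/
noncomputable def koszulDiff {I : Type*} [Fintype I] (b : Module.Basis I K V) (f : V →ₗ[K] A) :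
    Module.End K (KoszulSpace K A V) :=
  ∑ i, (TensorProduct.map (LinearMap.mulRight K (f (b i)))
      (TensorProduct.map LinearMap.id (contr (b.coord i))) -
    TensorProduct.map LinearMap.id
      (TensorProduct.map (LinearMap.mulLeft K (f (b i))) (contr (b.coord i))))

theorem koszulDiff_tmul {I : Type*} [Fintype I] (b : Module.Basis I K V) (f : V →ₗ[K] A)
    (a c : A) (x : ExteriorAlgebra K V) :
    koszulDiff b f (a ⊗ₜ (c ⊗ₜ x)) = ∑ i, ((a * f (b i)) ⊗ₜ (c ⊗ₜ contr (b.coord i) x) -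
      a ⊗ₜ[K] ((f (b i) * c) ⊗ₜ[K] contr (b.coord i) x)) := by
  simp [koszulDiff, LinearMap.sum_apply]

/-- The augmentation of the Koszul bimodule complex. -/
noncomputable def koszulAug (K A V : Type*) [Field K] [Ring A] [Algebra K A] [AddCommGroup V]
    [Module K V] : KoszulSpace K A V →ₗ[K] A :=
  TensorProduct.lift ((LinearMap.mul K A).compl₂
    ((TensorProduct.rid K A).toLinearMap ∘ₗ
      TensorProduct.map LinearMap.id algebraMapInv.toLinearMap))

theorem koszulAug_tmul (a c : A) (x : ExteriorAlgebra K V) :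
    koszulAug K A V (a ⊗ₜ (c ⊗ₜ x)) = algebraMapInv x • (a * c) := by
  simp [koszulAug]

theorem koszulAug_koszulDiff {I : Type*} [Fintype I] (b : Module.Basis I K V) (f : V →ₗ[K] A)
    (z) : koszulAug K A V (koszulDiff b f z) = 0 := by
  refine LinearMap.congr_fun (f := koszulAug K A V ∘ₗ koszulDiff b f) (g := 0)
    (koszulSpace_hom_ext fun a c x => ?_) z
  simp [koszulDiff_tmul, koszulAug_tmul, mul_assoc]

/-- Degree projections of the Koszul bimodule complex. -/
noncomputable def koszulDeg (p : ℕ) : Module.End K (KoszulSpace K A V) :=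
  TensorProduct.map LinearMap.id (TensorProduct.map LinearMap.id (degProj p))

theorem koszulDeg_tmul (p : ℕ) (a c : A) (x : ExteriorAlgebra K V) :
    koszulDeg p (a ⊗ₜ[K] (c ⊗ₜ[K] x)) = a ⊗ₜ (c ⊗ₜ degProj p x) := rfl

theorem koszulDeg_koszulDiff {I : Type*} [Fintype I] (b : Module.Basis I K V) (f : V →ₗ[K] A)
    (p : ℕ) (z) : koszulDeg p (koszulDiff b f z) = koszulDiff b f (koszulDeg (p + 1) z) := by
  refine LinearMap.congr_fun (f := koszulDeg p ∘ₗ koszulDiff b f)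
    (g := koszulDiff b f ∘ₗ koszulDeg (p + 1)) (koszulSpace_hom_ext fun a c x => ?_) z
  simp only [LinearMap.comp_apply, koszulDiff_tmul, map_sum, map_sub, koszulDeg_tmul, degProj_contr]

theorem koszulDiff_koszulDeg_zero {I : Type*} [Fintype I] (b : Module.Basis I K V) (f : V →ₗ[K] A)
    (z) : koszulDiff b f (koszulDeg 0 z) = 0 := by
  refine LinearMap.congr_fun (f := koszulDiff b f ∘ₗ koszulDeg 0)
    (g := 0) (koszulSpace_hom_ext fun a c x => ?_) z
  simp [LinearMap.comp_apply, koszulDiff_tmul, koszulDeg_tmul, contr_degProj_zero]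

theorem degProj_degProj (p : ℕ) (x : ExteriorAlgebra K V) : degProj p (degProj p x) = degProj p x :=
  degProj_of_mem (degProj_mem p x)

theorem koszulDeg_koszulDeg (p : ℕ) (z : KoszulSpace K A V) :
    koszulDeg p (koszulDeg p z) = koszulDeg p z := by
  refine LinearMap.congr_fun (f := koszulDeg p ∘ₗ koszulDeg p)
    (g := koszulDeg p) (koszulSpace_hom_ext fun a c x => ?_) z
  simp only [LinearMap.comp_apply, koszulDeg_tmul, degProj_degProj]

theorem koszulAug_koszulDeg_zero (z : KoszulSpace K A V) :
    koszulAug K A V (koszulDeg 0 z) = koszulAug K A V z := by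
  refine LinearMap.congr_fun (f := koszulAug K A V ∘ₗ koszulDeg 0)
    (g := koszulAug K A V) (koszulSpace_hom_ext fun a c x => ?_) z
  simp only [LinearMap.comp_apply, koszulDeg_tmul, koszulAug_tmul, algebraMapInv_degProj_zero]

theorem koszulAug_koszulDeg_succ (p : ℕ) (z : KoszulSpace K A V) :
    koszulAug K A V (koszulDeg (p + 1) z) = 0 := by
  refine LinearMap.congr_fun (f := koszulAug K A V ∘ₗ koszulDeg (p + 1))
    (g := 0) (koszulSpace_hom_ext fun a c x => ?_) z
  simp only [LinearMap.comp_apply, koszulDeg_tmul, koszulAug_tmul,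
    algebraMapInv_of_mem (degProj_mem (p + 1) x), zero_smul, LinearMap.zero_apply]

variable {I : Type*} [Fintype I] {b : Module.Basis I K V}
  {s : I → V} {ω : V →ₗ[K] V →ₗ[K] K} {f : V →ₗ[K] A}

/-- Antisymmetrising two multiplications by generators gives a scalar on either tensor factor.
Scalars cross the tensor sign, and the two contributions cancel. -/
theorem IsHeisenberg.koszulDiff_koszulDiff [CharZero K] (hf : IsHeisenberg ω f)
    (z : KoszulSpace K A V) : koszulDiff b f (koszulDiff b f z) = 0 := by
  induction z using koszulSpace_induction with
  | h0 => simp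
  | ha y z hy hz => rw [map_add, map_add, hy, hz, add_zero]
  | ht a c x =>
    have h1 : ∀ u v, f u * f v = f v * f u + algebraMap K A (ω u v) := fun u v => by
      rw [← hf.comm]; abel
    have e : koszulDiff b f (koszulDiff b f (a ⊗ₜ (c ⊗ₜ x))) =
        -koszulDiff b f (koszulDiff b f (a ⊗ₜ (c ⊗ₜ x))) := by
      simp only [koszulDiff_tmul, map_sum, map_sub]
      conv_rhs => enter [1]; rw [← Finset.sum_congr rfl fun i _ => Finset.sum_sub_distrib _ _]
      rw [Finset.sum_congr rfl fun i _ => (Finset.sum_sub_distrib _ _).symm]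
      conv_rhs => rw [Finset.sum_comm]
      rw [← Finset.sum_neg_distrib]
      refine Finset.sum_congr rfl fun i _ => ?_
      rw [← Finset.sum_neg_distrib]
      refine Finset.sum_congr rfl fun j _ => ?_
      rw [contr_comm (b.coord i) (b.coord j)]
      simp only [TensorProduct.tmul_neg]
      rw [mul_assoc a, mul_assoc a, h1 (b i) (b j), ← mul_assoc (f (b i)), h1 (b i) (b j), mul_add,
        add_mul, mul_assoc (f (b j)), TensorProduct.add_tmul, TensorProduct.add_tmul,
        ← Algebra.smul_def, ← Algebra.commutes, ← Algebra.smul_def, TensorProduct.smul_tmul,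
        TensorProduct.tmul_add, TensorProduct.smul_tmul']
      abel
    have h2 : (2 : K) • koszulDiff b f (koszulDiff b f (a ⊗ₜ (c ⊗ₜ x))) = 0 := by
      rw [two_smul]; nth_rewrite 1 [e]; exact neg_add_cancel _
    exact (smul_eq_zero.1 h2).resolve_left two_ne_zero

/-- The contracting homotopy of the Koszul bimodule complex. -/
noncomputable def koszulBimoduleHomotopy (b : Module.Basis I K V) (f : V →ₗ[K] A) (s : I → V) :
    Module.End K (KoszulSpace K A V) :=
  -∑ i, (TensorProduct.map LinearMap.id (TensorProduct.map (adGen f (s i)) (wedge (b i))) :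
    Module.End K (KoszulSpace K A V))

theorem koszulBimoduleHomotopy_tmul (a c : A) (x : ExteriorAlgebra K V) :
    koszulBimoduleHomotopy b f s (a ⊗ₜ (c ⊗ₜ x)) =
      -∑ i, a ⊗ₜ[K] (adGen f (s i) c ⊗ₜ[K] wedge (b i) x) := by
  simp [koszulBimoduleHomotopy, LinearMap.sum_apply]

variable [DecidableEq I]

/-- The filtration of the Koszul bimodule complex. -/
def koszulFil (b : Module.Basis I K V) (f : V →ₗ[K] A) (m : ℕ) :
    Submodule K (KoszulSpace K A V) :=
  Submodule.span K {z | ∃ S, ∃ x ∈ jointEigenspace (koszulIdem b ∅) S,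
    ∃ a, ∃ c ∈ degFil f (m + 1 - S.card), z = a ⊗ₜ (c ⊗ₜ x)}

theorem tmul_mem_koszulFil {m k : ℕ} {S : Finset I} {x : ExteriorAlgebra K V} {c : A}
    (hx : x ∈ jointEigenspace (koszulIdem b ∅) S) (a : A) (hc : c ∈ degFil f k)
    (hk : k = m + 1 - S.card) : a ⊗ₜ (c ⊗ₜ x) ∈ koszulFil b f m :=
  Submodule.subset_span ⟨S, x, hx, a, c, hk ▸ hc, rfl⟩

theorem bimodule_laplacian_tmul (hf : IsHeisenberg ω f)
    (hs : ∀ i j, ω (s j) (b i) = if i = j then 1 else 0) (a c : A) (x : ExteriorAlgebra K V) :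
    koszulDiff b f (koszulBimoduleHomotopy b f s (a ⊗ₜ (c ⊗ₜ x))) +
      koszulBimoduleHomotopy b f s (koszulDiff b f (a ⊗ₜ (c ⊗ₜ x))) =
      a ⊗ₜ[K] ((∑ i, f (b i) * adGen f (s i) c) ⊗ₜ x) -
        ∑ i, (a * f (b i)) ⊗ₜ[K] (adGen f (s i) c ⊗ₜ[K] x) +
        a ⊗ₜ[K] (c ⊗ₜ[K] ∑ i, koszulIdem b ∅ i x) := by
  have h1 : ∀ i j (a c : A), a ⊗ₜ[K] (c ⊗ₜ[K] contr (b.coord i) (wedge (b j) x)) =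
      (if i = j then a ⊗ₜ[K] (c ⊗ₜ[K] x) else 0) -
        a ⊗ₜ[K] (c ⊗ₜ[K] wedge (b j) (contr (b.coord i) x)) := by
    intro i j a c
    by_cases hij : i = j
    · subst hij
      rw [contr_wedge_self, if_pos rfl, TensorProduct.tmul_sub, TensorProduct.tmul_sub]
    · rw [contr_wedge_ne b hij, if_neg hij, zero_sub, TensorProduct.tmul_neg,
        TensorProduct.tmul_neg]
  have h2 : ∀ i j, a ⊗ₜ[K] (adGen f (s j) (f (b i) * c) ⊗ₜ[K] wedge (b j) (contr (b.coord i) x)) =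
      a ⊗ₜ[K] ((f (b i) * adGen f (s j) c) ⊗ₜ[K] wedge (b j) (contr (b.coord i) x)) +
      if i = j then a ⊗ₜ[K] (c ⊗ₜ[K] koszulIdem b ∅ i x) else 0 := by
    intro i j
    rw [adGen_mul, hf.adGen_gen, hs]
    by_cases hij : i = j
    · subst hij
      rw [if_pos rfl, if_pos rfl, map_one, one_mul, TensorProduct.add_tmul,
        TensorProduct.tmul_add, koszulIdem_of_notMem b ∅ (by simp), add_comm]
    · rw [if_neg hij, if_neg hij, map_zero, zero_mul, zero_add, add_zero]
  simp only [koszulBimoduleHomotopy_tmul, koszulDiff_tmul, map_neg, map_sum, map_sub, h1, h2,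
    Finset.sum_sub_distrib, Finset.sum_add_distrib, Finset.sum_ite_eq, Finset.sum_ite_eq',
    Finset.mem_univ, if_true, TensorProduct.sum_tmul, TensorProduct.tmul_sum,
    Finset.sum_neg_distrib]
  rw [Finset.sum_comm (f := fun i j => (a * f (b j)) ⊗ₜ[K]
      (adGen f (s i) c ⊗ₜ[K] wedge (b i) (contr (b.coord j) x))),
    Finset.sum_comm (f := fun i j => a ⊗ₜ[K]
      ((f (b j) * adGen f (s i) c) ⊗ₜ[K] wedge (b i) (contr (b.coord j) x)))]
  abel

/-- The weight counts the degree of the second factor and the exterior degree. Terms that multiply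
the first factor by a generator differentiate the second one, so they have lower weight; the rest is
an Euler operator. -/
theorem bimodule_laplacian_mem (hf : IsHeisenberg ω f)
    (hs : ∀ i j, ω (s j) (b i) = if i = j then 1 else 0) (hs' : ∀ w, ∑ i, ω (s i) w • b i = w)
    (m : ℕ) (z : KoszulSpace K A V) (hz : z ∈ koszulFil b f (m + 1)) :
    koszulDiff b f (koszulBimoduleHomotopy b f s z) +
      koszulBimoduleHomotopy b f s (koszulDiff b f z) - ((m + 1 : ℕ) : K) • z ∈
      koszulFil b f m := by
  induction hz using Submodule.span_induction with
  | zero => simp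
  | add y z _ _ hy hz =>
    simp only [map_add, smul_add] at hy hz ⊢
    convert Submodule.add_mem _ hy hz using 1
    abel
  | smul r y _ hy =>
    simp only [map_smul]
    rw [smul_comm _ r y, ← smul_add, ← smul_sub]
    exact Submodule.smul_mem _ r hy
  | mem z hz =>
    obtain ⟨S, x, hx, a, c, hc, rfl⟩ := hz
    rw [bimodule_laplacian_tmul hf hs, sum_koszulIdem b ∅ hx]
    rcases Nat.lt_or_ge (m + 1) S.card with hS | hS
    · rw [show m + 1 + 1 - S.card = 0 by omega] at hc
      rw [(Submodule.mem_bot K).1 hc]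
      simp
    · obtain ⟨k, hk⟩ := Nat.exists_eq_add_of_le hS
      rw [show m + 1 + 1 - S.card = k + 1 by omega] at hc
      have h2 := hf.euler s b hs' hc
      have e : a ⊗ₜ[K] ((∑ i, f (b i) * adGen f (s i) c) ⊗ₜ[K] x) -
          ∑ i, (a * f (b i)) ⊗ₜ[K] (adGen f (s i) c ⊗ₜ[K] x) + a ⊗ₜ[K] (c ⊗ₜ[K] ((S.card : K) • x)) -
          ((m + 1 : ℕ) : K) • a ⊗ₜ[K] (c ⊗ₜ[K] x) =
          a ⊗ₜ[K] ((∑ i, f (b i) * adGen f (s i) c - (k : K) • c) ⊗ₜ[K] x) -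
          ∑ i, (a * f (b i)) ⊗ₜ[K] (adGen f (s i) c ⊗ₜ[K] x) := by
        rw [hk, Nat.cast_add, add_smul, TensorProduct.sub_tmul, TensorProduct.tmul_sub,
          TensorProduct.tmul_smul, TensorProduct.tmul_smul, ← TensorProduct.smul_tmul',
          TensorProduct.tmul_smul]
        abel
      rw [e]
      refine Submodule.sub_mem _ (tmul_mem_koszulFil hx a h2 (by omega))
        (Submodule.sum_mem _ fun i _ => tmul_mem_koszulFil hx _ (hf.adGen_mem _ hc) (by omega))

theorem exists_mem_koszulFil (hf : IsHeisenberg ω f) (z : KoszulSpace K A V) :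
    ∃ m, z ∈ koszulFil b f m := by
  have hmono : ∀ {m m'}, m ≤ m' → koszulFil b f m ≤ koszulFil b f m' := by
    intro m m' h
    refine Submodule.span_mono ?_
    rintro _ ⟨S, x, hx, a, c, hc, rfl⟩
    exact ⟨S, x, hx, a, c, degFil_mono f (by omega) hc, rfl⟩
  induction z using koszulSpace_induction with
  | h0 => exact ⟨0, Submodule.zero_mem _⟩
  | ha y z hy hz =>
    obtain ⟨m, hm⟩ := hy
    obtain ⟨m', hm'⟩ := hz
    exact ⟨max m m', Submodule.add_mem _ (hmono (le_max_left _ _) hm)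
      (hmono (le_max_right _ _) hm')⟩
  | ht a c x =>
    obtain ⟨m, hm⟩ := hf.exists_mem c
    refine ⟨m + Fintype.card I, ?_⟩
    have hx : x ∈ ⨆ S, jointEigenspace (koszulIdem b ∅) S := by
      rw [iSup_koszulIdem]; trivial
    refine Submodule.iSup_induction _ (motive := fun x => a ⊗ₜ (c ⊗ₜ x) ∈
      koszulFil b f (m + Fintype.card I)) hx (fun S x hx => ?_) (by simp) fun x y hx hy => by
        rw [TensorProduct.tmul_add, TensorProduct.tmul_add]; exact Submodule.add_mem _ hx hy
    have := Finset.card_le_univ S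
    exact tmul_mem_koszulFil hx a (degFil_mono f (by omega) hm) rfl

/-- The Koszul bimodule complex resolves the algebra. -/
theorem IsHeisenberg.exists_koszulDiff_eq [CharZero K] (hf : IsHeisenberg ω f)
    (hs : ∀ i j, ω (s j) (b i) = if i = j then 1 else 0) (hs' : ∀ w, ∑ i, ω (s i) w • b i = w)
    (z : KoszulSpace K A V) (hz : koszulDiff b f z = 0) (hz' : koszulAug K A V z = 0) :
    ∃ y, koszulDiff b f y = z := by
  obtain ⟨m, hm⟩ := exists_mem_koszulFil (b := b) hf z
  obtain ⟨z₀, h0, y, rfl⟩ := exists_add_of_homotopy (koszulDiff b f)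
    (koszulBimoduleHomotopy b f s) (koszulFil b f) hf.koszulDiff_koszulDiff
    (bimodule_laplacian_mem hf hs hs') m z hm hz
  rw [map_add, koszulAug_koszulDiff, add_zero] at hz'
  -- Weight zero leaves scalars in the second and third factors, and on such elements the
  -- augmentation is injective.
  have h1 : ∃ a : A, z₀ = a ⊗ₜ ((1 : A) ⊗ₜ (1 : ExteriorAlgebra K V)) := by
    clear hz' hm hz
    induction h0 using Submodule.span_induction with
    | zero => exact ⟨0, by simp⟩
    | add y z _ _ hy hz =>
      obtain ⟨a, rfl⟩ := hy
      obtain ⟨a', rfl⟩ := hz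
      exact ⟨a + a', by rw [TensorProduct.add_tmul]⟩
    | smul r y _ hy =>
      obtain ⟨a, rfl⟩ := hy
      exact ⟨r • a, by rw [TensorProduct.smul_tmul']⟩
    | mem z hz =>
      obtain ⟨S, x, hx, a, c, hc, rfl⟩ := hz
      rcases S.eq_empty_or_nonempty with rfl | hS
      · obtain ⟨r, rfl⟩ := mem_degFil_one.1 hc
        have h2 : ∀ i, contr (b.coord i) x = 0 := fun i => by
          have h := hx.2 i (by simp)
          rw [koszulIdem_of_notMem b _ (by simp)] at h
          have h3 := congrArg (contr (b.coord i)) h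
          rwa [contr_wedge_self, contr_contr, map_zero, sub_zero, map_zero] at h3
        obtain ⟨t, rfl⟩ := eq_algebraMap_of_contr_eq_zero b h2
        refine ⟨(t * r) • a, ?_⟩
        rw [Algebra.algebraMap_eq_smul_one, Algebra.algebraMap_eq_smul_one,
          TensorProduct.tmul_smul, ← TensorProduct.smul_tmul', smul_smul, TensorProduct.tmul_smul,
          TensorProduct.smul_tmul']
      · have := hS.card_pos
        rw [show 0 + 1 - S.card = 0 by omega] at hc
        rw [(Submodule.mem_bot K).1 hc]
        exact ⟨0, by simp⟩
  obtain ⟨a, rfl⟩ := h1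
  rw [koszulAug_tmul, map_one, one_smul, mul_one] at hz'
  exact ⟨y, by rw [hz', TensorProduct.zero_tmul, zero_add]⟩

end KoszulBimodule

/-! ### Yoneda products through projective resolutions -/

section AugmentedResolution

universe v w

open Abelian Limits

/-- A projective resolution `⋯ ⟶ proj 1 ⟶ proj 0 ⟶ X`. -/
structure AugmentedResolution {C : Type v} [Category.{w} C] [Abelian C] (X : C) where
  proj : ℕ → C
  diff (n : ℕ) : proj (n + 1) ⟶ proj n
  aug : proj 0 ⟶ X
  diff_aug : diff 0 ≫ aug = 0
  diff_diff (n : ℕ) : diff (n + 1) ≫ diff n = 0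
  epi_aug : Epi aug
  exact_aug : (ShortComplex.mk (diff 0) aug diff_aug).Exact
  exact_diff (n : ℕ) : (ShortComplex.mk (diff (n + 1)) (diff n) (diff_diff n)).Exact
  projective (n : ℕ) : Projective (proj n)

namespace AugmentedResolution

variable {C : Type v} [Category.{w} C] [Abelian C] {X : C} (P : AugmentedResolution X)

/-- The target of the map out of the `n`-th term. -/
def prev : ℕ → C
  | 0 => X
  | n + 1 => P.proj n

/-- The map out of the `n`-th term. -/
def out : ∀ n, P.proj n ⟶ P.prev n
  | 0 => P.aug
  | n + 1 => P.diff n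

theorem diff_out (n : ℕ) : P.diff n ≫ P.out n = 0 := by
  rcases n with _ | n
  · exact P.diff_aug
  · exact P.diff_diff n

theorem exact_out (n : ℕ) : (ShortComplex.mk (P.diff n) (P.out n) (P.diff_out n)).Exact := by
  rcases n with _ | n
  · exact P.exact_aug
  · exact P.exact_diff n

/-- The syzygies. -/
noncomputable def syzygy : ℕ → C
  | 0 => X
  | n + 1 => kernel (P.out n)

/-- The projection onto the `n`-th syzygy. -/
noncomputable def cover : ∀ n, P.proj n ⟶ P.syzygy n
  | 0 => P.aug
  | n + 1 => kernel.lift (P.out n) (P.diff n) (P.diff_out n)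

/-- The inclusion of the `(n + 1)`-st syzygy. -/
noncomputable def incl (n : ℕ) : P.syzygy (n + 1) ⟶ P.proj n := kernel.ι (P.out n)

theorem cover_incl (n : ℕ) : P.cover (n + 1) ≫ P.incl n = P.diff n := kernel.lift_ι _ _ _

instance (n : ℕ) : Mono (P.incl n) := inferInstanceAs (Mono (kernel.ι (P.out n)))

instance epi_cover (n : ℕ) : Epi (P.cover n) := by
  rcases n with _ | n
  · exact P.epi_aug
  · exact (ShortComplex.exact_iff_epi_kernel_lift _).1 (P.exact_out n)

theorem incl_cover (n : ℕ) : P.incl n ≫ P.cover n = 0 := by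
  rcases n with _ | n
  · exact kernel.condition _
  · rw [← cancel_mono (P.incl n), Category.assoc, P.cover_incl, zero_comp]
    exact kernel.condition _

theorem syzygy_shortExact (n : ℕ) :
    (ShortComplex.mk (P.incl n) (P.cover n) (P.incl_cover n)).ShortExact := by
  have h2 : (ShortComplex.mk (P.incl n) (P.cover n) (P.incl_cover n)).Exact := by
    refine ShortComplex.exact_of_f_is_kernel _ ?_
    rcases n with _ | n
    · exact kernelIsKernel P.aug
    · refine KernelFork.IsLimit.ofι (P.incl (n + 1)) (P.incl_cover (n + 1))
        (fun {T} k hk => kernel.lift (P.diff n) k ?_)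
        (fun {T} k hk => kernel.lift_ι _ _ _)
        (fun {T} k hk m hm => (cancel_mono (P.incl (n + 1))).1 ?_)
      · have h := hk =≫ P.incl n
        rwa [Category.assoc, P.cover_incl, zero_comp] at h
      · exact hm.trans (kernel.lift_ι _ _ _).symm
  exact { exact := h2, mono_f := inferInstanceAs (Mono (P.incl n)), epi_g := P.epi_cover n }

/-- The syzygies as a sequence of short exact sequences. -/
noncomputable abbrev syzygies : SyzygySequence C where
  obj := P.syzygy
  proj := P.proj
  incl := P.incl
  cover := P.cover
  zero := P.incl_cover
  exact := P.syzygy_shortExact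
  projective := P.projective

/-- The morphism from a syzygy that is given by a cocycle. -/
noncomputable def desc {Y : C} (p : ℕ) (F : P.proj p ⟶ Y) (hF : P.diff p ≫ F = 0) :
    P.syzygy p ⟶ Y :=
  haveI : Epi (ShortComplex.mk (P.incl p) (P.cover p) (P.incl_cover p)).g := P.epi_cover p
  (P.syzygy_shortExact p).exact.desc F (by
    rw [← P.cover_incl p, Category.assoc] at hF
    exact (cancel_epi (P.cover (p + 1))).1 (hF.trans comp_zero.symm))

theorem cover_desc {Y : C} (p : ℕ) (F : P.proj p ⟶ Y) (hF : P.diff p ≫ F = 0) :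
    P.cover p ≫ P.desc p F hF = F :=
  haveI : Epi (ShortComplex.mk (P.incl p) (P.cover p) (P.incl_cover p)).g := P.epi_cover p
  (P.syzygy_shortExact p).exact.g_desc F _

theorem desc_cover {Y : C} (p : ℕ) (f : P.syzygy p ⟶ Y) (h : P.diff p ≫ P.cover p ≫ f = 0) :
    P.desc p (P.cover p ≫ f) h = f := by
  rw [← cancel_epi (P.cover p), cover_desc]

theorem diff_cover (p : ℕ) : P.diff p ≫ P.cover p = 0 := by
  rw [← P.cover_incl, Category.assoc, P.incl_cover, comp_zero]

theorem desc_congr {Y : C} {p : ℕ} {F : P.proj p ⟶ Y} {hF : P.diff p ≫ F = 0}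
    {f : P.syzygy p ⟶ Y} (h : P.cover p ≫ f = F) : P.desc p F hF = f := by
  rw [← cancel_epi (P.cover p), cover_desc, h]

/-- A chain map of degree `-p` from a resolution to itself. -/
structure ChainShift (p : ℕ) where
  hom (n : ℕ) : P.proj (p + n) ⟶ P.proj n
  comm (n : ℕ) : P.diff (p + n) ≫ hom n = hom (n + 1) ≫ P.diff n

variable {P} in
theorem ChainShift.diff_hom_cover {p : ℕ} (T : P.ChainShift p) (n : ℕ) :
    P.diff (p + n) ≫ T.hom n ≫ P.cover n = 0 := by
  rw [← Category.assoc, T.comm, Category.assoc, P.diff_cover, comp_zero]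

variable [HasExt.{u} C]

/-- The iterated extension class of the resolution. -/
noncomputable def extClass (p : ℕ) : Ext.{u} X (P.syzygy p) p :=
  P.syzygies.extClass 0 p p (zero_add p)

/-- The class of a cocycle. -/
noncomputable def cls {Y : C} (p : ℕ) (F : P.proj p ⟶ Y) (hF : P.diff p ≫ F = 0) :
    Ext.{u} X Y p :=
  (P.extClass p).comp (Ext.mk₀ (P.desc p F hF)) (add_zero p)

theorem exists_eq_cls {Y : C} (p : ℕ) (x : Ext.{u} X Y p) :
    ∃ F hF, x = P.cls p F hF := by
  obtain ⟨f, rfl⟩ := P.syzygies.exists_comp_mk₀ 0 p p (zero_add p) x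
  refine ⟨P.cover p ≫ f, ?_, ?_⟩
  · rw [← Category.assoc, P.diff_cover, zero_comp]
  · rw [cls, desc_cover]
    rfl

theorem cls_zero_eq_zero {Y : C} (F : P.proj 0 ⟶ Y) (hF : P.diff 0 ≫ F = 0)
    (h : P.cls 0 F hF = 0) : F = 0 := by
  have h1 : P.cls 0 F hF = Ext.mk₀ (P.desc 0 F hF) := by
    rw [cls, extClass, SyzygySequence.extClass_zero]
    exact Ext.mk₀_id_comp _
  rw [h1] at h
  have h2 : P.desc 0 F hF = 0 := (Ext.mk₀_bijective _ _).1 (h.trans (Ext.mk₀_zero _ _).symm)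
  rw [← P.cover_desc 0 F hF, h2, comp_zero]

theorem cls_succ_eq_zero_iff {Y : C} (p : ℕ) (F : P.proj (p + 1) ⟶ Y)
    (hF : P.diff (p + 1) ≫ F = 0) :
    P.cls (p + 1) F hF = 0 ↔ ∃ H : P.proj p ⟶ Y, P.diff p ≫ H = F := by
  refine (P.syzygies.extClass_comp_mk₀_eq_zero_iff 0 p p (zero_add p) _).trans ?_
  refine exists_congr fun H => ?_
  rw [← cancel_epi (P.cover (p + 1)), P.cover_desc, ← P.cover_incl, Category.assoc]

theorem cls_add {Y : C} (p : ℕ) (F F' : P.proj p ⟶ Y) (hF : P.diff p ≫ F = 0)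
    (hF' : P.diff p ≫ F' = 0) (h : P.diff p ≫ (F + F') = 0) :
    P.cls p (F + F') h = P.cls p F hF + P.cls p F' hF' := by
  rw [cls, cls, cls, ← Ext.comp_add, ← Ext.mk₀_add]
  congr 2
  exact P.desc_congr (by rw [Preadditive.comp_add, cover_desc, cover_desc])

theorem cls_smul {K : Type*} [Ring K] [Linear K C] {Y : C} (p : ℕ) (r : K) (F : P.proj p ⟶ Y)
    (hF : P.diff p ≫ F = 0) (h : P.diff p ≫ (r • F) = 0) :
    P.cls p (r • F) h = r • P.cls p F hF := by
  rw [cls, cls, ← Ext.comp_smul, ← Ext.mk₀_smul]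
  congr 2
  exact P.desc_congr (by rw [Linear.comp_smul, cover_desc])

variable {P}

/-- The morphisms on syzygies induced by a chain map. -/
noncomputable def ChainShift.shiftHom {p : ℕ} (T : P.ChainShift p) : P.syzygies.ShiftHom p where
  obj n := P.desc (p + n) (T.hom n ≫ P.cover n) (T.diff_hom_cover n)
  proj := T.hom
  incl_comm n := by
    refine (cancel_epi (P.cover (p + n + 1))).1 ?_
    refine (Category.assoc _ _ _).symm.trans ((P.cover_incl (p + n) =≫ T.hom n).trans ?_)
    refine Eq.trans ?_ (Category.assoc _ _ _)
    refine Eq.trans ?_ (P.cover_desc (p + (n + 1)) _ (T.diff_hom_cover (n + 1)) =≫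
      P.incl n).symm
    rw [Category.assoc, P.cover_incl, T.comm]
  cover_comm n := P.cover_desc (p + n) _ _

/-- Once a cocycle lifts to a chain map, its Yoneda product with any class is computed by composing
cochains. -/
theorem ChainShift.cls_comp {p : ℕ} (T : P.ChainShift p) {Y : C} (q : ℕ) (F : P.proj q ⟶ Y)
    (hF : P.diff q ≫ F = 0) (h : P.diff (p + q) ≫ T.hom q ≫ F = 0) :
    (P.cls p (T.hom 0 ≫ P.aug) (T.diff_hom_cover 0)).comp (P.cls q F hF) rfl =
      P.cls (p + q) (T.hom q ≫ F) h := by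
  refine (T.shiftHom.comp_eq q (P.desc q F hF)).trans ?_
  rw [cls]
  congr 2
  refine (P.desc_congr ?_).symm
  refine (Category.assoc _ _ _).symm.trans ((P.cover_desc (p + q) _ (T.diff_hom_cover q) =≫
    P.desc q F hF).trans ?_)
  rw [Category.assoc, P.cover_desc]

theorem cls_aug {hF : P.diff 0 ≫ P.aug = 0} : P.cls 0 P.aug hF = Ext.mk₀ (𝟙 X) := by
  rw [cls, extClass, SyzygySequence.extClass_zero]
  refine (Ext.mk₀_id_comp _).trans ?_
  congr 1
  exact P.desc_congr (Category.comp_id _)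

end AugmentedResolution

end AugmentedResolution

/-! ### The Galois property of the action on an algebra with Heisenberg generators -/

section Galois

variable {K A V G : Type*} [Field K] [Ring A] [Algebra K A] [AddCommGroup V] [Module K V]
  [Group G]

/-- An action of a group by symplectic substitutions of Heisenberg generators. -/
structure IsSymplecticAction (ω : V →ₗ[K] V →ₗ[K] K) (f : V →ₗ[K] A) (r : G →* Module.End K V)
    (ρ : G →* (A →ₐ[K] A)) : Prop where
  heis : IsHeisenberg ω f
  skew : ∀ u v, ω u v = -ω v u
  nondeg : ∀ v, v ≠ 0 → ∃ u, ω u v = 1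
  map_gen : ∀ g v, ρ g (f v) = f (r g v)
  isometry : ∀ g u v, ω (r g u) (r g v) = ω u v
  faithful : Function.Injective r

/-- Families that exhibit the algebra as a Galois extension of its invariants. -/
def IsGaloisPair (ρ : G →* (A →ₐ[K] A)) {ι : Type*} [Fintype ι] (a b : ι → A) : Prop :=
  ∀ h, (h = 1 → ∑ i, a i * ρ h (b i) = 1) ∧ (h ≠ 1 → ∑ i, a i * ρ h (b i) = 0)

/-- The functions on the group of the form `h ↦ ∑ a * h b`. -/
def galoisSpan (ρ : G →* (A →ₐ[K] A)) : Submodule K (G → A) :=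
  Submodule.span K (Set.range fun p : A × A => fun h => p.1 * ρ h p.2)

theorem galoisSpan_exists {ρ : G →* (A →ₐ[K] A)} {y : G → A} (hy : y ∈ galoisSpan ρ) :
    ∃ (s : Finset (A × A)) (a b : s → A), ∀ h, y h = ∑ i, a i * ρ h (b i) := by
  obtain ⟨c, rfl⟩ := Finsupp.mem_span_range_iff_exists_finsupp.1 hy
  refine ⟨c.support, fun p => c p • p.1.1, fun p => p.1.2, fun h => ?_⟩
  rw [Finsupp.sum, Finset.sum_apply, ← Finset.sum_coe_sort]
  simp

/-- The twisted commutator on functions on the group. -/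
def groupComm (ρ : G →* (A →ₐ[K] A)) (v w : A) : Module.End K (G → A) where
  toFun y h := v * y h - y h * ρ h w
  map_add' y z := by
    funext h
    simp only [Pi.add_apply]
    noncomm_ring
  map_smul' r y := by
    funext h
    simp [smul_sub]

theorem groupComm_apply (ρ : G →* (A →ₐ[K] A)) (v w : A) (y : G → A) (h : G) :
    groupComm ρ v w y h = v * y h - y h * ρ h w := rfl

/-- In `a * ρ h b` the multiplier `v` is absorbed by `a` and the multiplier `ρ h w` by `b`. -/
theorem groupComm_mem (ρ : G →* (A →ₐ[K] A)) (v w : A) {y : G → A} (hy : y ∈ galoisSpan ρ) :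
    groupComm ρ v w y ∈ galoisSpan ρ := by
  induction hy using Submodule.span_induction with
  | mem y hy =>
    obtain ⟨⟨a, b⟩, rfl⟩ := hy
    have e : groupComm ρ v w (fun h => a * ρ h b) =
        (fun h => (v * a) * ρ h b) - (fun h => a * ρ h (b * w)) := by
      funext h
      simp [groupComm_apply, mul_assoc]
    rw [e]
    exact Submodule.sub_mem _ (Submodule.subset_span ⟨(v * a, b), rfl⟩)
      (Submodule.subset_span ⟨(a, b * w), rfl⟩)
  | zero => rw [map_zero]; exact Submodule.zero_mem _
  | add y z _ _ h h' => rw [map_add]; exact Submodule.add_mem _ h h'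
  | smul r y _ h => rw [map_smul]; exact Submodule.smul_mem _ _ h

theorem iterate_groupComm_apply_eq_zero {ρ : G →* (A →ₐ[K] A)} (v w : A) (k : ℕ) {y : G → A}
    {h : G} (hy : y h = 0) : (groupComm ρ v w)^[k] y h = 0 := by
  induction k with
  | zero => exact hy
  | succ k ih => rw [Function.iterate_succ_apply', groupComm_apply, ih, mul_zero, zero_mul, sub_zero]

variable {ω : V →ₗ[K] V →ₗ[K] K} {f : V →ₗ[K] A} {r : G →* Module.End K V}
  {ρ : G →* (A →ₐ[K] A)}

/-- At the identity the commutator with `f u` acts like a derivative in the variable `f v - f w`. It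
takes the `(k + 1)`-st iterate to `k + 1` times the `k`-th, so `k` of them produce `k!`. -/
theorem IsHeisenberg.iterate_commutator (hf : IsHeisenberg ω f) (ρ : G →* (A →ₐ[K] A)) (u v w : V)
    (hu : ω u (v - w) = 1) (k : ℕ) {y : G → A} (hy : y 1 = 1) :
    (groupComm ρ (f u) (f u))^[k] ((groupComm ρ (f v) (f w))^[k] y) 1 = (k.factorial : A) := by
  have key : ∀ k : ℕ, adGen f u ((groupComm ρ (f v) (f w))^[k + 1] y 1) =
      ((k + 1 : ℕ) : A) * ((groupComm ρ (f v) (f w))^[k] y 1) := by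
    have hstep : ∀ x : A, adGen f u (f v * x - x * f w) =
        x + (f v * adGen f u x - adGen f u x * f w) := by
      intro x
      rw [map_sub, adGen_mul, adGen_mul, hf.adGen_gen, hf.adGen_gen, ← Algebra.commutes (ω u w)]
      rw [map_sub, sub_eq_iff_eq_add] at hu
      rw [hu, map_add, map_one]
      noncomm_ring
    intro k
    induction k with
    | zero =>
      simp only [Function.iterate_succ_apply', Function.iterate_zero, id, groupComm_apply, map_one,
        AlgHom.one_apply]
      rw [hstep, hy, adGen_apply]
      simp
    | succ k ih =>
      rw [Function.iterate_succ_apply', groupComm_apply, map_one, AlgHom.one_apply, hstep, ih]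
      rw [Function.iterate_succ_apply' _ k, groupComm_apply, map_one, AlgHom.one_apply]
      push_cast
      have hc := (Nat.cast_commute (α := A) k (f v)).eq
      simp only [add_mul, one_mul, mul_add, mul_sub, ← mul_assoc, hc]
      abel
  have hiter : ∀ (k : ℕ) (c : A) (z : G → A), (∀ x, c * x = x * c) →
      (groupComm ρ (f u) (f u))^[k] (fun h => c * z h) 1 =
        c * (groupComm ρ (f u) (f u))^[k] z 1 := by
    intro k c z hc
    have : ∀ h, (groupComm ρ (f u) (f u))^[k] (fun h => c * z h) h =
        c * (groupComm ρ (f u) (f u))^[k] z h := by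
      induction k with
      | zero => exact fun h => rfl
      | succ k ih =>
        intro h
        rw [Function.iterate_succ_apply', Function.iterate_succ_apply', groupComm_apply,
          groupComm_apply, ih, mul_sub, ← mul_assoc, ← hc (f u)]
        simp only [mul_assoc]
    exact this 1
  have hloc : ∀ (k : ℕ) (z z' : G → A), z 1 = z' 1 →
      (groupComm ρ (f u) (f u))^[k] z 1 = (groupComm ρ (f u) (f u))^[k] z' 1 := by
    intro k z z' h
    induction k with
    | zero => exact h
    | succ k ih =>
      rw [Function.iterate_succ_apply', Function.iterate_succ_apply', groupComm_apply,
        groupComm_apply, ih]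
  induction k with
  | zero => simpa using hy
  | succ k ih =>
    rw [Function.iterate_succ_apply]
    have e : groupComm ρ (f u) (f u) ((groupComm ρ (f v) (f w))^[k + 1] y) 1 =
        (fun h => ((k + 1 : ℕ) : A) * (groupComm ρ (f v) (f w))^[k] y h) 1 := by
      rw [groupComm_apply, map_one, AlgHom.one_apply]
      exact key k
    rw [hloc k _ (fun h => ((k + 1 : ℕ) : A) * (groupComm ρ (f v) (f w))^[k] y h) e, hiter k _ _ (Nat.cast_commute _), ih, Nat.factorial_succ, Nat.cast_mul]

/-- Interpolation on the group, one new zero at a time. For `g ≠ 1` choose `v` moved by `g⁻¹`. The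
iterated twisted commutator with `f v` and `f (g⁻¹ v)` kills the value at `g`, while commutators
with a suitable `f u` restore a nonzero scalar at `1`. Earlier zeros persist. -/
theorem IsSymplecticAction.exists_mem_galoisSpan [CharZero K]
    (h : IsSymplecticAction ω f r ρ) (S : Finset G) (hS : 1 ∉ S) :
    ∃ y ∈ galoisSpan ρ, y 1 = 1 ∧ ∀ g ∈ S, y g = 0 := by
  classical
  induction S using Finset.induction_on with
  | empty => exact ⟨_, Submodule.subset_span ⟨(1, 1), rfl⟩, by simp, by simp⟩
  | insert g S hg ih =>
    rw [Finset.mem_insert, not_or] at hS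
    obtain ⟨y, hy, hy1, hyS⟩ := ih hS.2
    obtain ⟨v, hv⟩ : ∃ v, v - r g⁻¹ v ≠ 0 := by
      by_contra! hc
      refine hS.1 (inv_injective (h.faithful (LinearMap.ext fun v => ?_)))
      rw [inv_one, map_one, Module.End.one_apply, ← sub_eq_zero]
      exact hc v
    obtain ⟨u, hu⟩ := h.nondeg _ hv
    obtain ⟨k, hk⟩ := h.heis.exists_mem (y g)
    -- At `g` the twist disappears, since `ρ g (f (g⁻¹ v)) = f v`. What remains is the plain
    -- commutator with `f v`, and `k` of these exhaust the degree of `y g`.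
    have hD : ∀ m j, j + m = k → (groupComm ρ (f v) (f (r g⁻¹ v)))^[m] y g ∈ degFil f j := by
      intro m
      induction m with
      | zero => rintro j rfl; exact hk
      | succ m ihm =>
        intro j hj
        have h1 := h.heis.adGen_mem v (ihm (j + 1) (by omega))
        rw [Function.iterate_succ_apply', groupComm_apply, h.map_gen, ← Module.End.mul_apply,
          ← map_mul, mul_inv_cancel, map_one, Module.End.one_apply]
        exact h1
    have hmem : ∀ (v w : A) (m : ℕ) (y), y ∈ galoisSpan ρ →
        (groupComm ρ v w)^[m] y ∈ galoisSpan ρ := by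
      intro v w m
      induction m with
      | zero => exact fun y hy => hy
      | succ m ihm => exact fun y hy => ihm _ (groupComm_mem ρ v w hy)
    refine ⟨((k.factorial : K)⁻¹) • (groupComm ρ (f u) (f u))^[k]
      ((groupComm ρ (f v) (f (r g⁻¹ v)))^[k] y), Submodule.smul_mem _ _
        (hmem _ _ _ _ (hmem _ _ _ _ hy)), ?_, ?_⟩
    · rw [Pi.smul_apply, h.heis.iterate_commutator ρ u v _ hu k hy1, Algebra.smul_def,
        ← map_natCast (algebraMap K A), ← map_mul, inv_mul_cancel₀ (by
          exact_mod_cast k.factorial_ne_zero), map_one]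
    · intro g' hg'
      rw [Pi.smul_apply]
      rcases Finset.mem_insert.1 hg' with rfl | hg'
      · rw [iterate_groupComm_apply_eq_zero _ _ _ ((Submodule.mem_bot K).1 (hD k 0 (by omega))),
          smul_zero]
      · rw [iterate_groupComm_apply_eq_zero _ _ _ (iterate_groupComm_apply_eq_zero _ _ _
          (hyS g' hg')), smul_zero]

theorem IsSymplecticAction.exists_isGaloisPair [CharZero K] [Finite G]
    (h : IsSymplecticAction ω f r ρ) :
    ∃ (s : Finset (A × A)) (a b : s → A), IsGaloisPair ρ a b := by
  classical
  have := Fintype.ofFinite G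
  obtain ⟨y, hy, h1, h2⟩ := h.exists_mem_galoisSpan (Finset.univ.erase 1) (by simp)
  obtain ⟨s, a, b, e⟩ := galoisSpan_exists hy
  refine ⟨s, a, b, fun g => ⟨?_, fun hg => ?_⟩⟩
  · rintro rfl
    rw [← e, h1]
  · rw [← e, h2 g (by simpa using hg)]

/-- The sum over the orbit. -/
noncomputable def orbitSum [Fintype G] (ρ : G →* (A →ₐ[K] A)) : A →ₗ[K] A :=
  ∑ g, (ρ g).toLinearMap

theorem orbitSum_apply [Fintype G] (ρ : G →* (A →ₐ[K] A)) (x : A) :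
    orbitSum ρ x = ∑ g, ρ g x := by
  simp [orbitSum, LinearMap.sum_apply]

theorem map_orbitSum [Fintype G] (ρ : G →* (A →ₐ[K] A)) (h : G) (x : A) :
    ρ h (orbitSum ρ x) = orbitSum ρ x := by
  rw [orbitSum_apply, map_sum]
  refine Fintype.sum_equiv (Equiv.mulLeft h) _ _ fun g => ?_
  simp [AlgHom.mul_apply]

section Pair

variable {ι : Type*} [Fintype ι] {a b : ι → A}

theorem IsGaloisPair.sum_mul_map (h : IsGaloisPair ρ a b) (g k : G) :
    (g = k → ∑ i, ρ g (a i) * ρ k (b i) = 1) ∧ (g ≠ k → ∑ i, ρ g (a i) * ρ k (b i) = 0) := by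
  have e : ∑ i, ρ g (a i) * ρ k (b i) = ρ g (∑ i, a i * ρ (g⁻¹ * k) (b i)) := by
    simp only [map_sum, map_mul]
    refine Finset.sum_congr rfl fun i _ => ?_
    rw [AlgHom.mul_apply, ← AlgHom.mul_apply (ρ g), ← map_mul, mul_inv_cancel, map_one,
      AlgHom.one_apply]
  rw [e]
  constructor
  · rintro rfl
    rw [(h _).1 (by simp), map_one]
  · intro hgk
    rw [(h _).2 (by rwa [ne_eq, inv_mul_eq_one]), map_zero]

variable [Fintype G]

/-- A dual basis for `A` as a right module over the invariants, with coordinates `x ↦ orbitSum ρ (b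
i * x)`: the Galois condition keeps only the term of the identity. -/
theorem IsGaloisPair.sum_mul_orbitSum (h : IsGaloisPair ρ a b) (x : A) :
    ∑ i, a i * orbitSum ρ (b i * x) = x := by
  simp only [orbitSum_apply, Finset.mul_sum, map_mul]
  rw [Finset.sum_comm]
  simp only [← mul_assoc, ← Finset.sum_mul]
  rw [Finset.sum_eq_single 1 (fun g _ hg => by rw [(h g).2 hg, zero_mul]) (by simp), (h 1).1 rfl]
  simp

/-- The dual basis on the other side, twisted by `g`: orthogonality of translates keeps only the
term of `g`. -/
theorem IsGaloisPair.sum_map_mul_orbitSum (h : IsGaloisPair ρ a b) (g : G) (x : A) :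
    ∑ i, orbitSum ρ (x * a i) * ρ g (b i) = ρ g x := by
  simp only [orbitSum_apply, Finset.sum_mul, map_mul]
  rw [Finset.sum_comm]
  simp only [mul_assoc, ← Finset.mul_sum]
  rw [Finset.sum_eq_single g (fun k _ hk => by rw [(h.sum_mul_map k g).2 hk, mul_zero]) (by simp),
    (h.sum_mul_map g g).1 rfl, mul_one]

theorem IsGaloisPair.sum_orbitSum_mul (h : IsGaloisPair ρ a b) (x : A) :
    ∑ i, orbitSum ρ (x * a i) * b i = x := by
  simpa using h.sum_map_mul_orbitSum 1 x

end Pair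

end Galois

/-! ### Invariant forms and families of twisted cochains -/

section Forms

variable {K A V G : Type*} [Field K] [Ring A] [Algebra K A] [AddCommGroup V] [Module K V]
  [Group G]

/-- The action of the group on the Koszul bimodule complex. -/
noncomputable def koszulAct (ρ : G →* (A →ₐ[K] A)) (r : G →* Module.End K V) (g : G) :
    Module.End K (KoszulSpace K A V) :=
  TensorProduct.map (ρ g).toLinearMap
    (TensorProduct.map (ρ g).toLinearMap (ExteriorAlgebra.map (r g)).toLinearMap)

theorem koszulAct_tmul (ρ : G →* (A →ₐ[K] A)) (r : G →* Module.End K V) (g : G) (a c : A)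
    (x : ExteriorAlgebra K V) : koszulAct ρ r g (a ⊗ₜ[K] (c ⊗ₜ[K] x)) =
      ρ g a ⊗ₜ (ρ g c ⊗ₜ ExteriorAlgebra.map (r g) x) := rfl

theorem map_map_mul (r : G →* Module.End K V) (g h : G) (x : ExteriorAlgebra K V) :
    ExteriorAlgebra.map (r g) (ExteriorAlgebra.map (r h) x) =
      ExteriorAlgebra.map (r (g * h)) x := by
  rw [map_mul, Module.End.mul_eq_comp, ← ExteriorAlgebra.map_comp_map]
  rfl

theorem koszulAct_koszulAct (ρ : G →* (A →ₐ[K] A)) (r : G →* Module.End K V) (g h : G)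
    (z : KoszulSpace K A V) : koszulAct ρ r g (koszulAct ρ r h z) = koszulAct ρ r (g * h) z := by
  refine LinearMap.congr_fun (f := koszulAct ρ r g ∘ₗ koszulAct ρ r h)
    (g := koszulAct ρ r (g * h)) (koszulSpace_hom_ext fun a c x => ?_) z
  simp only [LinearMap.comp_apply, koszulAct_tmul, map_map_mul, map_mul, AlgHom.mul_apply]

/-- A bimodule form over the invariants with invariant values. -/
structure IsBimoduleForm (ρ : G →* (A →ₐ[K] A)) (F : KoszulSpace K A V →ₗ[K] A) : Prop where
  left : ∀ β, (∀ g, ρ g β = β) → ∀ a (y : A ⊗[K] ExteriorAlgebra K V),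
    F ((β * a) ⊗ₜ y) = β * F (a ⊗ₜ y)
  right : ∀ β, (∀ g, ρ g β = β) → ∀ a c (x : ExteriorAlgebra K V),
    F (a ⊗ₜ ((c * β) ⊗ₜ x)) = F (a ⊗ₜ (c ⊗ₜ x)) * β
  value : ∀ g z, ρ g (F z) = F z

/-- A bimodule form over the invariants that is invariant under the group. -/
structure IsInvariantForm (ρ : G →* (A →ₐ[K] A)) (r : G →* Module.End K V)
    (F : KoszulSpace K A V →ₗ[K] A) : Prop extends IsBimoduleForm ρ F where
  act : ∀ g z, F (koszulAct ρ r g z) = F z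

variable {ρ : G →* (A →ₐ[K] A)} {r : G →* Module.End K V} {ι : Type*} [Fintype ι] {a b : ι → A}

/-- The map on `A ⊗ Λ V` given by a form and a Galois pair. -/
noncomputable def halfForm (a b : ι → A) (F : KoszulSpace K A V →ₗ[K] A) :
    A ⊗[K] ExteriorAlgebra K V →ₗ[K] A :=
  ∑ j, LinearMap.mulLeft K (a j) ∘ₗ F ∘ₗ TensorProduct.mk K A _ (b j)

theorem halfForm_apply (F : KoszulSpace K A V →ₗ[K] A) (y : A ⊗[K] ExteriorAlgebra K V) :
    halfForm a b F y = ∑ j, a j * F (b j ⊗ₜ y) := by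
  simp [halfForm, LinearMap.sum_apply]

/-- The family of twisted cochains given by a form and a Galois pair. -/
noncomputable def recoverCochain (ρ : G →* (A →ₐ[K] A)) (a b : ι → A)
    (F : KoszulSpace K A V →ₗ[K] A) (g : G) : ExteriorAlgebra K V →ₗ[K] A :=
  ∑ i, LinearMap.mulRight K (ρ g (b i)) ∘ₗ halfForm a b F ∘ₗ TensorProduct.mk K A _ (a i)

theorem recoverCochain_apply (F : KoszulSpace K A V →ₗ[K] A) (g : G) (x : ExteriorAlgebra K V) :
    recoverCochain ρ a b F g x = ∑ i, halfForm a b F (a i ⊗ₜ x) * ρ g (b i) := by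
  simp [recoverCochain, LinearMap.sum_apply]

theorem IsInvariantForm.halfForm_mul_right {F : KoszulSpace K A V →ₗ[K] A}
    (hF : IsInvariantForm ρ r F) (β : A) (hβ : ∀ g, ρ g β = β) (c : A) (x : ExteriorAlgebra K V) :
    halfForm a b F ((c * β) ⊗ₜ x) = halfForm a b F (c ⊗ₜ x) * β := by
  simp only [halfForm_apply, Finset.sum_mul, hF.right β hβ, mul_assoc]

section Fintype

variable [Fintype G]

/-- The form given by a family of twisted cochains. -/
noncomputable def twistedForm (ρ : G →* (A →ₐ[K] A)) (φ : G → ExteriorAlgebra K V →ₗ[K] A) :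
    KoszulSpace K A V →ₗ[K] A :=
  ∑ g, TensorProduct.lift ((LinearMap.mul K A).compl₂
    (TensorProduct.lift (((LinearMap.mul K A).flip ∘ₗ (ρ g).toLinearMap).compl₂ (φ g))))

theorem twistedForm_tmul (φ : G → ExteriorAlgebra K V →ₗ[K] A) (a c : A)
    (x : ExteriorAlgebra K V) :
    twistedForm ρ φ (a ⊗ₜ (c ⊗ₜ x)) = ∑ g, a * (φ g x * ρ g c) := by
  simp [twistedForm, LinearMap.sum_apply]

theorem twistedForm_mul_left (φ : G → ExteriorAlgebra K V →ₗ[K] A) (d a : A)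
    (y : A ⊗[K] ExteriorAlgebra K V) :
    twistedForm ρ φ ((d * a) ⊗ₜ y) = d * twistedForm ρ φ (a ⊗ₜ y) := by
  induction y using TensorProduct.induction_on with
  | zero => simp
  | add y z hy hz => simp only [TensorProduct.tmul_add, map_add, hy, hz, mul_add]
  | tmul c x => simp only [twistedForm_tmul, Finset.mul_sum, mul_assoc]

theorem twistedForm_add (φ ψ : G → ExteriorAlgebra K V →ₗ[K] A) :
    twistedForm ρ (φ + ψ) = twistedForm ρ φ + twistedForm ρ ψ := by
  refine koszulSpace_hom_ext fun a c x => ?_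
  rw [LinearMap.add_apply]
  simp only [twistedForm_tmul, Pi.add_apply, LinearMap.add_apply, add_mul, mul_add,
    Finset.sum_add_distrib]

theorem twistedForm_koszulDiff {I : Type*} [Fintype I] (e : Module.Basis I K V) {f : V →ₗ[K] A}
    (hf : ∀ g v, ρ g (f v) = f (r g v)) (φ : G → ExteriorAlgebra K V →ₗ[K] A)
    (z : KoszulSpace K A V) : twistedForm ρ φ (koszulDiff e f z) =
      twistedForm ρ (fun g => twistedDiff e f (r g) (φ g)) z := by
  refine LinearMap.congr_fun (f := twistedForm ρ φ ∘ₗ koszulDiff e f)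
    (koszulSpace_hom_ext fun a c x => ?_) z
  simp only [LinearMap.comp_apply, koszulDiff_tmul, map_sum, map_sub, twistedForm_tmul,
    twistedDiff_apply, twistedComm_apply, ← Finset.sum_sub_distrib]
  rw [Finset.sum_comm]
  refine Finset.sum_congr rfl fun g _ => ?_
  rw [Finset.sum_mul, Finset.mul_sum]
  refine Finset.sum_congr rfl fun i _ => ?_
  rw [map_mul, hf]
  noncomm_ring

variable (hab : IsGaloisPair ρ a b)

-- Expanding `b j * d` in the left dual basis and using linearity over the invariants moves `d` out
-- to the left. This property makes the two halves of a form separate.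
include hab in
theorem IsGaloisPair.sum_mul_form {F : KoszulSpace K A V →ₗ[K] A} (hF : IsInvariantForm ρ r F)
    (d : A) (y : A ⊗[K] ExteriorAlgebra K V) :
    ∑ j, a j * F ((b j * d) ⊗ₜ y) = d * halfForm a b F y := by
  have h1 : ∀ j, F ((b j * d) ⊗ₜ y) = ∑ k, orbitSum ρ (b j * d * a k) * F (b k ⊗ₜ y) := by
    intro j
    nth_rewrite 1 [← hab.sum_orbitSum_mul (b j * d)]
    rw [TensorProduct.sum_tmul, map_sum]
    exact Finset.sum_congr rfl fun k _ => hF.left _ (fun g => map_orbitSum ρ g _) _ _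
  simp only [h1, Finset.mul_sum, halfForm_apply]
  rw [Finset.sum_comm]
  refine Finset.sum_congr rfl fun k _ => ?_
  simp only [← mul_assoc, ← Finset.sum_mul]
  congr 1
  simp only [mul_assoc]
  exact hab.sum_mul_orbitSum _

-- The trace pairing represents maps from `A` to the invariants that are linear over the invariants:
-- such a map is the orbit sum of right multiplication by one element.
include hab in
theorem IsGaloisPair.orbitSum_halfForm {F : KoszulSpace K A V →ₗ[K] A}
    (hF : IsInvariantForm ρ r F) (d : A) (y : A ⊗[K] ExteriorAlgebra K V) :
    orbitSum ρ (d * halfForm a b F y) = F (d ⊗ₜ y) := by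
  nth_rewrite 2 [← hab.sum_orbitSum_mul d]
  rw [halfForm_apply, Finset.mul_sum, map_sum, TensorProduct.sum_tmul, map_sum]
  refine Finset.sum_congr rfl fun j _ => ?_
  rw [hF.left _ (fun g => map_orbitSum ρ g _), orbitSum_apply, orbitSum_apply, Finset.sum_mul]
  refine Finset.sum_congr rfl fun g _ => ?_
  rw [← mul_assoc, map_mul, hF.value]

-- Expanding `d * a i` in the right dual basis moves `d` out to the right, where the twisted dual
-- basis formula turns it into `ρ g d`.
include hab in
theorem IsGaloisPair.sum_halfForm_mul {F : KoszulSpace K A V →ₗ[K] A}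
    (hF : IsInvariantForm ρ r F) (g : G) (d : A) (x : ExteriorAlgebra K V) :
    ∑ i, halfForm a b F ((d * a i) ⊗ₜ x) * ρ g (b i) = recoverCochain ρ a b F g x * ρ g d := by
  have h1 : ∀ i, halfForm a b F ((d * a i) ⊗ₜ x) =
      ∑ k, halfForm a b F (a k ⊗ₜ x) * orbitSum ρ (b k * (d * a i)) := by
    intro i
    nth_rewrite 1 [← hab.sum_mul_orbitSum (d * a i)]
    rw [TensorProduct.sum_tmul, map_sum]
    exact Finset.sum_congr rfl fun k _ =>
      hF.halfForm_mul_right _ (fun g => map_orbitSum ρ g _) _ _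
  simp only [h1, Finset.sum_mul, recoverCochain_apply]
  rw [Finset.sum_comm]
  refine Finset.sum_congr rfl fun k _ => ?_
  simp only [mul_assoc, ← Finset.mul_sum]
  congr 1
  simp only [← mul_assoc]
  rw [hab.sum_map_mul_orbitSum, map_mul]

include hab in
theorem IsGaloisPair.twistedForm_recoverCochain {F : KoszulSpace K A V →ₗ[K] A}
    (hF : IsInvariantForm ρ r F) (d c : A) (x : ExteriorAlgebra K V) :
    twistedForm ρ (recoverCochain ρ a b F) (d ⊗ₜ (c ⊗ₜ x)) = d * halfForm a b F (c ⊗ₜ x) := by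
  rw [twistedForm_tmul, ← Finset.mul_sum]
  congr 1
  simp only [recoverCochain_apply, Finset.sum_mul, mul_assoc, ← map_mul]
  rw [Finset.sum_comm]
  simp only [← Finset.mul_sum, ← orbitSum_apply]
  nth_rewrite 2 [← hab.sum_mul_orbitSum c]
  rw [TensorProduct.sum_tmul, map_sum]
  exact Finset.sum_congr rfl fun i _ =>
    (hF.halfForm_mul_right _ (fun g => map_orbitSum ρ g _) _ _).symm

include hab in
theorem IsGaloisPair.orbitSum_twistedForm_recoverCochain {F : KoszulSpace K A V →ₗ[K] A}
    (hF : IsInvariantForm ρ r F) (z : KoszulSpace K A V) :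
    orbitSum ρ (twistedForm ρ (recoverCochain ρ a b F) z) = F z := by
  refine LinearMap.congr_fun (f := orbitSum ρ ∘ₗ twistedForm ρ (recoverCochain ρ a b F)) (g := F)
    (koszulSpace_hom_ext fun d c x => ?_) z
  rw [LinearMap.comp_apply, hab.twistedForm_recoverCochain hF, hab.orbitSum_halfForm hF]

-- A generator multiplying the first tensor factor comes out on the left, and one multiplying the
-- second comes out on the right as its translate by `g`. Together they form the twisted commutator.
include hab in
theorem IsGaloisPair.recoverCochain_koszulDiff {I : Type*} [Fintype I] (e : Module.Basis I K V)
    {f : V →ₗ[K] A} (hf : ∀ g v, ρ g (f v) = f (r g v))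
    {F : KoszulSpace K A V →ₗ[K] A} (hF : IsInvariantForm ρ r F) (g : G) :
    recoverCochain ρ a b (F ∘ₗ koszulDiff e f) g =
      twistedDiff e f (r g) (recoverCochain ρ a b F g) := by
  have h1 : ∀ c x, halfForm a b (F ∘ₗ koszulDiff e f) (c ⊗ₜ x) =
      ∑ v, (f (e v) * halfForm a b F (c ⊗ₜ contr (e.coord v) x) -
        halfForm a b F ((f (e v) * c) ⊗ₜ contr (e.coord v) x)) := by
    intro c x
    rw [halfForm_apply]
    simp only [LinearMap.comp_apply, koszulDiff_tmul, map_sum, map_sub, Finset.mul_sum, mul_sub]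
    rw [Finset.sum_comm]
    refine Finset.sum_congr rfl fun v _ => ?_
    rw [Finset.sum_sub_distrib, hab.sum_mul_form hF, halfForm_apply (y := (f (e v) * c) ⊗ₜ _)]
  refine LinearMap.ext fun x => ?_
  rw [recoverCochain_apply, twistedDiff_apply]
  simp only [h1, twistedComm_apply, Finset.sum_mul, sub_mul]
  rw [Finset.sum_comm]
  refine Finset.sum_congr rfl fun v _ => ?_
  rw [Finset.sum_sub_distrib, hab.sum_halfForm_mul hF, hf, recoverCochain_apply, Finset.mul_sum]
  simp only [mul_assoc]

-- The left dual basis undoes the orbit sum, and orthogonality of translates then isolates the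
-- member indexed by `g`.
include hab in
theorem IsGaloisPair.recoverCochain_orbitSum_twistedForm
    (φ : G → ExteriorAlgebra K V →ₗ[K] A) :
    recoverCochain ρ a b (orbitSum ρ ∘ₗ twistedForm ρ φ) = φ := by
  have h1 : ∀ y, halfForm a b (orbitSum ρ ∘ₗ twistedForm ρ φ) y = twistedForm ρ φ (1 ⊗ₜ y) := by
    intro y
    rw [halfForm_apply, ← hab.sum_mul_orbitSum (twistedForm ρ φ (1 ⊗ₜ y))]
    refine Finset.sum_congr rfl fun j _ => ?_
    rw [LinearMap.comp_apply, ← twistedForm_mul_left, mul_one]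
  funext g
  refine LinearMap.ext fun x => ?_
  rw [recoverCochain_apply]
  simp only [h1, twistedForm_tmul, one_mul, Finset.sum_mul, mul_assoc]
  rw [Finset.sum_comm]
  simp only [← Finset.mul_sum]
  rw [Finset.sum_eq_single g (fun k _ hk => by rw [(hab.sum_mul_map k g).2 hk, mul_zero])
    (by simp), (hab.sum_mul_map g g).1 rfl, mul_one]

end Fintype

end Forms

/-! ### The equivariant Koszul resolution -/

section Envelope

variable {K A V : Type u} [Field K] [Ring A] [Algebra K A] [AddCommGroup V] [Module K V]

theorem enveloping_induction {B : Type u} [Ring B] [Algebra K B] {C : B ⊗[K] Bᵐᵒᵖ → Prop}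
    (h0 : C 0) (ha : ∀ s t, C s → C t → C (s + t))
    (ht : ∀ β γ, C (β ⊗ₜ MulOpposite.op γ)) (s : B ⊗[K] Bᵐᵒᵖ) : C s :=
  TensorProduct.induction_on s h0 (fun β γ => ht β γ.unop) ha

/-- The left action of a subalgebra on the Koszul bimodule complex. -/
noncomputable def envLeft (V : Type u) [AddCommGroup V] [Module K V] (B : Subalgebra K A) :
    B →ₐ[K] Module.End K (KoszulSpace K A V) where
  toFun := fun β => TensorProduct.map (LinearMap.mulLeft K (β : A)) LinearMap.id
  map_one' := koszulSpace_hom_ext fun a c x => by simp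
  map_mul' := fun β γ => koszulSpace_hom_ext fun a c x => by simp [-LinearMap.mulLeft_mul, mul_assoc]
  map_zero' := koszulSpace_hom_ext fun a c x => by simp
  map_add' := fun β γ => koszulSpace_hom_ext fun a c x => by
    simp [add_mul, TensorProduct.add_tmul]
  commutes' := fun t => koszulSpace_hom_ext fun a c x => by
    rw [Module.algebraMap_end_apply]
    simp [← Algebra.smul_def, TensorProduct.smul_tmul']

/-- The right action of a subalgebra on the Koszul bimodule complex. -/
noncomputable def envRight (V : Type u) [AddCommGroup V] [Module K V] (B : Subalgebra K A) :
    Bᵐᵒᵖ →ₐ[K] Module.End K (KoszulSpace K A V) where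
  toFun := fun β => TensorProduct.map LinearMap.id
    (TensorProduct.map (LinearMap.mulRight K (β.unop : A)) LinearMap.id)
  map_one' := koszulSpace_hom_ext fun a c x => by simp
  map_mul' := fun β γ => koszulSpace_hom_ext fun a c x => by simp
  map_zero' := koszulSpace_hom_ext fun a c x => by simp
  map_add' := fun β γ => koszulSpace_hom_ext fun a c x => by
    simp [mul_add, TensorProduct.add_tmul, TensorProduct.tmul_add]
  commutes' := fun t => koszulSpace_hom_ext fun a c x => by
    rw [Module.algebraMap_end_apply]
    simp [MulOpposite.algebraMap_apply, ← Algebra.commutes, ← Algebra.smul_def,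
      ← TensorProduct.smul_tmul']

theorem envLeft_comm_envRight (B : Subalgebra K A) (β : B) (γ : Bᵐᵒᵖ) :
    Commute (envLeft V B β) (envRight V B γ) :=
  koszulSpace_hom_ext fun _ _ _ => rfl

/-- The action of the enveloping algebra of a subalgebra on the Koszul bimodule complex. -/
noncomputable def envHom (V : Type u) [AddCommGroup V] [Module K V] (B : Subalgebra K A) :
    B ⊗[K] Bᵐᵒᵖ →ₐ[K] Module.End K (KoszulSpace K A V) :=
  Algebra.TensorProduct.lift (envLeft V B) (envRight V B) (envLeft_comm_envRight B)

noncomputable instance envModule (B : Subalgebra K A) :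
    Module (B ⊗[K] Bᵐᵒᵖ) (KoszulSpace K A V) :=
  Module.compHom (KoszulSpace K A V) (envHom V B).toRingHom

theorem env_smul_def (B : Subalgebra K A) (s : B ⊗[K] Bᵐᵒᵖ) (z : KoszulSpace K A V) :
    s • z = envHom V B s z := rfl

theorem env_smul_tmul (B : Subalgebra K A) (β γ : B) (a c : A) (x : ExteriorAlgebra K V) :
    (β ⊗ₜ[K] MulOpposite.op γ : B ⊗[K] Bᵐᵒᵖ) • (a ⊗ₜ[K] (c ⊗ₜ[K] x)) =
      ((β : A) * a) ⊗ₜ[K] ((c * γ) ⊗ₜ[K] x) := by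
  rw [env_smul_def, envHom, Algebra.TensorProduct.lift_tmul]
  rfl

theorem env_algebraMap_smul (B : Subalgebra K A) (t : K) (z : KoszulSpace K A V) :
    (algebraMap K (B ⊗[K] Bᵐᵒᵖ) t) • z = t • z := by
  rw [env_smul_def, AlgHom.commutes, Module.algebraMap_end_apply]

/-- The scalars that commute with an additive map. -/
def smulCommSubmonoid {R M N : Type*} [Semiring R] [AddCommMonoid M] [AddCommMonoid N]
    [Module R M] [Module R N] (φ : M →+ N) : AddSubmonoid R where
  carrier := {s | ∀ z, φ (s • z) = s • φ z}
  zero_mem' z := by rw [zero_smul, zero_smul, map_zero]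
  add_mem' hs ht z := by rw [add_smul, add_smul, map_add, hs, ht]

theorem env_smul_comm {M : Type*} [AddCommGroup M] (B : Subalgebra K A)
    [Module (B ⊗[K] Bᵐᵒᵖ) M] (φ : KoszulSpace K A V →+ M)
    (h : ∀ (β γ : B) (a c : A) (x : ExteriorAlgebra K V),
      φ (((β : A) * a) ⊗ₜ[K] ((c * γ) ⊗ₜ[K] x)) =
        (β ⊗ₜ[K] MulOpposite.op γ : B ⊗[K] Bᵐᵒᵖ) • φ (a ⊗ₜ (c ⊗ₜ x)))
    (s : B ⊗[K] Bᵐᵒᵖ) (z : KoszulSpace K A V) : φ (s • z) = s • φ z := by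
  refine enveloping_induction (C := fun s => s ∈ smulCommSubmonoid φ) (AddSubmonoid.zero_mem _)
    (fun s t hs ht => AddSubmonoid.add_mem _ hs ht) (fun β γ z => ?_) s z
  induction z using koszulSpace_induction with
  | h0 => simp
  | ha y z hy hz => rw [smul_add, map_add, hy, hz, map_add, smul_add]
  | ht a c x => rw [env_smul_tmul, h]

/-- A linear map over the enveloping algebra, given by a linear map compatible with products. -/
def envLinear {M : Type*} [AddCommGroup M] [Module K M] (B : Subalgebra K A)
    [Module (B ⊗[K] Bᵐᵒᵖ) M] (φ : KoszulSpace K A V →ₗ[K] M)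
    (h : ∀ (β γ : B) (a c : A) (x : ExteriorAlgebra K V),
      φ (((β : A) * a) ⊗ₜ[K] ((c * γ) ⊗ₜ[K] x)) =
        (β ⊗ₜ[K] MulOpposite.op γ : B ⊗[K] Bᵐᵒᵖ) • φ (a ⊗ₜ (c ⊗ₜ x))) :
    KoszulSpace K A V →ₗ[B ⊗[K] Bᵐᵒᵖ] M where
  toFun := φ
  map_add' := map_add φ
  map_smul' s z := env_smul_comm B φ.toAddMonoidHom h s z


theorem envLinear_apply {M : Type*} [AddCommGroup M] [Module K M] (B : Subalgebra K A)
    [Module (B ⊗[K] Bᵐᵒᵖ) M] (φ : KoszulSpace K A V →ₗ[K] M) (h) (z : KoszulSpace K A V) :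
    envLinear B φ h z = φ z := rfl

end Envelope

/-! ### Equivariance and averaging on the Koszul bimodule complex. -/

section Resolution

variable {K A V G : Type u} [Field K] [Ring A] [Algebra K A] [AddCommGroup V] [Module K V]
  [Group G] {ρ : G →* (A →ₐ[K] A)} {r : G →* Module.End K V}

/-- The differential of the Koszul complex as a linear map over the enveloping algebra. -/
noncomputable def envDiff {I : Type*} [Fintype I] (B : Subalgebra K A) (b : Module.Basis I K V)
    (f : V →ₗ[K] A) : KoszulSpace K A V →ₗ[B ⊗[K] Bᵐᵒᵖ] KoszulSpace K A V :=
  envLinear B (koszulDiff b f) fun β γ a c x => by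
    simp only [koszulDiff_tmul, Finset.smul_sum, smul_sub, env_smul_tmul, mul_assoc]

/-- The sum over the group of the translates of the part of degree `p`. -/
noncomputable def koszulSum [Fintype G] (ρ : G →* (A →ₐ[K] A)) (r : G →* Module.End K V) (p : ℕ) :
    Module.End K (KoszulSpace K A V) :=
  ∑ g, koszulAct ρ r g ∘ₗ koszulDeg p

theorem koszulSum_apply [Fintype G] (p : ℕ) (z : KoszulSpace K A V) :
    koszulSum ρ r p z = ∑ g, koszulAct ρ r g (koszulDeg p z) := by
  simp [koszulSum, LinearMap.sum_apply]

theorem koszulAct_koszulDeg (g : G) (p : ℕ) (z : KoszulSpace K A V) :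
    koszulAct ρ r g (koszulDeg p z) = koszulDeg p (koszulAct ρ r g z) := by
  refine LinearMap.congr_fun (f := koszulAct ρ r g ∘ₗ koszulDeg p)
    (g := koszulDeg p ∘ₗ koszulAct ρ r g) (koszulSpace_hom_ext fun a c x => ?_) z
  simp only [LinearMap.comp_apply, koszulDeg_tmul, koszulAct_tmul, degProj_map]

theorem koszulAug_koszulAct (g : G) (z : KoszulSpace K A V) :
    koszulAug K A V (koszulAct ρ r g z) = ρ g (koszulAug K A V z) := by
  refine LinearMap.congr_fun (f := koszulAug K A V ∘ₗ koszulAct ρ r g)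
    (g := (ρ g).toLinearMap ∘ₗ koszulAug K A V) (koszulSpace_hom_ext fun a c x => ?_) z
  have e : ExteriorAlgebra.algebraMapInv (ExteriorAlgebra.map (r g) x) =
      ExteriorAlgebra.algebraMapInv x := by
    refine DFunLike.congr_fun (F := ExteriorAlgebra K V →ₐ[K] K)
      (f := ExteriorAlgebra.algebraMapInv.comp (ExteriorAlgebra.map (r g)))
      (ExteriorAlgebra.hom_ext (LinearMap.ext fun v => ?_)) x
    simp [ExteriorAlgebra.algebraMapInv]
  simp only [LinearMap.comp_apply, koszulAug_tmul, koszulAct_tmul, e, AlgHom.toLinearMap_apply,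
    map_smul, map_mul]

theorem koszulDiff_basis {I I' : Type*} [Fintype I] [Fintype I'] (b : Module.Basis I K V)
    (b' : Module.Basis I' K V) (f : V →ₗ[K] A) : koszulDiff b f = koszulDiff b' f := by
  refine koszulSpace_hom_ext fun a c x => ?_
  let Φ : V →ₗ[K] Module.Dual K V →ₗ[K] KoszulSpace K A V := LinearMap.mk₂ K
    (fun v ξ => (a * f v) ⊗ₜ (c ⊗ₜ contr ξ x) - a ⊗ₜ[K] ((f v * c) ⊗ₜ[K] contr ξ x))
    (fun v w ξ => by
      simp only [map_add, mul_add, add_mul, TensorProduct.add_tmul, TensorProduct.tmul_add]; abel)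
    (fun t v ξ => by
      simp only [map_smul, mul_smul_comm, smul_mul_assoc, ← TensorProduct.smul_tmul',
        TensorProduct.tmul_smul, smul_sub])
    (fun v ξ η => by
      simp only [map_add, LinearMap.add_apply, TensorProduct.tmul_add]; abel)
    (fun t v ξ => by
      simp only [map_smul, LinearMap.smul_apply, TensorProduct.tmul_smul, smul_sub])
  rw [koszulDiff_tmul, koszulDiff_tmul]
  exact sum_basis_coord b b' Φ

theorem koszulDiff_koszulAct {I : Type*} [Fintype I] (b : Module.Basis I K V) {f : V →ₗ[K] A}
    (hf : ∀ g v, ρ g (f v) = f (r g v)) (g : G) (z : KoszulSpace K A V) :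
    koszulDiff b f (koszulAct ρ r g z) = koszulAct ρ r g (koszulDiff b f z) := by
  have h1 : r g⁻¹ ∘ₗ r g = LinearMap.id := by
    rw [← Module.End.mul_eq_comp, ← map_mul, inv_mul_cancel, map_one]; rfl
  have h2 : r g ∘ₗ r g⁻¹ = LinearMap.id := by
    rw [← Module.End.mul_eq_comp, ← map_mul, mul_inv_cancel, map_one]; rfl
  -- In the translated basis equivariance is termwise, and the differential does not depend on the
  -- basis.
  let b' := b.map (LinearEquiv.ofLinearMap (r g) (r g⁻¹) h2 h1)
  have hc : ∀ i, b'.coord i = b.coord i ∘ₗ r g⁻¹ := fun i => LinearMap.ext fun v => by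
    simp [b']
  have hb : ∀ i, b' i = r g (b i) := fun i => by simp [b']
  refine LinearMap.congr_fun (f := koszulDiff b f ∘ₗ koszulAct ρ r g)
    (g := koszulAct ρ r g ∘ₗ koszulDiff b f) (koszulSpace_hom_ext fun a c x => ?_) z
  rw [LinearMap.comp_apply, LinearMap.comp_apply]
  nth_rewrite 1 [koszulDiff_basis b b']
  simp only [koszulAct_tmul, koszulDiff_tmul, map_sum, map_sub, map_mul, hf, hc, hb,
    map_contr (r g) (r g⁻¹) h1]

/-- The invariants of degree `p` in the Koszul bimodule complex. -/
noncomputable def koszulPart (ρ : G →* (A →ₐ[K] A)) (r : G →* Module.End K V) {B : Subalgebra K A}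
    (hB : ∀ a, a ∈ B ↔ ∀ g, ρ g a = a) (p : ℕ) :
    Submodule (B ⊗[K] Bᵐᵒᵖ) (KoszulSpace K A V) where
  carrier := {z | (∀ g, koszulAct ρ r g z = z) ∧ koszulDeg p z = z}
  zero_mem' := by simp
  add_mem' := fun hy hz => ⟨fun g => by rw [map_add, hy.1, hz.1], by rw [map_add, hy.2, hz.2]⟩
  smul_mem' := fun s z hz =>
    ⟨fun g => (env_smul_comm B (koszulAct ρ r g).toAddMonoidHom (fun β γ a c x => by
      simp only [LinearMap.toAddMonoidHom_coe, koszulAct_tmul, env_smul_tmul, map_mul,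
        (hB _).1 β.2, (hB _).1 γ.2]) s z).trans (congrArg _ (hz.1 g)),
    (env_smul_comm B (koszulDeg p).toAddMonoidHom (fun β γ a c x => by
      simp only [LinearMap.toAddMonoidHom_coe, koszulDeg_tmul, env_smul_tmul]) s z).trans
      (congrArg _ hz.2)⟩

variable {B : Subalgebra K A} {hB : ∀ a, a ∈ B ↔ ∀ g, ρ g a = a}

theorem mem_koszulPart {p : ℕ} {z : KoszulSpace K A V} :
    z ∈ koszulPart ρ r hB p ↔ (∀ g, koszulAct ρ r g z = z) ∧ koszulDeg p z = z := Iff.rfl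

theorem koszulSum_mem [Fintype G] (p : ℕ) (z : KoszulSpace K A V) :
    koszulSum ρ r p z ∈ koszulPart ρ r hB p := by
  rw [mem_koszulPart]
  constructor
  · intro g
    rw [koszulSum_apply, map_sum]
    refine Fintype.sum_equiv (Equiv.mulLeft g) _ _ fun h => ?_
    rw [koszulAct_koszulAct]
    rfl
  · rw [koszulSum_apply, map_sum]
    simp only [← koszulAct_koszulDeg, koszulDeg_koszulDeg]

theorem koszulSum_of_mem [Fintype G] {p : ℕ} {z : KoszulSpace K A V}
    (hz : z ∈ koszulPart ρ r hB p) : koszulSum ρ r p z = (Fintype.card G : K) • z := by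
  rw [koszulSum_apply]
  simp only [hz.1, hz.2, Finset.sum_const, Finset.card_univ, Nat.cast_smul_eq_nsmul]

theorem koszulDiff_koszulSum [Fintype G] {I : Type*} [Fintype I] (b : Module.Basis I K V)
    {f : V →ₗ[K] A} (hf : ∀ g v, ρ g (f v) = f (r g v)) (p : ℕ) (z : KoszulSpace K A V) :
    koszulDiff b f (koszulSum ρ r (p + 1) z) = koszulSum ρ r p (koszulDiff b f z) := by
  rw [koszulSum_apply, koszulSum_apply, map_sum]
  simp only [koszulDiff_koszulAct b hf, koszulDeg_koszulDiff]

theorem koszulDiff_mem {I : Type*} [Fintype I] (b : Module.Basis I K V)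
    {f : V →ₗ[K] A} (hf : ∀ g v, ρ g (f v) = f (r g v)) (p : ℕ) {z : KoszulSpace K A V}
    (hz : z ∈ koszulPart ρ r hB (p + 1)) : koszulDiff b f z ∈ koszulPart ρ r hB p :=
  ⟨fun g => by rw [← koszulDiff_koszulAct b hf, hz.1], by rw [koszulDeg_koszulDiff, hz.2]⟩

end Resolution

/-! ### Bimodule maps to the invariants as forms on the Koszul space. -/

section BimoduleForms

variable {K A V G : Type u} [Field K] [Ring A] [Algebra K A] [AddCommGroup V] [Module K V]
  [Group G] {ρ : G →* (A →ₐ[K] A)} {r : G →* Module.End K V} {B : Subalgebra K A}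

/-- The inclusion of a subalgebra, as a map on its regular bimodule. -/
def bimoduleVal (B : Subalgebra K A) : selfBimodule K B →+ A := B.val.toAddMonoidHom

theorem bimoduleVal_injective : Function.Injective (bimoduleVal B) := Subtype.val_injective

theorem bimoduleVal_smul (β γ : B) (x : selfBimodule K B) :
    bimoduleVal B ((β ⊗ₜ[K] MulOpposite.op γ : B ⊗[K] Bᵐᵒᵖ) • x) =
      β * (bimoduleVal B x * γ) := rfl

theorem bimoduleVal_algebraMap_smul (t : K) (x : selfBimodule K B) :
    bimoduleVal B (algebraMap K (B ⊗[K] Bᵐᵒᵖ) t • x) = t • bimoduleVal B x := by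
  rw [Algebra.TensorProduct.algebraMap_apply]
  refine (bimoduleVal_smul _ 1 x).trans ?_
  rw [OneMemClass.coe_one, mul_one, Algebra.smul_def]
  rfl

theorem IsBimoduleForm.orbitSum [Fintype G] {F : KoszulSpace K A V →ₗ[K] A}
    (hl : ∀ β, (∀ g, ρ g β = β) → ∀ a (y : A ⊗[K] ExteriorAlgebra K V),
      F ((β * a) ⊗ₜ y) = β * F (a ⊗ₜ y))
    (hr : ∀ β, (∀ g, ρ g β = β) → ∀ a c (x : ExteriorAlgebra K V),
      F (a ⊗ₜ ((c * β) ⊗ₜ x)) = F (a ⊗ₜ (c ⊗ₜ x)) * β) :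
    IsBimoduleForm ρ (orbitSum ρ ∘ₗ F) where
  left β hβ a y := by
    rw [LinearMap.comp_apply, LinearMap.comp_apply, hl β hβ, orbitSum_apply, orbitSum_apply,
      Finset.mul_sum]
    simp only [map_mul, hβ]
  right β hβ a c x := by
    rw [LinearMap.comp_apply, LinearMap.comp_apply, hr β hβ, orbitSum_apply, orbitSum_apply,
      Finset.sum_mul]
    simp only [map_mul, hβ]
  value g z := map_orbitSum ρ g _

theorem IsBimoduleForm.smul {F : KoszulSpace K A V →ₗ[K] A} (hF : IsBimoduleForm ρ F) (t : K) :
    IsBimoduleForm ρ (t • F) where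
  left β hβ a y := by simp only [LinearMap.smul_apply, hF.left β hβ, mul_smul_comm]
  right β hβ a c x := by simp only [LinearMap.smul_apply, hF.right β hβ, smul_mul_assoc]
  value g z := by rw [LinearMap.smul_apply, map_smul, hF.value]

variable (hB : ∀ a, a ∈ B ↔ ∀ g, ρ g a = a)

/-- The bimodule map given by a bimodule form. -/
def formHom {F : KoszulSpace K A V →ₗ[K] A} (hF : IsBimoduleForm ρ F) :
    KoszulSpace K A V →ₗ[B ⊗[K] Bᵐᵒᵖ] selfBimodule K B where
  toFun z := (⟨F z, (hB _).2 fun g => hF.value g z⟩ : B)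
  map_add' y z := Subtype.ext (map_add F y z)
  map_smul' s z := env_smul_comm B (M := selfBimodule K B)
    { toFun := fun z => (⟨F z, (hB _).2 fun g => hF.value g z⟩ : B)
      map_zero' := Subtype.ext (map_zero F)
      map_add' := fun y z => Subtype.ext (map_add F y z) }
    (fun β γ a c x => bimoduleVal_injective (by
      rw [bimoduleVal_smul]
      change F _ = _ * (F _ * _)
      rw [hF.left β ((hB _).1 β.2), hF.right γ ((hB _).1 γ.2)])) s z

/-- The morphism given by a bimodule form. -/
noncomputable def ofForm (r : G →* Module.End K V) {F : KoszulSpace K A V →ₗ[K] A}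
    (hF : IsBimoduleForm ρ F) (p : ℕ) :
    ModuleCat.of (B ⊗[K] Bᵐᵒᵖ) (koszulPart ρ r hB p) ⟶ selfBimodule K B :=
  ModuleCat.ofHom (Y := (selfBimodule K B : Type u)) (formHom hB hF ∘ₗ (koszulPart ρ r hB p).subtype)

variable {hB}

theorem hom_ext_bimoduleVal {p : ℕ}
    {F F' : ModuleCat.of (B ⊗[K] Bᵐᵒᵖ) (koszulPart ρ r hB p) ⟶ selfBimodule K B}
    (h : ∀ z : koszulPart ρ r hB p, bimoduleVal B (F.hom z) = bimoduleVal B (F'.hom z)) :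
    F = F' :=
  ModuleCat.hom_ext (LinearMap.ext fun z => bimoduleVal_injective (h z))

theorem bimoduleVal_smul_hom {p : ℕ} (t : K)
    (F : ModuleCat.of (B ⊗[K] Bᵐᵒᵖ) (koszulPart ρ r hB p) ⟶ selfBimodule K B)
    (z : koszulPart ρ r hB p) :
    bimoduleVal B ((t • F).hom z) = t • bimoduleVal B (F.hom z) :=
  bimoduleVal_algebraMap_smul t (F.hom z)

variable [Fintype G]

/-- The form given by a morphism. -/
noncomputable def formOf {p : ℕ}
    (F : ModuleCat.of (B ⊗[K] Bᵐᵒᵖ) (koszulPart ρ r hB p) ⟶ selfBimodule K B) :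
    KoszulSpace K A V →ₗ[K] A where
  toFun z := bimoduleVal B (F.hom (⟨koszulSum ρ r p z, koszulSum_mem p z⟩ : koszulPart ρ r hB p))
  map_add' y z := by
    rw [← map_add, ← map_add]
    congr 2
    exact Subtype.ext (map_add _ _ _)
  map_smul' t z := by
    rw [RingHom.id_apply, ← bimoduleVal_algebraMap_smul, ← map_smul]
    congr 2
    refine Subtype.ext ?_
    exact (map_smul _ t z).trans (env_algebraMap_smul B t _).symm

theorem formOf_apply {p : ℕ}
    (F : ModuleCat.of (B ⊗[K] Bᵐᵒᵖ) (koszulPart ρ r hB p) ⟶ selfBimodule K B)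
    (z : KoszulSpace K A V) : formOf F z =
      bimoduleVal B (F.hom (⟨koszulSum ρ r p z, koszulSum_mem p z⟩ : koszulPart ρ r hB p)) := rfl

/-- `formOf` precomposes with the sum over the group, not the mean, hence the factor. It is balanced
by the inverses of `Fintype.card G` in `classForm` and in `exists_eq_classMap`. -/
theorem formOf_of_mem {p : ℕ}
    (F : ModuleCat.of (B ⊗[K] Bᵐᵒᵖ) (koszulPart ρ r hB p) ⟶ selfBimodule K B)
    (z : koszulPart ρ r hB p) :
    formOf F z = (Fintype.card G : K) • bimoduleVal B (F.hom z) := by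
  rw [formOf_apply, ← bimoduleVal_algebraMap_smul, ← map_smul]
  congr 2
  exact Subtype.ext ((koszulSum_of_mem z.2).trans (env_algebraMap_smul B _ _).symm)

theorem koszulSum_smul (p : ℕ) (hB : ∀ a, a ∈ B ↔ ∀ g, ρ g a = a) (s : B ⊗[K] Bᵐᵒᵖ)
    (z : KoszulSpace K A V) :
    koszulSum ρ r p (s • z) = s • koszulSum ρ r p z :=
  env_smul_comm B (koszulSum ρ r p).toAddMonoidHom (fun β γ a c x => by
    simp only [LinearMap.toAddMonoidHom_coe, koszulSum_apply, koszulAct_tmul, koszulDeg_tmul,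
      Finset.smul_sum, env_smul_tmul, map_mul, (hB _).1 β.2, (hB _).1 γ.2]) s z

theorem formOf_smul {p : ℕ}
    (F : ModuleCat.of (B ⊗[K] Bᵐᵒᵖ) (koszulPart ρ r hB p) ⟶ selfBimodule K B) (β γ : B)
    (z : KoszulSpace K A V) :
    formOf F ((β ⊗ₜ[K] MulOpposite.op γ : B ⊗[K] Bᵐᵒᵖ) • z) = β * (formOf F z * γ) := by
  rw [formOf_apply, formOf_apply, ← bimoduleVal_smul, ← map_smul]
  congr 2
  exact Subtype.ext (koszulSum_smul p hB _ z)

theorem isInvariantForm_formOf {p : ℕ}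
    (F : ModuleCat.of (B ⊗[K] Bᵐᵒᵖ) (koszulPart ρ r hB p) ⟶ selfBimodule K B) :
    IsInvariantForm ρ r (formOf F) where
  left β hβ a y := by
    have h := formOf_smul F ⟨β, (hB β).2 hβ⟩ 1
    induction y using TensorProduct.induction_on with
    | zero => simp
    | add y z hy hz => simp only [TensorProduct.tmul_add, map_add, hy, hz, mul_add]
    | tmul c x =>
      have h' := h (a ⊗ₜ (c ⊗ₜ x))
      rw [env_smul_tmul] at h'
      simpa using h'
  right β hβ a c x := by
    have h := formOf_smul F 1 ⟨β, (hB β).2 hβ⟩ (a ⊗ₜ (c ⊗ₜ x))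
    rw [env_smul_tmul] at h
    simpa using h
  value g z := (hB _).1 (Subtype.property (p := fun a => a ∈ B) (F.hom _)) g
  act g z := by
    rw [formOf_apply, formOf_apply]
    congr 3
    simp only [koszulSum_apply, ← koszulAct_koszulDeg, koszulAct_koszulAct]
    exact Fintype.sum_equiv (Equiv.mulRight g) _ _ fun h => rfl

end BimoduleForms

/-! ### Projectivity from the Galois property. -/

section ProjectiveTerms

variable {K A V G : Type u} [Field K] [Ring A] [Algebra K A] [AddCommGroup V] [Module K V]
  [Group G] {ρ : G →* (A →ₐ[K] A)} {r : G →* Module.End K V} {B : Subalgebra K A}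
  (hB : ∀ a, a ∈ B ↔ ∀ g, ρ g a = a) [Fintype G] {ι : Type*} [Fintype ι] {a b : ι → A}

/-- The sum over the orbit, as a map to the invariants. -/
noncomputable def invariantSum : A →ₗ[K] B :=
  (orbitSum ρ).codRestrict (Subalgebra.toSubmodule B) fun x => (hB _).2 fun g => map_orbitSum ρ g x

theorem coe_invariantSum (x : A) : (invariantSum hB x : A) = orbitSum ρ x := rfl

theorem invariantSum_mul_left (β : B) (x : A) :
    invariantSum hB (β * x) = β * invariantSum hB x := by
  refine Subtype.ext ?_
  rw [coe_invariantSum, MulMemClass.coe_mul, coe_invariantSum, orbitSum_apply, orbitSum_apply,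
    Finset.mul_sum]
  simp only [map_mul, (hB _).1 β.2]

theorem invariantSum_mul_right (β : B) (x : A) :
    invariantSum hB (x * β) = invariantSum hB x * β := by
  refine Subtype.ext ?_
  rw [coe_invariantSum, MulMemClass.coe_mul, coe_invariantSum, orbitSum_apply, orbitSum_apply,
    Finset.sum_mul]
  simp only [map_mul, (hB _).1 β.2]

/-- The coordinate functions of the Koszul bimodule complex over the invariants. -/
noncomputable def koszulCoord (u v : A) (ξ : Module.Dual K (ExteriorAlgebra K V)) :
    KoszulSpace K A V →ₗ[B ⊗[K] Bᵐᵒᵖ] B ⊗[K] Bᵐᵒᵖ :=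
  envLinear B (TensorProduct.map (invariantSum hB ∘ₗ LinearMap.mulRight K u)
    ((MulOpposite.opLinearEquiv K).toLinearMap ∘ₗ invariantSum hB ∘ₗ LinearMap.mulLeft K v ∘ₗ
      (TensorProduct.rid K A).toLinearMap ∘ₗ TensorProduct.map LinearMap.id ξ))
    fun β γ a c x => by
      simp only [TensorProduct.map_tmul, LinearMap.comp_apply, LinearMap.mulRight_apply,
        LinearMap.id_apply, LinearEquiv.coe_coe, TensorProduct.rid_tmul, LinearMap.mulLeft_apply,
        MulOpposite.coe_opLinearEquiv, smul_eq_mul, Algebra.TensorProduct.tmul_mul_tmul,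
        ← MulOpposite.op_mul, ← invariantSum_mul_left, ← invariantSum_mul_right, mul_assoc,
        smul_mul_assoc, mul_smul_comm]

theorem koszulCoord_tmul (u v : A) (ξ : Module.Dual K (ExteriorAlgebra K V)) (a c : A)
    (x : ExteriorAlgebra K V) : koszulCoord hB u v ξ (a ⊗ₜ (c ⊗ₜ x)) =
      invariantSum hB (a * u) ⊗ₜ[K] MulOpposite.op (invariantSum hB (v * ξ x • c)) := rfl

-- The Galois pair gives finite dual bases for both copies of `A`, one on each side. With a basis of
-- the exterior algebra they split a map from a finite free module over the enveloping algebra.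
include hB in
theorem IsGaloisPair.projective_koszulSpace [Module.Finite K (ExteriorAlgebra K V)]
    (hab : IsGaloisPair ρ a b) : Module.Projective (B ⊗[K] Bᵐᵒᵖ) (KoszulSpace K A V) := by
  classical
  let e := Module.finBasis K (ExteriorAlgebra K V)
  let i : KoszulSpace K A V →ₗ[B ⊗[K] Bᵐᵒᵖ]
      (ι × ι × Fin (Module.finrank K (ExteriorAlgebra K V)) → B ⊗[K] Bᵐᵒᵖ) :=
    LinearMap.pi fun t => koszulCoord hB (a t.1) (b t.2.1) (e.coord t.2.2)
  let s : (ι × ι × Fin (Module.finrank K (ExteriorAlgebra K V)) → B ⊗[K] Bᵐᵒᵖ)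
      →ₗ[B ⊗[K] Bᵐᵒᵖ] KoszulSpace K A V :=
    Fintype.linearCombination (B ⊗[K] Bᵐᵒᵖ) fun t => b t.1 ⊗ₜ (a t.2.1 ⊗ₜ e t.2.2)
  refine Module.Projective.of_split i s (LinearMap.ext fun z => ?_)
  induction z using koszulSpace_induction with
  | h0 => exact map_zero _
  | ha y z hy hz => exact (map_add _ y z).trans (congrArg₂ _ hy hz)
  | ht d c x =>
    have h1 : ∀ t : ι × ι × Fin (Module.finrank K (ExteriorAlgebra K V)),
        koszulCoord hB (a t.1) (b t.2.1) (e.coord t.2.2) (d ⊗ₜ (c ⊗ₜ x)) •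
          (b t.1 ⊗ₜ[K] (a t.2.1 ⊗ₜ[K] e t.2.2)) =
        (orbitSum ρ (d * a t.1) * b t.1) ⊗ₜ[K]
          ((a t.2.1 * orbitSum ρ (b t.2.1 * c)) ⊗ₜ[K] (e.coord t.2.2 x • e t.2.2)) := by
      intro t
      rw [koszulCoord_tmul, env_smul_tmul, coe_invariantSum, coe_invariantSum, mul_smul_comm,
        map_smul, mul_smul_comm, TensorProduct.smul_tmul]
    calc s (i (d ⊗ₜ (c ⊗ₜ x))) = ∑ t : ι × ι × Fin (Module.finrank K (ExteriorAlgebra K V)),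
        koszulCoord hB (a t.1) (b t.2.1) (e.coord t.2.2) (d ⊗ₜ (c ⊗ₜ x)) •
          (b t.1 ⊗ₜ[K] (a t.2.1 ⊗ₜ[K] e t.2.2)) := rfl
      _ = d ⊗ₜ (c ⊗ₜ x) := by
        simp only [h1, Fintype.sum_prod_type, ← TensorProduct.tmul_sum, Module.Basis.coord_apply,
          e.sum_repr, ← TensorProduct.sum_tmul, hab.sum_mul_orbitSum, hab.sum_orbitSum_mul]

-- Averaging over the group followed by projection to one degree is linear over the enveloping
-- algebra, so the invariants are a direct summand of a projective module.
include hB in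
theorem IsGaloisPair.projective_koszulPart [CharZero K] [Module.Finite K (ExteriorAlgebra K V)]
    (hab : IsGaloisPair ρ a b) (p : ℕ) :
    Module.Projective (B ⊗[K] Bᵐᵒᵖ) (koszulPart ρ r hB p) := by
  have := hab.projective_koszulSpace (V := V) hB
  have hG : (Fintype.card G : K) ≠ 0 := by exact_mod_cast Fintype.card_ne_zero
  let s : KoszulSpace K A V →ₗ[B ⊗[K] Bᵐᵒᵖ] koszulPart ρ r hB p :=
    { toFun := fun z => ⟨koszulSum ρ r p ((Fintype.card G : K)⁻¹ • z), koszulSum_mem p _⟩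
      map_add' := fun y z => Subtype.ext (by
        change koszulSum ρ r p ((Fintype.card G : K)⁻¹ • (y + z)) =
          koszulSum ρ r p ((Fintype.card G : K)⁻¹ • y) + koszulSum ρ r p ((Fintype.card G : K)⁻¹ • z)
        rw [smul_add, map_add])
      map_smul' := fun t z => Subtype.ext (by
        change koszulSum ρ r p ((Fintype.card G : K)⁻¹ • t • z) =
          t • koszulSum ρ r p ((Fintype.card G : K)⁻¹ • z)
        rw [← koszulSum_smul p hB, ← env_algebraMap_smul B, ← env_algebraMap_smul B, smul_smul,
          smul_smul, Algebra.commutes]) }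
  refine Module.Projective.of_split (koszulPart ρ r hB p).subtype s (LinearMap.ext fun z =>
    Subtype.ext ?_)
  change koszulSum ρ r p ((Fintype.card G : K)⁻¹ • (z : KoszulSpace K A V)) = z
  rw [map_smul, koszulSum_of_mem z.2, smul_smul, inv_mul_cancel₀ hG, one_smul]

end ProjectiveTerms

/-- Each exterior power is finite, and those above the dimension vanish. -/
theorem finite_exteriorAlgebra (K V : Type*) [Field K] [AddCommGroup V] [Module K V]
    [FiniteDimensional K V] : Module.Finite K (ExteriorAlgebra K V) := by
  have h0 : ∀ p, Module.finrank K V < p → ⋀[K]^p V = ⊥ := fun p hp =>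
    Submodule.finrank_eq_zero.1 (by rw [exteriorPower.finrank_eq, Nat.choose_eq_zero_of_lt hp])
  refine Module.finite_def.2 ?_
  have h1 : (⊤ : Submodule K (ExteriorAlgebra K V)) =
      ⨆ p ∈ Finset.range (Module.finrank K V + 1), ⋀[K]^p V := by
    refine le_antisymm (fun x _ => ?_) le_top
    induction x using homogeneous_induction with
    | h0 => exact Submodule.zero_mem _
    | ha x y hx hy => exact Submodule.add_mem _ (hx trivial) (hy trivial)
    | hh p x hx =>
      by_cases hp : p < Module.finrank K V + 1
      · exact Submodule.mem_iSup_of_mem p (Submodule.mem_iSup_of_mem (Finset.mem_range.2 hp) hx)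
      · rw [h0 p (by omega)] at hx
        rw [(Submodule.mem_bot K).1 hx]
        exact Submodule.zero_mem _
  rw [h1]
  exact Submodule.fg_biSup _ _ fun p _ => (Module.Finite.iff_fg).1 inferInstance

/-! ### The resolution of the algebra of invariants. -/

section KoszulResolution

open Limits

variable {K A V G : Type u} [Field K] [Ring A] [Algebra K A] [AddCommGroup V] [Module K V]
  [Group G] {ρ : G →* (A →ₐ[K] A)} {r : G →* Module.End K V} {B : Subalgebra K A}
  {ω : V →ₗ[K] V →ₗ[K] K} {f : V →ₗ[K] A}

theorem IsSymplecticAction.exists_dual [FiniteDimensional K V] (h : IsSymplecticAction ω f r ρ)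
    {I : Type*} [DecidableEq I] [Fintype I] (b : Module.Basis I K V) :
    ∃ s : I → V, (∀ i j, ω (s j) (b i) = if i = j then 1 else 0) ∧
      ∀ w, ∑ i, ω (s i) w • b i = w := by
  have hinj : Function.Injective ω := by
    rw [← LinearMap.ker_eq_bot, LinearMap.ker_eq_bot']
    intro v hv
    by_contra hne
    obtain ⟨u, hu⟩ := h.nondeg v hne
    rw [h.skew, hv, LinearMap.zero_apply, neg_zero] at hu
    exact zero_ne_one hu
  have hsurj : Function.Surjective ω :=
    (LinearMap.injective_iff_surjective_of_finrank_eq_finrank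
      (Subspace.dual_finrank_eq (K := K) (V := V)).symm).1 hinj
  choose s hs using fun i => hsurj (b.coord i)
  refine ⟨s, fun i j => ?_, fun w => ?_⟩
  · rw [hs, Module.Basis.coord_apply, b.repr_self, Finsupp.single_apply]
  · simp only [hs, Module.Basis.coord_apply, b.sum_repr]

/-- The differential of the equivariant Koszul resolution. -/
noncomputable def partDiff (h : IsSymplecticAction ω f r ρ) (hB : ∀ a, a ∈ B ↔ ∀ g, ρ g a = a)
    {I : Type*} [Fintype I] (b : Module.Basis I K V) (p : ℕ) :
    ModuleCat.of (B ⊗[K] Bᵐᵒᵖ) (koszulPart ρ r hB (p + 1)) ⟶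
      ModuleCat.of (B ⊗[K] Bᵐᵒᵖ) (koszulPart ρ r hB p) :=
  ModuleCat.ofHom ((envDiff B b f).restrict fun _ hz => koszulDiff_mem b h.map_gen p hz)

variable (h : IsSymplecticAction ω f r ρ) (hB : ∀ a, a ∈ B ↔ ∀ g, ρ g a = a)
  {I : Type*} [Fintype I] (b : Module.Basis I K V)

variable [Fintype G]

/-- The normalised invariant augmentation. -/
noncomputable def invariantAug (ρ : G →* (A →ₐ[K] A)) (V : Type u) [AddCommGroup V] [Module K V] :
    KoszulSpace K A V →ₗ[K] A :=
  (Fintype.card G : K)⁻¹ • (orbitSum ρ ∘ₗ koszulAug K A V)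

theorem isBimoduleForm_invariantAug : IsBimoduleForm ρ (invariantAug ρ V) := by
  refine IsBimoduleForm.smul (IsBimoduleForm.orbitSum (fun β _ a y => ?_) fun β _ a c x => ?_) _
  · induction y using TensorProduct.induction_on with
    | zero => simp
    | add y z hy hz => simp only [TensorProduct.tmul_add, map_add, hy, hz, mul_add]
    | tmul c x => simp only [koszulAug_tmul, mul_assoc, mul_smul_comm]
  · simp only [koszulAug_tmul, ← mul_assoc, smul_mul_assoc]

variable [CharZero K]

theorem invariantAug_of_fixed {z : KoszulSpace K A V} (hz : ∀ g, koszulAct ρ r g z = z) :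
    invariantAug ρ V z = koszulAug K A V z := by
  have hG : (Fintype.card G : K) ≠ 0 := by exact_mod_cast Fintype.card_ne_zero
  rw [invariantAug, LinearMap.smul_apply, LinearMap.comp_apply, orbitSum_apply]
  simp only [← koszulAug_koszulAct (r := r), hz, Finset.sum_const, Finset.card_univ]
  rw [← Nat.cast_smul_eq_nsmul K, smul_smul, inv_mul_cancel₀ hG, one_smul]

variable [FiniteDimensional K V]

-- Taking invariants is exact in characteristic zero: a preimage in the full complex is replaced by
-- the mean of its translates in the right degree.
include h in
theorem exists_koszulDiff_eq_of_mem (p : ℕ) {z : KoszulSpace K A V}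
    (hz : z ∈ koszulPart ρ r hB p) (hd : koszulDiff b f z = 0) (ha : koszulAug K A V z = 0) :
    ∃ y ∈ koszulPart ρ r hB (p + 1), koszulDiff b f y = z := by
  classical
  have hG : (Fintype.card G : K) ≠ 0 := by exact_mod_cast Fintype.card_ne_zero
  obtain ⟨s, hs, hs'⟩ := h.exists_dual b
  obtain ⟨y, rfl⟩ := h.heis.exists_koszulDiff_eq hs hs' z hd ha
  refine ⟨koszulSum ρ r (p + 1) ((Fintype.card G : K)⁻¹ • y), koszulSum_mem _ _, ?_⟩
  rw [koszulDiff_koszulSum b h.map_gen, map_smul, map_smul, koszulSum_of_mem hz, smul_smul,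
    inv_mul_cancel₀ hG, one_smul]

/-- The equivariant Koszul resolution of the algebra of invariants. -/
noncomputable def koszulResolution : AugmentedResolution (selfBimodule K B) where
  proj p := ModuleCat.of (B ⊗[K] Bᵐᵒᵖ) (koszulPart ρ r hB p)
  diff := partDiff h hB b
  aug := ofForm hB r isBimoduleForm_invariantAug 0
  diff_aug := hom_ext_bimoduleVal fun z => by
    refine (invariantAug_of_fixed (koszulDiff_mem b h.map_gen 0 z.2).1).trans ?_
    exact koszulAug_koszulDiff b f _
  diff_diff p := by
    refine ModuleCat.hom_ext (LinearMap.ext fun z => Subtype.ext ?_)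
    exact h.heis.koszulDiff_koszulDiff _
  epi_aug := by
    rw [ModuleCat.epi_iff_surjective]
    intro x
    have hG : (Fintype.card G : K) ≠ 0 := by exact_mod_cast Fintype.card_ne_zero
    -- The tensor `x ⊗ 1 ⊗ 1` has augmentation `x`, and averaging keeps this value because `x` is
    -- invariant.
    refine ⟨(⟨koszulSum ρ r 0 ((Fintype.card G : K)⁻¹ • (bimoduleVal B x ⊗ₜ (1 ⊗ₜ 1))),
      koszulSum_mem 0 _⟩ : koszulPart ρ r hB 0), bimoduleVal_injective ?_⟩
    refine (invariantAug_of_fixed (koszulSum_mem (hB := hB) 0 _).1).trans ?_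
    have hx : ∀ g, ρ g (bimoduleVal B x) = bimoduleVal B x :=
      (hB _).1 (Subtype.property (p := fun a => a ∈ B) x)
    rw [map_smul, map_smul, koszulSum_apply, map_sum]
    simp only [koszulAug_koszulAct, koszulAug_koszulDeg_zero, koszulAug_tmul, map_one, one_smul,
      mul_one, hx, Finset.sum_const, Finset.card_univ]
    rw [← Nat.cast_smul_eq_nsmul K, smul_smul, inv_mul_cancel₀ hG, one_smul]
  exact_aug := by
    rw [ShortComplex.moduleCat_exact_iff]
    intro z hz
    have hz2 : (z : koszulPart ρ r hB 0).1 ∈ koszulPart ρ r hB 0 := Subtype.property _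
    have hz' : koszulAug K A V (z : koszulPart ρ r hB 0).1 = 0 :=
      (invariantAug_of_fixed hz2.1).symm.trans (congrArg (bimoduleVal B) hz)
    obtain ⟨y, hy, e⟩ := exists_koszulDiff_eq_of_mem h hB b 0 hz2
      (by rw [← hz2.2, koszulDiff_koszulDeg_zero]) hz'
    exact ⟨(⟨y, hy⟩ : koszulPart ρ r hB 1), Subtype.ext e⟩
  exact_diff p := by
    rw [ShortComplex.moduleCat_exact_iff]
    intro z hz
    have hz2 : (z : koszulPart ρ r hB (p + 1)).1 ∈ koszulPart ρ r hB (p + 1) := Subtype.property _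
    obtain ⟨y, hy, e⟩ := exists_koszulDiff_eq_of_mem h hB b (p + 1) hz2
      (congrArg (fun x : koszulPart ρ r hB p => (x : KoszulSpace K A V)) hz)
      (by rw [← hz2.2, koszulAug_koszulDeg_succ])
    exact ⟨(⟨y, hy⟩ : koszulPart ρ r hB (p + 2)), Subtype.ext e⟩
  projective p := by
    have := finite_exteriorAlgebra K V
    obtain ⟨s, a, b, hab⟩ := h.exists_isGaloisPair
    exact (IsProjective.iff_projective _).1 (hab.projective_koszulPart hB p)

end KoszulResolution

/-! ### Cocycles from class functions -/

/-- The part of a function supported in degree `p`. -/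
def degreePart {K G : Type*} [Field K] (d : G → ℕ) (p : ℕ) : (G → K) →ₗ[K] (G → K) where
  toFun z g := if d g = p then z g else 0
  map_add' y z := by
    funext g
    by_cases h : d g = p <;> simp [h]
  map_smul' t z := by
    funext g
    by_cases h : d g = p <;> simp [h]

theorem degreePart_apply {K G : Type*} [Field K] (d : G → ℕ) (p : ℕ) (z : G → K) (g : G) :
    degreePart d p z g = if d g = p then z g else 0 := rfl

/-- The conjugate of a function on the group. -/
def conjFun {K G : Type*} [Group G] (h : G) (z : G → K) : G → K := fun g => z (h⁻¹ * g * h)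

theorem sum_conjFun {K G M : Type*} [Group G] [Fintype G] [AddCommMonoid M] (h : G) (z : G → K)
    (Φ : K → G → M) : ∑ g, Φ (conjFun h z g) g = ∑ g, Φ (z g) (h * g * h⁻¹) :=
  (Fintype.sum_equiv (MulAut.conj h).toEquiv _ _ fun g => by
    change _ = Φ (conjFun h z (h * g * h⁻¹)) (h * g * h⁻¹)
    simp [conjFun, mul_assoc]).symm

/-! ### Chain maps from a compatible family of top forms. -/

section TwistedVolume

variable {K A V G : Type u} [Field K] [Ring A] [Algebra K A] [AddCommGroup V] [Module K V]
  [Group G]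

/-- A compatible family of top forms along the images of `1 - g`. -/
structure IsTwistedVolume (ω : V →ₗ[K] V →ₗ[K] K) (r : G →* Module.End K V) (d : G → ℕ)
    (α : G → ExteriorAlgebra K V) : Prop where
  even : ∀ g, Even (d g)
  map : ∀ h g, ExteriorAlgebra.map (r h) (α g) = α (h * g * h⁻¹)
  mul_eq : ∀ g h, d (g * h) = d g + d h → α g * α h = α (g * h)
  mul_eq_zero : ∀ g h, d (g * h) ≠ d g + d h → α g * α h = 0
  deg_one : d 1 = 0
  one : α 1 = 1
  adapted : ∀ g, ∃ (I : Type) (_ : Fintype I) (_ : DecidableEq I) (b : Module.Basis I K V)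
    (l : List I) (s : I → V), l.length = d g ∧ AdaptedBasis ω (r g) b l.toFinset s ∧
      IsTopForm ω b l (α g)

variable {ω : V →ₗ[K] V →ₗ[K] K} {f : V →ₗ[K] A} {r : G →* Module.End K V}
  {ρ : G →* (A →ₐ[K] A)} {d : G → ℕ} {α : G → ExteriorAlgebra K V}

theorem IsTwistedVolume.mem (hα : IsTwistedVolume ω r d α) (g : G) : α g ∈ ⋀[K]^(d g) V := by
  obtain ⟨I, _, _, b, l, s, hl, -, h⟩ := hα.adapted g
  rw [← hl]
  exact h.mem

/-- The form of the conjugate is a translate of `α g`, so it has degree `d g`; being a top form, it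
is also nonzero in its own degree. -/
theorem IsTwistedVolume.deg_conj (hα : IsTwistedVolume ω r d α) (g h : G) :
    d (h * g * h⁻¹) = d g := by
  have h1 := map_mem_exteriorPower (r h) (hα.mem g)
  rw [hα.map] at h1
  by_contra hne
  have h2 : α (h * g * h⁻¹) = 0 := by
    rw [← degProj_of_mem (hα.mem (h * g * h⁻¹)), degProj_of_mem_ne h1 (Ne.symm hne)]
  obtain ⟨I, _, _, b, l, s, hl, -, h⟩ := hα.adapted (h * g * h⁻¹)
  have h3 := h.scalarCochain_ne (A := K)
  rw [h2, scalarCochain_apply, map_zero, LinearMap.zero_apply, map_zero, map_zero] at h3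
  exact h3 rfl

/-- The elementary chain map given by a group element. -/
noncomputable def twistTerm (ρ : G →* (A →ₐ[K] A)) (ω : V →ₗ[K] V →ₗ[K] K)
    (α : G → ExteriorAlgebra K V) (g : G) : Module.End K (KoszulSpace K A V) :=
  TensorProduct.map LinearMap.id (TensorProduct.map (ρ g).toLinearMap (ctr ω (α g)))

theorem twistTerm_tmul (g : G) (a c : A) (x : ExteriorAlgebra K V) :
    twistTerm ρ ω α g (a ⊗ₜ (c ⊗ₜ x)) = a ⊗ₜ (ρ g c ⊗ₜ ctr ω (α g) x) := rfl

theorem IsTwistedVolume.contr_ctr (hα : IsTwistedVolume ω r d α) (g : G) (ξ : Module.Dual K V)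
    (x : ExteriorAlgebra K V) : contr ξ (ctr ω (α g) x) = ctr ω (α g) (contr ξ x) := by
  rw [_root_.contr_ctr ω ξ (hα.mem g), (hα.even g).neg_one_pow, one_smul]

/-- The two sides differ only by `f (g (b i))` in place of `f (b i)` in the second factor. In an
adapted basis the fixed `b i` cause no difference. For the moved ones the term is zero, because `α
g` already contracts along `b i`. Even degree removes the sign. -/
theorem IsTwistedVolume.koszulDiff_twistTerm (hα : IsTwistedVolume ω r d α)
    (hf : ∀ g v, ρ g (f v) = f (r g v)) {I : Type*} [Fintype I] (b : Module.Basis I K V) (g : G)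
    (z : KoszulSpace K A V) :
    koszulDiff b f (twistTerm ρ ω α g z) = twistTerm ρ ω α g (koszulDiff b f z) := by
  obtain ⟨I', _, _, b', l, s, -, hb, ht⟩ := hα.adapted g
  rw [koszulDiff_basis b b']
  refine LinearMap.congr_fun (f := koszulDiff b' f ∘ₗ twistTerm ρ ω α g)
    (g := twistTerm ρ ω α g ∘ₗ koszulDiff b' f) (koszulSpace_hom_ext fun a c x => ?_) z
  simp only [LinearMap.comp_apply, twistTerm_tmul, koszulDiff_tmul, map_sum, map_sub, map_mul, hf,
    hα.contr_ctr]
  refine Finset.sum_congr rfl fun i _ => ?_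
  by_cases hi : i ∈ l
  · obtain ⟨w, hw, c', -, e⟩ := ht.exists_eq
    have h0 : ctr ω (α g) (contr (b'.coord i) x) = 0 := by
      rw [← hα.contr_ctr, ← hw i hi, ← ctr_ι_mul, e, mul_smul_comm,
        ι_mul_prod_of_mem w (by simpa using hi), smul_zero, map_zero, LinearMap.zero_apply]
    rw [h0]
    simp
  · rw [hb.fixed i (by simpa using hi)]

theorem map_ctr_of_isometry (hr : ∀ g u v, ω (r g u) (r g v) = ω u v) (h : G)
    (y x : ExteriorAlgebra K V) :
    ExteriorAlgebra.map (r h) (ctr ω y x) =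
      ctr ω (ExteriorAlgebra.map (r h) y) (ExteriorAlgebra.map (r h) x) := by
  refine map_ctr ω (r h) (r h⁻¹) ?_ (fun v => LinearMap.ext fun u => ?_) y x
  · rw [← Module.End.mul_eq_comp, ← map_mul, inv_mul_cancel, map_one]; rfl
  · rw [LinearMap.comp_apply, ← hr h v, ← Module.End.mul_apply, ← map_mul, mul_inv_cancel, map_one,
      Module.End.one_apply]

theorem IsTwistedVolume.koszulAct_twistTerm (hα : IsTwistedVolume ω r d α)
    (hr : ∀ g u v, ω (r g u) (r g v) = ω u v) (h g : G) (z : KoszulSpace K A V) :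
    koszulAct ρ r h (twistTerm ρ ω α g z) =
      twistTerm ρ ω α (h * g * h⁻¹) (koszulAct ρ r h z) := by
  refine LinearMap.congr_fun (f := koszulAct ρ r h ∘ₗ twistTerm ρ ω α g)
    (g := twistTerm ρ ω α (h * g * h⁻¹) ∘ₗ koszulAct ρ r h)
    (koszulSpace_hom_ext fun a c x => ?_) z
  simp only [LinearMap.comp_apply, twistTerm_tmul, koszulAct_tmul, map_ctr_of_isometry hr, hα.map,
    ← AlgHom.mul_apply, ← map_mul, inv_mul_cancel_right]

theorem IsTwistedVolume.koszulDeg_twistTerm (hα : IsTwistedVolume ω r d α) (g : G) (p : ℕ)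
    (z : KoszulSpace K A V) :
    koszulDeg p (twistTerm ρ ω α g z) = twistTerm ρ ω α g (koszulDeg (p + d g) z) := by
  refine LinearMap.congr_fun (f := koszulDeg p ∘ₗ twistTerm ρ ω α g)
    (g := twistTerm ρ ω α g ∘ₗ koszulDeg (p + d g)) (koszulSpace_hom_ext fun a c x => ?_) z
  simp only [LinearMap.comp_apply, twistTerm_tmul, koszulDeg_tmul, degProj_ctr ω (hα.mem g)]

theorem conjFun_degreePart (hα : IsTwistedVolume ω r d α) (h : G) (p : ℕ) (z : G → K) :
    conjFun h (degreePart d p z) = degreePart d p (conjFun h z) := by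
  funext g
  simp only [conjFun, degreePart_apply]
  have := hα.deg_conj g h⁻¹
  rw [inv_inv] at this
  rw [this]

variable [Fintype G]

/-- The chain map given by a function on the group. -/
noncomputable def twistOp (ρ : G →* (A →ₐ[K] A)) (ω : V →ₗ[K] V →ₗ[K] K)
    (α : G → ExteriorAlgebra K V) (z : G → K) : Module.End K (KoszulSpace K A V) :=
  ∑ g, z g • twistTerm ρ ω α g

theorem twistOp_apply (z : G → K) (x : KoszulSpace K A V) :
    twistOp ρ ω α z x = ∑ g, z g • twistTerm ρ ω α g x := by
  simp [twistOp, LinearMap.sum_apply]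

theorem IsTwistedVolume.koszulDiff_twistOp (hα : IsTwistedVolume ω r d α)
    (hf : ∀ g v, ρ g (f v) = f (r g v)) {I : Type*} [Fintype I] (b : Module.Basis I K V)
    (z : G → K) (x : KoszulSpace K A V) :
    koszulDiff b f (twistOp ρ ω α z x) = twistOp ρ ω α z (koszulDiff b f x) := by
  simp only [twistOp_apply, map_sum, map_smul, hα.koszulDiff_twistTerm hf]

theorem IsTwistedVolume.koszulDeg_twistOp (hα : IsTwistedVolume ω r d α) (p q : ℕ) (z : G → K)
    (x : KoszulSpace K A V) : koszulDeg q (twistOp ρ ω α (degreePart d p z) x) =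
      twistOp ρ ω α (degreePart d p z) (koszulDeg (p + q) x) := by
  simp only [twistOp_apply, map_sum, map_smul, degreePart_apply]
  refine Finset.sum_congr rfl fun g _ => ?_
  by_cases h : d g = p
  · rw [hα.koszulDeg_twistTerm, h, add_comm]
  · rw [if_neg h, zero_smul, zero_smul]

theorem IsTwistedVolume.koszulAct_twistOp (hα : IsTwistedVolume ω r d α)
    (hr : ∀ g u v, ω (r g u) (r g v) = ω u v) (h : G) (z : G → K) (x : KoszulSpace K A V) :
    koszulAct ρ r h (twistOp ρ ω α z x) = twistOp ρ ω α (conjFun h z) (koszulAct ρ r h x) := by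
  simp only [twistOp_apply, map_sum, map_smul, hα.koszulAct_twistTerm hr]
  exact (sum_conjFun h z fun t g => t • twistTerm ρ ω α g (koszulAct ρ r h x)).symm

/-- The twisted cochains given by a function on the group. -/
noncomputable def volumeCochain (A : Type*) [Ring A] [Algebra K A] (ω : V →ₗ[K] V →ₗ[K] K)
    (α : G → ExteriorAlgebra K V) (z : G → K) (g : G) : ExteriorAlgebra K V →ₗ[K] A :=
  z g • scalarCochain A ω (α g)

theorem twistedForm_volumeCochain (z : G → K) (x : KoszulSpace K A V) :
    twistedForm ρ (volumeCochain A ω α z) x = koszulAug K A V (twistOp ρ ω α z x) := by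
  refine LinearMap.congr_fun (f := twistedForm ρ (volumeCochain A ω α z))
    (g := koszulAug K A V ∘ₗ twistOp ρ ω α z) (koszulSpace_hom_ext fun a c x => ?_) x
  rw [LinearMap.comp_apply, twistOp_apply, map_sum, twistedForm_tmul]
  refine Finset.sum_congr rfl fun g _ => ?_
  rw [map_smul, twistTerm_tmul, koszulAug_tmul, volumeCochain, LinearMap.smul_apply,
    scalarCochain_apply, smul_mul_assoc, mul_smul_comm, ← Algebra.smul_def, mul_smul_comm]

/-- The convolution product of functions on the group, restricted to one degree. -/
def gradedConv (d : G → ℕ) (p : ℕ) (w z : G → K) : G → K := fun k =>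
  if d k = p then ∑ g, w (k * g⁻¹) * z g else 0

/-- Elementary chain maps multiply like their forms: to the map of the product when lengths add, to
zero otherwise. This is convolution restricted to length `p + q`. -/
theorem IsTwistedVolume.twistOp_twistOp (hα : IsTwistedVolume ω r d α) (p q : ℕ) (w z : G → K)
    (x : KoszulSpace K A V) :
    twistOp ρ ω α (degreePart d q w) (twistOp ρ ω α (degreePart d p z) x) =
      twistOp ρ ω α (gradedConv d (p + q) (degreePart d q w) (degreePart d p z)) x := by
  have h1 : ∀ h g, twistTerm ρ ω α h (twistTerm ρ ω α g x) =
      if d (h * g) = d h + d g then twistTerm ρ ω α (h * g) x else 0 := by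
    intro h g
    refine LinearMap.congr_fun (f := twistTerm ρ ω α h ∘ₗ twistTerm ρ ω α g)
      (g := if d (h * g) = d h + d g then twistTerm ρ ω α (h * g) else 0)
      (koszulSpace_hom_ext fun a c x => ?_) x |>.trans (by split_ifs <;> rfl)
    rw [LinearMap.comp_apply, twistTerm_tmul, twistTerm_tmul, ← AlgHom.mul_apply, ← map_mul,
      ← Module.End.mul_apply, ← map_mul]
    split_ifs with hd
    · rw [hα.mul_eq _ _ hd, twistTerm_tmul]
    · rw [hα.mul_eq_zero _ _ hd]
      simp
  have h2 : ∀ h g, degreePart d p z g • degreePart d q w h •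
        twistTerm ρ ω α h (twistTerm ρ ω α g x) =
      if d (h * g) = p + q then
        (degreePart d q w h * degreePart d p z g) • twistTerm ρ ω α (h * g) x else 0 := by
    intro h g
    rw [smul_smul, mul_comm (degreePart d p z g)]
    by_cases hh : d h = q
    · by_cases hg : d g = p
      · rw [h1, hh, hg, add_comm q p]
        split_ifs <;> simp
      · rw [degreePart_apply d p z g, if_neg hg]
        simp
    · rw [degreePart_apply d q w h, if_neg hh]
      simp
  simp only [twistOp_apply, map_sum, map_smul, Finset.smul_sum, h2]
  have h3 : ∀ g, ∑ h, (if d (h * g) = p + q then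
        (degreePart d q w h * degreePart d p z g) • twistTerm ρ ω α (h * g) x else 0) =
      ∑ k, if d k = p + q then (degreePart d q w (k * g⁻¹) * degreePart d p z g) •
        twistTerm ρ ω α k x else 0 := fun g =>
    Fintype.sum_equiv (Equiv.mulRight g) _ _ fun h => by
      simp only [Equiv.coe_mulRight, mul_inv_cancel_right]
  simp only [h3]
  rw [Finset.sum_comm]
  refine Finset.sum_congr rfl fun k _ => ?_
  rw [gradedConv]
  split_ifs
  · rw [Finset.sum_smul]
  · simp

theorem conjFun_gradedConv (hα : IsTwistedVolume ω r d α) (h : G) (p : ℕ) (w z : G → K) :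
    conjFun h (gradedConv d p w z) = gradedConv d p (conjFun h w) (conjFun h z) := by
  funext k
  have := hα.deg_conj k h⁻¹
  rw [inv_inv] at this
  simp only [conjFun, gradedConv, this]
  congr 1
  refine (Fintype.sum_equiv (MulAut.conj h).toEquiv _ _ fun g => ?_)
  change _ = w (h⁻¹ * (k * (h * g * h⁻¹)⁻¹) * h) * z (h⁻¹ * (h * g * h⁻¹) * h)
  simp [mul_assoc]

end TwistedVolume

/-! ### Invariant forms attached to functions on the group. -/

section ClassMorphisms

variable {K A V G : Type u} [Field K] [Ring A] [Algebra K A] [AddCommGroup V] [Module K V]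
  [Group G] [Fintype G] {ρ : G →* (A →ₐ[K] A)} {r : G →* Module.End K V} {B : Subalgebra K A}
  {ω : V →ₗ[K] V →ₗ[K] K} {f : V →ₗ[K] A} {d : G → ℕ} {α : G → ExteriorAlgebra K V}

/-- The invariant form given by a function on the group in one degree. -/
noncomputable def classForm (ρ : G →* (A →ₐ[K] A)) (ω : V →ₗ[K] V →ₗ[K] K) (d : G → ℕ)
    (α : G → ExteriorAlgebra K V) (p : ℕ) (z : G → K) : KoszulSpace K A V →ₗ[K] A :=
  (Fintype.card G : K)⁻¹ •
    (orbitSum ρ ∘ₗ twistedForm ρ (volumeCochain A ω α (degreePart d p z)))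

theorem isBimoduleForm_orbitSum_twistedForm (φ : G → ExteriorAlgebra K V →ₗ[K] A) :
    IsBimoduleForm ρ (orbitSum ρ ∘ₗ twistedForm ρ φ) :=
  IsBimoduleForm.orbitSum (fun β _ a y => twistedForm_mul_left φ β a y) fun β hβ a c x => by
    simp only [twistedForm_tmul, map_mul, hβ, Finset.sum_mul, mul_assoc]

theorem isBimoduleForm_classForm (p : ℕ) (z : G → K) :
    IsBimoduleForm ρ (classForm ρ ω d α p z) :=
  (isBimoduleForm_orbitSum_twistedForm _).smul _

omit [Group G] [Fintype G] in
theorem volumeCochain_add (w z : G → K) :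
    volumeCochain A ω α (w + z) = volumeCochain A ω α w + volumeCochain A ω α z := by
  funext g
  simp [volumeCochain, add_smul]

omit [Group G] [Fintype G] in
theorem volumeCochain_smul (t : K) (z : G → K) :
    volumeCochain A ω α (t • z) = t • volumeCochain A ω α z := by
  funext g
  simp [volumeCochain, mul_smul]

theorem twistedForm_smul (t : K) (φ : G → ExteriorAlgebra K V →ₗ[K] A) :
    twistedForm ρ (t • φ) = t • twistedForm ρ φ := by
  refine koszulSpace_hom_ext fun a c x => ?_
  rw [LinearMap.smul_apply]
  simp only [twistedForm_tmul, Pi.smul_apply, LinearMap.smul_apply, smul_mul_assoc,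
    mul_smul_comm, Finset.smul_sum]

theorem classForm_add (p : ℕ) (w z : G → K) :
    classForm ρ ω d α p (w + z) = classForm ρ ω d α p w + classForm ρ ω d α p z := by
  rw [classForm, map_add, volumeCochain_add, twistedForm_add, LinearMap.comp_add, smul_add]
  rfl

theorem classForm_smul (p : ℕ) (t : K) (z : G → K) :
    classForm ρ ω d α p (t • z) = t • classForm ρ ω d α p z := by
  rw [classForm, map_smul, volumeCochain_smul, twistedForm_smul, LinearMap.comp_smul, smul_comm]
  rfl

theorem IsTwistedVolume.map_twistedForm (hα : IsTwistedVolume ω r d α)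
    (hr : ∀ g u v, ω (r g u) (r g v) = ω u v) (h : G) (z : G → K) (x : KoszulSpace K A V) :
    ρ h (twistedForm ρ (volumeCochain A ω α z) x) =
      twistedForm ρ (volumeCochain A ω α (conjFun h z)) (koszulAct ρ r h x) := by
  rw [twistedForm_volumeCochain, twistedForm_volumeCochain, ← hα.koszulAct_twistOp hr,
    koszulAug_koszulAct]

/-- Contraction with `α g` followed by the scalar part only sees exterior degree `d g`. -/
theorem IsTwistedVolume.twistedForm_degreePart (hα : IsTwistedVolume ω r d α) (p : ℕ) (z : G → K)
    {x : KoszulSpace K A V} (hx : koszulDeg p x = x) :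
    twistedForm ρ (volumeCochain A ω α (degreePart d p z)) x =
      twistedForm ρ (volumeCochain A ω α z) x := by
  have key : ∀ x : KoszulSpace K A V,
      twistedForm ρ (volumeCochain A ω α (degreePart d p z)) (koszulDeg p x) =
      twistedForm ρ (volumeCochain A ω α z) (koszulDeg p x) := by
    intro x
    refine LinearMap.congr_fun
      (f := twistedForm ρ (volumeCochain A ω α (degreePart d p z)) ∘ₗ koszulDeg p)
      (g := twistedForm ρ (volumeCochain A ω α z) ∘ₗ koszulDeg p)
      (koszulSpace_hom_ext fun a c x => ?_) x
    rw [LinearMap.comp_apply, LinearMap.comp_apply, koszulDeg_tmul, twistedForm_tmul,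
      twistedForm_tmul]
    refine Finset.sum_congr rfl fun g _ => ?_
    by_cases h : d g = p
    · rw [volumeCochain, volumeCochain, degreePart_apply, if_pos h]
    · rw [volumeCochain, volumeCochain, LinearMap.smul_apply, LinearMap.smul_apply,
        scalarCochain_degProj_ne (hα.mem g) (Ne.symm h), smul_zero, smul_zero]
  rw [← hx, key]

variable [CharZero K]

omit [Fintype G] in
theorem card_inv_smul_sum {M : Type*} [AddCommGroup M] [Module K M] [Fintype G] {F : G → M} {m : M}
    (h : ∀ g, F g = m) : (Fintype.card G : K)⁻¹ • ∑ g, F g = m := by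
  have hG : (Fintype.card G : K) ≠ 0 := by exact_mod_cast Fintype.card_ne_zero
  rw [Finset.sum_congr rfl fun g _ => h g, Finset.sum_const, Finset.card_univ,
    ← Nat.cast_smul_eq_nsmul K, smul_smul, inv_mul_cancel₀ hG, one_smul]

/-- For a class function and an invariant argument all terms of the orbit sum agree, and the
normalising factor cancels their number. -/
theorem IsTwistedVolume.classForm_of_class (hα : IsTwistedVolume ω r d α)
    (hr : ∀ g u v, ω (r g u) (r g v) = ω u v) (p : ℕ) {z : G → K} (hz : ∀ h, conjFun h z = z)
    {x : KoszulSpace K A V} (hx : ∀ g, koszulAct ρ r g x = x) :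
    classForm ρ ω d α p z x = koszulAug K A V (twistOp ρ ω α (degreePart d p z) x) := by
  rw [classForm, LinearMap.smul_apply, LinearMap.comp_apply, orbitSum_apply]
  refine card_inv_smul_sum fun h => ?_
  rw [hα.map_twistedForm hr, conjFun_degreePart hα, hz, hx, twistedForm_volumeCochain]

/-- The average of a function on the group over conjugation. -/
noncomputable def averageFun (z : G → K) : G → K :=
  (Fintype.card G : K)⁻¹ • ∑ h : G, conjFun h z

omit [CharZero K] in
theorem conjFun_averageFun (h : G) (z : G → K) : conjFun h (averageFun z) = averageFun z := by
  funext g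
  simp only [conjFun, averageFun, Pi.smul_apply, Finset.sum_apply]
  congr 1
  exact Fintype.sum_equiv (Equiv.mulLeft h) _ _ fun k => by simp [mul_assoc]

/-- Translating the value by `h` conjugates the function by `h`, so on invariant elements only its
mean over conjugation matters. This reduces arbitrary functions to class functions. -/
theorem IsTwistedVolume.orbitSum_twistedForm (hα : IsTwistedVolume ω r d α)
    (hr : ∀ g u v, ω (r g u) (r g v) = ω u v) (p : ℕ) (z : G → K)
    {x : KoszulSpace K A V} (hx : ∀ g, koszulAct ρ r g x = x) (hx' : koszulDeg p x = x) :
    (Fintype.card G : K)⁻¹ • orbitSum ρ (twistedForm ρ (volumeCochain A ω α z) x) =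
      classForm ρ ω d α p (averageFun z) x := by
  rw [hα.classForm_of_class hr p (fun h => conjFun_averageFun h z) hx,
    ← twistedForm_volumeCochain, hα.twistedForm_degreePart p _ hx', averageFun,
    volumeCochain_smul, twistedForm_smul, LinearMap.smul_apply, orbitSum_apply]
  congr 1
  have h1 : ∀ s : Finset G, twistedForm ρ (volumeCochain A ω α (∑ h ∈ s, conjFun h z)) x =
      ∑ h ∈ s, twistedForm ρ (volumeCochain A ω α (conjFun h z)) x := by
    classical
    intro s
    induction s using Finset.induction_on with
    | empty =>
      rw [Finset.sum_empty, Finset.sum_empty, twistedForm_volumeCochain, twistOp_apply]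
      simp
    | insert g s hg ih =>
      rw [Finset.sum_insert hg, Finset.sum_insert hg, volumeCochain_add, twistedForm_add,
        LinearMap.add_apply, ih]
  rw [h1]
  exact Finset.sum_congr rfl fun h _ => by rw [hα.map_twistedForm hr, hx]

end ClassMorphisms

/-! ### Cohomology classes of cocycles on the Koszul resolution. -/

section KoszulClass

open Abelian

variable {K A V G : Type u} [Field K] [Ring A] [Algebra K A] [AddCommGroup V] [Module K V]
  [Group G] [Fintype G] {ρ : G →* (A →ₐ[K] A)} {r : G →* Module.End K V} {B : Subalgebra K A}
  {ω : V →ₗ[K] V →ₗ[K] K} {f : V →ₗ[K] A} [CharZero K] [FiniteDimensional K V]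
  (h : IsSymplecticAction ω f r ρ) (hB : ∀ a, a ∈ B ↔ ∀ g, ρ g a = a)
  {I : Type*} [Fintype I] (b : Module.Basis I K V)

/-- The class of a cocycle on the equivariant Koszul resolution. -/
noncomputable def koszulCls (p : ℕ)
    (F : ModuleCat.of (B ⊗[K] Bᵐᵒᵖ) (koszulPart ρ r hB p) ⟶ selfBimodule K B)
    (hF : partDiff h hB b p ≫ F = 0) : Ext.{u} (selfBimodule K B) (selfBimodule K B) p :=
  (koszulResolution h hB b).cls p F hF

variable {p : ℕ} {F F' : ModuleCat.of (B ⊗[K] Bᵐᵒᵖ) (koszulPart ρ r hB p) ⟶ selfBimodule K B}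

theorem koszulCls_congr (e : F = F') (hF : partDiff h hB b p ≫ F = 0)
    (hF' : partDiff h hB b p ≫ F' = 0) :
    koszulCls h hB b p F hF = koszulCls h hB b p F' hF' := by
  subst e
  rfl

theorem koszulCls_add (hF : partDiff h hB b p ≫ F = 0) (hF' : partDiff h hB b p ≫ F' = 0)
    (hs : partDiff h hB b p ≫ (F + F') = 0) :
    koszulCls h hB b p (F + F') hs = koszulCls h hB b p F hF + koszulCls h hB b p F' hF' :=
  (koszulResolution h hB b).cls_add p F F' hF hF' hs

theorem koszulCls_smul (t : K) (hF : partDiff h hB b p ≫ F = 0)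
    (hs : partDiff h hB b p ≫ (t • F) = 0) :
    koszulCls h hB b p (t • F) hs = t • koszulCls h hB b p F hF :=
  (koszulResolution h hB b).cls_smul p t F hF hs

theorem exists_eq_koszulCls (x : Ext.{u} (selfBimodule K B) (selfBimodule K B) p) :
    ∃ F hF, x = koszulCls h hB b p F hF :=
  (koszulResolution h hB b).exists_eq_cls p x

theorem koszulCls_zero_eq_zero
    {F : ModuleCat.of (B ⊗[K] Bᵐᵒᵖ) (koszulPart ρ r hB 0) ⟶ selfBimodule K B}
    (hF : partDiff h hB b 0 ≫ F = 0) (e : koszulCls h hB b 0 F hF = 0) : F = 0 :=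
  (koszulResolution h hB b).cls_zero_eq_zero F hF e

theorem koszulCls_succ_eq_zero_iff
    {F : ModuleCat.of (B ⊗[K] Bᵐᵒᵖ) (koszulPart ρ r hB (p + 1)) ⟶ selfBimodule K B}
    (hF : partDiff h hB b (p + 1) ≫ F = 0) : koszulCls h hB b (p + 1) F hF = 0 ↔
      ∃ H : ModuleCat.of (B ⊗[K] Bᵐᵒᵖ) (koszulPart ρ r hB p) ⟶ selfBimodule K B,
        partDiff h hB b p ≫ H = F :=
  (koszulResolution h hB b).cls_succ_eq_zero_iff p F hF

theorem koszulCls_aug (hF : partDiff h hB b 0 ≫ ofForm hB r isBimoduleForm_invariantAug 0 = 0) :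
    koszulCls h hB b 0 (ofForm hB r isBimoduleForm_invariantAug 0) hF =
      Ext.mk₀ (𝟙 (selfBimodule K B)) :=
  (koszulResolution h hB b).cls_aug

theorem koszulCls_comp (T : (koszulResolution h hB b).ChainShift p) {q : ℕ}
    {F : ModuleCat.of (B ⊗[K] Bᵐᵒᵖ) (koszulPart ρ r hB q) ⟶ selfBimodule K B}
    (hF : partDiff h hB b q ≫ F = 0)
    {E : ModuleCat.of (B ⊗[K] Bᵐᵒᵖ) (koszulPart ρ r hB p) ⟶ selfBimodule K B}
    (hE : partDiff h hB b p ≫ E = 0)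
    {E' : ModuleCat.of (B ⊗[K] Bᵐᵒᵖ) (koszulPart ρ r hB (p + q)) ⟶ selfBimodule K B}
    (hE' : partDiff h hB b (p + q) ≫ E' = 0)
    (e : T.hom 0 ≫ ofForm hB r isBimoduleForm_invariantAug 0 = E) (e' : T.hom q ≫ F = E') :
    (koszulCls h hB b p E hE).comp (koszulCls h hB b q F hF) rfl =
      koszulCls h hB b (p + q) E' hE' := by
  subst e
  subst e'
  exact T.cls_comp q F hF hE'

end KoszulClass

/-! ### The map from functions on the group to Hochschild cohomology. -/

section ClassMap

open Abelian

variable {K A V G : Type u} [Field K] [Ring A] [Algebra K A] [AddCommGroup V] [Module K V]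
  [Group G] [Fintype G] {ρ : G →* (A →ₐ[K] A)} {r : G →* Module.End K V} {B : Subalgebra K A}
  {ω : V →ₗ[K] V →ₗ[K] K} {f : V →ₗ[K] A} {d : G → ℕ} {α : G → ExteriorAlgebra K V}
  [CharZero K] [FiniteDimensional K V]
  (h : IsSymplecticAction ω f r ρ) (hB : ∀ a, a ∈ B ↔ ∀ g, ρ g a = a)
  {I : Type*} [Fintype I] (b : Module.Basis I K V) (hα : IsTwistedVolume ω r d α)

/-- The cocycle given by a function on the group. -/
noncomputable def classMor (r : G →* Module.End K V) (hB : ∀ a, a ∈ B ↔ ∀ g, ρ g a = a)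
    (ω : V →ₗ[K] V →ₗ[K] K) (d : G → ℕ) (α : G → ExteriorAlgebra K V) (p : ℕ) (z : G → K) :
    ModuleCat.of (B ⊗[K] Bᵐᵒᵖ) (koszulPart ρ r hB p) ⟶ selfBimodule K B :=
  ofForm hB r (isBimoduleForm_classForm (ω := ω) (d := d) (α := α) p z) p

-- The form is an orbit sum of the augmentation composed with a chain map, and the augmentation
-- kills boundaries.
omit [CharZero K] [FiniteDimensional K V] in
include hα in
theorem diff_classMor (p : ℕ) (z : G → K) :
    partDiff h hB b p ≫ classMor r hB ω d α p z = 0 := by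
  refine hom_ext_bimoduleVal fun y => ?_
  change classForm ρ ω d α p z (koszulDiff b f y) = 0
  rw [classForm, LinearMap.smul_apply, LinearMap.comp_apply, twistedForm_volumeCochain,
    ← hα.koszulDiff_twistOp h.map_gen, koszulAug_koszulDiff, map_zero, smul_zero]

omit [CharZero K] [FiniteDimensional K V] in
theorem classMor_add (p : ℕ) (w z : G → K) : classMor r hB ω d α p (w + z) =
    classMor r hB ω d α p w + classMor r hB ω d α p z :=
  hom_ext_bimoduleVal fun _ => LinearMap.congr_fun (classForm_add p w z) _

omit [CharZero K] [FiniteDimensional K V] in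
theorem classMor_smul (p : ℕ) (t : K) (z : G → K) : classMor r hB ω d α p (t • z) =
    t • classMor r hB ω d α p z :=
  hom_ext_bimoduleVal fun y => (LinearMap.congr_fun (classForm_smul p t z) y.1).trans
    (bimoduleVal_smul_hom t (classMor r hB ω d α p z) y).symm

/-- The cohomology class given by a function on the group. -/
noncomputable def classMap (p : ℕ) :
    (G → K) →ₗ[K] Ext.{u} (selfBimodule K B) (selfBimodule K B) p where
  toFun z := koszulCls h hB b p (classMor r hB ω d α p z) (diff_classMor h hB b hα p z)
  map_add' w z := by
    have e := classMor_add (r := r) (ω := ω) (d := d) (α := α) hB p w z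
    exact (koszulCls_congr h hB b e _ (e ▸ diff_classMor h hB b hα p (w + z))).trans
      (koszulCls_add h hB b _ _ _)
  map_smul' t z := by
    have e := classMor_smul (r := r) (ω := ω) (d := d) (α := α) hB p t z
    exact (koszulCls_congr h hB b e _ (e ▸ diff_classMor h hB b hα p (t • z))).trans
      (koszulCls_smul h hB b t _ _)

theorem classMap_apply (p : ℕ) (z : G → K) : classMap h hB b hα p z =
    koszulCls h hB b p (classMor r hB ω d α p z) (diff_classMor h hB b hα p z) := rfl

theorem classMap_degreePart (p : ℕ) (z : G → K) :
    classMap h hB b hα p (degreePart d p z) = classMap h hB b hα p z := by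
  refine koszulCls_congr h hB b (hom_ext_bimoduleVal fun y => ?_) _ _
  change classForm ρ ω d α p (degreePart d p z) y = classForm ρ ω d α p z y
  have : degreePart d p (degreePart d p z) = degreePart d p z := by
    funext g
    simp only [degreePart_apply]
    split_ifs <;> rfl
  rw [classForm, classForm, this]

theorem classMap_one [DecidableEq G] : classMap h hB b hα 0 (fun g => if g = 1 then 1 else 0) =
    Ext.mk₀ (𝟙 (selfBimodule K B)) := by
  refine (koszulCls_congr h hB b (hom_ext_bimoduleVal fun y => ?_) _ _).trans
    (koszulCls_aug h hB b (koszulResolution h hB b).diff_aug)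
  change classForm ρ ω d α 0 _ y = invariantAug ρ V y
  have hz : ∀ h : G, conjFun h (fun g => if g = 1 then (1 : K) else 0) =
      fun g => if g = 1 then (1 : K) else 0 := by
    intro h
    funext g
    have e : h⁻¹ * g * h = 1 ↔ g = 1 := by
      rw [mul_assoc, inv_mul_eq_one, right_eq_mul]
    simp only [conjFun, e]
  rw [hα.classForm_of_class h.isometry 0 hz y.2.1, invariantAug_of_fixed y.2.1, twistOp_apply]
  congr 1
  rw [Finset.sum_eq_single 1]
  · rw [degreePart_apply, if_pos hα.deg_one, if_pos rfl, one_smul]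
    refine LinearMap.congr_fun (f := twistTerm ρ ω α 1) (g := LinearMap.id)
      (koszulSpace_hom_ext fun a c x => ?_) _
    rw [twistTerm_tmul, hα.one, map_one, map_one]
    rfl
  · intro g _ hg
    rw [degreePart_apply, if_neg hg, ite_self, zero_smul]
  · simp

/-- The chain map given by a class function. -/
noncomputable def classShift (p : ℕ) {z : G → K} (hz : ∀ h, conjFun h z = z) :
    (koszulResolution h hB b).ChainShift p where
  hom n := ModuleCat.ofHom ((envLinear B (twistOp ρ ω α (degreePart d p z))
      fun β γ a c x => by
        simp only [twistOp_apply, twistTerm_tmul, Finset.smul_sum, map_mul, (hB _).1 γ.2]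
        refine Finset.sum_congr rfl fun g _ => ?_
        rw [← env_algebraMap_smul B, ← env_algebraMap_smul B, smul_smul, ← Algebra.commutes,
          ← smul_smul, env_smul_tmul]).restrict
      (p := koszulPart ρ r hB (p + n)) (q := koszulPart ρ r hB n) fun x hx => by
        refine ⟨fun g => ?_, ?_⟩
        · rw [envLinear_apply, hα.koszulAct_twistOp h.isometry, conjFun_degreePart hα, hz, hx.1]
        · rw [envLinear_apply, hα.koszulDeg_twistOp, hx.2])
  comm n := by
    refine ModuleCat.hom_ext (LinearMap.ext fun y => Subtype.ext ?_)
    exact (hα.koszulDiff_twistOp h.map_gen b _ _).symm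

/-- `classShift` lifts the cocycle of `z`, so the product is the cocycle of `w` after this chain
map. Hence `w` stands on the left in the convolution; the order becomes immaterial for central
elements. -/
theorem classMap_mul (p q : ℕ) {z w : G → K} (hz : ∀ h, conjFun h z = z)
    (hw : ∀ h, conjFun h w = w) :
    (classMap h hB b hα p z).comp (classMap h hB b hα q w) rfl =
      classMap h hB b hα (p + q) (gradedConv d (p + q) (degreePart d q w) (degreePart d p z)) := by
  have hc : ∀ h, conjFun h (gradedConv d (p + q) (degreePart d q w) (degreePart d p z)) =
      gradedConv d (p + q) (degreePart d q w) (degreePart d p z) := fun h => by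
    rw [conjFun_gradedConv hα, conjFun_degreePart hα, conjFun_degreePart hα, hz, hw]
  let T := classShift h hB b hα p hz
  have e : T.hom q ≫ classMor r hB ω d α q w = classMor r hB ω d α (p + q)
      (gradedConv d (p + q) (degreePart d q w) (degreePart d p z)) := by
    refine hom_ext_bimoduleVal fun y => ?_
    have hy := (((T.hom q).hom y : koszulPart ρ r hB q)).2.1
    change classForm ρ ω d α q w (twistOp ρ ω α (degreePart d p z) y) = classForm ρ ω d α _ _ y
    refine (hα.classForm_of_class h.isometry q hw hy).trans ?_
    rw [hα.classForm_of_class h.isometry (p + q) hc y.2.1]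
    refine congrArg (koszulAug K A V) ((hα.twistOp_twistOp p q w z y.1).trans ?_)
    refine congrArg (fun u => twistOp ρ ω α u y.1) (funext fun k => ?_)
    simp only [degreePart_apply, gradedConv]
    split_ifs <;> rfl
  have e0 : T.hom 0 ≫ ofForm hB r isBimoduleForm_invariantAug 0 = classMor r hB ω d α p z := by
    refine hom_ext_bimoduleVal fun y => ?_
    have hy := (((T.hom 0).hom y : koszulPart ρ r hB 0)).2.1
    refine (invariantAug_of_fixed hy).trans ?_
    exact (hα.classForm_of_class h.isometry p hz y.2.1).symm
  exact koszulCls_comp h hB b T _ _ _ e0 e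

end ClassMap

/-! ### The class map is bijective on class functions of given length. -/

section ClassMapBijective

open Abelian

variable {K A V G : Type u} [Field K] [Ring A] [Algebra K A] [AddCommGroup V] [Module K V]
  [Group G] [Fintype G] {ρ : G →* (A →ₐ[K] A)} {r : G →* Module.End K V} {B : Subalgebra K A}
  {ω : V →ₗ[K] V →ₗ[K] K} {f : V →ₗ[K] A} {d : G → ℕ} {α : G → ExteriorAlgebra K V}

section Forms

variable (hB : ∀ a, a ∈ B ↔ ∀ g, ρ g a = a) (h : IsSymplecticAction ω f r ρ)
  {I : Type*} [Fintype I] (b : Module.Basis I K V)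

theorem formOf_zero (p : ℕ) :
    formOf (0 : ModuleCat.of (B ⊗[K] Bᵐᵒᵖ) (koszulPart ρ r hB p) ⟶ selfBimodule K B) = 0 :=
  LinearMap.ext fun _ => rfl

theorem formOf_partDiff_comp {p : ℕ}
    (H : ModuleCat.of (B ⊗[K] Bᵐᵒᵖ) (koszulPart ρ r hB p) ⟶ selfBimodule K B) :
    formOf (partDiff h hB b p ≫ H) = formOf H ∘ₗ koszulDiff b f := by
  refine LinearMap.ext fun z => ?_
  change bimoduleVal B (H.hom _) = bimoduleVal B (H.hom _)
  congr 2
  exact Subtype.ext (koszulDiff_koszulSum b h.map_gen p z)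

omit [Fintype G] in
theorem recoverCochain_zero {ι : Type*} [Fintype ι] (a c : ι → A) :
    recoverCochain ρ a c (0 : KoszulSpace K A V →ₗ[K] A) = 0 := by
  funext g
  refine LinearMap.ext fun x => ?_
  simp [recoverCochain_apply, halfForm_apply]

end Forms

theorem IsTwistedVolume.twistedForm_koszulDeg (hα : IsTwistedVolume ω r d α) (p : ℕ) (z : G → K)
    (x : KoszulSpace K A V) :
    twistedForm ρ (volumeCochain A ω α (degreePart d p z)) (koszulDeg p x) =
      twistedForm ρ (volumeCochain A ω α (degreePart d p z)) x := by
  refine LinearMap.congr_fun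
    (f := twistedForm ρ (volumeCochain A ω α (degreePart d p z)) ∘ₗ koszulDeg p)
    (g := twistedForm ρ (volumeCochain A ω α (degreePart d p z)))
    (koszulSpace_hom_ext fun a c x => ?_) x
  rw [LinearMap.comp_apply, koszulDeg_tmul, twistedForm_tmul, twistedForm_tmul]
  refine Finset.sum_congr rfl fun g _ => ?_
  by_cases h : d g = p
  · rw [volumeCochain, LinearMap.smul_apply, LinearMap.smul_apply, ← h,
      scalarCochain_degProj (hα.mem g)]
  · rw [volumeCochain, degreePart_apply, if_neg h, zero_smul, LinearMap.zero_apply,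
      LinearMap.zero_apply]

variable [CharZero K]

/-- Both sides are sums over the group. The term in which the argument is translated by `g` equals
the term in which the value is translated by `g`. -/
theorem IsTwistedVolume.formOf_classMor (hα : IsTwistedVolume ω r d α)
    (hB : ∀ a, a ∈ B ↔ ∀ g, ρ g a = a)
    (hr : ∀ g u v, ω (r g u) (r g v) = ω u v) (p : ℕ) {z : G → K} (hz : ∀ h, conjFun h z = z) :
    formOf (classMor r hB ω d α p z) =
      orbitSum ρ ∘ₗ twistedForm ρ (volumeCochain A ω α (degreePart d p z)) := by
  refine LinearMap.ext fun x => ?_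
  have hx := koszulSum_mem (hB := hB) (r := r) p x
  refine (hα.classForm_of_class hr p hz hx.1).trans ?_
  rw [← twistedForm_volumeCochain, koszulSum_apply, map_sum, LinearMap.comp_apply, orbitSum_apply]
  refine Finset.sum_congr rfl fun g _ => ?_
  rw [← hα.twistedForm_koszulDeg p z x, hα.map_twistedForm hr, conjFun_degreePart hα, hz]

variable [FiniteDimensional K V] [Nontrivial A] (h : IsSymplecticAction ω f r ρ)
  {I : Type*} [Fintype I] (b : Module.Basis I K V) (hα : IsTwistedVolume ω r d α)

omit [Fintype G] in
include h hα in
theorem IsTwistedVolume.eq_zero_of_smul_eq (g : G) (ψ : ExteriorAlgebra K V →ₗ[K] A) (t : K)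
    (e : t • scalarCochain A ω (α g) = twistedDiff b f (r g) ψ) : t = 0 := by
  have := finite_exteriorAlgebra K V
  obtain ⟨I', _, _, b', l, s, -, hb, ht⟩ := hα.adapted g
  rw [twistedDiff_basis b b'] at e
  exact ht.eq_zero_of_smul_eq h.heis hb ψ t e

omit [Fintype G] in
include h hα in
theorem IsTwistedVolume.exists_eq_smul_add (g : G) (φ : ExteriorAlgebra K V →ₗ[K] A)
    (e : twistedDiff b f (r g) φ = 0) :
    ∃ t : K, ∃ ψ, φ = t • scalarCochain A ω (α g) + twistedDiff b f (r g) ψ := by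
  have := finite_exteriorAlgebra K V
  obtain ⟨I', _, _, b', l, s, -, hb, ht⟩ := hα.adapted g
  rw [twistedDiff_basis b b'] at e ⊢
  exact ht.exists_eq_smul_add h.heis hb φ e

variable (hB : ∀ a, a ∈ B ↔ ∀ g, ρ g a = a)

/-- Recovering the twisted cochain at `g` turns a bounding cochain of the form into one for `z g`
times the scalar cochain, whose class is nonzero. -/
theorem eq_zero_of_classMap_eq_zero (p : ℕ) {z : G → K} (hz : ∀ h, conjFun h z = z)
    (e : classMap h hB b hα p z = 0) {g : G} (hg : d g = p) : z g = 0 := by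
  obtain ⟨s, a, c, hab⟩ := h.exists_isGaloisPair
  have h1 := hα.formOf_classMor hB h.isometry p hz
  have h2 := hab.recoverCochain_orbitSum_twistedForm
    (volumeCochain A ω α (degreePart d p z))
  rw [← h1] at h2
  have h3 : volumeCochain A ω α (degreePart d p z) g = z g • scalarCochain A ω (α g) := by
    rw [volumeCochain, degreePart_apply, if_pos hg]
  rw [← h2] at h3
  rw [classMap_apply] at e
  -- There are no coboundaries in degree zero: a vanishing class means a vanishing morphism.
  rcases p with _ | p
  · have h4 := koszulCls_zero_eq_zero h hB b _ e
    rw [h4, formOf_zero, recoverCochain_zero] at h3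
    exact hα.eq_zero_of_smul_eq h b g 0 _ (by rw [← h3, map_zero]; rfl)
  · obtain ⟨H, hH⟩ := (koszulCls_succ_eq_zero_iff h hB b _).1 e
    rw [← hH, formOf_partDiff_comp hB h b, hab.recoverCochain_koszulDiff b h.map_gen
      (isInvariantForm_formOf H)] at h3
    exact hα.eq_zero_of_smul_eq h b g _ _ h3.symm

/-- The recovered cochains of a cocycle are twisted cocycles, so each one is a multiple `z g` of the
scalar cochain plus a coboundary. The multiples, averaged over conjugation, are the class function,
and the bounding cochains assemble to an invariant one. -/
theorem exists_eq_classMap (p : ℕ) (x : Ext.{u} (selfBimodule K B) (selfBimodule K B) p) :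
    ∃ z : G → K, (∀ h, conjFun h z = z) ∧ x = classMap h hB b hα p z := by
  obtain ⟨s, a, c, hab⟩ := h.exists_isGaloisPair
  obtain ⟨F, hF, rfl⟩ := exists_eq_koszulCls h hB b x
  have hG : (Fintype.card G : K) ≠ 0 := by exact_mod_cast Fintype.card_ne_zero
  have hF' := isInvariantForm_formOf F
  have h1 : ∀ g, twistedDiff b f (r g) (recoverCochain ρ a c (formOf F) g) = 0 := fun g => by
    rw [← hab.recoverCochain_koszulDiff b h.map_gen hF', ← formOf_partDiff_comp hB h b, hF,
      formOf_zero, recoverCochain_zero]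
    rfl
  choose z ψ hzψ using fun g => hα.exists_eq_smul_add h b g _ (h1 g)
  have h2 : recoverCochain ρ a c (formOf F) =
      volumeCochain A ω α z + fun g => twistedDiff b f (r g) (ψ g) := funext hzψ
  have h3 : ∀ y : koszulPart ρ r hB p, bimoduleVal B (F.hom y) =
      classForm ρ ω d α p (averageFun z) y +
        ((Fintype.card G : K)⁻¹ • (orbitSum ρ ∘ₗ twistedForm ρ ψ)) (koszulDiff b f y) := by
    intro y
    have h4 := hab.orbitSum_twistedForm_recoverCochain hF' y
    rw [formOf_of_mem, h2, twistedForm_add, LinearMap.add_apply, map_add,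
      ← twistedForm_koszulDiff b h.map_gen] at h4
    rw [← hα.orbitSum_twistedForm h.isometry p z y.2.1 y.2.2, LinearMap.smul_apply,
      LinearMap.comp_apply, ← smul_add, h4, smul_smul, inv_mul_cancel₀ hG, one_smul]
  refine ⟨averageFun z, fun k => conjFun_averageFun k z, ?_⟩
  rw [classMap_apply]
  -- In degree zero the correction term vanishes by itself, because the Koszul differential is zero
  -- on degree zero.
  rcases p with _ | p
  · refine koszulCls_congr h hB b (hom_ext_bimoduleVal fun y => ?_) _ _
    rw [h3]
    have h5 : koszulDiff b f (y : KoszulSpace K A V) = 0 := by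
      rw [← y.2.2, koszulDiff_koszulDeg_zero]
    rw [h5, map_zero, add_zero]
    rfl
  · let H : ModuleCat.of (B ⊗[K] Bᵐᵒᵖ) (koszulPart ρ r hB p) ⟶ selfBimodule K B :=
      ofForm hB r ((isBimoduleForm_orbitSum_twistedForm ψ).smul (Fintype.card G : K)⁻¹) p
    have h5 : F = classMor r hB ω d α (p + 1) (averageFun z) + partDiff h hB b p ≫ H :=
      hom_ext_bimoduleVal h3
    have h6 : partDiff h hB b (p + 1) ≫ partDiff h hB b p ≫ H = 0 := by
      rw [← Category.assoc]
      exact ((koszulResolution h hB b).diff_diff p =≫ H).trans Limits.zero_comp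
    refine (koszulCls_congr h hB b h5 hF (by rw [← h5, hF])).trans ?_
    refine (koszulCls_add h hB b (diff_classMor h hB b hα _ _) h6 _).trans ?_
    rw [(koszulCls_succ_eq_zero_iff h hB b h6).2 ⟨H, rfl⟩, add_zero]

end ClassMapBijective

/-! ### Normalised volume elements of symplectic representations -/

section Multivectors

open ExteriorAlgebra

variable {F V : Type*} [Field F] [AddCommGroup V] [Module F V]

/-- Both sides are alternating in the rows of `T`, so they need only be compared on permutations of
the standard basis. -/
theorem ιMulti_sum_smul {n : ℕ} (T : Matrix (Fin n) (Fin n) F) (w : Fin n → V) :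
    ιMulti F n (fun i => ∑ j, T i j • w j) = T.det • ιMulti F n w := by
  let L := Fintype.linearCombination F w
  have h : (ιMulti F n).compLinearMap L =
      (LinearMap.toSpanSingleton F (ExteriorAlgebra F V) (ιMulti F n w)).compAlternatingMap
        (Matrix.detRowAlternating (R := F) (n := Fin n)) := by
    refine Module.Basis.ext_alternating (Pi.basisFun F (Fin n)) fun v hv => ?_
    have hL : ∀ i, L (Pi.basisFun F (Fin n) i) = w i := fun i => by
      simp [L, Fintype.linearCombination_apply, Pi.single_apply]
    obtain ⟨σ, rfl⟩ : ∃ σ : Equiv.Perm (Fin n), v = σ :=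
      ⟨Equiv.ofBijective v (Finite.injective_iff_bijective.1 hv), rfl⟩
    rw [AlternatingMap.compLinearMap_apply, LinearMap.compAlternatingMap_apply]
    simp only [hL]
    have h1 := (ιMulti F n).map_perm w σ
    have h2 := (Matrix.detRowAlternating (R := F) (n := Fin n)).map_perm
      (fun i => Pi.basisFun F (Fin n) i) σ
    have h3 : Matrix.detRowAlternating (R := F) (fun i => Pi.basisFun F (Fin n) i) = 1 := by
      change Matrix.det (fun i => Pi.basisFun F (Fin n) i) = 1
      rw [← Matrix.det_one (n := Fin n)]
      congr 1
      ext i j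
      simp [Matrix.one_apply, Pi.single_apply, eq_comm]
    rw [h3] at h2
    refine h1.trans ?_
    change _ = LinearMap.toSpanSingleton F _ _
      (Matrix.detRowAlternating ((fun i => Pi.basisFun F (Fin n) i) ∘ σ))
    rw [h2]
    rw [LinearMap.toSpanSingleton_apply, smul_assoc, one_smul]
  exact congrArg (fun t => t T) h

theorem ιMulti_ne_zero {n : ℕ} {v : Fin n → V} (hv : LinearIndependent F v) :
    ιMulti F n v ≠ 0 := by
  intro h
  have h1 := exteriorPower.ιMulti_family_linearIndependent_field (n := n) hv
  have h2 := h1.ne_zero ⟨Finset.univ, by simp⟩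
  have h0 : exteriorPower.ιMulti F n v = 0 := Subtype.ext h
  apply h2
  rw [exteriorPower.ιMulti_family]
  have h3 := (exteriorPower.ιMulti F n).map_perm v
    (Equiv.ofBijective _ (Finite.injective_iff_bijective.1
      (Set.powersetCard.ofFinEmbEquiv.symm
        (⟨Finset.univ, by simp⟩ : Set.powersetCard (Fin n) n)).injective))
  rw [h0, smul_zero] at h3
  exact h3

theorem linearIndependent_of_ιMulti_ne_zero {n : ℕ} {v : Fin n → V} (hv : ιMulti F n v ≠ 0) :
    LinearIndependent F v := by
  by_contra h
  exact hv ((ιMulti F n).map_linearDependent v h)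

/-- A nonzero decomposable multivector determines the span of its factors. This allows two frames to
be compared when only their multivectors are known to be proportional. -/
theorem ι_mul_ιMulti_eq_zero_iff {n : ℕ} {v : Fin n → V} (hv : LinearIndependent F v) (x : V) :
    ι F x * ιMulti F n v = 0 ↔ x ∈ Submodule.span F (Set.range v) := by
  have e : ι F x * ιMulti F n v = ιMulti F (n + 1) (Fin.cons x v : Fin (n + 1) → V) := by
    rw [ιMulti_succ_apply]
    rfl
  rw [e]
  constructor
  · intro h
    by_contra hx
    exact ιMulti_ne_zero (linearIndependent_finCons.2 ⟨hv, hx⟩) h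
  · intro h
    by_contra hx
    exact (linearIndependent_finCons.1 (linearIndependent_of_ιMulti_ne_zero hx)).2 h

end Multivectors

/-! ### The operator `1 - g` on a symplectic representation. -/

section SymplecticRep

variable {F V G : Type*} [Field F] [AddCommGroup V] [Module F V] [Group G]

/-- A symplectic representation. -/
structure IsSymplecticRep (ω : V →ₗ[F] V →ₗ[F] F) (r : G →* Module.End F V) : Prop where
  skew : ∀ u v, ω u v = -ω v u
  nondeg : ∀ v, v ≠ 0 → ∃ u, ω u v = 1
  isometry : ∀ g u v, ω (r g u) (r g v) = ω u v

/-- The operator `1 - g`. -/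
def defect (r : G →* Module.End F V) (g : G) : Module.End F V := 1 - r g

/-- The rank of `1 - g`. -/
noncomputable def defectRank (r : G →* Module.End F V) (g : G) : ℕ :=
  Module.finrank F (LinearMap.range (defect r g))

variable {ω : V →ₗ[F] V →ₗ[F] F} {r : G →* Module.End F V}

theorem defect_apply (g : G) (v : V) : defect r g v = v - r g v := rfl

theorem defect_mul (g h : G) (v : V) :
    defect r (g * h) v = defect r g (r h v) + defect r h v := by
  simp only [defect_apply, map_mul, Module.End.mul_apply]
  abel

theorem map_defect (g h : G) (v : V) :
    r h (defect r g v) = defect r (h * g * h⁻¹) (r h v) := by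
  rw [defect_apply, defect_apply, map_sub, ← Module.End.mul_apply, ← Module.End.mul_apply,
    ← map_mul, ← map_mul, inv_mul_cancel_right]

theorem IsSymplecticRep.eq_zero (hr : IsSymplecticRep ω r) {v : V} (hv : ∀ u, ω u v = 0) :
    v = 0 := by
  by_contra h
  obtain ⟨u, hu⟩ := hr.nondeg v h
  rw [hv] at hu
  exact zero_ne_one hu

theorem IsSymplecticRep.eq_zero_left (hr : IsSymplecticRep ω r) {v : V} (hv : ∀ u, ω v u = 0) :
    v = 0 := hr.eq_zero fun u => by rw [hr.skew, hv, neg_zero]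

theorem IsSymplecticRep.surjective [FiniteDimensional F V] (hr : IsSymplecticRep ω r) :
    Function.Surjective ω := by
  refine (LinearMap.injective_iff_surjective_of_finrank_eq_finrank
      (Subspace.dual_finrank_eq (K := F) (V := V)).symm).1 ?_
  rw [← LinearMap.ker_eq_bot, LinearMap.ker_eq_bot']
  exact fun v hv => hr.eq_zero_left fun u => LinearMap.congr_fun hv u

theorem IsSymplecticRep.defect_fixed (hr : IsSymplecticRep ω r) (g : G) (u : V) {v : V}
    (hv : defect r g v = 0) : ω (defect r g u) v = 0 := by
  rw [defect_apply, sub_eq_zero] at hv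
  rw [defect_apply, map_sub, LinearMap.sub_apply]
  nth_rewrite 2 [hv]
  rw [hr.isometry, sub_self]

/-- The image of `1 - g` is the whole orthogonal complement of its kernel: a covector that vanishes
on the kernel factors through `1 - g`. -/
theorem IsSymplecticRep.mem_range_defect [FiniteDimensional F V] (hr : IsSymplecticRep ω r)
    (g : G) (x : V) (hx : ∀ v, defect r g v = 0 → ω x v = 0) :
    x ∈ LinearMap.range (defect r g) := by
  have h1 : ω x ∈ LinearMap.range (defect r g).dualMap := by
    rw [LinearMap.range_dualMap_eq_dualAnnihilator_ker, Submodule.mem_dualAnnihilator]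
    exact fun v hv => hx v hv
  obtain ⟨ξ, hξ⟩ := h1
  obtain ⟨z, rfl⟩ := hr.surjective ξ
  -- Invariance of the form gives `ω (g y) ((1 - g) u) = -ω ((1 - g) y) u`, hence the preimage `-y`.
  obtain ⟨y, rfl⟩ : ∃ y, r g y = z := ⟨r g⁻¹ z, by
    rw [← Module.End.mul_apply, ← map_mul, mul_inv_cancel, map_one, Module.End.one_apply]⟩
  refine ⟨-y, ?_⟩
  rw [← sub_eq_zero]
  refine hr.eq_zero_left fun u => ?_
  have h3 := LinearMap.congr_fun hξ u
  rw [LinearMap.dualMap_apply, defect_apply, map_sub, hr.isometry] at h3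
  rw [map_sub, LinearMap.sub_apply, ← h3, defect_apply, map_neg, map_sub, map_neg, map_neg,
    LinearMap.sub_apply, LinearMap.neg_apply, LinearMap.neg_apply]
  ring

section Finite

theorem sub_pow_mem_range_defect (g : G) (v : V) (k : ℕ) :
    v - r (g ^ k) v ∈ LinearMap.range (defect r g) := by
  induction k with
  | zero => simp
  | succ k ih =>
    have : v - r (g ^ (k + 1)) v = (v - r (g ^ k) v) + defect r g (r (g ^ k) v) := by
      rw [defect_apply, ← Module.End.mul_apply, ← map_mul, ← pow_succ']
      abel
    rw [this]
    exact Submodule.add_mem _ ih ⟨_, rfl⟩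

variable [Finite G] [CharZero F]

/-- The mean over the powers of `g` is a projection onto the fixed vectors, and its complement
consists of differences `v - g ^ k v`. -/
theorem isCompl_ker_range_defect (r : G →* Module.End F V) (g : G) :
    IsCompl (LinearMap.ker (defect r g)) (LinearMap.range (defect r g)) := by
  have hN : (orderOf g : F) ≠ 0 := by exact_mod_cast (orderOf_pos g).ne'
  have hs : ∀ v, r g (∑ k ∈ Finset.range (orderOf g), r (g ^ k) v) =
      ∑ k ∈ Finset.range (orderOf g), r (g ^ k) v := by
    intro v
    rw [map_sum]
    simp only [← Module.End.mul_apply, ← map_mul, ← pow_succ']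
    rw [← sub_eq_zero, ← Finset.sum_sub_distrib,
      Finset.sum_range_sub (fun k => r (g ^ k) v), pow_orderOf_eq_one, pow_zero, sub_self]
  constructor
  · rw [Submodule.disjoint_def]
    rintro v hv ⟨u, rfl⟩
    rw [LinearMap.mem_ker, defect_apply, sub_eq_zero] at hv
    have h1 : ∀ k, r (g ^ k) (defect r g u) = defect r g u := by
      intro k
      induction k with
      | zero => simp
      | succ k ih => rw [pow_succ, map_mul, Module.End.mul_apply, ← hv, ih]
    have h2 : ∑ k ∈ Finset.range (orderOf g), r (g ^ k) (defect r g u) = 0 := by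
      simp only [defect_apply, map_sub, Finset.sum_sub_distrib]
      rw [sub_eq_zero, ← hs u, map_sum]
      simp only [← Module.End.mul_apply, ← map_mul, ← pow_succ, ← pow_succ']
    simp only [h1, Finset.sum_const, Finset.card_range] at h2
    rw [← Nat.cast_smul_eq_nsmul F, smul_eq_zero] at h2
    exact h2.resolve_left hN
  · rw [codisjoint_iff_le_sup]
    intro v _
    have h1 : v = (orderOf g : F)⁻¹ • ∑ k ∈ Finset.range (orderOf g), r (g ^ k) v +
        (orderOf g : F)⁻¹ • ∑ k ∈ Finset.range (orderOf g), (v - r (g ^ k) v) := by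
      rw [← smul_add, Finset.sum_sub_distrib, Finset.sum_const, Finset.card_range,
        ← Nat.cast_smul_eq_nsmul F, add_sub_cancel, smul_smul, inv_mul_cancel₀ hN, one_smul]
    rw [h1]
    refine Submodule.add_mem_sup (Submodule.smul_mem _ _ ?_) (Submodule.smul_mem _ _
      (Submodule.sum_mem _ fun k _ => sub_pow_mem_range_defect g v k))
    rw [LinearMap.mem_ker, defect_apply, hs, sub_self]

end Finite

end SymplecticRep

/-! ### Normalised volume elements and their uniqueness up to sign. -/

section NormalVolume

open ExteriorAlgebra

variable {F V G : Type*} [Field F] [AddCommGroup V] [Module F V] [Group G]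
  {ω : V →ₗ[F] V →ₗ[F] F} {r : G →* Module.End F V}

/-- The Gram matrix of the form `ω ((1 - g) u) v`. -/
def defectGram (ω : V →ₗ[F] V →ₗ[F] F) (r : G →* Module.End F V) (g : G) {n : ℕ} (y : Fin n → V) :
    Matrix (Fin n) (Fin n) F := Matrix.of fun i j => ω (defect r g (y i)) (y j)

theorem defectGram_apply (g : G) {n : ℕ} (y : Fin n → V) (i j : Fin n) :
    defectGram ω r g y i j = ω (defect r g (y i)) (y j) := rfl

/-- A normalised volume element on the image of `1 - g`. -/
def IsNormalVolume (ω : V →ₗ[F] V →ₗ[F] F) (r : G →* Module.End F V) (g : G)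
    (α : ExteriorAlgebra F V) : Prop :=
  ∃ (n : ℕ) (y : Fin n → V) (x : F), n = defectRank r g ∧ x ^ 2 * (defectGram ω r g y).det = 1 ∧
    α = x • ιMulti F n fun i => defect r g (y i)

theorem linearIndependent_of_defectGram {g : G} {n : ℕ} {y : Fin n → V}
    (hy : (defectGram ω r g y).det ≠ 0) : LinearIndependent F fun i => defect r g (y i) := by
  rw [Fintype.linearIndependent_iff]
  intro c hc
  have h1 : Matrix.vecMul c (defectGram ω r g y) = 0 := by
    funext j
    have := LinearMap.congr_fun (congrArg ω hc) (y j)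
    simpa [Matrix.vecMul, dotProduct, defectGram_apply, LinearMap.sum_apply] using this
  exact fun i => congrFun (Matrix.eq_zero_of_vecMul_eq_zero hy h1) i

theorem span_defect_eq [FiniteDimensional F V] {g : G} {n : ℕ} {y : Fin n → V}
    (hn : n = defectRank r g) (hy : LinearIndependent F fun i => defect r g (y i)) :
    Submodule.span F (Set.range fun i => defect r g (y i)) = LinearMap.range (defect r g) := by
  refine Submodule.eq_of_le_of_finrank_eq (Submodule.span_le.2 ?_) ?_
  · rintro _ ⟨i, rfl⟩
    exact ⟨_, rfl⟩
  · rw [finrank_span_eq_card hy, Fintype.card_fin, hn, defectRank]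

theorem le_defectRank [FiniteDimensional F V] {g : G} {n : ℕ} {y : Fin n → V}
    (hy : LinearIndependent F fun i => defect r g (y i)) : n ≤ defectRank r g := by
  have h := Submodule.finrank_mono (R := F)
    (s := Submodule.span F (Set.range fun i => defect r g (y i)))
    (t := LinearMap.range (defect r g)) (Submodule.span_le.2 (by
      rintro _ ⟨i, rfl⟩
      exact ⟨_, rfl⟩))
  rwa [finrank_span_eq_card hy, Fintype.card_fin] at h

theorem exists_defect_basis [FiniteDimensional F V] (r : G →* Module.End F V) (g : G) :
    ∃ y : Fin (defectRank r g) → V, LinearIndependent F fun i => defect r g (y i) := by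
  let w : Module.Basis (Fin (defectRank r g)) F (LinearMap.range (defect r g)) :=
    Module.finBasis F (LinearMap.range (defect r g))
  choose y hy using fun i => (w i).2
  refine ⟨y, ?_⟩
  have e : (fun i => defect r g (y i)) = fun i => (w i : V) := funext hy
  rw [e]
  exact w.linearIndependent.map' (LinearMap.range (defect r g)).subtype (Submodule.ker_subtype _)

namespace IsSymplecticRep

/-- By invariance `ω (g u) ((1 - g) v) = -ω ((1 - g) u) v`, and `g u` runs through all of `V`. So
the form `ω ((1 - g) u) v` induces a nondegenerate form on the image of `1 - g`. -/
theorem defect_eq_zero (hr : IsSymplecticRep ω r) {g : G} {v : V}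
    (hv : ∀ u, ω (defect r g u) v = 0) : defect r g v = 0 := by
  refine hr.eq_zero fun u => ?_
  obtain ⟨u, rfl⟩ : ∃ u', r g u' = u := ⟨r g⁻¹ u, by
    rw [← Module.End.mul_apply, ← map_mul, mul_inv_cancel, map_one, Module.End.one_apply]⟩
  have h := hv u
  rw [defect_apply, map_sub, LinearMap.sub_apply, sub_eq_zero] at h
  rw [defect_apply, map_sub, hr.isometry, h, sub_self]

theorem defectGram_det_ne_zero [FiniteDimensional F V] (hr : IsSymplecticRep ω r) {g : G} {n : ℕ}
    {y : Fin n → V} (hn : n = defectRank r g)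
    (hy : LinearIndependent F fun i => defect r g (y i)) : (defectGram ω r g y).det ≠ 0 := by
  intro h0
  obtain ⟨c, hc, h1⟩ := Matrix.exists_mulVec_eq_zero_iff.2 h0
  apply hc
  have h2 : defect r g (∑ j, c j • y j) = 0 := hr.defect_eq_zero fun u => by
    have hu : defect r g u ∈ Submodule.span F (Set.range fun i => defect r g (y i)) := by
      rw [span_defect_eq hn hy]
      exact ⟨u, rfl⟩
    refine Submodule.span_induction (p := fun x _ => ω x (∑ j, c j • y j) = 0) ?_ ?_ ?_ ?_ hu
    · rintro _ ⟨i, rfl⟩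
      have := congrFun h1 i
      simpa [Matrix.mulVec, dotProduct, defectGram_apply, mul_comm] using this
    · simp
    · intro a b _ _ ha hb
      rw [map_add, LinearMap.add_apply, ha, hb, add_zero]
    · intro t a _ ha
      rw [map_smul, LinearMap.smul_apply, ha, smul_zero]
  rw [map_sum] at h2
  simp only [map_smul] at h2
  exact funext (Fintype.linearIndependent_iff.1 hy c h2)

/-- Two preimages differ by a fixed vector, which is orthogonal to the image of `1 - g`. Preimages
may thus be chosen freely. -/
theorem defectGram_congr (hr : IsSymplecticRep ω r) {g : G} {n : ℕ} {y y' : Fin n → V}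
    (h : ∀ i, defect r g (y i) = defect r g (y' i)) :
    defectGram ω r g y = defectGram ω r g y' := by
  ext i j
  have h1 : ω (defect r g (y' i)) (y j - y' j) = 0 :=
    hr.defect_fixed g _ (by rw [map_sub, h, sub_self])
  rw [map_sub, sub_eq_zero] at h1
  rw [defectGram_apply, defectGram_apply, h, h1]

theorem exists_isNormalVolume [IsAlgClosed F] [FiniteDimensional F V] (hr : IsSymplecticRep ω r)
    (g : G) : ∃ α, IsNormalVolume ω r g α := by
  obtain ⟨y, hy⟩ := exists_defect_basis r g
  have h := hr.defectGram_det_ne_zero rfl hy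
  obtain ⟨x, hx⟩ := IsAlgClosed.exists_pow_nat_eq ((defectGram ω r g y).det)⁻¹ (n := 2) two_pos
  exact ⟨_, _, y, x, rfl, by rw [hx, inv_mul_cancel₀ h], rfl⟩

theorem exists_sum_smul_defect [FiniteDimensional F V] {g : G} {n m : ℕ} {y : Fin n → V}
    (hn : n = defectRank r g) (hy : LinearIndependent F fun i => defect r g (y i))
    (w : Fin m → V) (hw : ∀ i, w i ∈ LinearMap.range (defect r g)) :
    ∃ T : Matrix (Fin m) (Fin n) F, ∀ i, ∑ j, T i j • defect r g (y j) = w i := by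
  have h : ∀ i, ∃ c : Fin n → F, ∑ j, c j • defect r g (y j) = w i := fun i => by
    have := hw i
    rw [← span_defect_eq hn hy] at this
    exact (Submodule.mem_span_range_iff_exists_fun F).1 this
  choose T hT using h
  exact ⟨T, hT⟩

theorem defectGram_sum (hr : IsSymplecticRep ω r) {g : G} {n : ℕ}
    {y y' : Fin n → V} (T : Matrix (Fin n) (Fin n) F)
    (hT : ∀ i, ∑ j, T i j • defect r g (y j) = defect r g (y' i)) :
    (defectGram ω r g y').det = T.det ^ 2 * (defectGram ω r g y).det := by
  have h1 : defectGram ω r g y' = T * defectGram ω r g y * T.transpose := by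
    have h2 : ∀ i, defect r g (y' i) = defect r g (∑ j, T i j • y j) := fun i => by
      rw [← hT, map_sum]
      simp only [map_smul]
    rw [hr.defectGram_congr h2]
    have h3 : ∀ i k, ω (defect r g (∑ j, T i j • y j)) (y k) = (T * defectGram ω r g y) i k :=
      fun i k => by
        simp only [map_sum, map_smul, LinearMap.sum_apply, LinearMap.smul_apply, smul_eq_mul,
          Matrix.mul_apply, defectGram_apply]
    ext i j
    rw [defectGram_apply, Matrix.mul_apply, map_sum]
    refine Finset.sum_congr rfl fun k _ => ?_
    rw [map_smul, h3, smul_eq_mul, mul_comm, Matrix.transpose_apply]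
  rw [h1, Matrix.det_mul, Matrix.det_mul, Matrix.det_transpose]
  ring

end IsSymplecticRep

namespace IsNormalVolume

variable {g h : G} {α β : ExteriorAlgebra F V}

theorem ne_zero (hα : IsNormalVolume ω r g α) : α ≠ 0 := by
  obtain ⟨n, y, x, hn, hx, rfl⟩ := hα
  have hx0 : x ≠ 0 := by
    rintro rfl
    simp at hx
  have hd : (defectGram ω r g y).det ≠ 0 := by
    intro h0
    simp [h0] at hx
  exact smul_ne_zero hx0 (ιMulti_ne_zero (linearIndependent_of_defectGram hd))

theorem neg (hα : IsNormalVolume ω r g α) : IsNormalVolume ω r g (-α) := by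
  obtain ⟨n, y, x, hn, hx, rfl⟩ := hα
  exact ⟨n, y, -x, hn, by rw [neg_sq, hx], (neg_smul _ _).symm⟩

/-- A change of frame multiplies the multivector by the determinant and the Gram determinant by its
square, so the normalisation leaves two choices. -/
theorem eq_or_eq_neg [FiniteDimensional F V] (hα : IsNormalVolume ω r g α)
    (hr : IsSymplecticRep ω r) (hβ : IsNormalVolume ω r g β) : α = β ∨ α = -β := by
  obtain ⟨n, y, x, hn, hx, rfl⟩ := hα
  obtain ⟨m, y', x', hm, hx', rfl⟩ := hβ
  obtain rfl : n = m := hn.trans hm.symm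
  have hd : (defectGram ω r g y).det ≠ 0 := by
    intro h0
    simp [h0] at hx
  obtain ⟨T, hT⟩ := IsSymplecticRep.exists_sum_smul_defect hn (linearIndependent_of_defectGram hd)
    (fun i => defect r g (y' i)) fun i => ⟨_, rfl⟩
  have h1 := hr.defectGram_sum T hT
  have h2 : ιMulti F n (fun i => defect r g (y' i)) =
      T.det • ιMulti F n fun i => defect r g (y i) := by
    rw [← ιMulti_sum_smul]
    simp only [hT]
  have h3 : x ^ 2 = (x' * T.det) ^ 2 := by
    refine mul_right_cancel₀ hd ?_
    rw [hx, ← hx', h1]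
    ring
  rw [h2, smul_smul]
  rcases sq_eq_sq_iff_eq_or_eq_neg.1 h3 with h | h
  · exact Or.inl (by rw [h])
  · exact Or.inr (by rw [h, neg_smul])

theorem defectRank_conj (g h : G) : defectRank r (h * g * h⁻¹) = defectRank r g := by
  let e : V ≃ₗ[F] V := LinearEquiv.ofLinearMap (r h) (r h⁻¹)
    (by rw [← Module.End.mul_eq_comp, ← map_mul, mul_inv_cancel, map_one]; rfl)
    (by rw [← Module.End.mul_eq_comp, ← map_mul, inv_mul_cancel, map_one]; rfl)
  have h1 : LinearMap.range (defect r (h * g * h⁻¹)) =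
      (LinearMap.range (defect r g)).map (e : V →ₗ[F] V) := by
    ext v
    simp only [LinearMap.mem_range, Submodule.mem_map, exists_exists_eq_and]
    constructor
    · rintro ⟨u, rfl⟩
      refine ⟨e.symm u, ?_⟩
      refine (map_defect g h _).trans (congrArg _ (e.apply_symm_apply u))
    · rintro ⟨u, rfl⟩
      exact ⟨r h u, (map_defect g h u).symm⟩
  rw [defectRank, h1, LinearEquiv.finrank_map_eq]
  rfl

theorem map (hα : IsNormalVolume ω r g α) (hr : IsSymplecticRep ω r) (h : G) :
    IsNormalVolume ω r (h * g * h⁻¹) (ExteriorAlgebra.map (r h) α) := by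
  obtain ⟨n, y, x, hn, hx, rfl⟩ := hα
  refine ⟨n, fun i => r h (y i), x, hn.trans (defectRank_conj g h).symm, ?_, ?_⟩
  · rw [← hx]
    congr 2
    ext i j
    rw [defectGram_apply, ← map_defect, hr.isometry, defectGram_apply]
  · rw [map_smul, map_apply_ιMulti]
    simp only [← map_defect]
    rfl

theorem one : IsNormalVolume ω r (1 : G) 1 := by
  refine ⟨0, Fin.elim0, 1, ?_, by simp, by simp⟩
  have : defect r (1 : G) = 0 := by
    rw [defect, map_one, sub_self]
  rw [defectRank, this, LinearMap.range_zero, finrank_bot]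

end IsNormalVolume

end NormalVolume

/-! ### Products of normalised volume elements. -/

section NormalVolumeMul

open ExteriorAlgebra

variable {F V G : Type*} [Field F] [AddCommGroup V] [Module F V] [Group G]
  {ω : V →ₗ[F] V →ₗ[F] F} {r : G →* Module.End F V} {g h : G} [FiniteDimensional F V]
  {α β : ExteriorAlgebra F V}

omit [FiniteDimensional F V] in
theorem range_defect_mul_le (r : G →* Module.End F V) (g h : G) :
    LinearMap.range (defect r (g * h)) ≤
      LinearMap.range (defect r g) ⊔ LinearMap.range (defect r h) := by
  rintro _ ⟨v, rfl⟩
  rw [defect_mul]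
  exact Submodule.add_mem_sup ⟨_, rfl⟩ ⟨_, rfl⟩

theorem defectRank_mul_le (r : G →* Module.End F V) (g h : G) :
    defectRank r (g * h) ≤ defectRank r g + defectRank r h :=
  (Submodule.finrank_mono (range_defect_mul_le r g h)).trans
    (Submodule.finrank_add_le_finrank_add_finrank _ _)

/-- Since `1 - g h = (1 - g) h + (1 - h)`, the image lies in the sum of the two images. If the ranks
add, this sum must be direct. -/
theorem disjoint_of_defectRank_mul (h1 : defectRank r (g * h) = defectRank r g + defectRank r h) :
    Disjoint (LinearMap.range (defect r g)) (LinearMap.range (defect r h)) := by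
  have h2 := Submodule.finrank_mono (range_defect_mul_le r g h)
  have h3 := Submodule.finrank_sup_add_finrank_inf_eq (LinearMap.range (defect r g))
    (LinearMap.range (defect r h))
  rw [defectRank, defectRank, defectRank] at h1
  rw [disjoint_iff, ← Submodule.finrank_eq_zero (R := F)]
  omega

/-- The orthogonal dual of the disjointness of the images. -/
theorem IsSymplecticRep.sup_ker_defect (hr : IsSymplecticRep ω r)
    (hd : Disjoint (LinearMap.range (defect r g)) (LinearMap.range (defect r h))) :
    LinearMap.ker (defect r g) ⊔ LinearMap.ker (defect r h) = ⊤ := by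
  by_contra hne
  obtain ⟨ξ, hξ, hle⟩ := Submodule.exists_le_ker_of_lt_top _ (lt_top_iff_ne_top.2 hne)
  obtain ⟨x, rfl⟩ := hr.surjective ξ
  apply hξ
  have hx : x = 0 := by
    refine Submodule.disjoint_def.1 hd x ?_ ?_
    · exact hr.mem_range_defect g x fun v hv => hle (Submodule.mem_sup_left hv)
    · exact hr.mem_range_defect h x fun v hv => hle (Submodule.mem_sup_right hv)
  rw [hx, map_zero]

/-- As the two kernels span `V`, the preimages for `g` can be taken fixed by `h`, and those for `h`
so that their images under `h` are fixed by `g`. On the first `1 - g h` is then `1 - g`, on the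
second it is `1 - h`. The joint Gram matrix is block triangular, and its determinant is the product.
-/
theorem IsNormalVolume.mul (hα : IsNormalVolume ω r g α) (hβ : IsNormalVolume ω r h β)
    (hr : IsSymplecticRep ω r)
    (hd : Disjoint (LinearMap.range (defect r g)) (LinearMap.range (defect r h))) :
    defectRank r (g * h) = defectRank r g + defectRank r h ∧
      IsNormalVolume ω r (g * h) (α * β) := by
  obtain ⟨n, y₀, x, hn, hx, rfl⟩ := hα
  obtain ⟨m, y₀', x', hm, hx', rfl⟩ := hβ
  have hs := hr.sup_ker_defect hd
  have h1 : ∀ v : V, ∃ a b, defect r g a = 0 ∧ defect r h b = 0 ∧ a + b = v := fun v => by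
    obtain ⟨a, ha, b, hb, e⟩ := Submodule.mem_sup.1 (hs ▸ Submodule.mem_top (x := v))
    exact ⟨a, b, ha, hb, e⟩
  have h2 : ∀ v : V, ∃ y, defect r g y = defect r g v ∧ defect r h y = 0 := fun v => by
    obtain ⟨a, b, ha, hb, rfl⟩ := h1 v
    exact ⟨b, by rw [map_add, ha, zero_add], hb⟩
  have h3 : ∀ v : V, ∃ y, defect r h y = defect r h v ∧ defect r g (r h y) = 0 := fun v => by
    obtain ⟨a, b, ha, hb, e⟩ := h1 (r h v)
    refine ⟨v - b, by rw [map_sub, hb, sub_zero], ?_⟩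
    have hb' : r h b = b := by
      rw [defect_apply, sub_eq_zero] at hb
      exact hb.symm
    rw [map_sub, hb', ← e, add_sub_cancel_right, ha]
  choose y hyg hyh using fun i => h2 (y₀ i)
  choose y' hyh' hyg' using fun i => h3 (y₀' i)
  let z : Fin (n + m) → V := Fin.append y y'
  have e1 : ∀ i, defect r (g * h) (y i) = defect r g (y i) := fun i => by
    have : r h (y i) = y i := by
      have := hyh i
      rw [defect_apply, sub_eq_zero] at this
      exact this.symm
    rw [defect_mul, hyh, add_zero, this]
  have e2 : ∀ i, defect r (g * h) (y' i) = defect r h (y' i) := fun i => by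
    rw [defect_mul, hyg', zero_add]
  have e3 : (defectGram ω r (g * h) z).det =
      (defectGram ω r g y₀).det * (defectGram ω r h y₀').det := by
    rw [hr.defectGram_congr fun i => (hyg i).symm, hr.defectGram_congr fun i => (hyh' i).symm,
      ← Matrix.det_submatrix_equiv_self finSumFinEquiv,
      ← Matrix.det_fromBlocks_zero₂₁ (defectGram ω r g y)
        (Matrix.of fun i j => ω (defect r g (y i)) (y' j)) (defectGram ω r h y')]
    congr 1
    ext i j
    rcases i with i | i <;> rcases j with j | j
    · simp [defectGram_apply, z, e1]
    · simp [defectGram_apply, z, e1]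
    · simp [defectGram_apply, z, e2, hr.defect_fixed h _ (hyh j)]
    · simp [defectGram_apply, z, e2]
  have hxx : (x * x') ^ 2 * (defectGram ω r (g * h) z).det = 1 := by
    rw [e3, ← one_mul (1 : F)]
    nth_rewrite 2 [← hx]
    rw [one_mul, ← mul_one (x ^ 2 * _), ← hx']
    ring
  have hli := linearIndependent_of_defectGram (ω := ω) (r := r) (g := g * h) (y := z) fun h0 => by
    simp [h0] at hxx
  have hrank : n + m = defectRank r (g * h) :=
    le_antisymm (le_defectRank hli) (hn ▸ hm ▸ defectRank_mul_le r g h)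
  refine ⟨by rw [← hrank, hn, hm], n + m, z, x * x', hrank, hxx, ?_⟩
  rw [smul_mul_smul_comm, ιMulti_mul_ιMulti]
  congr 2
  funext i
  refine Fin.addCases (fun i => ?_) (fun i => ?_) i
  · simp [z, e1, hyg]
  · simp [z, e2, hyh']

/-- A product of multivectors whose spans intersect has linearly dependent factors. -/
theorem IsNormalVolume.mul_eq_zero (hα : IsNormalVolume ω r g α) (hβ : IsNormalVolume ω r h β)
    (hd : ¬Disjoint (LinearMap.range (defect r g)) (LinearMap.range (defect r h))) :
    α * β = 0 := by
  obtain ⟨n, y, x, hn, hx, rfl⟩ := hα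
  obtain ⟨m, y', x', hm, hx', rfl⟩ := hβ
  rw [smul_mul_smul_comm, ιMulti_mul_ιMulti]
  have h1 : (defectGram ω r g y).det ≠ 0 := fun h0 => by simp [h0] at hx
  have h2 : (defectGram ω r h y').det ≠ 0 := fun h0 => by simp [h0] at hx'
  by_contra hne
  apply hd
  have h3 := linearIndependent_of_ιMulti_ne_zero (right_ne_zero_of_smul hne)
  have h4 := (linearIndependent_equiv finSumFinEquiv).2 h3
  have h5 := (linearIndependent_sum.1 h4).2.2
  rw [← span_defect_eq hn (linearIndependent_of_defectGram h1),
    ← span_defect_eq hm (linearIndependent_of_defectGram h2)]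
  have e1 : ((Fin.append (fun i => defect r g (y i)) fun i => defect r h (y' i)) ∘
      finSumFinEquiv) ∘ Sum.inl = fun i => defect r g (y i) := funext fun i => by simp
  have e2 : ((Fin.append (fun i => defect r g (y i)) fun i => defect r h (y' i)) ∘
      finSumFinEquiv) ∘ Sum.inr = fun i => defect r h (y' i) := funext fun i => by simp
  rwa [e1, e2] at h5

end NormalVolumeMul

/-! ### Adapted bases, top forms and parity. -/

section AdaptedBases

open ExteriorAlgebra

variable {F V G : Type*} [Field F] [AddCommGroup V] [Module F V] [Group G]
  {ω : V →ₗ[F] V →ₗ[F] F} {r : G →* Module.End F V} [FiniteDimensional F V]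

/-- A basis of the image of `1 - g` and the kernel of `1 - g`. -/
theorem exists_split_basis [Finite G] [CharZero F] (r : G →* Module.End F V) (g : G) :
    ∃ (m : ℕ) (b b' : Module.Basis (Fin (defectRank r g) ⊕ Fin m) F V),
      (∀ i, b (Sum.inl i) ∈ LinearMap.range (defect r g)) ∧
      (∀ k, defect r g (b (Sum.inr k)) = 0) ∧
      (∀ i, b' (Sum.inl i) = defect r g (b (Sum.inl i))) ∧
      ∀ k, b' (Sum.inr k) = b (Sum.inr k) := by
  have hc := isCompl_ker_range_defect r g
  let bW : Module.Basis (Fin (defectRank r g)) F (LinearMap.range (defect r g)) :=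
    Module.finBasis F _
  let bK := Module.finBasis F (LinearMap.ker (defect r g))
  let b := (bW.prod bK).map (Submodule.prodEquivOfIsCompl _ _ hc.symm)
  have h1 : ∀ i, b (Sum.inl i) = bW i := fun i => by simp [b]
  have h2 : ∀ k, b (Sum.inr k) = bK k := fun k => by simp [b]
  have hk : ∀ k, defect r g (bK k) = 0 := fun k => (bK k).2
  let φ : Fin (defectRank r g) ⊕ Fin (Module.finrank F (LinearMap.ker (defect r g))) → V :=
    Sum.elim (fun i => defect r g (bW i)) fun k => bK k
  have hli : LinearIndependent F φ := by
    refine LinearIndependent.sum_type ?_ ?_ ?_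
    · rw [Fintype.linearIndependent_iff]
      intro c hc0
      have h3 : defect r g (∑ i, c i • (bW i : V)) = 0 := by
        rw [map_sum]
        simpa only [map_smul] using hc0
      have h4 : ∑ i, c i • (bW i : V) = 0 :=
        Submodule.disjoint_def.1 hc.disjoint _ h3
          (Submodule.sum_mem _ fun i _ => Submodule.smul_mem _ _ (bW i).2)
      have h5 : ∑ i, c i • bW i = 0 := Subtype.ext (by simpa using h4)
      exact Fintype.linearIndependent_iff.1 bW.linearIndependent c h5
    · exact bK.linearIndependent.map' (Submodule.subtype _) (Submodule.ker_subtype _)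
    · refine hc.symm.disjoint.mono (Submodule.span_le.2 ?_) (Submodule.span_le.2 ?_)
      · rintro _ ⟨i, rfl⟩
        exact ⟨_, rfl⟩
      · rintro _ ⟨i, rfl⟩
        exact (bK i).2
  let b' := Module.Basis.mk hli
    (hli.span_eq_top_of_card_eq_finrank' (Module.finrank_eq_card_basis b).symm).ge
  have h6 : ∀ i, b' i = φ i := fun i => by simp [b']
  exact ⟨_, b, b', fun i => h1 i ▸ (bW i).2, fun k => by rw [h2, hk],
    fun i => by rw [h6, h1]; rfl, fun k => by rw [h6, h2]; rfl⟩

/-- `b` joins bases of the image and the kernel of `1 - g`, and `b'` is `b` with `1 - g` applied to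
the image part. Moved directions use vectors dual to `b'`, fixed ones vectors dual to `b`. -/
theorem IsSymplecticRep.exists_adaptedBasis [Finite G] [CharZero F] (hr : IsSymplecticRep ω r)
    (g : G) : ∃ (m : ℕ) (b : Module.Basis (Fin (defectRank r g) ⊕ Fin m) F V)
      (s : Fin (defectRank r g) ⊕ Fin m → V),
      (∀ k, defect r g (b (Sum.inr k)) = 0) ∧
      AdaptedBasis ω (r g) b ((List.finRange (defectRank r g)).map Sum.inl).toFinset s := by
  obtain ⟨m, b, b', hbW, hbK, hb', hb''⟩ := exists_split_basis r g
  have hmem : ∀ i : Fin (defectRank r g),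
      (Sum.inl i : Fin (defectRank r g) ⊕ Fin m) ∈
        ((List.finRange (defectRank r g)).map Sum.inl).toFinset := fun i => by simp
  have hnot : ∀ k : Fin m, (Sum.inr k : Fin (defectRank r g) ⊕ Fin m) ∉
        ((List.finRange (defectRank r g)).map Sum.inl).toFinset := fun k => by simp
  choose u hu using fun j => hr.surjective (b'.coord j)
  choose t ht using fun j => hr.surjective (b.coord j)
  -- The minus sign accounts for skewness: in `dual_fixed` the vector `s k` stands in the second
  -- slot of the form.
  let s : Fin (defectRank r g) ⊕ Fin m → V :=
    Sum.elim (fun i => u (Sum.inl i)) fun k => -t (Sum.inr k)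
  have hfix : ∀ k, r g (b (Sum.inr k)) = b (Sum.inr k) := fun k => by
    have := hbK k
    rw [defect_apply, sub_eq_zero] at this
    exact this.symm
  have hdual : ∀ i, ∀ k, ω (b i) (s (Sum.inr k)) = if i = Sum.inr k then 1 else 0 := by
    intro i k
    change ω (b i) (-t (Sum.inr k)) = _
    rw [hr.skew, map_neg, LinearMap.neg_apply, neg_neg, ht, Module.Basis.coord_apply, b.repr_self,
      Finsupp.single_apply]
  refine ⟨m, b, s, hbK, ?_⟩
  refine ⟨hr.isometry g, ?_, ?_, ?_, ?_⟩
  · rintro (i | k) hk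
    · exact absurd (hmem i) hk
    · exact hfix k
  · rintro i (j | k) hk
    · exact absurd (hmem j) hk
    · exact hdual i k
  · rintro i (j | k) hj
    · change ω (u (Sum.inl j)) _ = _
      rw [hu]
      rcases i with i | i
      · rw [← defect_apply, ← hb', Module.Basis.coord_apply, b'.repr_self, Finsupp.single_apply]
      · rw [hfix, sub_self, map_zero, if_neg (by simp)]
    · exact absurd hj (hnot k)
  · intro w
    rw [Fintype.sum_sum_type]
    simp only [hmem, hnot, if_true, if_false, ← defect_apply, ← hb']
    have h1 : ∀ i, ω (s (Sum.inl i)) w = b'.repr w (Sum.inl i) := fun i =>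
      LinearMap.congr_fun (hu (Sum.inl i)) w
    simp only [h1]
    -- Image and kernel are orthogonal, so pairing with kernel vectors sees only the kernel
    -- component of `w`. Both sides then have the same pairing with every vector of `b`.
    have h2 : ∑ k, ω (b (Sum.inr k)) w • s (Sum.inr k) =
        ∑ k, b'.repr w (Sum.inr k) • b (Sum.inr k) := by
      rw [← sub_eq_zero]
      have hw : w = ∑ i, b'.repr w (Sum.inl i) • defect r g (b (Sum.inl i)) +
          ∑ k, b'.repr w (Sum.inr k) • b (Sum.inr k) := by
        conv_lhs => rw [← b'.sum_repr w, Fintype.sum_sum_type]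
        simp only [hb', hb'']
      have h3 : ∀ k, ω (b (Sum.inr k)) w =
          ω (b (Sum.inr k)) (∑ k, b'.repr w (Sum.inr k) • b (Sum.inr k)) := by
        intro k
        conv_lhs => rw [hw]
        rw [map_add, map_sum, Finset.sum_eq_zero, zero_add]
        intro i _
        rw [map_smul, hr.skew, hr.defect_fixed g _ (hbK k), neg_zero, smul_zero]
      refine hr.eq_zero fun v => ?_
      have h4 : ω.flip (∑ k, ω (b (Sum.inr k)) w • s (Sum.inr k) -
          ∑ k, b'.repr w (Sum.inr k) • b (Sum.inr k)) = 0 := by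
        refine b.ext fun i => ?_
        rw [LinearMap.flip_apply, LinearMap.zero_apply, map_sub, sub_eq_zero, map_sum]
        simp only [map_smul, hdual]
        rcases i with i | i
        · rw [Finset.sum_eq_zero (by simp), map_sum, Finset.sum_eq_zero]
          intro k _
          obtain ⟨y, hy⟩ := hbW i
          rw [map_smul, ← hy, hr.defect_fixed g _ (hbK k), smul_zero]
        · rw [Finset.sum_eq_single i (by
            intro k _ hk
            simp [Ne.symm hk]) (by simp), if_pos rfl, smul_eq_mul, mul_one, h3]
      exact LinearMap.congr_fun h4 v
    rw [h2]
    conv_rhs => rw [← b'.sum_repr w, Fintype.sum_sum_type]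
    simp only [hb'']

/-- The moved coordinates vanish on the kernel, so the vectors representing them through `ω` lie in
the image of `1 - g`. They form a second frame there, and the two multivectors are proportional. -/
theorem IsNormalVolume.isTopForm {g : G} {α : ExteriorAlgebra F V} (hα : IsNormalVolume ω r g α)
    (hr : IsSymplecticRep ω r) {m : ℕ} (b : Module.Basis (Fin (defectRank r g) ⊕ Fin m) F V)
    (hb : ∀ v, defect r g v = 0 → ∀ i, b.coord (Sum.inl i) v = 0) :
    IsTopForm ω b ((List.finRange (defectRank r g)).map Sum.inl) α := by
  choose w hw using fun j => hr.surjective (b.coord j)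
  obtain ⟨n, y, x, rfl, hx, rfl⟩ := hα
  have hd : (defectGram ω r g y).det ≠ 0 := fun h0 => by simp [h0] at hx
  have hx0 : x ≠ 0 := by
    rintro rfl
    simp at hx
  -- The order is reversed to match the reversed list in `IsTopForm`.
  let w' : Fin (defectRank r g) → V := fun i => w (Sum.inl i.rev)
  obtain ⟨T, hT⟩ := IsSymplecticRep.exists_sum_smul_defect (r := r) (g := g) rfl
    (linearIndependent_of_defectGram hd) w' fun i => hr.mem_range_defect g _ fun v hv => by
      rw [hw]
      exact hb v hv _
  have h1 := ιMulti_sum_smul T fun i => defect r g (y i)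
  simp only [hT] at h1
  have h2 : LinearIndependent F w' := by
    have h3 : LinearIndependent F w := by
      refine LinearIndependent.of_comp ω ?_
      have : (⇑ω ∘ w) = b.coord := funext hw
      rw [this]
      exact b.linearIndependent_coord
    exact h3.comp _ (Sum.inl_injective.comp Fin.rev_injective)
  have h4 := ιMulti_ne_zero h2
  rw [h1] at h4
  have hT0 : T.det ≠ 0 := left_ne_zero_of_smul h4
  refine ⟨(List.nodup_finRange _).map Sum.inl_injective, w, fun j _ => hw j, x / T.det,
    div_ne_zero hx0 hT0, ?_⟩
  have h5 : ((((List.finRange (defectRank r g)).map Sum.inl).reverse.map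
      fun j => ι F (w j)).prod : ExteriorAlgebra F V) = ιMulti F _ w' := by
    rw [ιMulti_apply, ← List.map_reverse, List.map_map, List.finRange_reverse, List.map_map,
      List.ofFn_eq_map]
    rfl
  rw [h5, h1, smul_smul, div_mul_cancel₀ _ hT0]

/-- The skew form is nondegenerate on the image of `1 - g`, which meets its orthogonal complement,
the kernel, trivially. A skew matrix of odd size has determinant zero. -/
theorem IsSymplecticRep.even_defectRank [Finite G] [CharZero F] (hr : IsSymplecticRep ω r)
    (g : G) : Even (defectRank r g) := by
  let b : Module.Basis (Fin (defectRank r g)) F (LinearMap.range (defect r g)) :=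
    Module.finBasis F _
  let M : Matrix (Fin (defectRank r g)) (Fin (defectRank r g)) F :=
    Matrix.of fun i j => ω (b i) (b j)
  have h1 : M.transpose = -M := by
    ext i j
    exact hr.skew _ _
  have h2 : M.det ≠ 0 := by
    intro h0
    obtain ⟨c, hc, h3⟩ := Matrix.exists_mulVec_eq_zero_iff.2 h0
    apply hc
    have h4 : ∀ v ∈ LinearMap.range (defect r g), ω v (∑ j, c j • (b j : V)) = 0 := by
      intro v hv
      have h5 : ∀ i, ω (b i) (∑ j, c j • (b j : V)) = 0 := fun i => by
        have := congrFun h3 i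
        simpa [Matrix.mulVec, dotProduct, M, mul_comm] using this
      have h6 : v = ∑ i, b.repr ⟨v, hv⟩ i • (b i : V) := by
        have := congrArg (LinearMap.range (defect r g)).subtype (b.sum_repr ⟨v, hv⟩)
        rw [map_sum] at this
        exact this.symm
      generalize ∑ j, c j • (b j : V) = u at h5
      rw [h6, map_sum, LinearMap.sum_apply]
      simp only [map_smul, LinearMap.smul_apply, h5, smul_zero, Finset.sum_const_zero]
    have h7 : ∑ j, c j • (b j : V) = 0 :=
      Submodule.disjoint_def.1 (isCompl_ker_range_defect r g).disjoint _
        (hr.defect_eq_zero fun u => h4 _ ⟨u, rfl⟩)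
        (Submodule.sum_mem _ fun i _ => Submodule.smul_mem _ _ (b i).2)
    have h8 : ∑ j, c j • b j = 0 := Subtype.ext (by simpa using h7)
    exact funext (Fintype.linearIndependent_iff.1 b.linearIndependent c h8)
  by_contra hodd
  rw [Nat.not_even_iff_odd] at hodd
  have h3 := Matrix.det_transpose M
  rw [h1, Matrix.det_neg, Fintype.card_fin, hodd.neg_one_pow, neg_one_mul] at h3
  exact h2 (self_eq_neg.1 h3.symm)

theorem IsNormalVolume.exists_isTopForm [Finite G] [CharZero F] {g : G} {α : ExteriorAlgebra F V}
    (hα : IsNormalVolume ω r g α) (hr : IsSymplecticRep ω r) :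
    ∃ (I : Type) (_ : Fintype I) (_ : DecidableEq I) (b : Module.Basis I F V)
      (l : List I) (s : I → V), l.length = defectRank r g ∧
        AdaptedBasis ω (r g) b l.toFinset s ∧ IsTopForm ω b l α := by
  obtain ⟨m, b, s, hK, h⟩ := hr.exists_adaptedBasis g
  refine ⟨_, inferInstance, inferInstance, b, _, s, by simp, h, hα.isTopForm hr b fun v hv i => ?_⟩
  have h1 : ω (s (Sum.inl i)) ∘ₗ defect r g = b.coord (Sum.inl i) := b.ext fun j => by
    rw [LinearMap.comp_apply, defect_apply, h.dual_moved j (Sum.inl i) (by simp),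
      Module.Basis.coord_apply, b.repr_self, Finsupp.single_apply]
  rw [← h1, LinearMap.comp_apply, hv, map_zero]

end AdaptedBases

/-! ### Quaternionic structures -/

section QuaternionicDet

open Module

variable {V : Type*} [AddCommGroup V] [Module ℂ V]

/-- Antilinear operators of square `-1`. -/
def IsQuaternionic (J : V →ₛₗ[starRingEnd ℂ] V) : Prop := ∀ v, J (J v) = -v

/-- With `x = a v + b J v`, the combination `conj a • x - b • J x` equals `(|a|² + |b|²) • v`. -/
theorem IsQuaternionic.smul_add_eq_zero {J : V →ₛₗ[starRingEnd ℂ] V} (hJ : IsQuaternionic J)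
    {W : Submodule ℂ V} (hW : ∀ v ∈ W, J v ∈ W) {v : V} (hv : v ∉ W) {a b : ℂ}
    (h : a • v + b • J v ∈ W) : a = 0 ∧ b = 0 := by
  have h1 := W.sub_mem (W.smul_mem (starRingEnd ℂ a) h) (W.smul_mem b (hW _ h))
  have h2 : (starRingEnd ℂ a) • (a • v + b • J v) - b • J (a • v + b • J v) =
      ((Complex.normSq a + Complex.normSq b : ℝ) : ℂ) • v := by
    rw [map_add, map_smulₛₗ, map_smulₛₗ, hJ, Complex.ofReal_add, ← Complex.mul_conj,
      ← Complex.mul_conj]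
    module
  rw [h2] at h1
  by_cases h0 : Complex.normSq a + Complex.normSq b = 0
  · have ha := Complex.normSq_nonneg a
    have hb := Complex.normSq_nonneg b
    exact ⟨Complex.normSq_eq_zero.1 (by linarith), Complex.normSq_eq_zero.1 (by linarith)⟩
  · exact absurd ((W.smul_mem_iff (by exact_mod_cast h0)).1 h1) hv

theorem IsQuaternionic.linearIndependent_pair {J : V →ₛₗ[starRingEnd ℂ] V}
    (hJ : IsQuaternionic J) {v : V} (hv : v ≠ 0) : LinearIndependent ℂ ![v, J v] := by
  rw [LinearIndependent.pair_iff]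
  intro a b h
  exact hJ.smul_add_eq_zero (W := ⊥) (by simp) (by simpa using hv) (by simpa using h)

/-- If `u` is an eigenvector for `c`, then `J u` is one for the conjugate of `c`. Their plane
contributes `|c|² > 0`, and the quotient by it is again quaternionic. -/
theorem IsQuaternionic.det_pos [FiniteDimensional ℂ V] {J : V →ₛₗ[starRingEnd ℂ] V}
    (hJ : IsQuaternionic J) (T : End ℂ V) (hT : ∀ v, T (J v) = J (T v))
    (hs : Function.Surjective T) : ∃ t : ℝ, 0 < t ∧ LinearMap.det T = t := by
  obtain ⟨n, hn⟩ : ∃ n, finrank ℂ V = n := ⟨_, rfl⟩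
  induction n using Nat.strong_induction_on generalizing V with
  | _ n ih =>
    rcases subsingleton_or_nontrivial V with hV | hV
    · exact ⟨1, one_pos, by
        rw [Complex.ofReal_one, Subsingleton.elim T LinearMap.id, LinearMap.det_id]⟩
    obtain ⟨c, hc⟩ := End.exists_eigenvalue T
    obtain ⟨u, hu⟩ := hc.exists_hasEigenvector
    have hu1 : T u = c • u := hu.apply_eq_smul
    have hu2 : T (J u) = (starRingEnd ℂ c) • J u := by rw [hT, hu1, map_smulₛₗ]
    have hc0 : c ≠ 0 := by
      rintro rfl
      rw [zero_smul] at hu1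
      exact hu.2 ((LinearMap.injective_iff_surjective.2 hs) (hu1.trans (map_zero T).symm))
    have hli := hJ.linearIndependent_pair hu.2
    let U : Submodule ℂ V := Submodule.span ℂ (Set.range ![u, J u])
    let b : Basis (Fin 2) ℂ U := Basis.span hli
    have hb : ∀ i, (b i : V) = ![u, J u] i := fun i =>
      congrArg Subtype.val (Basis.span_apply hli i)
    have hTU : U ≤ U.comap T := by
      refine Submodule.span_le.2 ?_
      rintro _ ⟨i, rfl⟩
      fin_cases i
      · change T u ∈ U
        rw [hu1]
        exact U.smul_mem _ (Submodule.subset_span ⟨0, rfl⟩)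
      · change T (J u) ∈ U
        rw [hu2]
        exact U.smul_mem _ (Submodule.subset_span ⟨1, rfl⟩)
    have hJU : U ≤ U.comap J := by
      refine Submodule.span_le.2 ?_
      rintro _ ⟨i, rfl⟩
      fin_cases i
      · exact Submodule.subset_span ⟨1, rfl⟩
      · change J (J u) ∈ U
        rw [hJ u]
        exact U.neg_mem (Submodule.subset_span ⟨0, rfl⟩)
    have hdet : LinearMap.det (T.restrict hTU) = ((Complex.normSq c : ℝ) : ℂ) := by
      have h1 : LinearMap.toMatrix b b (T.restrict hTU) = Matrix.diagonal ![c, starRingEnd ℂ c] := by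
        have h2 : ∀ j, T.restrict hTU (b j) = ![c, starRingEnd ℂ c] j • b j := by
          intro j
          refine Subtype.ext ?_
          rw [LinearMap.coe_restrict_apply, hb, Submodule.coe_smul, hb]
          fin_cases j
          · exact hu1
          · exact hu2
        ext i j
        rw [LinearMap.toMatrix_apply, h2, map_smul, b.repr_self, Finsupp.smul_apply,
          Finsupp.single_apply, Matrix.diagonal_apply]
        by_cases h : j = i
        · subst h
          simp
        · simp [h, Ne.symm h]
      rw [← LinearMap.det_toMatrix b, h1, Matrix.det_diagonal, ← Complex.mul_conj]
      simp
    have hfin : finrank ℂ (V ⧸ U) < n := by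
      have h1 := U.finrank_quotient_add_finrank
      have h2 := finrank_eq_card_basis b
      rw [Fintype.card_fin] at h2
      omega
    obtain ⟨t, ht, e⟩ := ih _ hfin (V := V ⧸ U) (J := U.mapQ U J hJU) (fun v => by
        obtain ⟨v, rfl⟩ := U.mkQ_surjective v
        simp only [Submodule.mkQ_apply, Submodule.mapQ_apply, hJ v, Submodule.Quotient.mk_neg])
      (U.mapQ U T hTU) (fun v => by
        obtain ⟨v, rfl⟩ := U.mkQ_surjective v
        simp only [Submodule.mkQ_apply, Submodule.mapQ_apply, hT])
      (fun v => by
        obtain ⟨v, rfl⟩ := U.mkQ_surjective v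
        obtain ⟨w, rfl⟩ := hs v
        exact ⟨U.mkQ w, by simp⟩) rfl
    refine ⟨Complex.normSq c * t, mul_pos (Complex.normSq_pos.2 hc0) ht, ?_⟩
    rw [LinearMap.det_eq_det_mul_det U T hTU, hdet, e, Complex.ofReal_mul]

end QuaternionicDet

/-! ### Invariant Hermitian forms and fourth roots of positive operators. -/

section ExistsQuaternionic

open Module

variable {V G : Type*} [AddCommGroup V] [Module ℂ V] [Group G]

/-- A positive definite Hermitian form. -/
structure IsHermitianPos (H : V →ₛₗ[starRingEnd ℂ] Dual ℂ V) : Prop where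
  conj : ∀ u v, H u v = starRingEnd ℂ (H v u)
  pos : ∀ v, v ≠ 0 → 0 < (H v v).re

theorem exists_invariant_hermitian [Finite G] [FiniteDimensional ℂ V] (r : G →* End ℂ V) :
    ∃ H : V →ₛₗ[starRingEnd ℂ] Dual ℂ V, IsHermitianPos H ∧
      ∀ g u v, H (r g u) (r g v) = H u v := by
  have := Fintype.ofFinite G
  let e := finBasis ℂ V
  let H : V →ₛₗ[starRingEnd ℂ] Dual ℂ V := LinearMap.mk₂'ₛₗ (starRingEnd ℂ) (RingHom.id ℂ)
    (fun u v => ∑ g, ∑ i, starRingEnd ℂ (e.repr (r g u) i) * e.repr (r g v) i)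
    (fun u u' v => by simp [add_mul, Finset.sum_add_distrib])
    (fun t u v => by simp [Finset.mul_sum, mul_assoc])
    (fun u v v' => by simp [mul_add, Finset.sum_add_distrib])
    (fun t u v => by simp [Finset.mul_sum, mul_left_comm])
  have hH : ∀ u v, H u v = ∑ g, ∑ i, starRingEnd ℂ (e.repr (r g u) i) * e.repr (r g v) i :=
    fun u v => rfl
  refine ⟨H, ⟨fun u v => ?_, fun v hv => ?_⟩, fun h u v => ?_⟩
  · simp [hH, mul_comm]
  · have h1 : (H v v).re = ∑ g, ∑ i, Complex.normSq (e.repr (r g v) i) := by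
      rw [hH, Complex.re_sum]
      refine Finset.sum_congr rfl fun g _ => ?_
      rw [Complex.re_sum]
      refine Finset.sum_congr rfl fun i _ => ?_
      rw [mul_comm, Complex.mul_conj, Complex.ofReal_re]
    rw [h1]
    refine Finset.sum_pos' (fun g _ => Finset.sum_nonneg fun i _ => Complex.normSq_nonneg _)
      ⟨1, Finset.mem_univ _, ?_⟩
    obtain ⟨i, hi⟩ : ∃ i, e.repr v i ≠ 0 := by
      by_contra! h
      exact hv (e.repr.map_eq_zero_iff.1 (Finsupp.ext h))
    refine Finset.sum_pos' (fun i _ => Complex.normSq_nonneg _) ⟨i, Finset.mem_univ _, ?_⟩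
    rw [map_one, End.one_apply]
    exact Complex.normSq_pos.2 hi
  · rw [hH, hH]
    refine Fintype.sum_equiv (Equiv.mulRight h) _ _ fun g => ?_
    simp [map_mul]

variable {H : V →ₛₗ[starRingEnd ℂ] Dual ℂ V} {P : End ℂ V}

theorem IsHermitianPos.eq_zero (hH : IsHermitianPos H) {v : V} (hv : H v v = 0) : v = 0 := by
  by_contra h
  have := hH.pos v h
  rw [hv] at this
  exact lt_irrefl _ this

/-- Self-adjointness makes generalised eigenvectors genuine: if `N ^ (k + 2)` kills `v`, then `N ^
(k + 1) v` pairs to zero with itself. Positivity makes the eigenvalues positive. -/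
theorem IsHermitianPos.iSup_eigenspace [FiniteDimensional ℂ V] (hH : IsHermitianPos H)
    (hP : ∀ u v, H (P u) v = H u (P v)) (hpos : ∀ v, v ≠ 0 → 0 < (H v (P v)).re) :
    ⨆ t : {t : ℝ // 0 < t}, End.eigenspace P (t : ℂ) = ⊤ := by
  have heig : ∀ (c : ℂ) (v : V), v ≠ 0 → P v = c • v → ∃ t : ℝ, 0 < t ∧ c = t := by
    intro c v hv hc
    have h1 := hP v v
    have h2 := hpos v hv
    have h3 := hH.pos v hv
    have him : (H v v).im = 0 := by
      have := congrArg Complex.im (hH.conj v v)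
      rw [Complex.conj_im] at this
      linarith
    rw [hc, map_smulₛₗ, LinearMap.smul_apply, map_smul, smul_eq_mul, smul_eq_mul] at h1
    have h4 : H v v ≠ 0 := fun h => by
      rw [h] at h3
      exact lt_irrefl _ h3
    have h5 := mul_right_cancel₀ h4 h1
    obtain ⟨t, rfl⟩ := Complex.conj_eq_iff_real.1 h5
    rw [hc, map_smul, smul_eq_mul, Complex.re_ofReal_mul] at h2
    exact ⟨t, pos_of_mul_pos_left h2 h3.le, rfl⟩
  rw [eq_top_iff, ← End.iSup_maxGenEigenspace_eq_top P]
  refine iSup_le fun c v hv => ?_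
  rw [End.mem_maxGenEigenspace] at hv
  obtain ⟨k, hk⟩ := hv
  by_cases hv0 : v = 0
  · rw [hv0]
    exact Submodule.zero_mem _
  let N : End ℂ V := P - c • 1
  have hN : ∀ v, N v = P v - c • v := fun v => rfl
  have hreal : ∃ t : ℝ, 0 < t ∧ c = t := by
    by_contra hne
    have hinj : ∀ w, N w = 0 → w = 0 := fun w hw => by
      by_contra hw0
      rw [hN, sub_eq_zero] at hw
      exact hne (heig c w hw0 hw)
    have : ∀ k, (N ^ k) v ≠ 0 := by
      intro k
      induction k with
      | zero => simpa using hv0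
      | succ k ih =>
        rw [pow_succ', End.mul_apply]
        exact fun h => ih (hinj _ h)
    exact this k hk
  obtain ⟨t, ht, rfl⟩ := hreal
  have hself : ∀ u v, H (N u) v = H u (N v) := fun u v => by
    rw [hN, hN, map_sub, map_smulₛₗ, LinearMap.sub_apply, hP, LinearMap.smul_apply, map_sub,
      map_smul, Complex.conj_ofReal]
  have hpow : ∀ k, (N ^ (k + 1)) v = 0 → N v = 0 := by
    intro k
    induction k with
    | zero => simp
    | succ k ih =>
      intro h
      refine ih (hH.eq_zero ?_)
      nth_rewrite 1 [pow_succ']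
      rw [End.mul_apply, hself, ← End.mul_apply, ← pow_succ', h, map_zero]
  refine Submodule.mem_iSup_of_mem ⟨t, ht⟩ ?_
  rw [End.mem_eigenspace_iff]
  rcases k with _ | k
  · exact absurd hk hv0
  · have := hpow k hk
    rwa [hN, sub_eq_zero] at this

/-- Inverse fourth roots of positive operators as real polynomials in the operator. -/
theorem exists_fourth_root [FiniteDimensional ℂ V]
    (htop : ⨆ t : {t : ℝ // 0 < t}, End.eigenspace P (t : ℂ) = ⊤) :
    ∃ q : Polynomial ℝ, ∀ v, Polynomial.aeval P (q.map Complex.ofRealHom)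
      (Polynomial.aeval P (q.map Complex.ofRealHom) (Polynomial.aeval P (q.map Complex.ofRealHom)
        (Polynomial.aeval P (q.map Complex.ofRealHom) (P v)))) = v := by
  classical
  -- The nodes include all eigenvalues, which are real. Interpolating `t ↦ t ^ (-1/4)` there gives
  -- real coefficients, so the result will also commute with antilinear maps.
  let S : Finset ℝ := (minpoly ℂ P).roots.toFinset.image Complex.re
  let q := Lagrange.interpolate S id fun t => (√(√t))⁻¹
  refine ⟨q, fun v => ?_⟩
  set C := Polynomial.aeval P (q.map Complex.ofRealHom) with hC
  have key : ⊤ ≤ LinearMap.eqLocus (C * C * C * C * P) LinearMap.id := by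
    rw [← htop]
    refine iSup_le fun t w hw => ?_
    rw [End.mem_eigenspace_iff] at hw
    rw [LinearMap.mem_eqLocus]
    by_cases hw0 : w = 0
    · rw [hw0, map_zero, map_zero]
    have ht : (t : ℝ) ∈ S := by
      refine Finset.mem_image.2 ⟨((t : ℝ) : ℂ), ?_, Complex.ofReal_re _⟩
      rw [Multiset.mem_toFinset, Polynomial.mem_roots (minpoly.ne_zero
        (Algebra.IsIntegral.isIntegral P))]
      exact End.isRoot_of_hasEigenvalue
        (End.hasEigenvalue_of_hasEigenvector ⟨End.mem_eigenspace_iff.2 hw, hw0⟩)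
    have hq : q.eval (t : ℝ) = (√(√t))⁻¹ :=
      Lagrange.eval_interpolate_at_node _ (Set.injOn_id _) ht
    have hCw : C w = ((√(√t) : ℝ) : ℂ)⁻¹ • w := by
      have h1 := End.aeval_apply_of_hasEigenvector (p := q.map Complex.ofRealHom)
        ⟨End.mem_eigenspace_iff.2 hw, hw0⟩
      rw [hC, h1]
      have h2 : Polynomial.eval ((t : ℝ) : ℂ) (q.map Complex.ofRealHom) = ((q.eval (t : ℝ) : ℝ) : ℂ) :=
        Polynomial.eval_map_apply (f := Complex.ofRealHom) (p := q) (t : ℝ)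
      rw [h2, hq, Complex.ofReal_inv]
    simp only [End.mul_apply, hw, map_smul, hCw, smul_smul, LinearMap.id_apply]
    have h3 : (√(√t) : ℝ) ^ 4 = t := by
      rw [show 4 = 2 * 2 from rfl, pow_mul, Real.sq_sqrt (Real.sqrt_nonneg _),
        Real.sq_sqrt t.2.le]
    have h4 : ((√(√t) : ℝ) : ℂ) ≠ 0 := by
      exact_mod_cast (Real.sqrt_pos.2 (Real.sqrt_pos.2 t.2)).ne'
    have h5 : ((t : ℝ) : ℂ) = ((√(√t) : ℝ) : ℂ) ^ 4 := by
      rw [← Complex.ofReal_pow, h3]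
    rw [h5]
    have h6 : ∀ z : ℂ, z ≠ 0 → z ^ 4 * (z⁻¹ * (z⁻¹ * (z⁻¹ * z⁻¹))) = 1 := fun z hz => by
      field_simp
    rw [h6 _ h4, one_smul]
  exact key (Submodule.mem_top (x := v))

end ExistsQuaternionic

/-! ### Existence of an invariant quaternionic structure. -/

section InvariantQuaternionic

open Module

variable {V G : Type*} [AddCommGroup V] [Module ℂ V] [Group G]
  {H : V →ₛₗ[starRingEnd ℂ] Dual ℂ V} {P : End ℂ V}

/-- Additivity and linearity over the reals suffice, so this covers both the linear group action and
an antilinear operator. -/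
theorem map_aeval_of_commute (Φ : V →+ V) (hP : ∀ v, Φ (P v) = P (Φ v))
    (hs : ∀ (t : ℝ) v, Φ ((t : ℂ) • v) = (t : ℂ) • Φ v) (q : Polynomial ℝ) (v : V) :
    Φ (Polynomial.aeval P (q.map Complex.ofRealHom) v) =
      Polynomial.aeval P (q.map Complex.ofRealHom) (Φ v) := by
  have hk : ∀ (k : ℕ) v, Φ ((P ^ k) v) = (P ^ k) (Φ v) := by
    intro k
    induction k with
    | zero => simp
    | succ k ih =>
      intro v
      rw [pow_succ, End.mul_apply, ih, hP, End.mul_apply]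
  induction q using Polynomial.induction_on' with
  | add p q hp hq =>
    rw [Polynomial.map_add, map_add, LinearMap.add_apply, map_add, hp, hq, LinearMap.add_apply]
  | monomial k t =>
    rw [Polynomial.map_monomial, Polynomial.aeval_monomial, End.mul_apply,
      Module.algebraMap_end_apply, End.mul_apply, Module.algebraMap_end_apply]
    exact (hs t _).trans (by rw [hk]; rfl)

theorem hermitian_aeval (hP : ∀ u v, H (P u) v = H u (P v)) (q : Polynomial ℝ) (u v : V) :
    H (Polynomial.aeval P (q.map Complex.ofRealHom) u) v =
      H u (Polynomial.aeval P (q.map Complex.ofRealHom) v) := by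
  have hk : ∀ (k : ℕ) u v, H ((P ^ k) u) v = H u ((P ^ k) v) := by
    intro k
    induction k with
    | zero => simp
    | succ k ih =>
      intro u v
      rw [pow_succ, End.mul_apply, ih, hP, ← End.mul_apply, ← pow_succ', pow_succ]
  induction q using Polynomial.induction_on' with
  | add p q hp hq =>
    rw [Polynomial.map_add, map_add, LinearMap.add_apply, map_add, LinearMap.add_apply, hp, hq,
      LinearMap.add_apply, map_add]
  | monomial k t =>
    rw [Polynomial.map_monomial, Polynomial.aeval_monomial, End.mul_apply,
      Module.algebraMap_end_apply, End.mul_apply, Module.algebraMap_end_apply, map_smulₛₗ,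
      LinearMap.smul_apply, hk, map_smul]
    congr 1
    exact Complex.conj_ofReal t

/-- A polar decomposition. Define the antilinear `B` by `ω (B u) v = H u v` for an invariant
Hermitian form `H`. Then `P = -B ^ 2` is positive and self-adjoint. With `C = P ^ (-1/4)` and `J = B
C ^ 2`, one gets `J ^ 2 = -1` and `ω (J u) v = H (C u) (C v)`. -/
theorem IsSymplecticRep.exists_quaternionic [Finite G] [FiniteDimensional ℂ V]
    {ω : V →ₗ[ℂ] V →ₗ[ℂ] ℂ} {r : G →* End ℂ V} (hr : IsSymplecticRep ω r) :
    ∃ J : V →ₛₗ[starRingEnd ℂ] V, IsQuaternionic J ∧ (∀ g v, J (r g v) = r g (J v)) ∧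
      IsHermitianPos (LinearMap.comp ω J) := by
  obtain ⟨H, hH, hinv⟩ := exists_invariant_hermitian r
  have hinj : Function.Injective ω := (LinearMap.injective_iff_surjective_of_finrank_eq_finrank
      (Subspace.dual_finrank_eq (K := ℂ) (V := V)).symm).2 hr.surjective
  let Ω : V ≃ₗ[ℂ] Dual ℂ V := LinearEquiv.ofBijective ω ⟨hinj, hr.surjective⟩
  let B : V →ₛₗ[starRingEnd ℂ] V := LinearMap.comp (Ω.symm : Dual ℂ V →ₗ[ℂ] V) H
  have hB : ∀ u v, ω (B u) v = H u v := fun u v =>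
    LinearMap.congr_fun (Ω.apply_symm_apply (H u)) v
  have hg : ∀ g v, ∃ v', r g v' = v := fun g v => ⟨r g⁻¹ v, by
    rw [← End.mul_apply, ← map_mul, mul_inv_cancel, map_one, End.one_apply]⟩
  have hBg : ∀ g u, B (r g u) = r g (B u) := fun g u => by
    refine hinj (LinearMap.ext fun v => ?_)
    obtain ⟨v, rfl⟩ := hg g v
    rw [hB, hinv, hr.isometry, hB]
  let P : End ℂ V := -(LinearMap.comp B B)
  have hP : ∀ v, P v = -B (B v) := fun v => rfl
  have hHP : ∀ u v, H u (P v) = H (B v) (B u) := fun u v => by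
    rw [hP, map_neg, ← hB, hr.skew, neg_neg, hB]
  have hself : ∀ u v, H (P u) v = H u (P v) := fun u v => by
    rw [hH.conj, hHP, ← hH.conj, hHP]
  have hpos : ∀ v, v ≠ 0 → 0 < (H v (P v)).re := fun v hv => by
    rw [hHP]
    refine hH.pos _ fun h => hv (hH.eq_zero ?_)
    rw [← hB, h, map_zero, LinearMap.zero_apply]
  obtain ⟨q, hq⟩ := exists_fourth_root (hH.iSup_eigenspace hself hpos)
  set C := Polynomial.aeval P (q.map Complex.ofRealHom) with hC
  have hBC : ∀ v, B (C v) = C (B v) := map_aeval_of_commute B.toAddMonoidHom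
    (fun v => by simp [hP])
    (fun t v => (map_smulₛₗ B (t : ℂ) v).trans (by rw [Complex.conj_ofReal]; rfl)) q
  have hPC : ∀ v, P (C v) = C (P v) := map_aeval_of_commute P.toAddMonoidHom
    (fun v => rfl) (fun t v => map_smul P (t : ℂ) v) q
  have hgC : ∀ g v, r g (C v) = C (r g v) := fun g => map_aeval_of_commute (r g).toAddMonoidHom
    (fun v => by simp [hP, hBg]) (fun t v => map_smul (r g) (t : ℂ) v) q
  have hCself : ∀ u v, H (C u) v = H u (C v) := hermitian_aeval hself q
  have hCinj : ∀ v, C v = 0 → v = 0 := fun v hv => by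
    rw [← hq v, ← hPC, ← hPC, ← hPC, ← hPC, hv]
    simp
  let J : V →ₛₗ[starRingEnd ℂ] V := LinearMap.comp B (C * C)
  have hJ : ∀ v, J v = B (C (C v)) := fun v => rfl
  have hωJ : ∀ u v, (LinearMap.comp ω J) u v = H (C u) (C v) := fun u v => by
    rw [LinearMap.comp_apply, hJ, hB, hCself]
  refine ⟨J, fun v => ?_, fun g v => ?_, fun u v => ?_, fun v hv => ?_⟩
  · rw [hJ, hJ]
    rw [← hBC, ← hBC, ← neg_eq_iff_eq_neg, ← hP, hPC, hPC, hPC, hPC, hq]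
  · rw [hJ, hJ, ← hgC, ← hgC, hBg]
  · rw [hωJ, hωJ, hH.conj]
  · rw [hωJ]
    exact hH.pos _ fun h => hv (hCinj v h)

end InvariantQuaternionic

/-! ### The orientation of quaternionic subspaces. -/

section QuaternionicFrame

open Module ExteriorAlgebra

variable {V : Type*} [AddCommGroup V] [Module ℂ V] {J : V →ₛₗ[starRingEnd ℂ] V}

/-- The family `u i, J (u i)`. -/
def quatFrame (J : V →ₛₗ[starRingEnd ℂ] V) {m : ℕ} (u : Fin m → V) (k : Fin m × Fin 2) : V :=
  if k.2 = 0 then u k.1 else J (u k.1)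

@[simp] theorem quatFrame_zero {m : ℕ} (u : Fin m → V) (i : Fin m) :
    quatFrame J u (i, 0) = u i := rfl

@[simp] theorem quatFrame_one {m : ℕ} (u : Fin m → V) (i : Fin m) :
    quatFrame J u (i, 1) = J (u i) := rfl

theorem IsQuaternionic.map_mem_span (hJ : IsQuaternionic J) {m : ℕ} (u : Fin m → V) :
    ∀ v ∈ Submodule.span ℂ (Set.range (quatFrame J u)),
      J v ∈ Submodule.span ℂ (Set.range (quatFrame J u)) := by
  have h : Submodule.span ℂ (Set.range (quatFrame J u)) ≤
      (Submodule.span ℂ (Set.range (quatFrame J u))).comap J := by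
    refine Submodule.span_le.2 ?_
    rintro _ ⟨⟨i, k⟩, rfl⟩
    fin_cases k
    · exact Submodule.subset_span ⟨(i, 1), rfl⟩
    · change J (J (u i)) ∈ Submodule.span ℂ (Set.range (quatFrame J u))
      rw [hJ]
      exact Submodule.neg_mem _ (Submodule.subset_span ⟨(i, 0), rfl⟩)
  exact h

theorem IsQuaternionic.linearIndependent_cons (hJ : IsQuaternionic J) {m : ℕ} {u : Fin m → V}
    (hu : LinearIndependent ℂ (quatFrame J u)) {w : V}
    (hw : w ∉ Submodule.span ℂ (Set.range (quatFrame J u))) :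
    LinearIndependent ℂ (quatFrame J (Fin.cons w u : Fin (m + 1) → V)) := by
  rw [Fintype.linearIndependent_iff] at hu ⊢
  intro c hc
  rw [Fintype.sum_prod_type, Fin.sum_univ_succ] at hc
  simp only [Fin.sum_univ_two, quatFrame_zero, quatFrame_one, Fin.cons_zero, Fin.cons_succ] at hc
  have h1 : ∑ i : Fin m, (c (i.succ, 0) • u i + c (i.succ, 1) • J (u i)) ∈
      Submodule.span ℂ (Set.range (quatFrame J u)) :=
    Submodule.sum_mem _ fun i _ => Submodule.add_mem _
      (Submodule.smul_mem _ _ (Submodule.subset_span ⟨(i, 0), rfl⟩))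
      (Submodule.smul_mem _ _ (Submodule.subset_span ⟨(i, 1), rfl⟩))
  have h2 : c (0, 0) = 0 ∧ c (0, 1) = 0 := by
    refine hJ.smul_add_eq_zero (hJ.map_mem_span u) hw ?_
    rw [eq_neg_of_add_eq_zero_left hc]
    exact Submodule.neg_mem _ h1
  rw [h2.1, h2.2, zero_smul, zero_smul, zero_add, zero_add] at hc
  have h3 := hu (fun k => c (k.1.succ, k.2)) (by
    rw [Fintype.sum_prod_type]
    simpa only [Fin.sum_univ_two, quatFrame_zero, quatFrame_one] using hc)
  rintro ⟨i, k⟩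
  refine Fin.cases ?_ (fun i => h3 (i, k)) i
  fin_cases k
  · exact h2.1
  · exact h2.2

/-- A stable subspace that is not yet exhausted contains another independent pair `w, J w`. If no
frame spanned, there would be independent families of every length. -/
theorem IsQuaternionic.exists_frame [FiniteDimensional ℂ V] (hJ : IsQuaternionic J)
    (W : Submodule ℂ V) (hW : ∀ v ∈ W, J v ∈ W) :
    ∃ (m : ℕ) (u : Fin m → V), LinearIndependent ℂ (quatFrame J u) ∧
      Submodule.span ℂ (Set.range (quatFrame J u)) = W := by
  by_contra! hne
  have key : ∀ m : ℕ, ∃ u : Fin m → V, LinearIndependent ℂ (quatFrame J u) ∧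
      Submodule.span ℂ (Set.range (quatFrame J u)) ≤ W := by
    intro m
    induction m with
    | zero => exact ⟨Fin.elim0, linearIndependent_empty_type, by
        rw [Set.range_eq_empty, Submodule.span_empty]
        exact bot_le⟩
    | succ m ih =>
      obtain ⟨u, hu, hle⟩ := ih
      obtain ⟨w, hw, hw'⟩ := SetLike.exists_of_lt (lt_of_le_of_ne hle (hne m u hu))
      refine ⟨Fin.cons w u, hJ.linearIndependent_cons hu hw', Submodule.span_le.2 ?_⟩
      rintro _ ⟨⟨i, k⟩, rfl⟩
      have hmem : (Fin.cons w u : Fin (m + 1) → V) i ∈ W := by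
        refine Fin.cases hw (fun i => ?_) i
        exact hle (Submodule.subset_span ⟨(i, 0), rfl⟩)
      fin_cases k
      · exact hmem
      · exact hW _ hmem
  obtain ⟨u, hu, -⟩ := key (finrank ℂ V + 1)
  have := hu.fintype_card_le_finrank
  rw [Fintype.card_prod, Fintype.card_fin, Fintype.card_fin] at this
  omega

/-- Positive multiples of the products `∏ ι (u i) * ι (J (u i))`. -/
def IsQuatPositive (J : V →ₛₗ[starRingEnd ℂ] V) (x : ExteriorAlgebra ℂ V) : Prop :=
  ∃ (m : ℕ) (u : Fin m → V) (t : ℝ), 0 < t ∧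
    x = (t : ℂ) • ιMulti ℂ (m * 2) fun k => quatFrame J u (finProdFinEquiv.symm k)

theorem ιMulti_quatFrame {m : ℕ} (u : Fin m → V) :
    ιMulti ℂ (m * 2) (fun k => quatFrame J u (finProdFinEquiv.symm k)) =
      (List.ofFn fun i => ι ℂ (u i) * ι ℂ (J (u i))).prod := by
  rw [ιMulti_apply, List.ofFn_mul, List.prod_flatten, List.map_ofFn]
  congr 1
  refine congrArg List.ofFn (funext fun i => ?_)
  rw [Function.comp_apply, List.ofFn_succ, List.ofFn_succ, List.ofFn_zero, List.prod_cons,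
    List.prod_cons, List.prod_nil, mul_one]
  have e : ∀ j : Fin 2, ∀ hj, finProdFinEquiv.symm (⟨i * 2 + j, hj⟩ : Fin (m * 2)) = (i, j) := by
    intro j hj
    rw [Equiv.symm_apply_eq]
    ext
    simp [finProdFinEquiv, mul_comm, add_comm]
  congr 2
  · exact congrArg (quatFrame J u) (e 0 _)
  · exact congrArg (quatFrame J u) (e 1 _)

theorem IsQuatPositive.mul {x y : ExteriorAlgebra ℂ V} (hx : IsQuatPositive J x)
    (hy : IsQuatPositive J y) : IsQuatPositive J (x * y) := by
  obtain ⟨m, u, t, ht, rfl⟩ := hx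
  obtain ⟨m', u', t', ht', rfl⟩ := hy
  refine ⟨m + m', Fin.append u u', t * t', mul_pos ht ht', ?_⟩
  rw [ιMulti_quatFrame, ιMulti_quatFrame, ιMulti_quatFrame, smul_mul_smul_comm, Complex.ofReal_mul,
    ← List.prod_append, ← List.ofFn_fin_append]
  congr 3
  funext i
  refine Fin.addCases (fun i => ?_) (fun i => ?_) i <;> simp

theorem IsQuatPositive.map {x : ExteriorAlgebra ℂ V} (hx : IsQuatPositive J x) {T : End ℂ V}
    (hT : ∀ v, J (T v) = T (J v)) : IsQuatPositive J (ExteriorAlgebra.map T x) := by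
  obtain ⟨m, u, t, ht, rfl⟩ := hx
  refine ⟨m, fun i => T (u i), t, ht, ?_⟩
  rw [map_smul, ιMulti_quatFrame, ιMulti_quatFrame, map_list_prod, List.map_ofFn]
  congr 3
  funext i
  simp [hT]

/-- The operator that takes one frame to the other commutes with `J`, so `IsQuaternionic.det_pos`
applies on their span. -/
theorem IsQuaternionic.frame_det_pos [FiniteDimensional ℂ V] (hJ : IsQuaternionic J) {m : ℕ}
    {u u' : Fin m → V} (hu : LinearIndependent ℂ (quatFrame J u))
    (hu' : LinearIndependent ℂ (quatFrame J u')) (T : Matrix (Fin m × Fin 2) (Fin m × Fin 2) ℂ)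
    (hT : ∀ i, ∑ j, T i j • quatFrame J u j = quatFrame J u' i) : ∃ t : ℝ, 0 < t ∧ T.det = t := by
  let W := Submodule.span ℂ (Set.range (quatFrame J u))
  let b : Basis (Fin m × Fin 2) ℂ W := Basis.span hu
  have hb : ∀ i, (b i : V) = quatFrame J u i := fun i =>
    congrArg Subtype.val (Basis.span_apply hu i)
  have hmem : ∀ i, quatFrame J u' i ∈ W := fun i => by
    rw [← hT]
    exact Submodule.sum_mem _ fun j _ => Submodule.smul_mem _ _ (Submodule.subset_span ⟨j, rfl⟩)
  let b' : Fin m × Fin 2 → W := fun i => ⟨quatFrame J u' i, hmem i⟩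
  let D : End ℂ W := b.constr ℂ b'
  let JW : W →ₛₗ[starRingEnd ℂ] W := J.restrict (hJ.map_mem_span u)
  have hJW : IsQuaternionic JW := fun v => Subtype.ext (hJ v)
  have hJb : ∀ i, JW (b (i, 0)) = b (i, 1) ∧ JW (b (i, 1)) = -b (i, 0) := fun i =>
    ⟨Subtype.ext ((congrArg J (hb _)).trans (hb (i, 1)).symm),
      Subtype.ext ((congrArg J (hb _)).trans ((hJ _).trans (congrArg Neg.neg (hb (i, 0)).symm)))⟩
  have hJb' : ∀ i, JW (b' (i, 0)) = b' (i, 1) ∧ JW (b' (i, 1)) = -b' (i, 0) := fun i =>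
    ⟨rfl, Subtype.ext (hJ _)⟩
  have hcomm : ∀ v, D (JW v) = JW (D v) := by
    have : LinearMap.comp D JW = LinearMap.comp JW D := by
      refine b.ext ?_
      rintro ⟨i, k⟩
      fin_cases k
      · change D (JW (b (i, 0))) = JW (D (b (i, 0)))
        rw [(hJb i).1, b.constr_basis, b.constr_basis, (hJb' i).1]
      · change D (JW (b (i, 1))) = JW (D (b (i, 1)))
        rw [(hJb i).2, map_neg, b.constr_basis, b.constr_basis, (hJb' i).2]
    exact fun v => LinearMap.congr_fun this v
  have hli : LinearIndependent ℂ b' := LinearIndependent.of_comp W.subtype hu'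
  have hsurj : Function.Surjective D := by
    refine LinearMap.injective_iff_surjective.1 ?_
    rw [← LinearMap.ker_eq_bot, LinearMap.ker_eq_bot']
    intro v hv
    replace hv : ∑ i, b.equivFun v i • b' i = 0 := (b.constr_apply_fintype ℂ b' v).symm.trans hv
    exact b.equivFun.map_eq_zero_iff.1 (funext (Fintype.linearIndependent_iff.1 hli _ hv))
  obtain ⟨t, ht, e⟩ := hJW.det_pos D hcomm hsurj
  refine ⟨t, ht, ?_⟩
  rw [← e, ← LinearMap.det_toMatrix b, ← Matrix.det_transpose]
  congr 1
  ext i j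
  have h1 : b' j = ∑ k, T j k • b k := Subtype.ext (by
    rw [Submodule.coe_sum]
    simp only [Submodule.coe_smul, hb, hT]
    rfl)
  rw [LinearMap.toMatrix_apply, b.constr_basis, h1, Matrix.transpose_apply, b.repr_sum_self]

/-- Frames of opposite multivectors would span the same subspace, and the determinant between them
would be both positive and negative. -/
theorem IsQuatPositive.not_neg [FiniteDimensional ℂ V] (hJ : IsQuaternionic J)
    {x : ExteriorAlgebra ℂ V} (hx : IsQuatPositive J x) (hx0 : x ≠ 0) : ¬IsQuatPositive J (-x) := by
  rintro ⟨m', u', t', ht', e⟩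
  obtain ⟨m, u, t, ht, rfl⟩ := hx
  have h1 := right_ne_zero_of_smul hx0
  have h2 := right_ne_zero_of_smul (e ▸ neg_ne_zero.2 hx0)
  have hli : LinearIndependent ℂ (quatFrame J u) :=
    (linearIndependent_equiv finProdFinEquiv.symm).1 (linearIndependent_of_ιMulti_ne_zero h1)
  have hli' : LinearIndependent ℂ (quatFrame J u') :=
    (linearIndependent_equiv finProdFinEquiv.symm).1 (linearIndependent_of_ιMulti_ne_zero h2)
  have hr : ∀ (m : ℕ) (u : Fin m → V), Set.range (fun k => quatFrame J u (finProdFinEquiv.symm k)) =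
      Set.range (quatFrame J u) := fun m u => 
    finProdFinEquiv.symm.surjective.range_comp (quatFrame J u)
  have hspan : Submodule.span ℂ (Set.range (quatFrame J u)) =
      Submodule.span ℂ (Set.range (quatFrame J u')) := by
    ext v
    rw [← hr, ← hr,
      ← ι_mul_ιMulti_eq_zero_iff (linearIndependent_of_ιMulti_ne_zero h1),
      ← ι_mul_ιMulti_eq_zero_iff (linearIndependent_of_ιMulti_ne_zero h2)]
    have h3 := congrArg (fun z => ι ℂ v * z) e
    simp only [mul_neg, mul_smul_comm] at h3
    have ht0 : (t : ℂ) ≠ 0 := by exact_mod_cast ht.ne'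
    have ht0' : (t' : ℂ) ≠ 0 := by exact_mod_cast ht'.ne'
    constructor
    · intro h
      rw [h, smul_zero, neg_zero, eq_comm] at h3
      exact (smul_eq_zero.1 h3).resolve_left ht0'
    · intro h
      rw [h, smul_zero, neg_eq_zero] at h3
      exact (smul_eq_zero.1 h3).resolve_left ht0
  obtain rfl : m = m' := by
    have h4 := finrank_span_eq_card hli
    have h5 := finrank_span_eq_card hli'
    rw [hspan, h5, Fintype.card_prod, Fintype.card_prod, Fintype.card_fin, Fintype.card_fin,
      Fintype.card_fin] at h4
    omega
  have hT : ∀ i, ∃ c : Fin m × Fin 2 → ℂ, ∑ j, c j • quatFrame J u j = quatFrame J u' i := fun i =>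
    (Submodule.mem_span_range_iff_exists_fun ℂ).1 (hspan ▸ Submodule.subset_span ⟨i, rfl⟩)
  choose T hT using hT
  obtain ⟨s, hs, hdet⟩ := hJ.frame_det_pos hli hli' T hT
  have h6 : ιMulti ℂ (m * 2) (fun k => quatFrame J u' (finProdFinEquiv.symm k)) =
      (s : ℂ) • ιMulti ℂ (m * 2) fun k => quatFrame J u (finProdFinEquiv.symm k) := by
    have h7 := ιMulti_sum_smul (F := ℂ)
      (Matrix.of fun i j : Fin (m * 2) => T (finProdFinEquiv.symm i) (finProdFinEquiv.symm j))
      fun k => quatFrame J u (finProdFinEquiv.symm k)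
    have h8 : (Matrix.of fun i j : Fin (m * 2) =>
        T (finProdFinEquiv.symm i) (finProdFinEquiv.symm j)).det = s := by
      rw [← hdet]
      exact Matrix.det_submatrix_equiv_self finProdFinEquiv.symm (Matrix.of T)
    rw [← h8, ← h7]
    congr 1
    funext k
    rw [← hT]
    exact (Equiv.sum_comp finProdFinEquiv.symm fun j =>
      T (finProdFinEquiv.symm k) j • quatFrame J u j).symm
  rw [h6, smul_smul, ← neg_smul] at e
  have h9 := smul_left_injective ℂ h1 e
  have h10 : -t = t' * s := by exact_mod_cast h9
  nlinarith [mul_pos ht' hs]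

end QuaternionicFrame

/-! ### Positive normalised volumes over the complex numbers. -/

section PositiveVolume

open Module ExteriorAlgebra
open scoped ComplexOrder Matrix Kronecker

variable {V G : Type*} [AddCommGroup V] [Module ℂ V] {J : V →ₛₗ[starRingEnd ℂ] V}
  {ω : V →ₗ[ℂ] V →ₗ[ℂ] ℂ}

theorem IsHermitianPos.gram_det_pos {H : V →ₛₗ[starRingEnd ℂ] Dual ℂ V} (hH : IsHermitianPos H)
    {I : Type*} [Fintype I] [DecidableEq I] {y : I → V} (hy : LinearIndependent ℂ y) :
    ∃ t : ℝ, 0 < t ∧ (Matrix.of fun i j => H (y i) (y j)).det = t := by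
  have h : (Matrix.of fun i j => H (y i) (y j)).PosDef := by
    refine Matrix.PosDef.of_dotProduct_mulVec_pos ?_ fun x hx => ?_
    · ext i j
      exact (hH.conj (y i) (y j)).symm
    · have h1 : star x ⬝ᵥ (Matrix.of fun i j => H (y i) (y j)) *ᵥ x =
          H (∑ i, x i • y i) (∑ i, x i • y i) := by
        rw [map_sum H, LinearMap.sum_apply]
        refine Finset.sum_congr rfl fun i _ => ?_
        rw [map_smulₛₗ, LinearMap.smul_apply, map_sum]
        refine congrArg (starRingEnd ℂ (x i) * ·) (Finset.sum_congr rfl fun j _ => ?_)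
        rw [map_smul, smul_eq_mul, mul_comm]
        rfl
      rw [h1]
      have h2 : ∑ i, x i • y i ≠ 0 := fun h0 =>
        hx (funext (Fintype.linearIndependent_iff.1 hy x h0))
      have h3 := congrArg Complex.im (hH.conj (∑ i, x i • y i) (∑ i, x i • y i))
      rw [Complex.conj_im] at h3
      exact Complex.lt_def.2 ⟨hH.pos _ h2, by rw [Complex.zero_im]; linarith⟩
  have h4 := Complex.lt_def.1 h.det_pos
  exact ⟨_, h4.1, Complex.ext rfl h4.2.symm⟩

/-- Up to signs `J` permutes the frame, by a block diagonal matrix of determinant one. So this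
determinant equals that of the positive Hermitian form `ω (J u) v`. -/
theorem IsQuaternionic.gram_det_pos (hJ : IsQuaternionic J)
    (hpos : IsHermitianPos (LinearMap.comp ω J)) {m : ℕ} {u : Fin m → V}
    (hu : LinearIndependent ℂ (quatFrame J u)) :
    ∃ t : ℝ, 0 < t ∧ (Matrix.of fun i j => ω (quatFrame J u i) (quatFrame J u j)).det = t := by
  obtain ⟨t, ht, e⟩ := hpos.gram_det_pos hu
  refine ⟨t, ht, ?_⟩
  have h1 : (Matrix.of fun i j => ω (quatFrame J u i) (quatFrame J u j)) =
      ((1 : Matrix (Fin m) (Fin m) ℂ) ⊗ₖ !![0, -1; 1, 0]) *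
        Matrix.of fun i j => (LinearMap.comp ω J) (quatFrame J u i) (quatFrame J u j) := by
    ext ⟨i, k⟩ j
    rw [Matrix.mul_apply, Fintype.sum_prod_type, Finset.sum_eq_single i]
    · rw [Fin.sum_univ_two]
      fin_cases k <;> simp [hJ (u i)]
    · intro i' _ hi'
      simp [Matrix.one_apply_ne' hi']
    · simp
  rw [h1, Matrix.det_mul, Matrix.det_kronecker, e]
  simp

variable [Group G] {r : G →* End ℂ V}

/-- In a quaternionic frame of the image of `1 - g`, the Gram matrix is the matrix of `1 - g` times
the Gram matrix of `ω`. Both determinants are positive, so the normalising factor is a positive real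
number. -/
theorem IsQuaternionic.exists_isNormalVolume [Finite G] [FiniteDimensional ℂ V]
    (hJ : IsQuaternionic J) (hJr : ∀ g v, J (r g v) = r g (J v))
    (hpos : IsHermitianPos (LinearMap.comp ω J)) (g : G) :
    ∃ α, IsNormalVolume ω r g α ∧ IsQuatPositive J α := by
  have hJd : ∀ v, J (defect r g v) = defect r g (J v) := fun v => by
    rw [defect_apply, defect_apply, map_sub, hJr]
  obtain ⟨m, u, hu, hspan⟩ := hJ.exists_frame (LinearMap.range (defect r g)) (by
    rintro _ ⟨v, rfl⟩
    exact ⟨J v, (hJd v).symm⟩)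
  have hframe : ∀ k, quatFrame J (fun i => defect r g (u i)) k = defect r g (quatFrame J u k) := by
    rintro ⟨i, k⟩
    fin_cases k
    · rfl
    · exact hJd (u i)
  have hu' : LinearIndependent ℂ (quatFrame J fun i => defect r g (u i)) := by
    rw [funext hframe]
    refine hu.map ?_
    rw [hspan]
    exact (isCompl_ker_range_defect r g).disjoint.symm
  have hM : ∀ i, ∃ c : Fin m × Fin 2 → ℂ,
      ∑ j, c j • quatFrame J u j = quatFrame J (fun i => defect r g (u i)) i := fun i =>
    (Submodule.mem_span_range_iff_exists_fun ℂ).1 (by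
      rw [hspan, hframe]
      exact ⟨_, rfl⟩)
  choose M hM using hM
  obtain ⟨t, ht, hdet⟩ := hJ.frame_det_pos hu hu' M hM
  obtain ⟨s, hs, hdet'⟩ := hJ.gram_det_pos hpos hu
  let y : Fin (m * 2) → V := fun k => quatFrame J u (finProdFinEquiv.symm k)
  have hy : ∀ k, defect r g (y k) =
      quatFrame J (fun i => defect r g (u i)) (finProdFinEquiv.symm k) := fun k => (hframe _).symm
  have hgram : (defectGram ω r g y).det = ((t * s : ℝ) : ℂ) := by
    replace hdet : (Matrix.of M).det = t := hdet
    rw [Complex.ofReal_mul, ← hdet, ← hdet', ← Matrix.det_mul (Matrix.of M),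
      ← Matrix.det_submatrix_equiv_self finProdFinEquiv.symm]
    congr 1
    ext i j
    rw [defectGram_apply, hy, ← hM, map_sum, LinearMap.sum_apply, Matrix.submatrix_apply,
      Matrix.mul_apply]
    refine Finset.sum_congr rfl fun k _ => ?_
    rw [map_smul]
    rfl
  have hts := mul_pos ht hs
  refine ⟨_, ⟨m * 2, y, ((√(t * s))⁻¹ : ℝ), ?_, ?_, rfl⟩, m, fun i => defect r g (u i),
    (√(t * s))⁻¹, inv_pos.2 (Real.sqrt_pos.2 hts), by simp only [hy]⟩
  · rw [defectRank, ← hspan, finrank_span_eq_card hu, Fintype.card_prod, Fintype.card_fin,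
      Fintype.card_fin]
  · rw [hgram, ← Complex.ofReal_pow, inv_pow, Real.sq_sqrt hts.le, ← Complex.ofReal_mul,
      inv_mul_cancel₀ hts.ne', Complex.ofReal_one]

end PositiveVolume

/-! ### Compatible families of normal volumes -/

section NormalSystem

variable {F V G : Type*} [Field F] [AddCommGroup V] [Module F V] [Group G]

/-- Compatible choices of the signs of normal volumes. -/
structure IsNormalSystem (ω : V →ₗ[F] V →ₗ[F] F) (r : G →* Module.End F V)
    (α : G → ExteriorAlgebra F V) : Prop where
  normal : ∀ g, IsNormalVolume ω r g (α g)
  map : ∀ h g, ExteriorAlgebra.map (r h) (α g) = α (h * g * h⁻¹)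
  mul : ∀ g h, Disjoint (LinearMap.range (defect r g)) (LinearMap.range (defect r h)) →
    α g * α h = α (g * h)
  one : α 1 = 1

theorem IsNormalSystem.isTwistedVolume {F V G : Type u} [Field F] [AddCommGroup V] [Module F V]
    [Group G] {ω : V →ₗ[F] V →ₗ[F] F} {r : G →* Module.End F V} {α : G → ExteriorAlgebra F V}
    [Finite G] [CharZero F] [FiniteDimensional F V] (hα : IsNormalSystem ω r α) (hr : IsSymplecticRep ω r) :
    IsTwistedVolume ω r (defectRank r) α where
  even g := hr.even_defectRank g
  map := hα.map
  mul_eq g h e := hα.mul g h (disjoint_of_defectRank_mul e)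
  mul_eq_zero g h e := (hα.normal g).mul_eq_zero (hα.normal h) fun hd =>
    e ((hα.normal g).mul (hα.normal h) hr hd).1
  deg_one := by
    rw [defectRank, defect, map_one, sub_self, LinearMap.range_zero, finrank_bot]
  one := hα.one
  adapted g := (hα.normal g).exists_isTopForm hr

end NormalSystem

/-! ### Normal volumes under extension of scalars. -/

section ScalarExtension

open ExteriorAlgebra

variable {F F' V V' : Type*} [Field F] [Field F'] [Algebra F F'] [AddCommGroup V] [Module F V]
  [AddCommGroup V'] [Module F V'] [Module F' V'] [IsScalarTower F F' V']

/-- The map of exterior algebras induced by a linear map over a smaller field. -/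
noncomputable def extendScalars (F' : Type*) [Field F'] [Algebra F F'] [Module F' V']
    [IsScalarTower F F' V'] (c : V →ₗ[F] V') : ExteriorAlgebra F V →ₐ[F] ExteriorAlgebra F' V' :=
  ExteriorAlgebra.lift F ⟨(ι F').restrictScalars F ∘ₗ c, fun v => ι_sq_zero (c v)⟩

@[simp] theorem extendScalars_ι (c : V →ₗ[F] V') (v : V) :
    extendScalars F' c (ι F v) = ι F' (c v) :=
  ExteriorAlgebra.lift_ι_apply _ _ _ _

theorem extendScalars_ιMulti (c : V →ₗ[F] V') {n : ℕ} (v : Fin n → V) :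
    extendScalars F' c (ιMulti F n v) = ιMulti F' n fun i => c (v i) := by
  rw [ιMulti_apply, ιMulti_apply, map_list_prod, List.map_ofFn]
  congr 2
  funext i
  exact extendScalars_ι c (v i)

theorem extendScalars_map {c : V →ₗ[F] V'} {T : Module.End F V} {T' : Module.End F' V'}
    (h : ∀ v, c (T v) = T' (c v)) (x : ExteriorAlgebra F V) :
    extendScalars F' c (ExteriorAlgebra.map T x) = ExteriorAlgebra.map T' (extendScalars F' c x) := by
  have : (extendScalars F' c).comp (ExteriorAlgebra.map T) =
      ((ExteriorAlgebra.map T').restrictScalars F).comp (extendScalars F' c) := by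
    refine ExteriorAlgebra.hom_ext (LinearMap.ext fun v => ?_)
    simp [h]
  exact AlgHom.congr_fun this x

variable {G : Type*} [Group G] {ω : V →ₗ[F] V →ₗ[F] F} {r : G →* Module.End F V}
  {ω' : V' →ₗ[F'] V' →ₗ[F'] F'} {r' : G →* Module.End F' V'}

/-- A linear map over a smaller field that presents one symplectic representation as a scalar
extension of another one. -/
structure IsScalarExtension (ω : V →ₗ[F] V →ₗ[F] F) (r : G →* Module.End F V)
    (ω' : V' →ₗ[F'] V' →ₗ[F'] F') (r' : G →* Module.End F' V') (c : V →ₗ[F] V') : Prop where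
  span : Submodule.span F' (Set.range c) = ⊤
  form : ∀ u v, ω' (c u) (c v) = algebraMap F F' (ω u v)
  map : ∀ g v, c (r g v) = r' g (c v)

variable {c : V →ₗ[F] V'} [FiniteDimensional F V] [FiniteDimensional F' V']

theorem IsScalarExtension.isNormalVolume (hc : IsScalarExtension ω r ω' r' c) {g : G}
    {α : ExteriorAlgebra F V} (hα : IsNormalVolume ω r g α) :
    IsNormalVolume ω' r' g (extendScalars F' c α) := by
  obtain ⟨n, y, x, hn, hx, rfl⟩ := hα
  have hd : ∀ v, c (defect r g v) = defect r' g (c v) := fun v => by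
    rw [defect_apply, defect_apply, map_sub, hc.map]
  have hdet : (defectGram ω' r' g fun i => c (y i)).det =
      algebraMap F F' (defectGram ω r g y).det := by
    rw [RingHom.map_det]
    congr 1
    ext i j
    rw [defectGram_apply, ← hd, hc.form, RingHom.mapMatrix_apply, Matrix.map_apply,
      defectGram_apply]
  have hx' : algebraMap F F' x ^ 2 * (defectGram ω' r' g fun i => c (y i)).det = 1 := by
    rw [hdet, ← map_pow, ← map_mul, hx, map_one]
  have hli := linearIndependent_of_defectGram (ω := ω') (r := r') (g := g) (y := fun i => c (y i))
    fun h0 => by simp [h0] at hx'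
  have hli0 := linearIndependent_of_defectGram (ω := ω) (r := r) (g := g) (y := y)
    fun h0 => by simp [h0] at hx
  refine ⟨n, fun i => c (y i), algebraMap F F' x, le_antisymm (le_defectRank hli) ?_, hx', ?_⟩
  · have hle : LinearMap.range (defect r' g) ≤
        Submodule.span F' (Set.range fun i => defect r' g (c (y i))) := by
      rw [LinearMap.range_eq_map, ← hc.span, Submodule.map_span, Submodule.span_le]
      rintro _ ⟨_, ⟨v, rfl⟩, rfl⟩
      obtain ⟨T, hT⟩ := IsSymplecticRep.exists_sum_smul_defect hn hli0
        (fun _ : Fin 1 => defect r g v) fun _ => ⟨v, rfl⟩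
      rw [SetLike.mem_coe, ← hd, ← hT 0, map_sum]
      refine Submodule.sum_mem _ fun j _ => ?_
      rw [map_smul, hd, ← algebraMap_smul F']
      exact Submodule.smul_mem _ _ (Submodule.subset_span ⟨j, rfl⟩)
    exact (Submodule.finrank_mono hle).trans
      ((finrank_range_le_card _).trans_eq (Fintype.card_fin n))
  · rw [map_smul, extendScalars_ιMulti, ← algebraMap_smul F']
    simp only [hd]

theorem IsScalarExtension.isNormalSystem (hc : IsScalarExtension ω r ω' r' c)
    (hr' : IsSymplecticRep ω' r') {α : G → ExteriorAlgebra F V} (hα : IsNormalSystem ω r α) :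
    IsNormalSystem ω' r' fun g => extendScalars F' c (α g) where
  normal g := hc.isNormalVolume (hα.normal g)
  map h g := by
    rw [← extendScalars_map (hc.map h), hα.map]
  mul g h hd := by
    rw [← map_mul]
    -- Disjointness of the extended images forces it below: otherwise the product would vanish
    -- before extension, hence also afterwards, where it is a normal volume.
    by_cases hd' : Disjoint (LinearMap.range (defect r g)) (LinearMap.range (defect r h))
    · rw [hα.mul g h hd']
    · refine absurd ?_ ((hc.isNormalVolume (hα.normal g)).mul (hc.isNormalVolume (hα.normal h))
        hr' hd).2.ne_zero
      rw [← map_mul, (hα.normal g).mul_eq_zero (hα.normal h) hd', map_zero]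
  one := by rw [hα.one, map_one]

/-- The predicate `p` is a notion of positivity that selects exactly one of the two signs.
Translates and products of selected forms are selected normal volumes, so uniqueness gives every
compatibility. -/
theorem IsScalarExtension.exists_isNormalSystem [IsAlgClosed F]
    (hc : IsScalarExtension ω r ω' r' c) (hr : IsSymplecticRep ω r) (hr' : IsSymplecticRep ω' r')
    (p : ExteriorAlgebra F' V' → Prop) (hp1 : p 1) (hpm : ∀ x y, p x → p y → p (x * y))
    (hpr : ∀ g x, p x → p (ExteriorAlgebra.map (r' g) x)) (hpn : ∀ x, x ≠ 0 → p x → ¬p (-x))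
    (hp : ∀ g, ∃ α, IsNormalVolume ω' r' g α ∧ p α) : ∃ α, IsNormalSystem ω r α := by
  have key : ∀ g, ∃ α, IsNormalVolume ω r g α ∧ p (extendScalars F' c α) := fun g => by
    obtain ⟨α, hα⟩ := hr.exists_isNormalVolume g
    obtain ⟨β, hβ, hpβ⟩ := hp g
    rcases (hc.isNormalVolume hα).eq_or_eq_neg hr' hβ with h | h
    · exact ⟨α, hα, h ▸ hpβ⟩
    · exact ⟨-α, hα.neg, by rwa [map_neg, h, neg_neg]⟩
  have huniq : ∀ g x y, IsNormalVolume ω r g x → IsNormalVolume ω r g y →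
      p (extendScalars F' c x) → p (extendScalars F' c y) → x = y := fun g x y hx hy hpx hpy => by
    rcases hx.eq_or_eq_neg hr hy with h | h
    · exact h
    · rw [h, map_neg] at hpx
      exact absurd hpx (hpn _ (hc.isNormalVolume hy).ne_zero hpy)
  choose α hα hpα using key
  refine ⟨α, hα, fun h g => ?_, fun g h hd => ?_, ?_⟩
  · refine huniq _ _ _ ((hα g).map hr h) (hα _) ?_ (hpα _)
    rw [extendScalars_map (hc.map h)]
    exact hpr _ _ (hpα g)
  · refine huniq _ _ _ ((hα g).mul (hα h) hr hd).2 (hα _) ?_ (hpα _)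
    rw [map_mul]
    exact hpm _ _ (hpα g) (hpα h)
  · exact huniq _ _ _ (hα 1) IsNormalVolume.one (hpα 1) (by rwa [map_one])

theorem IsQuatPositive.one {V : Type*} [AddCommGroup V] [Module ℂ V]
    {J : V →ₛₗ[starRingEnd ℂ] V} : IsQuatPositive J 1 :=
  ⟨0, Fin.elim0, 1, one_pos, by rw [ιMulti_quatFrame]; simp⟩

end ScalarExtension

/-! ### Signs from a complex embedding. -/

section ComplexExtension

variable {F V V' G : Type*} [Field F] [IsAlgClosed F] [Algebra F ℂ] [AddCommGroup V] [Module F V]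
  [AddCommGroup V'] [Module F V'] [Module ℂ V'] [IsScalarTower F ℂ V'] [FiniteDimensional F V]
  [FiniteDimensional ℂ V'] [Group G] [Finite G] {ω : V →ₗ[F] V →ₗ[F] F} {r : G →* Module.End F V}
  {ω' : V' →ₗ[ℂ] V' →ₗ[ℂ] ℂ} {r' : G →* Module.End ℂ V'} {c : V →ₗ[F] V'}

theorem IsScalarExtension.exists_isNormalSystem_of_complex (hc : IsScalarExtension ω r ω' r' c)
    (hr : IsSymplecticRep ω r) (hr' : IsSymplecticRep ω' r') : ∃ α, IsNormalSystem ω r α := by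
  obtain ⟨J, hJ, hJr, hpos⟩ := hr'.exists_quaternionic
  exact hc.exists_isNormalSystem hr hr' (IsQuatPositive J) IsQuatPositive.one
    (fun _ _ => IsQuatPositive.mul) (fun g _ hx => hx.map (hJr g))
    (fun _ hx0 hx => hx.not_neg hJ hx0) (hJ.exists_isNormalVolume hJr hpos)

end ComplexExtension

/-! ### Countable subfields and embeddings into the complex numbers. -/

section ComplexEmbedding

open Cardinal

/-- Countable algebraically closed fields of characteristic zero embed into the complex numbers. -/
theorem exists_ringHom_complex (E : Type u) [Field E] [CharZero E] (hE : #E ≤ ℵ₀) :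
    Nonempty (E →+* ℂ) := by
  obtain ⟨s, hs⟩ := exists_isTranscendenceBasis ℤ E
  obtain ⟨t, ht⟩ := exists_isTranscendenceBasis ℤ ℂ
  have hC : ℵ₀ < #ℂ := by
    rw [Cardinal.mk_complex]
    exact Cardinal.aleph0_lt_continuum
  -- A transcendence basis of `ℂ` is as large as `ℂ`, so a countable one injects into it.
  have h1 := IsAlgClosed.cardinal_eq_cardinal_transcendence_basis_of_aleph0_lt' _ ht
    (le_of_eq mk_int) hC
  have h2 : Cardinal.lift.{0} #s ≤ Cardinal.lift.{u} #t := by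
    rw [← h1]
    calc Cardinal.lift.{0} #s ≤ ℵ₀ := by
          rw [Cardinal.lift_le_aleph0]
          exact (Cardinal.mk_set_le s).trans hE
      _ ≤ Cardinal.lift.{u} #ℂ := by
          rw [Cardinal.aleph0_le_lift]
          exact hC.le
  obtain ⟨e⟩ := Cardinal.lift_mk_le'.1 h2
  let v : s → E := Subtype.val
  let φ : Algebra.adjoin ℤ (Set.range v) →+* ℂ :=
    ((MvPolynomial.aeval (R := ℤ) fun i : s => ((e i : t) : ℂ)).comp
      (hs.1.aevalEquiv.symm : Algebra.adjoin ℤ (Set.range v) →ₐ[ℤ] MvPolynomial s ℤ)).toRingHom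
  have hφ : Function.Injective φ :=
    Function.Injective.comp (g := MvPolynomial.aeval (R := ℤ) fun i : s => ((e i : t) : ℂ))
      (ht.1.comp e e.injective) hs.1.aevalEquiv.symm.injective
  let : Algebra (Algebra.adjoin ℤ (Set.range v)) ℂ := φ.toAlgebra
  have h3 : FaithfulSMul (Algebra.adjoin ℤ (Set.range v)) ℂ :=
    (faithfulSMul_iff_algebraMap_injective _ _).2 hφ
  have h4 : Algebra.IsAlgebraic (Algebra.adjoin ℤ (Set.range v)) E := hs.isAlgebraic
  exact ⟨(IsAlgClosed.lift (R := Algebra.adjoin ℤ (Set.range v)) (S := E) (M := ℂ)).toRingHom⟩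

theorem cardinalMk_algebraicClosure_le (k E : Type u) [Field k] [Field E] [Algebra k E]
    (h : #k ≤ ℵ₀) : #(algebraicClosure k E) ≤ ℵ₀ :=
  (Algebra.IsAlgebraic.cardinalMk_le_max k (algebraicClosure k E)).trans (max_le h le_rfl)

/-- Finitely many elements lie in an algebraically closed subfield that embeds into `ℂ`. -/
theorem exists_subfield_complex {K : Type u} [Field K] [IsAlgClosed K] [CharZero K] (S : Set K)
    (hS : S.Finite) : ∃ F : Subfield K, S ⊆ F ∧ IsAlgClosed F ∧ Nonempty (F →+* ℂ) := by
  -- A finitely generated field is countable, and so is its algebraic closure inside `K`.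
  let F₁ := IntermediateField.adjoin ℚ S
  let F₀ := algebraicClosure F₁ K
  have h1 : #F₁ ≤ ℵ₀ := by
    have := IntermediateField.lift_cardinalMk_adjoin_le ℚ S
    rw [Cardinal.mkRat] at this
    simpa [hS.countable] using this
  have h2 : #F₀ ≤ ℵ₀ := cardinalMk_algebraicClosure_le F₁ K h1
  have h3 : IsAlgClosed F₀ := IsAlgClosure.isAlgClosed F₁
  refine ⟨F₀.toSubfield, fun x hx => ?_, h3, exists_ringHom_complex F₀ h2⟩
  exact F₀.algebraMap_mem ⟨x, IntermediateField.subset_adjoin ℚ S hx⟩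

end ComplexEmbedding

/-! ### Representations by symplectic matrices. -/

section MatrixRep

variable {n : ℕ} {G : Type*} [Group G]

/-- The standard symplectic form. -/
noncomputable def stdForm (F : Type*) [Field F] (n : ℕ) :
    (Fin n ⊕ Fin n → F) →ₗ[F] (Fin n ⊕ Fin n → F) →ₗ[F] F :=
  Matrix.toLinearMap₂' F (Matrix.J (Fin n) F)

theorem stdForm_apply {F : Type*} [Field F] (u v : Fin n ⊕ Fin n → F) :
    stdForm F n u v = u ⬝ᵥ (Matrix.J (Fin n) F).mulVec v :=
  Matrix.toLinearMap₂'_apply' _ _ _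

/-- The representation on column vectors. -/
noncomputable def matrixRep {F I : Type*} [Field F] [Fintype I] [DecidableEq I]
    (ρ : G →* Matrix I I F) : G →* Module.End F (I → F) :=
  (Matrix.toLinAlgEquiv' : Matrix I I F ≃ₐ[F] _).toAlgHom.toMonoidHom.comp ρ

theorem matrixRep_apply {F I : Type*} [Field F] [Fintype I] [DecidableEq I]
    (ρ : G →* Matrix I I F) (g : G) (v : I → F) : matrixRep ρ g v = (ρ g).mulVec v := rfl

theorem isSymplecticRep_matrixRep {F : Type*} [Field F]
    {ρ : G →* Matrix (Fin n ⊕ Fin n) (Fin n ⊕ Fin n) F}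
    (hρ : ∀ g, ρ g ∈ Matrix.symplecticGroup (Fin n) F) :
    IsSymplecticRep (stdForm F n) (matrixRep ρ) where
  skew u v := by
    rw [stdForm_apply, stdForm_apply, Matrix.dotProduct_mulVec, ← Matrix.mulVec_transpose,
      Matrix.J_transpose, Matrix.neg_mulVec, neg_dotProduct, dotProduct_comm]
  nondeg v hv := by
    have h1 : (Matrix.J (Fin n) F).mulVec v ≠ 0 := fun h => hv (by
      have h2 := congrArg (Matrix.J (Fin n) F).mulVec h
      rw [Matrix.mulVec_mulVec, Matrix.J_squared, Matrix.neg_mulVec, Matrix.one_mulVec,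
        Matrix.mulVec_zero, neg_eq_zero] at h2
      exact h2)
    obtain ⟨i, hi⟩ := Function.ne_iff.1 h1
    refine ⟨Pi.single i ((Matrix.J (Fin n) F).mulVec v i)⁻¹, ?_⟩
    rw [stdForm_apply, single_dotProduct, inv_mul_cancel₀ hi]
  isometry g u v := by
    rw [stdForm_apply, stdForm_apply, matrixRep_apply, matrixRep_apply, Matrix.mulVec_mulVec,
      Matrix.dotProduct_mulVec, Matrix.vecMul_mulVec, ← Matrix.dotProduct_mulVec, ← mul_assoc,
      SymplecticGroup.mem_iff'.1 (hρ g)]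

theorem map_J {F F' : Type*} [Field F] [Field F'] (τ : F →+* F') :
    (Matrix.J (Fin n) F).map τ = Matrix.J (Fin n) F' := by
  ext i j
  rcases i with i | i <;> rcases j with j | j <;> simp [Matrix.J, Matrix.one_apply, apply_ite]

theorem map_mem_symplecticGroup_iff {F F' : Type*} [Field F] [Field F'] (τ : F →+* F')
    {A : Matrix (Fin n ⊕ Fin n) (Fin n ⊕ Fin n) F} :
    A.map τ ∈ Matrix.symplecticGroup (Fin n) F' ↔ A ∈ Matrix.symplecticGroup (Fin n) F := by
  rw [SymplecticGroup.mem_iff', SymplecticGroup.mem_iff', ← map_J τ, ← Matrix.transpose_map,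
    ← Matrix.map_mul, ← Matrix.map_mul]
  exact (Matrix.map_injective τ.injective).eq_iff

theorem isScalarExtension_matrixRep {F F' : Type*} [Field F] [Field F'] [Algebra F F']
    (ρ : G →* Matrix (Fin n ⊕ Fin n) (Fin n ⊕ Fin n) F)
    (ρ' : G →* Matrix (Fin n ⊕ Fin n) (Fin n ⊕ Fin n) F')
    (h : ∀ g, (ρ g).map (algebraMap F F') = ρ' g) :
    IsScalarExtension (stdForm F n) (matrixRep ρ) (stdForm F' n) (matrixRep ρ')
      ((Algebra.linearMap F F').compLeft (Fin n ⊕ Fin n)) where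
  span := by
    rw [eq_top_iff, ← (Pi.basisFun F' (Fin n ⊕ Fin n)).span_eq, Submodule.span_le]
    rintro _ ⟨i, rfl⟩
    refine Submodule.subset_span ⟨Pi.single i 1, ?_⟩
    funext j
    rw [Pi.basisFun_apply]
    by_cases hj : j = i
    · subst hj
      simp
    · simp [hj]
  form u v := by
    rw [stdForm_apply, stdForm_apply, ← map_J (algebraMap F F'), RingHom.map_dotProduct]
    congr 1
    funext i
    exact (RingHom.map_mulVec _ _ _ i).symm
  map g v := by
    funext i
    change _ = (ρ' g).mulVec _ i
    rw [← h]
    exact RingHom.map_mulVec (algebraMap F F') (ρ g) v i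

/-- The finitely many matrix entries lie in an algebraically closed field `F` that embeds both into
`K` and into `ℂ`. The complex embedding fixes the signs over `F`, and the system extends from `F` to
`K`. -/
theorem exists_isNormalSystem [Finite G] {K : Type u} [Field K] [IsAlgClosed K] [CharZero K]
    {ρ : G →* Matrix (Fin n ⊕ Fin n) (Fin n ⊕ Fin n) K}
    (hρ : ∀ g, ρ g ∈ Matrix.symplecticGroup (Fin n) K) :
    ∃ α, IsNormalSystem (stdForm K n) (matrixRep ρ) α := by
  obtain ⟨F, hF, _, ⟨σ⟩⟩ := exists_subfield_complex
    (Set.range fun x : G × (Fin n ⊕ Fin n) × (Fin n ⊕ Fin n) => ρ x.1 x.2.1 x.2.2)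
    (Set.finite_range _)
  have hmap : ∀ A B : Matrix (Fin n ⊕ Fin n) (Fin n ⊕ Fin n) F,
      A.map (algebraMap F K) = B.map (algebraMap F K) → A = B := fun A B h =>
    Matrix.map_injective (algebraMap F K).injective h
  let m : G → Matrix (Fin n ⊕ Fin n) (Fin n ⊕ Fin n) F := fun g =>
    Matrix.of fun i j => ⟨ρ g i j, hF ⟨(g, i, j), rfl⟩⟩
  have hm : ∀ g, (m g).map (algebraMap F K) = ρ g := fun g => rfl
  let ρF : G →* Matrix (Fin n ⊕ Fin n) (Fin n ⊕ Fin n) F :=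
    { toFun := m
      map_one' := hmap _ _ (by
        rw [hm, map_one]
        exact (Matrix.map_one _ (map_zero _) (map_one _)).symm)
      map_mul' := fun g h => hmap _ _ (by rw [Matrix.map_mul, hm, hm, hm, map_mul]) }
  have hρF : ∀ g, ρF g ∈ Matrix.symplecticGroup (Fin n) F := fun g =>
    (map_mem_symplecticGroup_iff (algebraMap F K)).1 (hρ g)
  let : Algebra F ℂ := σ.toAlgebra
  let ρC : G →* Matrix (Fin n ⊕ Fin n) (Fin n ⊕ Fin n) ℂ :=
    (σ.mapMatrix : Matrix (Fin n ⊕ Fin n) (Fin n ⊕ Fin n) F →+* _).toMonoidHom.comp ρF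
  have hρC : ∀ g, ρC g ∈ Matrix.symplecticGroup (Fin n) ℂ := fun g =>
    (map_mem_symplecticGroup_iff σ).2 (hρF g)
  obtain ⟨α, hα⟩ := (isScalarExtension_matrixRep ρF ρC fun g => rfl).exists_isNormalSystem_of_complex
    (isSymplecticRep_matrixRep hρF) (isSymplecticRep_matrixRep hρC)
  exact ⟨_, (isScalarExtension_matrixRep ρF ρ hm).isNormalSystem
    (isSymplecticRep_matrixRep hρ) hα⟩

end MatrixRep

/-! ### The symplectic action on the Weyl algebra -/

namespace WeylAlgebra

section Representation

variable (K : Type u) [Field K] (n : ℕ)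

/-- The operators of multiplication and differentiation. -/
noncomputable def polyOp (a : Fin n ⊕ Fin n) : Module.End K (MvPolynomial (Fin n) K) :=
  Sum.elim (fun i => LinearMap.mulLeft K (MvPolynomial.X i))
    (fun i => (MvPolynomial.pderiv i).toLinearMap) a

/-- The action of the Weyl algebra on polynomials. -/
noncomputable def polyRep : WeylAlgebra K n →ₐ[K] Module.End K (MvPolynomial (Fin n) K) :=
  RingQuot.liftAlgHom K ⟨FreeAlgebra.lift K (polyOp K n), by
    intro x y h
    induction h with
    | pp i j =>
      refine LinearMap.ext fun f => ?_
      simp [polyOp, mul_left_comm]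
    | qq i j =>
      refine LinearMap.ext fun f => ?_
      simp only [polyOp, map_mul, FreeAlgebra.lift_ι_apply, Sum.elim_inr, Module.End.mul_apply]
      have h : ⁅MvPolynomial.pderiv (R := K) i, MvPolynomial.pderiv j⁆ = 0 :=
        MvPolynomial.derivation_ext fun k => by
          rw [Derivation.commutator_apply, MvPolynomial.pderiv_X, MvPolynomial.pderiv_X,
            Pi.single_apply, Pi.single_apply]
          split_ifs <;> simp
      have h2 := DFunLike.congr_fun h f
      rw [Derivation.commutator_apply, Derivation.zero_apply, sub_eq_zero] at h2
      exact h2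
    | qp i j =>
      refine LinearMap.ext fun f => ?_
      by_cases hij : i = j
      · subst hij
        simp [polyOp, add_comm]
      · simp [polyOp, hij, MvPolynomial.pderiv_X_of_ne (Ne.symm hij)]⟩

/-- The action on polynomials rules out collapse. No finer property of the normal form in the Weyl
algebra is used. -/
instance : Nontrivial (WeylAlgebra K n) :=
  (polyRep K n).toRingHom.domain_nontrivial

end Representation

variable {K : Type u} [Field K] {n : ℕ}

variable (K n) in
/-- The parametrization of `V` by column vectors. -/
noncomputable def genMap : (Fin n ⊕ Fin n → K) →ₗ[K] WeylAlgebra K n :=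
  Fintype.linearCombination K (gen K n)

theorem genMap_apply (v : Fin n ⊕ Fin n → K) : genMap K n v = ∑ a, v a • gen K n a :=
  Fintype.linearCombination_apply K _ v

theorem range_genMap : LinearMap.range (genMap K n) = generatorSpace K n :=
  Fintype.range_linearCombination K _

theorem genMap_comm (u v : Fin n ⊕ Fin n → K) :
    genMap K n u * genMap K n v - genMap K n v * genMap K n u =
      algebraMap K (WeylAlgebra K n) (stdForm K n u v) := by
  have h : ∀ u v : Fin n ⊕ Fin n → K, genMap K n u * genMap K n v =
      ∑ i, ∑ j, (u i * v j) • (gen K n i * gen K n j) := fun u v => by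
    rw [genMap_apply, genMap_apply, Finset.sum_mul_sum]
    simp only [smul_mul_smul_comm]
  rw [h u v, h v u, Finset.sum_comm (s := Finset.univ) (t := Finset.univ)
    (f := fun i j => (v i * u j) • (gen K n i * gen K n j)), ← Finset.sum_sub_distrib,
    stdForm_apply, dotProduct, map_sum]
  refine Finset.sum_congr rfl fun i _ => ?_
  rw [← Finset.sum_sub_distrib, Matrix.mulVec, dotProduct, Finset.mul_sum, map_sum]
  refine Finset.sum_congr rfl fun j _ => ?_
  rw [mul_comm (v j), ← smul_sub, gen_comm, Algebra.smul_def, ← map_mul]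
  congr 1
  ring

theorem adjoin_range_genMap : Algebra.adjoin K (Set.range (genMap K n)) = ⊤ := by
  rw [eq_top_iff]
  have h1 : (⊤ : Subalgebra K (WeylAlgebra K n)) = (ofFree K n).range :=
    ((AlgHom.range_eq_top _).2 (RingQuot.mkAlgHom_surjective K (WeylRel K n))).symm
  rw [h1, ← Algebra.map_top, ← FreeAlgebra.adjoin_range_ι, AlgHom.map_adjoin]
  refine Algebra.adjoin_mono ?_
  rintro _ ⟨_, ⟨a, rfl⟩, rfl⟩
  refine ⟨Pi.single a 1, ?_⟩
  rw [genMap, Fintype.linearCombination_apply_single, one_smul]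
  rfl

theorem isHeisenberg_genMap : IsHeisenberg (stdForm K n) (genMap K n) where
  comm := genMap_comm
  gen := adjoin_range_genMap

theorem action_genMap (g : Matrix.symplecticGroup (Fin n) K) (v : Fin n ⊕ Fin n → K) :
    action K n g (genMap K n v) = genMap K n (g.1.mulVec v) := by
  rw [genMap_apply, genMap_apply, map_sum]
  have h : ∀ b, action K n g (v b • gen K n b) = ∑ a, (g.1 a b * v b) • gen K n a := fun b => by
    rw [map_smul]
    refine (congrArg _ (actHom_gen g b)).trans ?_
    rw [Finset.smul_sum]
    simp only [smul_smul, mul_comm]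
  simp only [h]
  rw [Finset.sum_comm]
  refine Finset.sum_congr rfl fun a _ => ?_
  rw [← Finset.sum_smul]
  rfl

theorem map_generatorSpace (g : Matrix.symplecticGroup (Fin n) K) :
    (generatorSpace K n).map (action K n g).toLinearMap = generatorSpace K n := by
  have hle : ∀ g : Matrix.symplecticGroup (Fin n) K,
      (generatorSpace K n).map (action K n g).toLinearMap ≤ generatorSpace K n := fun g => by
    rw [← range_genMap]
    rintro _ ⟨_, ⟨v, rfl⟩, rfl⟩
    exact ⟨_, (action_genMap g v).symm⟩
  refine le_antisymm (hle g) fun x hx => ⟨action K n g⁻¹ x, hle g⁻¹ ⟨x, hx, rfl⟩, ?_⟩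
  change (action K n g * action K n g⁻¹) x = x
  rw [← map_mul, mul_inv_cancel, map_one]
  rfl

/-! ### The subgroup acting on the Weyl algebra. -/

section Action

variable (G : Subgroup (Matrix.symplecticGroup (Fin n) K))

/-- The representation of `G` by matrices. -/
def matrixHom : G →* Matrix (Fin n ⊕ Fin n) (Fin n ⊕ Fin n) K :=
  (Matrix.symplecticGroup (Fin n) K).subtype.comp G.subtype

theorem matrixHom_mem (g : G) : matrixHom G g ∈ Matrix.symplecticGroup (Fin n) K := g.1.2

/-- The action of `G` on the Weyl algebra. -/
noncomputable def subgroupAction : G →* (WeylAlgebra K n →ₐ[K] WeylAlgebra K n) :=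
  (action K n).comp G.subtype

theorem isSymplecticAction :
    IsSymplecticAction (stdForm K n) (genMap K n) (matrixRep (matrixHom G)) (subgroupAction G) where
  heis := isHeisenberg_genMap
  skew := (isSymplecticRep_matrixRep (matrixHom_mem G)).skew
  nondeg := (isSymplecticRep_matrixRep (matrixHom_mem G)).nondeg
  map_gen g v := action_genMap g.1 v
  isometry := (isSymplecticRep_matrixRep (matrixHom_mem G)).isometry
  faithful := (Matrix.toLinAlgEquiv' : Matrix (Fin n ⊕ Fin n) (Fin n ⊕ Fin n) K ≃ₐ[K] _).injective.comp
    (Subtype.val_injective.comp Subtype.val_injective)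

theorem mem_invariants_iff (a : WeylAlgebra K n) :
    a ∈ invariants G ↔ ∀ g, subgroupAction G g a = a :=
  (mem_invariants G a).trans ⟨fun h g => h g.1 g.2, fun h g hg => h ⟨g, hg⟩⟩

/-- A vector sent to zero has zero commutator with all generators, so it lies in the radical of the
symplectic form. -/
theorem genMap_injective : Function.Injective (genMap K n) := by
  rw [injective_iff_map_eq_zero]
  intro v hv
  refine (isSymplecticRep_matrixRep (matrixHom_mem (⊥ : Subgroup _))).eq_zero fun u => ?_
  have h := genMap_comm u v
  rw [hv, mul_zero, zero_mul, sub_zero] at h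
  exact (FaithfulSMul.algebraMap_injective K (WeylAlgebra K n)) (h.symm.trans (map_zero _).symm)

/-- Rank and nullity of `1 - g`, after the generators are identified with column vectors. -/
theorem codimFixed_eq (g : G) :
    codimFixed (g : Matrix.symplecticGroup (Fin n) K) = defectRank (matrixRep (matrixHom G)) g := by
  have h1 : fixedSpace (g : Matrix.symplecticGroup (Fin n) K) =
      (LinearMap.ker (defect (matrixRep (matrixHom G)) g)).map (genMap K n) := by
    ext x
    rw [fixedSpace, Submodule.mem_inf, ← range_genMap, Submodule.mem_map]
    constructor
    · rintro ⟨⟨v, rfl⟩, hv⟩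
      refine ⟨v, ?_, rfl⟩
      rw [LinearMap.mem_ker, defect_apply, sub_eq_zero]
      exact genMap_injective (hv.symm.trans (action_genMap g.1 v))
    · rintro ⟨v, hv, rfl⟩
      rw [LinearMap.mem_ker, defect_apply, sub_eq_zero] at hv
      exact ⟨⟨v, rfl⟩, (action_genMap g.1 v).trans (congrArg _ hv.symm)⟩
  have h2 := (defect (matrixRep (matrixHom G)) g).finrank_range_add_finrank_ker
  rw [Module.finrank_fintype_fun_eq_card, Fintype.card_sum, Fintype.card_fin] at h2
  rw [codimFixed, h1, ((LinearMap.ker (defect (matrixRep (matrixHom G)) g)).equivMapOfInjective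
    (genMap K n) genMap_injective).finrank_eq.symm, defectRank]
  omega

end Action

end WeylAlgebra

/-! ### Filtrations of group algebras and their centers -/

section LengthFiltration

variable {K G : Type u} [Field K] [Group G] (d : G → ℕ)

variable (K) in
/-- The span of the group elements of length at most `p`. -/
noncomputable def lengthFiltration (p : ℕ) : Submodule K (MonoidAlgebra K G) :=
  Submodule.span K {x | ∃ g : G, d g ≤ p ∧ x = MonoidAlgebra.of K G g}

variable {d}

theorem mem_lengthFiltration {p : ℕ} {x : MonoidAlgebra K G} :
    x ∈ lengthFiltration K d p ↔ ∀ g, x.coeff g ≠ 0 → d g ≤ p := by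
  have h : lengthFiltration K d p = MonoidAlgebra.supported K K {g | d g ≤ p} := by
    rw [MonoidAlgebra.supported_eq_span_single, lengthFiltration]
    congr 1
    ext x
    exact ⟨fun ⟨g, hg, e⟩ => ⟨g, hg, e.symm⟩, fun ⟨g, hg, e⟩ => ⟨g, hg, e.symm⟩⟩
  rw [h, MonoidAlgebra.mem_supported']
  exact forall_congr' fun g => ⟨fun h hg => by_contra fun h0 => hg (h h0),
    fun h hg => by_contra fun h0 => hg (h h0)⟩

theorem lowerStep_le {B : Type u} [Ring B] [Algebra K B] {F : ℕ → Submodule K B} {p : ℕ}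
    {S : Submodule K B} (h : ∀ i < p, F i ≤ S) : lowerStep F p ≤ S :=
  iSup₂_le h

theorem le_lowerStep {B : Type u} [Ring B] [Algebra K B] (F : ℕ → Submodule K B) {i p : ℕ}
    (h : i < p) : F i ≤ lowerStep F p :=
  le_iSup₂_of_le i h le_rfl

theorem isRingFiltration_lowerStep {B : Type u} [Ring B] [Algebra K B] {F : ℕ → Submodule K B}
    (hmono : Monotone F) (h1 : 1 ∈ F 0) (hmul : ∀ i j x y, x ∈ F i → y ∈ F j → x * y ∈ F (i + j)) :
    IsRingFiltration F (lowerStep F) where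
  mono := hmono
  is_le h := le_lowerStep F h
  is_sup _ _ h := lowerStep_le h
  one_mem := h1
  mul_mem {i j x y} hx hy := hmul i j x y hx hy

variable (K d) in
/-- The filtration induced on the center. -/
noncomputable def centralFiltration (p : ℕ) :
    Submodule K (Subalgebra.center K (MonoidAlgebra K G)) :=
  (lengthFiltration K d p).comap (Subalgebra.center K (MonoidAlgebra K G)).val.toLinearMap

theorem mem_centralFiltration {p : ℕ} {x : Subalgebra.center K (MonoidAlgebra K G)} :
    x ∈ centralFiltration K d p ↔ (x : MonoidAlgebra K G) ∈ lengthFiltration K d p := Iff.rfl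

theorem lengthFiltration_mono : Monotone (lengthFiltration K d) := fun _ _ h _ hx =>
  mem_lengthFiltration.2 fun g hg => (mem_lengthFiltration.1 hx g hg).trans h

theorem one_mem_lengthFiltration (h1 : d 1 = 0) : 1 ∈ lengthFiltration K d 0 :=
  Submodule.subset_span ⟨1, h1.le, (map_one _).symm⟩

theorem mul_mem_lengthFiltration (hmul : ∀ g h, d (g * h) ≤ d g + d h) (i j : ℕ)
    (x y : MonoidAlgebra K G) (hx : x ∈ lengthFiltration K d i) (hy : y ∈ lengthFiltration K d j) :
    x * y ∈ lengthFiltration K d (i + j) := by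
  have h := Submodule.mul_mem_mul hx hy
  rw [lengthFiltration, lengthFiltration, Submodule.span_mul_span] at h
  refine Submodule.span_mono ?_ h
  rintro _ ⟨_, ⟨g, hg, rfl⟩, _, ⟨h, hh, rfl⟩, rfl⟩
  exact ⟨g * h, (hmul g h).trans (add_le_add hg hh), (map_mul _ _ _).symm⟩

theorem exists_mem_lengthFiltration [Finite G] (d : G → ℕ) :
    ∃ p, ∀ x : MonoidAlgebra K G, x ∈ lengthFiltration K d p := by
  obtain ⟨p, hp⟩ := (Set.finite_range d).bddAbove
  exact ⟨p, fun x => mem_lengthFiltration.2 fun g _ => hp ⟨g, rfl⟩⟩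

theorem isRingFiltration_lengthFiltration (h1 : d 1 = 0) (hmul : ∀ g h, d (g * h) ≤ d g + d h) :
    IsRingFiltration (lengthFiltration K d) (lowerStep (lengthFiltration K d)) :=
  isRingFiltration_lowerStep lengthFiltration_mono (one_mem_lengthFiltration h1)
    (mul_mem_lengthFiltration hmul)

theorem isRingFiltration_centralFiltration (h1 : d 1 = 0)
    (hmul : ∀ g h, d (g * h) ≤ d g + d h) :
    IsRingFiltration (centralFiltration K d) (lowerStep (centralFiltration K d)) :=
  isRingFiltration_lowerStep
    (fun _ _ h _ hx => mem_centralFiltration.2 (lengthFiltration_mono h (mem_centralFiltration.1 hx)))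
    (mem_centralFiltration.2 (by
      rw [OneMemClass.coe_one]
      exact one_mem_lengthFiltration h1))
    fun i j x y hx hy => mem_centralFiltration.2 (by
      rw [MulMemClass.coe_mul]
      exact mul_mem_lengthFiltration hmul i j _ _ (mem_centralFiltration.1 hx)
        (mem_centralFiltration.1 hy))

theorem coeff_conj_of_mem_center {x : MonoidAlgebra K G}
    (hx : x ∈ Subalgebra.center K (MonoidAlgebra K G)) (h : G) :
    conjFun h x.coeff = x.coeff := by
  funext g
  have h1 := (Subalgebra.mem_center_iff.1 hx) (MonoidAlgebra.single h 1)
  have h2 := congrArg (fun y => y.coeff (g * h)) h1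
  simp only [MonoidAlgebra.coeff_single_mul_apply, MonoidAlgebra.coeff_mul_single_apply, one_mul,
    mul_one, mul_inv_cancel_right] at h2
  rw [conjFun, mul_assoc, h2]

theorem mem_center_of_conjFun {x : MonoidAlgebra K G} (hx : ∀ h, conjFun h x.coeff = x.coeff) :
    x ∈ Subalgebra.center K (MonoidAlgebra K G) := by
  rw [Subalgebra.mem_center_iff]
  intro y
  induction y using MonoidAlgebra.induction_on with
  | of g =>
    refine MonoidAlgebra.ext (Finsupp.ext fun k => ?_)
    rw [MonoidAlgebra.of_apply, MonoidAlgebra.coeff_single_mul_apply,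
      MonoidAlgebra.coeff_mul_single_apply, one_mul, mul_one]
    have := congrFun (hx g) (k * g⁻¹)
    rw [conjFun] at this
    rw [← this]
    group
  | add a b ha hb => rw [add_mul, mul_add, ha, hb]
  | smul t a ha => rw [smul_mul_assoc, mul_smul_comm, ha]

end LengthFiltration

/-! ### Linear maps out of associated graded components. -/

section AssocGradedLift

variable {K B M : Type u} [Field K] [Ring B] [Algebra K B] [AddCommGroup M] [Module K M]

/-- The linear map on a component of the associated graded space induced by a linear map. -/
def AssocGraded.lift (F : ℕ → Submodule K B) (p : ℕ) (φ : B →ₗ[K] M)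
    (h : ∀ x ∈ lowerStep F p, φ x = 0) : AssocGraded F p →ₗ[K] M :=
  Submodule.liftQ ((lowerStep F p).submoduleOf (F p)) (φ ∘ₗ (F p).subtype) fun x hx => h x hx

theorem AssocGraded.lift_injective (F : ℕ → Submodule K B) (p : ℕ) (φ : B →ₗ[K] M)
    (h : ∀ x ∈ lowerStep F p, φ x = 0) (h' : ∀ x ∈ F p, φ x = 0 → x ∈ lowerStep F p) :
    Function.Injective (AssocGraded.lift F p φ h) := by
  rw [injective_iff_map_eq_zero]
  intro x hx
  obtain ⟨x, rfl⟩ := AssocGraded.mk_surjective F p x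
  exact (Submodule.Quotient.mk_eq_zero _).2 (h' x x.2 hx)

theorem AssocGraded.lift_surjective (F : ℕ → Submodule K B) (p : ℕ) (φ : B →ₗ[K] M)
    (h : ∀ x ∈ lowerStep F p, φ x = 0) (h' : ∀ y, ∃ x ∈ F p, φ x = y) :
    Function.Surjective (AssocGraded.lift F p φ h) := by
  intro y
  obtain ⟨x, hx, rfl⟩ := h' y
  exact ⟨AssocGraded.mk F p ⟨x, hx⟩, rfl⟩

end AssocGradedLift

/-! ### Symbols of central elements as class functions. -/

section GradedClass

variable {K G : Type u} [Field K] [Group G] {d : G → ℕ}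

theorem coeff_eq_zero_of_mem_lowerStep {p : ℕ}
    {x : Subalgebra.center K (MonoidAlgebra K G)} (hx : x ∈ lowerStep (centralFiltration K d) p)
    {g : G} (hg : d g = p) : (x : MonoidAlgebra K G).coeff g = 0 := by
  let S : Submodule K (Subalgebra.center K (MonoidAlgebra K G)) := LinearMap.ker
    (Finsupp.lapply g ∘ₗ (MonoidAlgebra.coeffLinearEquiv K).toLinearMap ∘ₗ
      (Subalgebra.center K (MonoidAlgebra K G)).val.toLinearMap)
  have h : lowerStep (centralFiltration K d) p ≤ S := lowerStep_le fun i hi y hy => by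
    by_contra hne
    have := mem_lengthFiltration.1 (mem_centralFiltration.1 hy) g hne
    omega
  exact h hx

theorem mem_lowerStep_of_coeff {p : ℕ} {x : Subalgebra.center K (MonoidAlgebra K G)}
    (hx : x ∈ centralFiltration K d p)
    (h : ∀ g, d g = p → (x : MonoidAlgebra K G).coeff g = 0) :
    x ∈ lowerStep (centralFiltration K d) p := by
  have key : ∀ g, (x : MonoidAlgebra K G).coeff g ≠ 0 → d g < p := fun g hg =>
    lt_of_le_of_ne (mem_lengthFiltration.1 (mem_centralFiltration.1 hx) g hg) fun e => hg (h g e)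
  rcases p with _ | p
  · have h0 : x = 0 := Subtype.ext (MonoidAlgebra.ext (Finsupp.ext fun g => by
      by_contra hne
      exact absurd (key g hne) (Nat.not_lt_zero _)))
    rw [h0]
    exact Submodule.zero_mem _
  · exact le_lowerStep _ (Nat.lt_succ_self p) (mem_centralFiltration.2
      (mem_lengthFiltration.2 fun g hg => Nat.lt_succ_iff.1 (key g hg)))

variable (K G) in
/-- The class function of a central element. -/
noncomputable def centerFun : Subalgebra.center K (MonoidAlgebra K G) →ₗ[K] (G → K) :=
  Finsupp.lcoeFun ∘ₗ (MonoidAlgebra.coeffLinearEquiv K).toLinearMap ∘ₗ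
    (Subalgebra.center K (MonoidAlgebra K G)).val.toLinearMap

theorem centerFun_apply (x : Subalgebra.center K (MonoidAlgebra K G)) (g : G) :
    centerFun K G x g = (x : MonoidAlgebra K G).coeff g := rfl

theorem conjFun_centerFun (x : Subalgebra.center K (MonoidAlgebra K G)) (h : G) :
    conjFun h (centerFun K G x) = centerFun K G x :=
  coeff_conj_of_mem_center x.2 h

variable [Fintype G]

theorem exists_centerFun_eq {z : G → K} (hz : ∀ h, conjFun h z = z) :
    ∃ x, centerFun K G x = z := by
  have hx : ∀ h, conjFun h (MonoidAlgebra.ofCoeff (Finsupp.equivFunOnFinite.symm z)).coeff =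
      (MonoidAlgebra.ofCoeff (Finsupp.equivFunOnFinite.symm z)).coeff := hz
  exact ⟨⟨_, mem_center_of_conjFun hx⟩, rfl⟩

/-- At an element of length `p + q` subadditivity leaves only factorisations with lengths exactly
`q` and `p`. Commutativity of the center adjusts the order of the factors. -/
theorem degreePart_centerFun_mul (hmul : ∀ g h, d (g * h) ≤ d g + d h) {p q : ℕ}
    {x y : Subalgebra.center K (MonoidAlgebra K G)} (hx : x ∈ centralFiltration K d p)
    (hy : y ∈ centralFiltration K d q) :
    gradedConv d (p + q) (degreePart d q (centerFun K G y)) (degreePart d p (centerFun K G x)) =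
      degreePart d (p + q) (centerFun K G (x * y)) := by
  funext k
  change (if d k = p + q then _ else _) = if d k = p + q then _ else _
  by_cases hk : d k = p + q
  · rw [if_pos hk, if_pos hk, mul_comm, centerFun_apply, MulMemClass.coe_mul,
      MonoidAlgebra.coeff_mul_apply_right, Finsupp.sum_fintype _ _ (fun _ => mul_zero _)]
    refine Finset.sum_congr rfl fun g _ => ?_
    change (if d (k * g⁻¹) = q then _ else _) * (if d g = p then _ else _) = _
    have h1 := mem_lengthFiltration.1 (mem_centralFiltration.1 hx) g
    have h2 := mem_lengthFiltration.1 (mem_centralFiltration.1 hy) (k * g⁻¹)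
    have h3 := hmul (k * g⁻¹) g
    rw [inv_mul_cancel_right, hk] at h3
    rw [centerFun_apply, centerFun_apply]
    by_cases e1 : (x : MonoidAlgebra K G).coeff g = 0
    · simp [e1]
    by_cases e2 : (y : MonoidAlgebra K G).coeff (k * g⁻¹) = 0
    · simp [e2]
    rw [if_pos (by have := h1 e1; have := h2 e2; omega),
      if_pos (by have := h1 e1; have := h2 e2; omega)]
  · rw [if_neg hk, if_neg hk]

omit [Fintype G] in
theorem degreePart_centerFun_of_mem_lowerStep {p : ℕ}
    {x : Subalgebra.center K (MonoidAlgebra K G)} (hx : x ∈ lowerStep (centralFiltration K d) p) :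
    degreePart d p (centerFun K G x) = 0 := by
  funext g
  change (if d g = p then centerFun K G x g else 0) = 0
  by_cases hg : d g = p
  · rw [if_pos hg, centerFun_apply]
    exact coeff_eq_zero_of_mem_lowerStep hx hg
  · rw [if_neg hg]

end GradedClass

/-! ### Hochschild classes of central elements. -/

section GradedClassMap

variable {K G : Type u} [Field K] [Group G] {d : G → ℕ} [Fintype G]
  {A V : Type u} [Ring A] [Algebra K A] [AddCommGroup V] [Module K V]
  {ρ : G →* (A →ₐ[K] A)} {r : G →* Module.End K V} {B : Subalgebra K A}
  {ω : V →ₗ[K] V →ₗ[K] K} {f : V →ₗ[K] A} {α : G → ExteriorAlgebra K V} [CharZero K]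
  [FiniteDimensional K V] (h : IsSymplecticAction ω f r ρ)
  (hB : ∀ a, a ∈ B ↔ ∀ g, ρ g a = a) {I : Type*} [Fintype I] (b : Module.Basis I K V)
  (hα : IsTwistedVolume ω r d α)

/-- The Hochschild classes of a central element. -/
noncomputable def centralClass (p : ℕ) :
    Subalgebra.center K (MonoidAlgebra K G) →ₗ[K] HochschildCohomology K B p :=
  LinearMap.comp (M₂ := G → K) (M₃ := HochschildCohomology K B p) (classMap h hB b hα p)
    (centerFun K G)

theorem centralClass_apply (p : ℕ) (x : Subalgebra.center K (MonoidAlgebra K G)) :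
    centralClass h hB b hα p x = classMap h hB b hα p (centerFun K G x) := rfl

theorem centralClass_eq (p : ℕ) (x : Subalgebra.center K (MonoidAlgebra K G)) :
    centralClass h hB b hα p x = classMap h hB b hα p (degreePart d p (centerFun K G x)) :=
  (classMap_degreePart h hB b hα p _).symm

theorem centralClass_eq_zero (p : ℕ) (x : Subalgebra.center K (MonoidAlgebra K G))
    (hx : x ∈ lowerStep (centralFiltration K d) p) : centralClass h hB b hα p x = 0 := by
  rw [centralClass_eq, degreePart_centerFun_of_mem_lowerStep hx]
  exact map_zero (classMap h hB b hα p)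

theorem mem_lowerStep_of_centralClass [Nontrivial A] (p : ℕ)
    (x : Subalgebra.center K (MonoidAlgebra K G)) (hx : x ∈ centralFiltration K d p)
    (h0 : centralClass h hB b hα p x = 0) : x ∈ lowerStep (centralFiltration K d) p :=
  mem_lowerStep_of_coeff hx fun _ hg => eq_zero_of_classMap_eq_zero h b hα hB p
    (fun k => conjFun_centerFun x k) h0 hg

theorem exists_centralClass_eq [Nontrivial A] (p : ℕ) (y : HochschildCohomology K B p) :
    ∃ x ∈ centralFiltration K d p, centralClass h hB b hα p x = y := by
  obtain ⟨z, hz, e⟩ := exists_eq_classMap h b hα hB p y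
  -- Cutting `z` down to length `p` does not change its class and puts it into step `p` of the
  -- filtration. It remains a class function because length is conjugation invariant.
  have hz' : ∀ k, conjFun k (degreePart d p z) = degreePart d p z := fun k => by
    funext g
    change (if d (k⁻¹ * g * k) = p then z (k⁻¹ * g * k) else 0) = if d g = p then z g else 0
    have h1 := hα.deg_conj g k⁻¹
    rw [inv_inv] at h1
    rw [h1]
    exact congrArg (fun t => if d g = p then t else 0) (congrFun (hz k) g)
  obtain ⟨x, hx⟩ := exists_centerFun_eq hz'
  refine ⟨x, mem_centralFiltration.2 (mem_lengthFiltration.2 fun g hg => ?_), ?_⟩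
  · rw [← centerFun_apply, hx] at hg
    by_contra hne
    exact hg (if_neg fun e => hne e.le)
  · rw [centralClass_apply, hx]
    exact (classMap_degreePart h hB b hα p z).trans e.symm

theorem centralClass_one : centralClass h hB b hα 0 1 = HochschildCohomology.gone K B := by
  classical
  refine Eq.trans ?_ (classMap_one h hB b hα)
  refine congrArg (classMap h hB b hα 0) (funext fun g => ?_)
  rw [centerFun_apply, OneMemClass.coe_one, MonoidAlgebra.one_def,
    MonoidAlgebra.coeff_single, Finsupp.single_apply]
  simp only [eq_comm]

theorem centralClass_mul (hmul : ∀ g h, d (g * h) ≤ d g + d h) {p q : ℕ}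
    {x y : Subalgebra.center K (MonoidAlgebra K G)} (hx : x ∈ centralFiltration K d p)
    (hy : y ∈ centralFiltration K d q) :
    centralClass h hB b hα (p + q) (x * y) =
      HochschildCohomology.gmul (centralClass h hB b hα p x) (centralClass h hB b hα q y) rfl := by
  rw [centralClass_eq]
  refine Eq.trans ?_ (classMap_mul h hB b hα p q (fun k => conjFun_centerFun x k)
    fun k => conjFun_centerFun y k).symm
  exact congrArg (classMap h hB b hα (p + q)) (degreePart_centerFun_mul hmul hx hy).symm

end GradedClassMap

/-! ### From a multiplicative family of linear maps to a graded isomorphism. -/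

section AssocGradedHom

variable {K B : Type u} [Field K] [Ring B] [Algebra K B] (F : ℕ → Submodule K B)
  [IsRingFiltration F (lowerStep F)] {N : ℕ → Type u} [∀ p, AddCommGroup (N p)]
  [∀ p, Module K (N p)] [DirectSum.GRing N] [DirectSum.GAlgebra K N] (φ : ∀ p, B →ₗ[K] N p)
  (hlow : ∀ p, ∀ x ∈ lowerStep F p, φ p x = 0) (hone : φ 0 1 = GradedMonoid.GOne.one)
  (hmul : ∀ p q x y, x ∈ F p → y ∈ F q →
    φ (p + q) (x * y) = GradedMonoid.GMul.mul (φ p x) (φ q y))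

/-- The homomorphism out of the associated graded algebra given by a multiplicative family of
linear maps. -/
noncomputable def AssocGraded.liftHom : (⨁ p, AssocGraded F p) →ₐ[K] ⨁ p, N p :=
  DirectSum.toAlgebra K _ (fun p => DirectSum.lof K ℕ N p ∘ₗ AssocGraded.lift F p (φ p) (hlow p))
    (congrArg (DirectSum.of N 0) hone)
    (fun {p q} x y => by
      obtain ⟨x, rfl⟩ := AssocGraded.mk_surjective F p x
      obtain ⟨y, rfl⟩ := AssocGraded.mk_surjective F q y
      exact (congrArg (DirectSum.of N (p + q)) (hmul p q x y x.2 y.2)).trans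
        (DirectSum.of_mul_of _ _).symm)

theorem AssocGraded.liftHom_of (p : ℕ) (x : AssocGraded F p) :
    AssocGraded.liftHom F φ hlow hone hmul (DirectSum.of _ p x) =
      DirectSum.of N p (AssocGraded.lift F p (φ p) (hlow p) x) :=
  DirectSum.toAddMonoid_of (fun p =>
    (DirectSum.lof K ℕ N p ∘ₗ AssocGraded.lift F p (φ p) (hlow p)).toAddMonoidHom) p x

include hlow hone hmul in
theorem AssocGraded.exists_algEquiv (hker : ∀ p, ∀ x ∈ F p, φ p x = 0 → x ∈ lowerStep F p)
    (hsurj : ∀ p y, ∃ x ∈ F p, φ p x = y) :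
    ∃ e : (⨁ p, N p) ≃ₐ[K] ⨁ p, AssocGraded F p, ∀ (p : ℕ) (x : N p), ∃ y : AssocGraded F p,
      e (DirectSum.of N p x) = DirectSum.of _ p y := by
  have hbij : Function.Bijective (AssocGraded.liftHom F φ hlow hone hmul) := by
    have e : (AssocGraded.liftHom F φ hlow hone hmul).toLinearMap =
        DirectSum.lmap fun p => AssocGraded.lift F p (φ p) (hlow p) :=
      DirectSum.linearMap_ext K fun p => LinearMap.ext fun x =>
        (AssocGraded.liftHom_of F φ hlow hone hmul p x).trans (DirectSum.lmap_of
          (fun p => AssocGraded.lift F p (φ p) (hlow p)) p x).symm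
    change Function.Bijective (AssocGraded.liftHom F φ hlow hone hmul).toLinearMap
    rw [e]
    exact ⟨(DirectSum.lmap_injective _).2 fun p => AssocGraded.lift_injective F p _ _ (hker p),
      (DirectSum.lmap_surjective _).2 fun p => AssocGraded.lift_surjective F p _ _ (hsurj p)⟩
  refine ⟨(AlgEquiv.ofBijective _ hbij).symm, fun p x => ?_⟩
  obtain ⟨y, rfl⟩ := AssocGraded.lift_surjective F p _ (hlow p) (hsurj p) x
  refine ⟨y, ?_⟩
  rw [AlgEquiv.symm_apply_eq]
  exact (AssocGraded.liftHom_of F φ hlow hone hmul p y).symm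

end AssocGradedHom

theorem exists_hochschild_algEquiv {K A V G : Type u} [Field K] [Group G] {d : G → ℕ} [Fintype G]
    [Ring A] [Algebra K A] [AddCommGroup V] [Module K V] {ρ : G →* (A →ₐ[K] A)}
    {r : G →* Module.End K V} {B : Subalgebra K A} {ω : V →ₗ[K] V →ₗ[K] K} {f : V →ₗ[K] A}
    {α : G → ExteriorAlgebra K V} [CharZero K] [FiniteDimensional K V] [Nontrivial A]
    (h : IsSymplecticAction ω f r ρ) (hB : ∀ a, a ∈ B ↔ ∀ g, ρ g a = a) {I : Type*} [Fintype I]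
    (b : Module.Basis I K V) (hα : IsTwistedVolume ω r d α) (hmul : ∀ g h, d (g * h) ≤ d g + d h)
    [IsRingFiltration (centralFiltration K d) (lowerStep (centralFiltration K d))] :
    ∃ e : (⨁ p, HochschildCohomology K B p) ≃ₐ[K] ⨁ p, AssocGraded (centralFiltration K d) p,
      ∀ (p : ℕ) (x : HochschildCohomology K B p), ∃ y : AssocGraded (centralFiltration K d) p,
        e (DirectSum.of _ p x) = DirectSum.of _ p y :=
  AssocGraded.exists_algEquiv (centralFiltration K d) (centralClass h hB b hα)
    (centralClass_eq_zero h hB b hα) (centralClass_one h hB b hα)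
    (fun _ _ _ _ hx hy => centralClass_mul h hB b hα hmul hx hy)
    (mem_lowerStep_of_centralClass h hB b hα) (exists_centralClass_eq h hB b hα)

theorem iSup_lengthFiltration {K G : Type u} [Field K] [Group G] [Finite G] (d : G → ℕ) :
    ⨆ p, lengthFiltration K d p = ⊤ := by
  obtain ⟨p, hp⟩ := exists_mem_lengthFiltration (K := K) d
  exact eq_top_iff.2 fun x _ => Submodule.mem_iSup_of_mem p (hp x)

theorem iSup_centralFiltration {K G : Type u} [Field K] [Group G] [Finite G] (d : G → ℕ) :
    ⨆ p, centralFiltration K d p = ⊤ := by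
  obtain ⟨p, hp⟩ := exists_mem_lengthFiltration (K := K) d
  exact eq_top_iff.2 fun x _ => Submodule.mem_iSup_of_mem p (mem_centralFiltration.2 (hp x.1))

theorem exists_ringFiltration_algEquiv {K A V G : Type u} [Field K] [Group G] {d : G → ℕ}
    [Fintype G] [Ring A] [Algebra K A] [AddCommGroup V] [Module K V] {ρ : G →* (A →ₐ[K] A)}
    {r : G →* Module.End K V} {B : Subalgebra K A} {ω : V →ₗ[K] V →ₗ[K] K} {f : V →ₗ[K] A}
    {α : G → ExteriorAlgebra K V} [CharZero K] [FiniteDimensional K V] [Nontrivial A]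
    (h : IsSymplecticAction ω f r ρ) (hB : ∀ a, a ∈ B ↔ ∀ g, ρ g a = a) {I : Type*} [Fintype I]
    (b : Module.Basis I K V) (hα : IsTwistedVolume ω r d α)
    (hmul : ∀ g h, d (g * h) ≤ d g + d h) :
    ∃ (_ : IsRingFiltration (lengthFiltration K d) (lowerStep (lengthFiltration K d)))
      (_ : IsRingFiltration (centralFiltration K d) (lowerStep (centralFiltration K d))),
      ∃ e : (⨁ p, HochschildCohomology K B p) ≃ₐ[K] ⨁ p, AssocGraded (centralFiltration K d) p,
        ∀ (p : ℕ) (x : HochschildCohomology K B p), ∃ y : AssocGraded (centralFiltration K d) p,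
          e (DirectSum.of _ p x) = DirectSum.of _ p y :=
  ⟨isRingFiltration_lengthFiltration hα.deg_one hmul,
    isRingFiltration_centralFiltration hα.deg_one hmul,
    @exists_hochschild_algEquiv K A V G _ _ d _ _ _ _ _ ρ r B ω f α _ _ _ h hB I _ b hα hmul
      (isRingFiltration_centralFiltration hα.deg_one hmul)⟩

theorem theorem1 {K : Type u} [Field K] [IsAlgClosed K] [CharZero K] (n : ℕ)
    (G : Subgroup (Matrix.symplecticGroup (Fin n) K)) [Finite G] :
    (∀ g ∈ G, (WeylAlgebra.generatorSpace K n).map (WeylAlgebra.action K n g).toLinearMap =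
      WeylAlgebra.generatorSpace K n) ∧
    ((⨆ p, WeylAlgebra.groupFiltration G p) = ⊤) ∧
    ((⨆ p, WeylAlgebra.centerFiltration G p) = ⊤) ∧
    ∃ (_ : IsRingFiltration (WeylAlgebra.groupFiltration G)
        (lowerStep (WeylAlgebra.groupFiltration G)))
      (_ : IsRingFiltration (WeylAlgebra.centerFiltration G)
        (lowerStep (WeylAlgebra.centerFiltration G))),
      ∃ e : (⨁ p, HochschildCohomology K (WeylAlgebra.invariants G) p) ≃ₐ[K]
          (⨁ p, AssocGraded (WeylAlgebra.centerFiltration G) p),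
        ∀ (p : ℕ) (x : HochschildCohomology K (WeylAlgebra.invariants G) p),
          ∃ y : AssocGraded (WeylAlgebra.centerFiltration G) p,
            e (DirectSum.of _ p x) = DirectSum.of _ p y := by
  have := Fintype.ofFinite G
  obtain ⟨α, hα⟩ := exists_isNormalSystem (WeylAlgebra.matrixHom_mem G)
  have hvol := hα.isTwistedVolume (isSymplecticRep_matrixRep (WeylAlgebra.matrixHom_mem G))
  have hmul := defectRank_mul_le (matrixRep (WeylAlgebra.matrixHom G))
  -- With `codimFixed` as length function, the two general filtrations are definitionally those of
  -- the statement.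
  rw [← funext (WeylAlgebra.codimFixed_eq G)] at hvol hmul
  exact ⟨fun g _ => WeylAlgebra.map_generatorSpace g, iSup_lengthFiltration _,
    iSup_centralFiltration _, exists_ringFiltration_algEquiv (WeylAlgebra.isSymplecticAction G)
    (WeylAlgebra.mem_invariants_iff G) (Pi.basisFun K (Fin n ⊕ Fin n)) hvol hmul⟩
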